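/- All graphs are finite and simple and are counted up to isomorphism. A snark is a cyclically $4$-edge connected cubic graph of girth $5$ that admits no proper $3$-edge coloring. For $i\ge 1$ let $T_i$ be the unique tree with all degrees in $\{1,3\}$ that has a $3$-valent vertex $x$ (the central vertex) at distance $i$ from all leaves, and let $l_i=3\cdot 2^{i-1}$ be the number of its leaves. A snark $G$ is a rotation $T_i$-snark ($i\ge 2$) if $G$ has a spanning tree $T$ isomorphic to $T_i$, a drawing in the plane (vertices are distinct points; edges are simple curves between the points of their ends that contain no other vertex point and may cross each other), and a labeling of the leaves of $T$ by $0,\dots,l_i-1$ such that: $T$ is drawn without crossings, with all leaves on a circle $C$ and everything else of $T$ inside $C$; the labels $0,\dots,l_i-1$ follow each other clockwise along $C$; the leaves $l_i-1$ and $0$ and the central vertex of $T$ lie on a common facial cycle of the plane graph formed by $T$ and $C$; and whenever $ab$ is an edge of $G$ between leaves of $T$, so is the pair $a+l_i/3$, $b+l_i/3$ (modulo $l_i$). Such a $T$ is called a rotation tree of $G$. Let $oc(G,T)$ be the multiset of lengths of the cycles of $G$ all of whose vertices are leaves of $T$. The two Loupekine snarks are the following graphs: take $T_3$ drawn in the plane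 with its leaves labeled $0,\dots,11$ in cyclic order such that the leaves $2j,2j+1$ have a common neighbor for $0\le j\le 5$ and the leaves $4k,\dots,4k+3$ have distance $2$ from a common neighbor of the central vertex for $0\le k\le 2$; add the cycles $(0,3,4,7,8,11)$ and $(1,2,9,10,5,6)$ for the first one, and the cycle $(0,9,10,7,4,1,2,11,8,5,6,3)$ for the second one. Theorem. (1) The rotation $T_i$-snarks with $i\le 3$ are precisely the Petersen graph and the two (non-isomorphic) Loupekine snarks. (2) There are precisely $15$ rotation $T_4$-snarks. For each of them, $oc(G,T)$ is the same multiset for all rotation trees $T\cong T_4$ of $G$; this multiset is $\{24\}$ for exactly $2$ of them, $\{12,12\}$ for exactly $1$, $\{18,6\}$ for exactly $1$, $\{8,8,8\}$ for exactly $8$, and $\{6,6,6,6\}$ for exactly $3$. -/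

import Mathlib

namespace HistSnark

universe u

variable {V : Type u}

/-! ### Snarks -/

/-- The degree of a vertex (all graphs to which this is applied are finite). -/
noncomputable def deg (G : SimpleGraph V) (v : V) : ℕ := (G.neighborSet v).ncard

/-- `G` is cyclically `k`-edge connected: no set of fewer than `k` edges can be deleted such that
two different components of the remaining graph both contain a cycle. -/
def CyclicallyEdgeConnected (k : ℕ) (G : SimpleGraph V) : Prop :=
  ∀ S : Set (Sym2 V), S ⊆ G.edgeSet → S.encard < k →
    ∀ (u v : V) (p : (G.deleteEdges S).Walk u u) (q : (G.deleteEdges S).Walk v v),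
      p.IsCycle → q.IsCycle → (G.deleteEdges S).Reachable u v

/-- A snark is a cyclically `4`-edge connected cubic graph of girth `5` without a
(proper) `3`-edge coloring, i.e. whose line graph is not (vertex) `3`-colorable. -/
structure IsSnark (G : SimpleGraph V) : Prop where
  cubic : ∀ v, deg G v = 3
  cyclically_connected : CyclicallyEdgeConnected 4 G
  girth_eq : G.girth = 5
  not_colorable : ¬ G.lineGraph.Colorable 3

/-! ### Hists, the trees `T_i`, outer cycles -/

/-- The leaves of a tree (vertices of degree one). -/
def leaves (T : SimpleGraph V) : Set V := {v | deg T v = 1}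

/-- `T` is a tree all of whose vertices have degree one or three, and `x` is a `3`-valent vertex
of `T` with distance `i` to all leaves. Such a tree is unique up to isomorphism: it is the tree
`T_i`, and `x` is its central vertex. -/
structure IsTreeT (i : ℕ) (T : SimpleGraph V) (x : V) : Prop where
  isTree : T.IsTree
  deg_eq : ∀ v, deg T v = 1 ∨ deg T v = 3
  deg_center : deg T x = 3
  dist_center : ∀ v ∈ leaves T, T.dist x v = i

/-- An outer cycle of `G` with respect to the spanning tree `T`: a cycle (a connected `2`-regular
subgraph) of `G` all of whose vertices are leaves of `T`. -/
structure IsOuterCycle (G T : SimpleGraph V) (C : G.Subgraph) : Prop where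
  connected : C.Connected
  two_regular : ∀ v ∈ C.verts, (C.neighborSet v).ncard = 2
  verts_subset : C.verts ⊆ leaves T

/-- The multiset `oc(G, T)` of the lengths of all outer cycles. -/
noncomputable def oc [Finite V] (G T : SimpleGraph V) : Multiset ℕ :=
  (Set.toFinite {C : G.Subgraph | IsOuterCycle G T C}).toFinset.val.map fun C => C.verts.ncard

/-! ### Drawings in the plane `ℂ` -/

/-- `S` is a simple curve with end points `p` and `q`: the image of the closed unit interval
under an injective continuous map that sends the end points of the interval to `p` and `q`. -/
def IsSimpleCurve (S : Set ℂ) (p q : ℂ) : Prop :=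
  ∃ γ : unitInterval → ℂ,
    Continuous γ ∧ Function.Injective γ ∧ γ 0 = p ∧ γ 1 = q ∧ Set.range γ = S

/-- A drawing of `G` in the plane: distinct points for the vertices, and for every edge a simple
curve that joins the points of its ends and contains no other vertex point. Edge curves may
cross. (The value of `curve` at a pair that is not an edge is irrelevant.) -/
structure Drawing (G : SimpleGraph V) where
  pt : V → ℂ
  curve : Sym2 V → Set ℂ
  pt_injective : Function.Injective pt
  curve_simple : ∀ a b, G.Adj a b → IsSimpleCurve (curve s(a, b)) (pt a) (pt b)
  curve_avoids : ∀ e ∈ G.edgeSet, ∀ v, pt v ∈ curve e → v ∈ e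

/-- Within the drawing `D` of `G`, the subgraph `T` is drawn without crossings: the curves of
two different edges of `T` meet at most in the point of a common end. -/
def Drawing.PlanarOn {G : SimpleGraph V} (D : Drawing G) (T : SimpleGraph V) : Prop :=
  ∀ e ∈ T.edgeSet, ∀ f ∈ T.edgeSet, e ≠ f → ∀ z ∈ D.curve e ∩ D.curve f,
    ∃ v, v ∈ e ∧ v ∈ f ∧ z = D.pt v

/-- The point set of the planar drawing that consists of the drawing of `T` and of the circle
with center `c` and radius `r`. -/
def Drawing.withCircle {G : SimpleGraph V} (D : Drawing G) (T : SimpleGraph V) (c : ℂ) (r : ℝ) :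
    Set ℂ :=
  (⋃ e ∈ T.edgeSet, D.curve e) ∪ Metric.sphere c r

/-- `T` is a spanning tree of `G` that is isomorphic to `T_i`, and there are a drawing of `G` and
a labeling of the leaves of `T` by the residues modulo their number `l` (that is, by
`0, …, l - 1`) which show the rotation symmetry. -/
def IsRotationHist (i : ℕ) (G T : SimpleGraph V) : Prop :=
  T ≤ G ∧ ∃ (x : V) (l : ℕ) (label : ZMod l → V) (D : Drawing G) (c : ℂ) (r : ℝ) (θ : ZMod l → ℝ),
    IsTreeT i T x ∧
    -- the labels are assigned bijectively to the leaves of the tree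
    Set.BijOn label Set.univ (leaves T) ∧
    -- the tree is drawn without crossings
    D.PlanarOn T ∧
    -- the leaves lie on a circle, and apart from them the tree lies inside this circle
    0 < r ∧
    (∀ e ∈ T.edgeSet, ∀ z ∈ D.curve e, z ∈ Metric.ball c r ∨ ∃ v ∈ leaves T, z = D.pt v) ∧
    -- the labels `0, 1, …, l - 1` follow each other clockwise, within one turn
    (∀ a, D.pt (label a) = c + r * Complex.exp (θ a * Complex.I)) ∧
    (∀ a b : ZMod l, a.val < b.val → θ b < θ a) ∧
    (∀ a, θ 0 - θ a < 2 * Real.pi) ∧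
    -- the leaves `l - 1` and `0` and the central vertex lie on the boundary of a common face of
    -- the drawing that consists of the tree and the circle
    (∃ z ∈ (D.withCircle T c r)ᶜ,
      D.pt (label (-1)) ∈ frontier (connectedComponentIn (D.withCircle T c r)ᶜ z) ∧
      D.pt (label 0) ∈ frontier (connectedComponentIn (D.withCircle T c r)ᶜ z) ∧
      D.pt x ∈ frontier (connectedComponentIn (D.withCircle T c r)ᶜ z)) ∧
    -- the edges between leaves are invariant under the rotation
    (∀ a b : ZMod l, G.Adj (label a) (label b) →
      G.Adj (label (a + ((l / 3 : ℕ) : ZMod l))) (label (b + ((l / 3 : ℕ) : ZMod l))))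

/-- `G` is a rotation `T_i`-snark. -/
def IsRotationSnark (i : ℕ) (G : SimpleGraph V) : Prop :=
  2 ≤ i ∧ IsSnark G ∧ ∃ T, IsRotationHist i G T

/-- `G` is a rotation `T_i`-snark, as shown by a spanning tree `T` with `oc(G, T) = S`. -/
def IsRotationSnarkWith [Finite V] (i : ℕ) (S : Multiset ℕ) (G : SimpleGraph V) : Prop :=
  2 ≤ i ∧ IsSnark G ∧ ∃ T, IsRotationHist i G T ∧ oc G T = S

/-! ### Counting up to isomorphism -/

/-- Finite graphs, on the vertex sets `{0, …, n - 1}`. -/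
abbrev FinGraph : Type := Σ n : ℕ, SimpleGraph (Fin n)

/-- Isomorphism of finite graphs. -/
instance isoSetoid : Setoid FinGraph where
  r G H := Nonempty (G.2 ≃g H.2)
  iseqv :=
    ⟨fun _ => ⟨SimpleGraph.Iso.refl⟩, fun ⟨f⟩ => ⟨f.symm⟩, fun ⟨f⟩ ⟨g⟩ => ⟨g.comp f⟩⟩

/-- The set of the isomorphism classes of the finite graphs with the property `P`. -/
def isoClasses (P : FinGraph → Prop) : Set (Quotient isoSetoid) :=
  (fun G => Quotient.mk isoSetoid G) '' {G | P G}

/-! ### The Petersen graph and the two Loupekine snarks -/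

/-- The Petersen graph: its vertices are the `2`-element subsets of a `5`-element set, and
disjoint subsets are adjacent. -/
def petersen : SimpleGraph {s : Finset (Fin 5) // s.card = 2} where
  Adj s t := Disjoint s.1 t.1
  symm := ⟨fun _ _ h => h.symm⟩
  loopless := ⟨fun s h => by
    have h0 : s.1 = ∅ := by simpa using h
    have h2 := s.2
    simp [h0] at h2⟩

/-- The graph on `{0, …, 21}` with the given edges. -/
def graph22 (E : List (Fin 22 × Fin 22)) : SimpleGraph (Fin 22) :=
  SimpleGraph.fromRel fun a b => (a, b) ∈ E

/-- The edges of the tree `T_3` with leaves `0, …, 11` (in cyclic order) and center `21`. -/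
def treeEdges : List (Fin 22 × Fin 22) :=
  [(0, 12), (1, 12), (2, 13), (3, 13), (4, 14), (5, 14), (6, 15), (7, 15), (8, 16), (9, 16),
   (10, 17), (11, 17), (12, 18), (13, 18), (14, 19), (15, 19), (16, 20), (17, 20),
   (18, 21), (19, 21), (20, 21)]

/-- The first Loupekine snark: the tree together with two outer cycles of length `6`. -/
def loupekine₁ : SimpleGraph (Fin 22) :=
  graph22 (treeEdges ++
    [(0, 3), (3, 4), (4, 7), (7, 8), (8, 11), (11, 0),
     (1, 2), (2, 9), (9, 10), (10, 5), (5, 6), (6, 1)])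

/-- The second Loupekine snark: the tree together with one outer cycle of length `12`. -/
def loupekine₂ : SimpleGraph (Fin 22) :=
  graph22 (treeEdges ++
    [(0, 9), (9, 10), (10, 7), (7, 4), (4, 1), (1, 2), (2, 11), (11, 8), (8, 5), (5, 6), (6, 3),
     (3, 0)])

end HistSnark

/-!
Let `m = 2 ^ (i - 1)`, so that the tree `T_i` has `3 * m` leaves and `6 * m - 2` vertices. The theorem
is proved by reducing the rotation `T_i`-snarks to cubic graphs on the vertices `0, …, 6 * m - 3` that
contain one fixed tree `stdTree m` and are invariant under a fixed rotation of its leaves (`RotGraph`),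
and by classifying these with a computation that the kernel checks.

*Reduction.* The only fact from plane topology is that two curves in a closed disk whose ends
alternate on the boundary meet (`curves_meet_unit`): otherwise `γ s - δ t` has a continuous logarithm
on the square of the parameters, but the increments of its imaginary part along the four sides, each
of which stays in a half plane, do not add up to zero. Hence the leaves below a vertex of a rotation
tree are consecutive on the circle (`not_interleaved`), so the leaves can be renumbered from a suitable
start such that the leaves below the vertices of height `k` are the blocks of `2 ^ k` consecutive
numbers, and the rotated labels still differ by `m` (`exists_rotGraph`).

*Classification.* A leaf has a position `x < m` in one of three branches, and the leaf edges are
determined by a quotient: a `2`-regular multigraph on the positions with voltages modulo `3`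
(`IsQuotient`). It decomposes into cycles. `qsearch` runs through all systems of cycles, and
`phase1` discards those that violate cyclic connectivity or are not extremal under the automorphisms
of the tree; `tsearch` runs through all voltages. Snarks are not `3`-edge colourable, and this is
exploited as follows. Fix a colouring `κ` of the tree edges by residues modulo `3`. It extends to the
whole graph if every leaf edge `ab`, with respect to an orientation of the leaf cycles, can be given
the colour `κ a + s a = κ b - s b` for a choice of signs `s` at the leaves (`colorable_of_signs`).
A family of tree colourings is treated at once by encoding each set of colourings as the bits of a
natural number. The search through the voltages uses the colourings `κ` which the rotation increases
by `1`, so that the signs live on the quotient. The voltages that survive have a cycle of length at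
most four, or a small edge cut, or a colouring in a second family, or else they give one of the listed
representatives (`leafCheck`, `classify`, `classify2`, `classify4`, `classify8`).

*The representatives.* There are `1`, `2` and `15` of them for `i = 2, 3, 4`. That they are snarks
is checked on a table of neighbours (`repOk`): for the cyclic connectivity, sets of at most three edges
are enumerated through the at most three tree edges in them; edge colourings are excluded by a
depth-first search. The outer cycles are listed (`oc_eq`), and a count of the ends of walks of length
four (`walkInv`) tells the representatives apart. An explicit drawing in polar coordinates, with the
tree edges straight in these coordinates and the leaf edges outside the circle, shows that they are
rotation snarks (`isRotationHist_std`).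

As different representatives are not isomorphic, every rotation snark determines its representative
and hence its multiset of outer cycle lengths, and all counts are read off from the lists
(`Classified`).
-/

namespace HistSnark

/-! ### Forced evaluation -/

/-- The value `f n`, where the kernel evaluates `n` before it substitutes it into `f`. -/
def force {α : Type} (n : ℕ) (f : ℕ → α) : α := match n with
  | 0 => f 0
  | k + 1 => f (k + 1)

/-! ### Quotient cycles -/

/-- The steps `(x, y, closing)` of a closed walk that starts at `r` and is now at `v`. -/
def stepsFrom (r : ℕ) : ℕ → List ℕ → List (ℕ × ℕ × Bool)
  | v, [] => [(v, r, true)]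
  | v, y :: ys => (v, y, false) :: stepsFrom r y ys

/-- The steps of the closed walk through the vertices of the list; the last one is closing. -/
def cycleSteps : List ℕ → List (ℕ × ℕ × Bool)
  | [] => []
  | x :: xs => stepsFrom x x xs

/-- The steps of a list of cycles. -/
def steps (cs : List (List ℕ)) : List (ℕ × ℕ × Bool) := cs.flatMap cycleSteps

/-- `List.erase` in terms of `Nat.beq`, which the kernel evaluates directly. -/
def eraseNat (w : ℕ) : List ℕ → List ℕ
  | [] => []
  | x :: xs => bif Nat.beq x w then xs else x :: eraseNat w xs

/-- A search through all decompositions of the positions into oriented cycles, with the test `fin` for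
each of them. The cycles in `done` are complete; the current cycle has visited `path` (in reverse order)
and is now at `v`, and `f` is its second vertex. Each cycle starts at the smallest unvisited vertex, and
is closed only if `f ≤ v`, which selects one of its two orientations. -/
def qsearch (fin : List (List ℕ) → Bool) :
    ℕ → List (List ℕ) → List ℕ → ℕ → ℕ → List ℕ → Bool
  | 0, _, _, _, _, _ => false
  | n + 1, done, path, v, f, unvis =>
    (match path with
      | [] => true
      | _ :: _ => bif Nat.ble f v then
          (match unvis with
            | [] => fin ((v :: path) :: done)
            | s :: u => qsearch fin n ((v :: path) :: done) [] s 0 u)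
        else true) &&
    unvis.all fun w =>
      qsearch fin n done (v :: path) w (match path with | [] => w | _ :: _ => f) (eraseNat w unvis)

/-! ### Colour masks -/

/-- The lane `i` of the packed table `T` (lanes of `w` bits). -/
def lane (w T i : ℕ) : ℕ := Nat.land (Nat.shiftRight T (Nat.mul w i)) (Nat.sub (Nat.shiftLeft 1 w) 1)

/-- The residue of `c` modulo three, as a colour or voltage. -/
def col3 (c : ℕ) : ℕ := Nat.mod c 3

/-- The mask of the colourings in which `c b = c a + d`. -/
def diffMask (M : ℕ → ℕ → ℕ) (d a b : ℕ) : ℕ :=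
  Nat.lor (Nat.land (M a 0) (M b (col3 d)))
    (Nat.lor (Nat.land (M a 1) (M b (col3 (Nat.add 1 d)))) (Nat.land (M a 2) (M b (col3 (Nat.add 2 d)))))

/-- A step from `x` to `y`, its flags and its three masks of colour differences (see `annotate`). -/
inductive AStep where
  | mk (x y : ℕ) (cl sib psib : Bool) (d0 d1 d2 : ℕ)

/-- `x` and `y` are equal or siblings. -/
def sameHalf (x y : ℕ) : Bool := Nat.beq (Nat.div x 2) (Nat.div y 2)

/-- The start of the previous step and the end `y` of this one are siblings. -/
def prevSib (p : Option (ℕ × ℕ)) (x y : ℕ) : Bool :=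
  match p with
  | none => false
  | some (z, w) => Nat.beq w x && sameHalf z y

/-- The steps with the masks of the colour differences; `sib` tells whether the ends of the step are
siblings, and `psib` whether the start of the previous step and the end of this one are. -/
def annotate (M : ℕ → ℕ → ℕ) : Option (ℕ × ℕ) → List (ℕ × ℕ × Bool) → List AStep
  | _, [] => []
  | p, (x, y, cl) :: l =>
    force (diffMask M 0 x y) fun d0 => force (diffMask M 1 x y) fun d1 =>
    force (diffMask M 2 x y) fun d2 =>
    .mk x y cl (sameHalf x y)
      (prevSib p x y) d0 d1 d2 ::
      annotate M (some (x, y)) l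

/-- The masks for the four combinations of signs at the start and at the current vertex. -/
def signStep {α : Type} (d0 d1 d2 pp pm mp mm : ℕ) (k : ℕ → ℕ → ℕ → ℕ → α) : α :=
  force (Nat.lor (Nat.land pp d2) (Nat.land pm d0)) fun pp' =>
  force (Nat.lor (Nat.land pp d0) (Nat.land pm d1)) fun pm' =>
  force (Nat.lor (Nat.land mp d2) (Nat.land mm d0)) fun mp' =>
  force (Nat.lor (Nat.land mp d0) (Nat.land mm d1)) fun mm' => k pp' pm' mp' mm'

/-- The masks after a step, or at the start of the next cycle. -/
def tnext (k : ℕ → ℕ → ℕ → ℕ → ℕ → Bool) (full acc pp pm mp mm : ℕ) (skip cl : Bool) (e0 e1 e2 : ℕ) :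
    Bool :=
  bif skip then true else
  signStep e0 e1 e2 pp pm mp mm fun pp' pm' mp' mm' =>
  match cl with
  | true => force (Nat.land acc (Nat.lor pp' mm')) fun acc' => k acc' full 0 0 full
  | false => k acc pp' pm' mp' mm'

/-- The search through the voltages of the steps. `acc` collects the colourings that have signs for
the complete cycles, and the test `fin` is needed only if none is left at the end. Between siblings the
voltage is not `0`, as there are no triangles; two steps between which the voltages cancel do not
join siblings, as there are no cycles of length four; and the first nonzero voltage is `1`, up to the
reflection. `seen` tells whether it has occurred, and `pt` is the previous voltage. -/
def tsearch (full : ℕ) (fin : List (ℕ × ℕ × ℕ) → Bool) :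
    List AStep → Bool → ℕ → ℕ → ℕ → ℕ → ℕ → ℕ → List (ℕ × ℕ × ℕ) → Bool
  | [], _, _, acc, _, _, _, _, es => bif Nat.beq acc 0 then fin es.reverse else true
  | .mk x y cl sib psib d0 d1 d2 :: l, seen, pt, acc, pp, pm, mp, mm, es =>
    let go : ℕ → Bool → ℕ → ℕ → ℕ → Bool := fun t seen' e0 e1 e2 =>
      tnext (fun acc pp pm mp mm => tsearch full fin l seen' t acc pp pm mp mm ((x, y, t) :: es))
        full acc pp pm mp mm (psib && Nat.beq (col3 (Nat.add pt t)) 0) cl e0 e1 e2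
    (sib || go 0 seen d0 d1 d2) && go 1 true d2 d0 d1 && (!seen || go 2 true d1 d2 d0)

/-- The search through the voltages of the cycles `cs`. -/
def tstart (M : ℕ → ℕ → ℕ) (full : ℕ) (fin : List (ℕ × ℕ × ℕ) → Bool) (cs : List (List ℕ)) : Bool :=
  tsearch full fin (annotate M none (steps cs)) false 0 full full 0 0 full []

/-! ### Lifting quotient cycles to cycles of leaves -/

/-- The leaf at the position `x` of the branch `k`. -/
def leafIx (m x k : ℕ) : ℕ := Nat.add x (Nat.mul m k)

/-- The lift, starting in the branch `k`, of a walk with voltages. -/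
def strand (m : ℕ) : ℕ → List (ℕ × ℕ × ℕ) → List (ℕ × ℕ)
  | _, [] => []
  | k, (x, y, t) :: l => (leafIx m x k, leafIx m y (col3 (Nat.add k t))) :: strand m (col3 (Nat.add k t)) l

/-- The total voltage of a walk. -/
def voltage : List (ℕ × ℕ × ℕ) → ℕ
  | [] => 0
  | (_, _, t) :: l => col3 (Nat.add t (voltage l))

/-- Runs along a walk; the masks start at `pp, pm, mp, mm`. -/
def signRun {α : Type} (M : ℕ → ℕ → ℕ) : List (ℕ × ℕ) → ℕ → ℕ → ℕ → ℕ → (ℕ → ℕ → ℕ → ℕ → α) → α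
  | [], pp, pm, mp, mm, k => k pp pm mp mm
  | (a, b) :: l, pp, pm, mp, mm, k =>
    force a fun a => force b fun b =>
    signStep (diffMask M 0 a b) (diffMask M 1 a b) (diffMask M 2 a b) pp pm mp mm
      fun pp' pm' mp' mm' => signRun M l pp' pm' mp' mm' k

/-- The mask of the colourings for which there are signs along the closed walk `l`. -/
def cycleMask (M : ℕ → ℕ → ℕ) (full : ℕ) (l : List (ℕ × ℕ)) : ℕ :=
  signRun M l full 0 0 full fun pp _ _ mm => Nat.lor pp mm

/-- The mask of the colourings for which there are signs along the lift of a cycle: this lift consists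
of three cycles if the voltage is zero, and of one cycle otherwise. -/
def liftMask (m : ℕ) (M : ℕ → ℕ → ℕ) (full : ℕ) (es : List (ℕ × ℕ × ℕ)) : ℕ :=
  match voltage es with
  | 0 => Nat.land (cycleMask M full (strand m 0 es))
      (Nat.land (cycleMask M full (strand m 1 es)) (cycleMask M full (strand m 2 es)))
  | t + 1 => cycleMask M full (strand m 0 es ++ (strand m (col3 (t + 1)) es ++ strand m (col3 (2 * (t + 1))) es))

/-- Runs along the lift of a walk that starts in the layer `k`. This is `signRun` along a `strand`,
written with the recursor because it is evaluated very often. -/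
noncomputable def liftRun (m : ℕ) (M : ℕ → ℕ → ℕ) (l : List (ℕ × ℕ × ℕ)) :
    ℕ → ℕ → ℕ → ℕ → ℕ → (ℕ → ℕ → ℕ → ℕ → ℕ) → ℕ :=
  @List.rec _ (fun _ => ℕ → ℕ → ℕ → ℕ → ℕ → (ℕ → ℕ → ℕ → ℕ → ℕ) → ℕ)
    (fun _ pp pm mp mm r => r pp pm mp mm)
    (fun e _ ih k pp pm mp mm r => @Prod.rec _ _ (fun _ => ℕ) (fun x p =>
      @Prod.rec _ _ (fun _ => ℕ) (fun y t =>
        force (col3 (Nat.add k t)) fun k' =>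
        signStep (diffMask M 0 (leafIx m x k) (leafIx m y k'))
          (diffMask M 1 (leafIx m x k) (leafIx m y k')) (diffMask M 2 (leafIx m x k) (leafIx m y k'))
          pp pm mp mm fun pp' pm' mp' mm' => ih k' pp' pm' mp' mm' r) p) e) l

/-- `liftMask`, evaluated by `liftRun`. -/
noncomputable def fastLiftMask (m : ℕ) (M : ℕ → ℕ → ℕ) (full : ℕ) (es : List (ℕ × ℕ × ℕ)) : ℕ :=
  match voltage es with
  | 0 => force (liftRun m M es 0 full 0 0 full fun pp _ _ mm => Nat.lor pp mm) fun r =>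
      force (Nat.land r (liftRun m M es 1 full 0 0 full fun pp _ _ mm => Nat.lor pp mm)) fun r =>
      Nat.land r (liftRun m M es 2 full 0 0 full fun pp _ _ mm => Nat.lor pp mm)
  | t + 1 => liftRun m M es 0 full 0 0 full fun pp pm mp mm =>
      liftRun m M es (col3 (t + 1)) pp pm mp mm fun pp pm mp mm =>
      liftRun m M es (col3 (2 * (t + 1))) pp pm mp mm fun pp _ _ mm => Nat.lor pp mm

/-- The darts in `es`, cut into pieces of the lengths of the cycles. -/
def splitCycles : List (List ℕ) → List (ℕ × ℕ × ℕ) → List (List (ℕ × ℕ × ℕ))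
  | [], _ => []
  | c :: cs, es => es.take c.length :: splitCycles cs (es.drop c.length)

/-- Is there a colouring in the family for the lift of all the cycles? -/
noncomputable def liftColourable (m : ℕ) (M : ℕ → ℕ → ℕ) (full : ℕ) (cs : List (List ℕ)) (es : List (ℕ × ℕ × ℕ)) : Bool :=
  !(Nat.beq ((splitCycles cs es).foldr (fun c r => Nat.land (fastLiftMask m M full c) r) full) 0)

/-! ### Tree colourings -/

/-- The masks of the colours of the two edges below an edge with the masks `M` of the colours, where `B`
is the mask of the choices between the two possibilities. -/
def childMasks (M : ℕ × ℕ × ℕ) (B full : ℕ) : List (ℕ × ℕ × ℕ) :=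
  match M with
  | (a, b, c) =>
    let B' := Nat.xor full B
    [(Nat.lor (Nat.land c B) (Nat.land b B'), Nat.lor (Nat.land a B) (Nat.land c B'), Nat.lor (Nat.land b B) (Nat.land a B')),
     (Nat.lor (Nat.land c B') (Nat.land b B), Nat.lor (Nat.land a B') (Nat.land c B), Nat.lor (Nat.land b B') (Nat.land a B))]

/-- The masks on one level of the tree, from those on the level above and the choices `Bs`. -/
def levelMasks (full : ℕ) : List (ℕ × ℕ × ℕ) → List ℕ → List (ℕ × ℕ × ℕ)
  | M :: Ms, B :: Bs => childMasks M B full ++ levelMasks full Ms Bs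
  | _, _ => []

/-- The masks of the colours of all edges of the tree, in the order of their lower ends. The three edges
at the center have the colours `0`, `1`, `2`. -/
def treeMasks (full : ℕ) (Bs : List (List ℕ)) : List (ℕ × ℕ × ℕ) :=
  Bs.foldl (fun (acc : List (ℕ × ℕ × ℕ) × List (ℕ × ℕ × ℕ)) B =>
    let l := levelMasks full acc.1 B
    (l, l ++ acc.2)) ([(full, 0, 0), (0, full, 0), (0, 0, full)], [(full, 0, 0), (0, full, 0), (0, 0, full)]) |>.2

/-- The masks, of `w` bits each, packed into a number that is read by `lane`. -/
def packTable (w : ℕ) : List (ℕ × ℕ × ℕ) → ℕ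
  | [] => 0
  | (a, b, c) :: l => Nat.lor a (Nat.shiftLeft (Nat.lor b (Nat.shiftLeft (Nat.lor c (Nat.shiftLeft (packTable w l) w)) w)) w)

/-! ### The test of a full assignment of voltages -/

/-- A quotient cycle that lifts to cycles of the same length, at most four. -/
def shortCycle : List (ℕ × ℕ × ℕ) → Bool
  | [e, f] => Nat.beq (voltage [e, f]) 0
  | [e, f, g] => Nat.beq (voltage [e, f, g]) 0
  | [e, f, g, h] => Nat.beq (voltage [e, f, g, h]) 0
  | _ => false

/-- A vertex whose two neighbours are siblings. -/
def siblingNeighbours (ds : List (ℕ × ℕ × ℕ)) : Bool :=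
  ds.any fun p => match p with
    | (x, y, t) => ds.any fun q => match q with
      | (x', z, s) => Nat.beq x x' && (Nat.beq t s && (!(Nat.beq y z) && sameHalf y z))

/-- The darts in `es` and their reverses. -/
def darts (es : List (ℕ × ℕ × ℕ)) : List (ℕ × ℕ × ℕ) :=
  es ++ es.map fun p => match p with | (x, y, t) => (y, x, col3 (Nat.sub 3 t))

/-- No leaf edge leaves the vertex set `X` (a bit mask). -/
def closedMask (m : ℕ) (es : List (ℕ × ℕ × ℕ)) (X : ℕ) : Bool :=
  es.all fun p => match p with
    | (x, y, t) => [0, 1, 2].all fun k => match Nat.testBit X (leafIx m x k) with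
      | true => Nat.testBit X (leafIx m y (col3 (Nat.add k t)))
      | false => !(Nat.testBit X (leafIx m y (col3 (Nat.add k t))))

/-- The number that encodes the dart `(x, y, t)`. -/
def dartKey (m x y t : ℕ) : ℕ := Nat.add (Nat.mul 3 (Nat.add (Nat.mul m x) y)) t

/-- A set of darts as a bit mask. -/
def dartMask (m : ℕ) : List (ℕ × ℕ × ℕ) → ℕ
  | [] => 0
  | (x, y, t) :: l => Nat.lor (Nat.shiftLeft 1 (dartKey m x y t)) (dartMask m l)

/-- The entry at an index of a list, or `0`. -/
def nthD : List ℕ → ℕ → ℕ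
  | [], _ => 0
  | x :: _, 0 => x
  | _ :: xs, n + 1 => nthD xs n

/-- A symmetry of the tree, given by `p` on the positions and by the factor `s` on the branches, maps
the darts to those of one of the representatives. -/
def matchRep (m : ℕ) (autos : List (List ℕ)) (reps : List ℕ) (es : List (ℕ × ℕ × ℕ)) : Bool :=
  autos.any fun p => [1, 2].any fun s => reps.any fun R => es.all fun e => match e with
    | (x, y, t) => Nat.testBit R (dartKey m (nthD p x) (nthD p y) (col3 (Nat.mul s t)))

/-- The data for the test of a full assignment of voltages: families of tree colourings, vertex sets
with small boundary in the tree, automorphisms of a branch, and the representatives (as masks of darts).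
-/
structure LeafData where
  m : ℕ
  families : List ((ℕ → ℕ → ℕ) × ℕ)
  cuts : List ℕ
  autos : List (List ℕ)
  reps : List ℕ

/-- The graph with the darts `es` is not a snark for one of four reasons, or it is isomorphic to a
representative. -/
noncomputable def leafCheck (D : LeafData) (cs : List (List ℕ)) (es : List (ℕ × ℕ × ℕ)) : Bool :=
  (splitCycles cs es).any shortCycle || ((D.families.any fun F => liftColourable D.m F.1 F.2 cs es) ||
    (siblingNeighbours (darts es) || (D.cuts.any (closedMask D.m es) || matchRep D.m D.autos D.reps es)))

/-- The search through the voltages for the quotient cycles `cs`, with the equivariant colourings `M`.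
-/
noncomputable def phase2 (D : LeafData) (M : ℕ → ℕ → ℕ) (full : ℕ) (cs : List (List ℕ)) : Bool :=
  tstart M full (leafCheck D cs) cs

/-! ### Reduction of the quotient cycles -/

/-- Binary tree automorphisms on the leaves `0, …, 2 ^ k - 1`. -/
def treeAutos : ℕ → List (List ℕ)
  | 0 => [[0]]
  | k + 1 =>
    (treeAutos k).flatMap fun p => (treeAutos k).flatMap fun q =>
      [p ++ q.map (2 ^ k + ·), p.map (2 ^ k + ·) ++ q]

/-- A weight of the vertex orbits; only its genericity matters. -/
def weight : ℕ → ℕ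
  | 0 => 50021 | 1 => 21397 | 2 => 36583 | 3 => 9277 | 4 => 62989 | 5 => 15101 | 6 => 44699 | _ => 28411

/-- The weights of the images of the positions under a permutation, packed into a number. -/
def packPerm : List ℕ → ℕ
  | [] => 0
  | x :: xs => Nat.add (weight x) (Nat.mul 65536 (packPerm xs))

/-- The weight at the position `u`. -/
def wt (S u : ℕ) : ℕ := Nat.land (Nat.shiftRight S (Nat.mul 16 u)) 65535

/-- The sum over the steps of the products of the weights at the two ends. It does not depend on the
order of the steps or on their orientation. -/
def code (S : ℕ) : List (ℕ × ℕ × Bool) → ℕ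
  | [] => 0
  | (x, y, _) :: l => Nat.add (Nat.mul (wt S x) (wt S y)) (code S l)

/-- No step of the quotient cycles leaves the block of the `u` with `u / d = b`. -/
def hasBlock (s : List (ℕ × ℕ × Bool)) (d b : ℕ) : Bool :=
  s.all fun p => match p with
    | (x, y, _) => match Nat.beq (Nat.div x d) b with
      | true => Nat.beq (Nat.div y d) b
      | false => !(Nat.beq (Nat.div y d) b)

/-- Equality of lists of numbers. -/
def beqL : List ℕ → List ℕ → Bool
  | [], [] => true
  | x :: xs, y :: ys => bif Nat.beq x y then beqL xs ys else false
  | _, _ => false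

/-- Equality of lists of lists of numbers. -/
def beqLL : List (List ℕ) → List (List ℕ) → Bool
  | [], [] => true
  | x :: xs, y :: ys => bif beqL x y then beqLL xs ys else false
  | _, _ => false

/-- The quotient cycles violate cyclic connectivity at one of the blocks, or a symmetry increases their
code, or they are in the list `canon`. -/
def phase1 (blocks : List (ℕ × ℕ)) (canon : List (ℕ × List (List ℕ))) (autos : List ℕ) (S₀ : ℕ)
    (cs : List (List ℕ)) : Bool :=
  let s := steps cs
  blocks.any (fun p => hasBlock s p.1 p.2) ||
    force (code S₀ s) fun c => autos.any (fun S => Nat.blt c (code S s)) ||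
      canon.any fun p => Nat.beq p.1 c && beqLL p.2 cs

/-! ### Rotation quotients -/

/-- The edges between leaves of a cubic graph with a rotation symmetry, up to the rotation: `R x y t`
says that the leaf `x` of branch `0` is adjacent to the leaf `y` of branch `t`. -/
structure IsQuotient (m : ℕ) (R : ℕ → ℕ → ℕ → Prop) : Prop where
  bound : ∀ {x y t}, R x y t → x < m ∧ y < m ∧ t < 3
  symm : ∀ {x y t}, R x y t → R y x (col3 (3 - t))
  irrefl : ∀ {x t}, ¬ R x x t
  two : ∀ x < m, ∃ d e : ℕ × ℕ, d ≠ e ∧ ∀ y t, R x y t ↔ (y, t) = d ∨ (y, t) = e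

/-- The reverse of a dart. -/
def revDart (p : ℕ × ℕ × ℕ) : ℕ × ℕ × ℕ := (p.2.1, p.1, col3 (3 - p.2.2))

theorem darts_eq (es : List (ℕ × ℕ × ℕ)) : darts es = es ++ es.map revDart := rfl

theorem revDart_revDart {p : ℕ × ℕ × ℕ} (h : p.2.2 < 3) : revDart (revDart p) = p := by
  obtain ⟨x, y, t⟩ := p
  have : t < 3 := h
  simp only [revDart, Prod.mk.injEq, true_and]
  interval_cases t <;> rfl

theorem darts_cons_perm (e : ℕ × ℕ × ℕ) (es : List (ℕ × ℕ × ℕ)) :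
    (darts (e :: es)).Perm (e :: revDart e :: darts es) := by
  simp only [darts_eq, List.cons_append, List.map_cons]
  exact List.Perm.cons _ List.perm_middle

theorem revDart_mem_darts {es : List (ℕ × ℕ × ℕ)} (h : ∀ e ∈ es, e.2.2 < 3) {d : ℕ × ℕ × ℕ}
    (hd : d ∈ darts es) : revDart d ∈ darts es := by
  simp only [darts_eq, List.mem_append, List.mem_map] at hd ⊢
  rcases hd with hd | ⟨a, ha, rfl⟩
  · exact .inr ⟨d, hd, rfl⟩
  · exact .inl (by rwa [revDart_revDart (h a ha)])

/-- The number of darts of `es` at `x`. -/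
def dartCount (x : ℕ) (es : List (ℕ × ℕ × ℕ)) : ℕ :=
  (es.map fun e => e.1).count x + (es.map fun e => e.2.1).count x

theorem length_filter_darts (x : ℕ) (es : List (ℕ × ℕ × ℕ)) :
    ((darts es).filter fun d => d.1 = x).length = dartCount x es := by
  rw [darts_eq, List.filter_append, List.length_append, dartCount]
  congr 1
  · induction es with
    | nil => rfl
    | cons e es ih => by_cases h : e.1 = x <;> simp [h, ih]
  · induction es with
    | nil => rfl
    | cons e es ih => by_cases h : e.2.1 = x <;> simp [h, ih, revDart]

variable {m : ℕ} {R : ℕ → ℕ → ℕ → Prop}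

theorem IsQuotient.mem_darts (hR : IsQuotient m R) {es : List (ℕ × ℕ × ℕ)} (hn : (darts es).Nodup)
    (hs : ∀ d ∈ darts es, R d.1 d.2.1 d.2.2) {x : ℕ} (hx : 2 ≤ dartCount x es) {y t : ℕ}
    (h : R x y t) : (x, y, t) ∈ darts es := by
  obtain ⟨d, e, hde, H⟩ := hR.two x (hR.bound h).1
  rw [← length_filter_darts] at hx
  set l := (darts es).filter fun d => d.1 = x with hl
  have hln : l.Nodup := hn.filter _
  have hsub : l.toFinset ⊆ {(x, d), (x, e)} := by
    intro p hp
    simp only [hl, List.mem_toFinset, List.mem_filter, decide_eq_true_eq] at hp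
    have := hs p hp.1
    rw [hp.2, H] at this
    obtain ⟨p1, p2, p3⟩ := p
    simp only at hp this
    rcases this with this | this <;> simp [hp.2, this]
  have hc : ({(x, d), (x, e)} : Finset (ℕ × ℕ × ℕ)).card = 2 := by
    rw [Finset.card_pair]; simpa using hde
  have heq := Finset.eq_of_subset_of_card_le hsub (by rw [hc, List.toFinset_card_of_nodup hln]; exact hx)
  have : (x, y, t) ∈ l.toFinset := by
    rw [heq]
    rcases (H y t).1 h with h | h <;> simp [h]
  rw [List.mem_toFinset] at this
  exact List.mem_of_mem_filter this

theorem IsQuotient.exists_dart (hR : IsQuotient m R) {es : List (ℕ × ℕ × ℕ)}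
    {x : ℕ} (hxm : x < m) (hx : dartCount x es ≤ 1) :
    ∃ y t, R x y t ∧ (x, y, t) ∉ darts es := by
  obtain ⟨d, e, hde, H⟩ := hR.two x hxm
  by_contra! hcon
  rw [← length_filter_darts] at hx
  set l := (darts es).filter fun d => d.1 = x with hl
  have h1 : (x, d) ∈ l := by
    simp only [hl, List.mem_filter, decide_true, and_true]; exact hcon d.1 d.2 ((H _ _).2 (.inl rfl))
  have h2 : (x, e) ∈ l := by
    simp only [hl, List.mem_filter, decide_true, and_true]; exact hcon e.1 e.2 ((H _ _).2 (.inr rfl))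
  have : ({(x, d), (x, e)} : Finset (ℕ × ℕ × ℕ)) ⊆ l.toFinset := by
    intro p hp; simp only [Finset.mem_insert, Finset.mem_singleton] at hp
    rcases hp with rfl | rfl <;> simpa
  have := Finset.card_le_card this
  rw [Finset.card_pair (by simpa using hde)] at this
  have := List.toFinset_card_le l
  omega

theorem IsQuotient.exists_min_dart (hR : IsQuotient m R) {x : ℕ} (hxm : x < m) :
    ∃ y t, R x y t ∧ ∀ y' t', R x y' t' → y ≤ y' := by
  obtain ⟨d, e, -, H⟩ := hR.two x hxm
  rcases le_total d.1 e.1 with h | h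
  · refine ⟨d.1, d.2, (H _ _).2 (.inl rfl), fun y' t' h' => ?_⟩
    rcases (H _ _).1 h' with h' | h' <;> simp [← h'] at h ⊢; exact h
  · refine ⟨e.1, e.2, (H _ _).2 (.inr rfl), fun y' t' h' => ?_⟩
    rcases (H _ _).1 h' with h' | h' <;> simp [← h'] at h ⊢; exact h

theorem dartCount_ne_zero {es : List (ℕ × ℕ × ℕ)} {x y t : ℕ} (h : (x, y, t) ∈ darts es) :
    dartCount x es ≠ 0 := by
  rw [← length_filter_darts]
  intro h0
  have : (x, y, t) ∈ (darts es).filter fun d => d.1 = x := by simp [h]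
  rw [List.length_eq_zero_iff.1 h0] at this
  simp at this

/-! ### Lists of quotient cycles -/

/-- The cycles `cs`, with the voltages given in `es`, list the quotient `R`. -/
structure Lists (m : ℕ) (R : ℕ → ℕ → ℕ → Prop) (cs : List (List ℕ)) (es : List (ℕ × ℕ × ℕ)) :
    Prop where
  pairs : (es.map fun e => (e.1, e.2.1)) = (steps cs).map fun s => (s.1, s.2.1)
  perm : cs.flatten.Perm (List.range m)
  nodup : (darts es).Nodup
  mem : ∀ x y t, R x y t ↔ (x, y, t) ∈ darts es

/-- The pairs of consecutive vertices of the path `v :: ys`. -/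
def openPairs : ℕ → List ℕ → List (ℕ × ℕ)
  | _, [] => []
  | v, y :: ys => (v, y) :: openPairs y ys

theorem map_stepsFrom (r v : ℕ) (ys : List ℕ) :
    ((stepsFrom r v ys).map fun s => (s.1, s.2.1)) =
      openPairs v ys ++ [((v :: ys).getLast (by simp), r)] := by
  induction ys generalizing v with
  | nil => rfl
  | cons y ys ih => simp [stepsFrom, openPairs, ih]

theorem openPairs_fst (v : ℕ) (ys : List ℕ) : (openPairs v ys).map Prod.fst = (v :: ys).dropLast := by
  induction ys generalizing v with
  | nil => rfl
  | cons y ys ih => simp [openPairs, ih]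

theorem openPairs_snd (v : ℕ) (ys : List ℕ) : (openPairs v ys).map Prod.snd = ys := by
  induction ys generalizing v with
  | nil => rfl
  | cons y ys ih => simp [openPairs, ih]

theorem cycleSteps_fst (c : List ℕ) : ((cycleSteps c).map fun s => s.1) = c := by
  cases c with
  | nil => rfl
  | cons x xs =>
    have := congrArg (List.map Prod.fst) (map_stepsFrom x x xs)
    rw [List.map_map, List.map_append, openPairs_fst] at this
    change _ = (x :: xs).dropLast ++ [(x :: xs).getLast _] at this
    rw [List.dropLast_append_getLast] at this
    exact this

theorem cycleSteps_snd (c : List ℕ) : ((cycleSteps c).map fun s => s.2.1).Perm c := by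
  cases c with
  | nil => exact .refl _
  | cons x xs =>
    have := congrArg (List.map Prod.snd) (map_stepsFrom x x xs)
    rw [List.map_map, List.map_append, openPairs_snd] at this
    change List.map _ (stepsFrom x x xs) = _ at this
    change (List.map _ (stepsFrom x x xs)).Perm _
    rw [show (fun s : ℕ × ℕ × Bool => s.2.1) = Prod.snd ∘ fun s => (s.1, s.2.1) from rfl, this]
    exact List.perm_append_singleton _ _

theorem steps_fst (cs : List (List ℕ)) : ((steps cs).map fun s => s.1) = cs.flatten := by
  induction cs with
  | nil => rfl
  | cons c cs ih =>
    have : steps (c :: cs) = cycleSteps c ++ steps cs := rfl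
    rw [this, List.map_append, ih, cycleSteps_fst, List.flatten_cons]

theorem steps_snd (cs : List (List ℕ)) : ((steps cs).map fun s => s.2.1).Perm cs.flatten := by
  induction cs with
  | nil => exact .refl _
  | cons c cs ih =>
    have : steps (c :: cs) = cycleSteps c ++ steps cs := rfl
    rw [this, List.map_append, List.flatten_cons]
    exact (cycleSteps_snd c).append ih

theorem map_fst_of_pairs {cs : List (List ℕ)} {es : List (ℕ × ℕ × ℕ)}
    (h : (es.map fun e => (e.1, e.2.1)) = (steps cs).map fun s => (s.1, s.2.1)) :
    (es.map fun e => e.1) = cs.flatten := by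
  have := congrArg (List.map Prod.fst) h
  rw [List.map_map, List.map_map] at this
  exact this.trans (steps_fst cs)

theorem map_snd_of_pairs {cs : List (List ℕ)} {es : List (ℕ × ℕ × ℕ)}
    (h : (es.map fun e => (e.1, e.2.1)) = (steps cs).map fun s => (s.1, s.2.1)) :
    (es.map fun e => e.2.1).Perm cs.flatten := by
  have := congrArg (List.map Prod.snd) h
  rw [List.map_map, List.map_map] at this
  exact (List.Perm.of_eq this).trans (steps_snd cs)

theorem eraseNat_perm {w : ℕ} {l : List ℕ} (h : w ∈ l) : l.Perm (w :: eraseNat w l) := by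
  induction l with
  | nil => simp at h
  | cons x xs ih =>
    rw [eraseNat]
    by_cases hx : x = w
    · subst hx; rw [show Nat.beq x x = true from Nat.beq_refl x]; exact .refl _
    · rw [show Nat.beq x w = false from Bool.eq_false_iff.2 fun h => hx (Nat.eq_of_beq_eq_true h)]
      have := ih (by simpa [Ne.symm hx] using h)
      exact (this.cons x).trans (.swap _ _ _)

/-- A partial traversal: the cycles in `done` are closed, and the open path `v :: path` has been
walked; `es` and `eo` are the darts used by them. -/
structure Partial (m : ℕ) (R : ℕ → ℕ → ℕ → Prop) (done : List (List ℕ)) (path : List ℕ) (v : ℕ)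
    (unvis : List ℕ) (es eo : List (ℕ × ℕ × ℕ)) : Prop where
  pairs : (es.map fun e => (e.1, e.2.1)) = (steps done).map fun s => (s.1, s.2.1)
  openp : (eo.map fun e => (e.1, e.2.1)) = openPairs v path
  perm : ((v :: path) ++ (done.flatten ++ unvis)).Perm (List.range m)
  nodup : (darts (eo ++ es)).Nodup
  rel : ∀ d ∈ darts (eo ++ es), R d.1 d.2.1 d.2.2

section Partial
variable {done : List (List ℕ)} {path : List ℕ} {v : ℕ} {unvis : List ℕ} {es eo : List (ℕ × ℕ × ℕ)}

theorem Partial.dartCount (h : Partial m R done path v unvis es eo) (x : ℕ) :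
    dartCount x (eo ++ es) =
      (v :: path).dropLast.count x + path.count x + 2 * done.flatten.count x := by
  have e1 : (eo.map fun e => e.1) = (v :: path).dropLast := by
    rw [← openPairs_fst, ← h.openp, List.map_map]; rfl
  have e2 : (eo.map fun e => e.2.1) = path := by
    rw [← openPairs_snd v path, ← h.openp, List.map_map]; rfl
  have e3 : (es.map fun e => e.1) = done.flatten := map_fst_of_pairs h.pairs
  have e4 : (es.map fun e => e.2.1).Perm done.flatten := map_snd_of_pairs h.pairs
  rw [HistSnark.dartCount, List.map_append, List.map_append, List.count_append, List.count_append,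
    e1, e2, e3, e4.count_eq]
  ring

theorem Partial.nodup' (h : Partial m R done path v unvis es eo) :
    ((v :: path) ++ (done.flatten ++ unvis)).Nodup :=
  h.perm.nodup_iff.2 List.nodup_range

theorem Partial.lt (h : Partial m R done path v unvis es eo) : v < m := by
  have : v ∈ List.range m := h.perm.subset (by simp)
  simpa using this

theorem Partial.count_v (h : Partial m R done path v unvis es eo) :
    HistSnark.dartCount v (eo ++ es) ≤ 1 ∧ (path = [] → HistSnark.dartCount v (eo ++ es) = 0) := by
  have hn := h.nodup'
  simp only [List.cons_append, List.nodup_cons, List.mem_append, not_or] at hn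
  have h1 : path.count v = 0 := List.count_eq_zero.2 hn.1.1
  have h2 : done.flatten.count v = 0 := List.count_eq_zero.2 hn.1.2.1
  rw [h.dartCount, h1, h2]
  constructor
  · have : (v :: path).dropLast.count v ≤ (v :: path).count v :=
      (List.dropLast_sublist _).count_le _
    rw [List.count_cons_self, h1] at this; omega
  · rintro rfl; simp

theorem Partial.tlt (hR : IsQuotient m R) (h : Partial m R done path v unvis es eo) :
    ∀ e ∈ eo ++ es, e.2.2 < 3 := fun e he =>
  (hR.bound (h.rel e (by rw [darts_eq]; exact List.mem_append_left _ he))).2.2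

/-- An unused dart leads to an unvisited vertex or closes the current cycle. -/
theorem Partial.next (hR : IsQuotient m R) (h : Partial m R done path v unvis es eo) {w t : ℕ}
    (hw : R v w t) (hnew : (v, w, t) ∉ darts (eo ++ es)) :
    w ∈ unvis ∨ (path ≠ [] ∧ w = (v :: path).getLast (by simp)) := by
  have hvw : w ≠ v := by rintro rfl; exact hR.irrefl hw
  have hlt : ¬ 2 ≤ HistSnark.dartCount w (eo ++ es) := fun hc => hnew <| by
    have := revDart_mem_darts (h.tlt hR) (hR.mem_darts h.nodup h.rel hc (hR.symm hw))
    have e := revDart_revDart (p := (v, w, t)) (hR.bound hw).2.2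
    simp only [revDart] at this e
    rwa [e] at this
  have hmem : w ∈ (v :: path) ++ (done.flatten ++ unvis) :=
    h.perm.symm.subset (by simpa using (hR.bound hw).2.1)
  rw [h.dartCount] at hlt
  simp only [List.mem_append] at hmem
  rcases hmem with hm | hm | hm
  · right
    have hp : w ∈ path := by simpa [hvw] using hm
    refine ⟨List.ne_nil_of_mem hp, ?_⟩
    by_contra hne
    have : w ∈ (v :: path).dropLast := by
      have hm2 := hm
      rw [← List.dropLast_append_getLast (l := v :: path) (by simp)] at hm2
      simpa [hne] using hm2
    have a := List.count_pos_iff.2 this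
    have b := List.count_pos_iff.2 hp
    omega
  · have := List.count_pos_iff.2 hm; omega
  · exact .inl hm

theorem nodup_darts_cons (hR : IsQuotient m R) {l : List (ℕ × ℕ × ℕ)} (hl : (darts l).Nodup)
    (ht : ∀ e ∈ l, e.2.2 < 3) {x y t : ℕ} (h : R x y t) (hnew : (x, y, t) ∉ darts l) :
    (darts ((x, y, t) :: l)).Nodup := by
  rw [(darts_cons_perm _ _).nodup_iff]
  have hxy : x ≠ y := by rintro rfl; exact hR.irrefl h
  simp only [List.nodup_cons, List.mem_cons, not_or]
  refine ⟨⟨by simp [revDart, hxy], hnew⟩, fun h' => hnew ?_, hl⟩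
  have := revDart_mem_darts ht h'
  rwa [revDart_revDart (hR.bound h).2.2] at this

theorem rel_darts_cons (hR : IsQuotient m R) {l : List (ℕ × ℕ × ℕ)}
    (hs : ∀ d ∈ darts l, R d.1 d.2.1 d.2.2) {x y t : ℕ} (h : R x y t) :
    ∀ d ∈ darts ((x, y, t) :: l), R d.1 d.2.1 d.2.2 := fun d hd => by
  have := (darts_cons_perm _ _).subset hd
  simp only [List.mem_cons] at this
  rcases this with rfl | rfl | hd
  · exact h
  · exact hR.symm h
  · exact hs d hd

theorem Partial.extend (hR : IsQuotient m R) (h : Partial m R done path v unvis es eo) {w t : ℕ}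
    (hw : R v w t) (hnew : (v, w, t) ∉ darts (eo ++ es)) (hu : w ∈ unvis) :
    Partial m R done (v :: path) w (eraseNat w unvis) es ((w, v, col3 (3 - t)) :: eo) where
  pairs := h.pairs
  openp := by simp [openPairs, h.openp]
  perm := by
    refine .trans ?_ h.perm
    have := eraseNat_perm hu
    have : ((v :: path) ++ (done.flatten ++ unvis)).Perm
        ((v :: path) ++ (done.flatten ++ (w :: eraseNat w unvis))) := by gcongr
    refine .symm (this.trans ?_)
    rw [← List.append_assoc]
    refine List.perm_middle.trans (.of_eq (by simp))
  nodup := by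
    refine nodup_darts_cons hR h.nodup (h.tlt hR) (hR.symm hw) fun h' => hnew ?_
    have := revDart_mem_darts (h.tlt hR) h'
    have e := revDart_revDart (p := (v, w, t)) (hR.bound hw).2.2
    simp only [revDart] at this e
    rwa [e] at this
  rel := rel_darts_cons hR h.rel (hR.symm hw)

/-- Closing the open path. -/
theorem Partial.close (hR : IsQuotient m R) (h : Partial m R done path v unvis es eo) {t : ℕ}
    (hw : R v ((v :: path).getLast (by simp)) t)
    (hnew : (v, (v :: path).getLast (by simp), t) ∉ darts (eo ++ es)) :
    ∃ e, ((e ++ es).map fun e => (e.1, e.2.1)) =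
        (steps ((v :: path) :: done)).map (fun s => (s.1, s.2.1)) ∧
      (darts (e ++ es)).Nodup ∧ ∀ d ∈ darts (e ++ es), R d.1 d.2.1 d.2.2 := by
  set r := (v :: path).getLast (by simp) with hr
  have hperm : (eo ++ [(r, v, col3 (3 - t))] ++ es).Perm ((r, v, col3 (3 - t)) :: (eo ++ es)) := by
    rw [List.append_assoc]; exact List.perm_middle
  have hd : (darts (eo ++ [(r, v, col3 (3 - t))] ++ es)).Perm
      (darts ((r, v, col3 (3 - t)) :: (eo ++ es))) := by
    rw [darts_eq, darts_eq]; exact hperm.append (hperm.map _)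
  refine ⟨eo ++ [(r, v, col3 (3 - t))], ?_, ?_, fun d hdm => ?_⟩
  · have : steps ((v :: path) :: done) = stepsFrom v v path ++ steps done := rfl
    rw [this, List.map_append, List.map_append, List.map_append, map_stepsFrom, h.openp, h.pairs]
    rfl
  · rw [hd.nodup_iff]
    refine nodup_darts_cons hR h.nodup (h.tlt hR) (hR.symm hw) fun h' => hnew ?_
    have := revDart_mem_darts (h.tlt hR) h'
    have e := revDart_revDart (p := (v, r, t)) (hR.bound hw).2.2
    simp only [revDart] at this e
    rwa [e] at this
  · exact rel_darts_cons hR h.rel (hR.symm hw) d (hd.subset hdm)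

end Partial

theorem qsearch_sound_aux (hR : IsQuotient m R) {fin : List (List ℕ) → Bool} (n : ℕ) :
    ∀ {done : List (List ℕ)} {path : List ℕ} {v f : ℕ} {unvis : List ℕ} {es eo : List (ℕ × ℕ × ℕ)},
      qsearch fin n done path v f unvis = true → Partial m R done path v unvis es eo →
      (path ≠ [] → ∀ y t, R ((v :: path).getLast (by simp)) y t → f ≤ y) →
      ∃ cs es, Lists m R cs es ∧ fin cs = true := by
  induction n with
  | zero => intro _ _ _ _ _ _ _ h; simp [qsearch] at h
  | succ n ih =>
    intro done path v f unvis es eo h hp hf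
    unfold qsearch at h
    rw [Bool.and_eq_true, List.all_eq_true] at h
    obtain ⟨hclose, hall⟩ := h
    by_cases hpath : path = []
    · subst hpath
      obtain ⟨w, t, hw, hmin⟩ := hR.exists_min_dart hp.lt
      have hnew : (v, w, t) ∉ darts (eo ++ es) := fun h' => dartCount_ne_zero h' (hp.count_v.2 rfl)
      rcases hp.next hR hw hnew with hu | hu
      · exact ih (hall w hu) (hp.extend hR hw hnew hu) fun _ y t' h' => hmin y t' (by simpa using h')
      · exact absurd rfl hu.1
    · obtain ⟨w, t, hw, hnew⟩ := hR.exists_dart hp.lt hp.count_v.1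
      rcases hp.next hR hw hnew with hu | ⟨-, rfl⟩
      · obtain ⟨p, ps, rfl⟩ := List.exists_cons_of_ne_nil hpath
        exact ih (hall w hu) (hp.extend hR hw hnew hu) fun _ y t' h' =>
          hf (by simp) y t' (by simpa using h')
      · obtain ⟨e, h1, h2, h3⟩ := hp.close hR hw hnew
        have hfv : Nat.ble f v = true := Nat.ble_eq_true_of_le (hf hpath v _ (hR.symm hw))
        obtain ⟨p, ps, rfl⟩ := List.exists_cons_of_ne_nil hpath
        simp only [hfv, cond_true] at hclose
        cases unvis with
        | nil =>
          have hperm : ((v :: p :: ps) :: done).flatten.Perm (List.range m) := by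
            simpa using hp.perm
          refine ⟨_, e ++ es, ⟨h1, hperm, h2, fun x y t => ⟨fun h => ?_, fun h => h3 _ h⟩⟩, hclose⟩
          refine hR.mem_darts h2 h3 ?_ h
          have hx : x ∈ ((v :: p :: ps) :: done).flatten :=
            hperm.symm.subset (by simpa using (hR.bound h).1)
          have a1 := map_fst_of_pairs h1
          have a2 := map_snd_of_pairs h1
          have := List.count_pos_iff.2 hx
          rw [dartCount, a1, a2.count_eq]
          omega
        | cons s u =>
          refine ih (es := e ++ es) (eo := []) hclose ⟨h1, rfl, ?_, h2, h3⟩ (by simp)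
          refine .trans ?_ hp.perm
          simp only [List.flatten_cons, List.cons_append, List.nil_append, List.append_assoc]
          have : (s :: (v :: p :: (ps ++ (done.flatten ++ u)))).Perm
            (v :: p :: (ps ++ (done.flatten ++ s :: u))) := by
            have e1 : v :: p :: (ps ++ (done.flatten ++ s :: u)) =
              (v :: p :: (ps ++ done.flatten)) ++ s :: u := by simp
            rw [e1]
            refine .symm (List.perm_middle.trans (.of_eq (by simp)))
          exact this

/-- The search through the oriented quotient cycles reaches every quotient. -/
theorem qsearch_sound (hR : IsQuotient m R) {fin : List (List ℕ) → Bool} {n r : ℕ} {l : List ℕ}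
    (hl : List.range m = r :: l) (h : qsearch fin n [] [] r 0 l = true) :
    ∃ cs es, Lists m R cs es ∧ fin cs = true :=
  qsearch_sound_aux hR n (es := []) (eo := []) h
    ⟨rfl, rfl, by simp [hl], by simp [darts_eq], by simp [darts_eq]⟩ (by simp)

/-! ### Evaluation of the search programs -/

theorem force_eq {α : Type} (n : ℕ) (f : ℕ → α) : force n f = f n := by cases n <;> rfl

theorem annotate_cons (M : ℕ → ℕ → ℕ) (p : Option (ℕ × ℕ)) (x y : ℕ) (cl : Bool)
    (l : List (ℕ × ℕ × Bool)) : annotate M p ((x, y, cl) :: l) =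
    .mk x y cl (sameHalf x y)
      (prevSib p x y)
      (diffMask M 0 x y) (diffMask M 1 x y) (diffMask M 2 x y) :: annotate M (some (x, y)) l := by
  conv_lhs => unfold annotate
  rw [force_eq, force_eq, force_eq]

theorem signStep_eq {α : Type} (d0 d1 d2 pp pm mp mm : ℕ) (k : ℕ → ℕ → ℕ → ℕ → α) :
    signStep d0 d1 d2 pp pm mp mm k = k (pp &&& d2 ||| pm &&& d0) (pp &&& d0 ||| pm &&& d1)
      (mp &&& d2 ||| mm &&& d0) (mp &&& d0 ||| mm &&& d1) := by
  rw [signStep, force_eq, force_eq, force_eq, force_eq]; rfl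

/-! ### Signs along cycles -/

/-- The sum of two signs modulo three. -/
def signSum : Bool → Bool → ℕ
  | true, true => 2
  | false, false => 1
  | _, _ => 0

/-- In the colouring with index `j` the signs `b`, `b'` at the ends fit to the step. -/
def StepOk (M : ℕ → ℕ → ℕ) (j : ℕ) (e : ℕ × ℕ × ℕ) (b b' : Bool) : Prop :=
  ∃ d < 3, (diffMask M d e.1 e.2.1).testBit j = true ∧ (e.2.2 + d) % 3 = signSum b b'

/-- The signs along a walk, from `b` at the start to `b'` at the end. -/
inductive Chain {ε : Type} (ok : ε → Bool → Bool → Prop) : Bool → List ε → Bool → Prop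
  | nil (b) : Chain ok b [] b
  | cons {b b₁ b₂ e l} : ok e b b₁ → Chain ok b₁ l b₂ → Chain ok b (e :: l) b₂

/-- The pairs `(x, y)` form a walk from `v` to `r`. -/
def IsWalk : ℕ → List (ℕ × ℕ) → ℕ → Prop
  | v, [], r => v = r
  | v, p :: l, r => p.1 = v ∧ IsWalk p.2 l r

theorem IsWalk.snd_mem {v r : ℕ} {l : List (ℕ × ℕ)} (h : IsWalk v l r) :
    ∀ p ∈ l, p.2 = r ∨ p.2 ∈ (l.map Prod.fst).tail := by
  induction l generalizing v with
  | nil => simp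
  | cons q l ih =>
    intro p hp
    simp only [List.map_cons, List.tail_cons]
    rcases List.mem_cons.1 hp with rfl | hp
    · cases l with
      | nil => exact .inl h.2
      | cons q' l => right; simp [h.2.1]
    · exact (ih h.2 p hp).imp_right fun h => List.mem_of_mem_tail h

theorem Chain.exists_sign {ε : Type} {pr : ε → ℕ × ℕ} {ok : ε → Bool → Bool → Prop} {l : List ε}
    {b b' : Bool} (h : Chain ok b l b') : ∀ {v r : ℕ}, IsWalk v (l.map pr) r →
      ((l.map pr).map Prod.fst).Nodup → r ∉ ((l.map pr).map Prod.fst).tail →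
      ∃ s : ℕ → Bool, (l ≠ [] → s v = b) ∧
        ∀ e ∈ l, ok e (s (pr e).1) (if (pr e).2 = r then b' else s (pr e).2) := by
  induction h with
  | nil b => intro _ _ _ _ _; exact ⟨fun _ => true, by simp, by simp⟩
  | @cons b b₁ b₂ e l hok hl ih =>
    intro v r hw hn hr
    simp only [List.map_cons, List.tail_cons, List.nodup_cons] at hw hn hr
    have hev : (pr e).1 = v := hw.1
    obtain ⟨s, hs, hall⟩ := ih hw.2 hn.2 fun h => hr (List.mem_of_mem_tail h)
    refine ⟨Function.update s v b, by simp, fun e' he' => ?_⟩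
    have hv : v ∉ (l.map pr).map Prod.fst := hev ▸ hn.1
    rcases List.mem_cons.1 he' with rfl | he'
    · rw [hev, Function.update_self]
      have key : (if (pr e').2 = r then b₂ else Function.update s v b (pr e').2) = b₁ := by
        cases l with
        | nil =>
          have : (pr e').2 = r := hw.2
          cases hl
          rw [if_pos this]
        | cons q l' =>
          have hq : (pr q).1 = (pr e').2 := hw.2.1
          have h1 : (pr e').2 ≠ r := by
            intro h; apply hr; simp [← h, hq]
          have h2 : (pr e').2 ≠ v := by
            intro h; apply hv; simp [← h, hq]
          rw [if_neg h1, Function.update_of_ne h2, hs (by simp)]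
      rwa [key]
    · have h1 : (pr e').1 ≠ v := by
        intro h; apply hv; rw [← h]; exact List.mem_map_of_mem (List.mem_map_of_mem he')
      rw [Function.update_of_ne h1]
      have := hall e' he'
      split_ifs with h2
      · rwa [if_pos h2] at this
      · rw [if_neg h2] at this
        rcases IsWalk.snd_mem hw.2 (pr e') (List.mem_map_of_mem he') with h3 | h3
        · exact absurd h3 h2
        · have : (pr e').2 ≠ v := fun h => hv (h ▸ List.mem_of_mem_tail h3)
          rwa [Function.update_of_ne this]

/-- Signs along disjoint cycles can be chosen simultaneously. -/
theorem exists_sign_of_chains {ε : Type} {pr : ε → ℕ × ℕ} {ok : ε → Bool → Bool → Prop}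
    (L : List (List ε)) (hn : ((L.flatten.map pr).map Prod.fst).Nodup)
    (hL : ∀ c ∈ L, (∃ b, Chain ok b c b) ∧ ∃ v, IsWalk v (c.map pr) v) :
    ∃ s : ℕ → Bool, ∀ e ∈ L.flatten, ok e (s (pr e).1) (s (pr e).2) := by
  induction L with
  | nil => exact ⟨fun _ => true, by simp⟩
  | cons c L ih =>
    rw [List.flatten_cons, List.map_append, List.map_append] at hn
    obtain ⟨s, hs⟩ := ih (List.Nodup.of_append_right hn) fun c hc => hL c (List.mem_cons_of_mem _ hc)
    obtain ⟨⟨b, hb⟩, v, hv⟩ := hL c (by simp)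
    have hcn := List.Nodup.of_append_left hn
    have hdis := List.disjoint_of_nodup_append hn
    have hvt : v ∉ ((c.map pr).map Prod.fst).tail := by
      cases c with
      | nil => simp
      | cons e c =>
        have : (pr e).1 = v := hv.1
        simp only [List.map_cons, List.nodup_cons] at hcn
        simpa [← this] using hcn.1
    obtain ⟨s', hs', hall⟩ := hb.exists_sign hv hcn hvt
    have htl : ∀ e ∈ c, (pr e).2 ∈ (c.map pr).map Prod.fst := fun e he => by
      rcases hv.snd_mem (pr e) (List.mem_map_of_mem he) with h | h
      · cases c with
        | nil => simp at he
        | cons e' c =>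
          have : (pr e').1 = v := hv.1
          simp [h, ← this]
      · exact List.mem_of_mem_tail h
    have hall' : ∀ e ∈ c, ok e (s' (pr e).1) (s' (pr e).2) := fun e he => by
      have := hall e he
      split_ifs at this with h
      · rwa [h, hs' (List.ne_nil_of_mem he)]
      · exact this
    classical
    refine ⟨fun x => if x ∈ (c.map pr).map Prod.fst then s' x else s x, fun e he => ?_⟩
    rcases List.mem_append.1 (List.flatten_cons ▸ he) with he | he
    · have h1 : (pr e).1 ∈ (c.map pr).map Prod.fst := List.mem_map_of_mem (List.mem_map_of_mem he)
      simp only [if_pos h1, if_pos (htl e he)]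
      exact hall' e he
    · have h1 : (pr e).1 ∈ (L.flatten.map pr).map Prod.fst :=
        List.mem_map_of_mem (List.mem_map_of_mem he)
      have h2 : (pr e).2 ∈ (L.flatten.map pr).map Prod.fst := by
        obtain ⟨c', hc', hec⟩ := List.mem_flatten.1 he
        obtain ⟨-, v', hv'⟩ := hL c' (List.mem_cons_of_mem _ hc')
        have : (pr e).2 ∈ (c'.map pr).map Prod.fst := by
          rcases hv'.snd_mem (pr e) (List.mem_map_of_mem hec) with h | h
          · cases c' with
            | nil => simp at hec
            | cons e' c' =>
              have : (pr e').1 = v' := hv'.1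
              simp [h, ← this]
          · exact List.mem_of_mem_tail h
        obtain ⟨q, hq, hq2⟩ := List.mem_map.1 this
        obtain ⟨q', hq', rfl⟩ := List.mem_map.1 hq
        rw [← hq2]
        exact List.mem_map_of_mem (List.mem_map_of_mem (List.mem_flatten.2 ⟨c', hc', hq'⟩))
      simp only [if_neg (hdis.symm h1), if_neg (hdis.symm h2)]
      exact hs e he

/-! ### The masks of a run along a walk -/

/-- The mask, of the four masks of a run, for the sign `a` at the start and `b` at the current vertex. -/
def stateMask (pp pm mp mm : ℕ) : Bool → Bool → ℕ
  | true, true => pp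
  | true, false => pm
  | false, true => mp
  | false, false => mm

theorem stateMask_step {pp pm mp mm j : ℕ} {E : ℕ → ℕ} {a b : Bool}
    (h : (stateMask (pp &&& E 2 ||| pm &&& E 0) (pp &&& E 0 ||| pm &&& E 1)
      (mp &&& E 2 ||| mm &&& E 0) (mp &&& E 0 ||| mm &&& E 1) a b).testBit j = true) :
    ∃ b₀, (stateMask pp pm mp mm a b₀).testBit j = true ∧ (E (signSum b₀ b)).testBit j = true := by
  cases a <;> cases b <;>
    simp only [stateMask, Nat.testBit_or, Nat.testBit_and, Bool.or_eq_true, Bool.and_eq_true] at h <;>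
    rcases h with h | h
  · exact ⟨true, h⟩
  · exact ⟨false, h⟩
  · exact ⟨true, h⟩
  · exact ⟨false, h⟩
  · exact ⟨true, h⟩
  · exact ⟨false, h⟩
  · exact ⟨true, h⟩
  · exact ⟨false, h⟩

/-- The condition on a step between leaves. -/
def PairOk (M : ℕ → ℕ → ℕ) (j : ℕ) (e : ℕ × ℕ) (b b' : Bool) : Prop :=
  (diffMask M (signSum b b') e.1 e.2).testBit j = true

/-- A colouring in a mask at the end of a run has signs along the walk. -/
theorem signRun_sound {α : Type} {M : ℕ → ℕ → ℕ} {l : List (ℕ × ℕ)} :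
    ∀ {pp pm mp mm : ℕ} {k : ℕ → ℕ → ℕ → ℕ → α}, ∃ pp' pm' mp' mm',
      signRun M l pp pm mp mm k = k pp' pm' mp' mm' ∧
      ∀ j a b, (stateMask pp' pm' mp' mm' a b).testBit j = true →
        ∃ b₀, (stateMask pp pm mp mm a b₀).testBit j = true ∧ Chain (PairOk M j) b₀ l b := by
  induction l with
  | nil => intro pp pm mp mm k; exact ⟨pp, pm, mp, mm, rfl, fun j a b h => ⟨b, h, .nil _⟩⟩
  | cons e l ih =>
    intro pp pm mp mm k
    obtain ⟨x, y⟩ := e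
    rw [signRun, force_eq, force_eq, signStep_eq]
    obtain ⟨a1, a2, a3, a4, h1, h2⟩ := ih
    refine ⟨a1, a2, a3, a4, h1, fun j a b hb => ?_⟩
    obtain ⟨b₁, h3, h4⟩ := h2 j a b hb
    obtain ⟨b₀, h5, h6⟩ := stateMask_step (E := fun d => diffMask M d x y) h3
    exact ⟨b₀, h5, .cons h6 h4⟩

theorem cycleMask_sound {M : ℕ → ℕ → ℕ} {full j : ℕ} {l : List (ℕ × ℕ)}
    (h : (cycleMask M full l).testBit j = true) : ∃ b, Chain (PairOk M j) b l b := by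
  rw [cycleMask] at h
  obtain ⟨a1, a2, a3, a4, h1, h2⟩ := signRun_sound (M := M) (l := l) (pp := full) (pm := 0) (mp := 0)
    (mm := full) (k := fun pp _ _ mm => Nat.lor pp mm)
  rw [h1, show Nat.lor a1 a4 = a1 ||| a4 from rfl, Nat.testBit_or, Bool.or_eq_true] at h
  rcases h with h | h
  · obtain ⟨b₀, h3, h4⟩ := h2 j true true h
    cases b₀ with
    | true => exact ⟨true, h4⟩
    | false => simp [stateMask] at h3
  · obtain ⟨b₀, h3, h4⟩ := h2 j false false h
    cases b₀ with
    | false => exact ⟨false, h4⟩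
    | true => simp [stateMask] at h3

/-! ### The search through the voltages -/

/-- The steps with the voltages `ts`. -/
def zipSteps : List (ℕ × ℕ × Bool) → List ℕ → List (ℕ × ℕ × ℕ)
  | (x, y, _) :: l, t :: ts => (x, y, t) :: zipSteps l ts
  | _, _ => []

/-- Signs along the steps, where each closing step has to return to the sign `a` at the start of
its cycle. -/
def Signed (M : ℕ → ℕ → ℕ) (j : ℕ) : Bool → Bool → List (ℕ × ℕ × Bool) → List ℕ → Prop
  | a, b, (x, y, cl) :: l, t :: ts => ∃ b', StepOk M j (x, y, t) b b' ∧
      if cl then b' = a ∧ (l = [] ∨ ∃ a', Signed M j a' a' l ts) else Signed M j a b' l ts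
  | _, _, _, _ => True

/-- Up to a change of the orientation, the first nonzero voltage is `1`. -/
def FirstOne : List ℕ → Prop
  | [] => True
  | 0 :: l => FirstOne l
  | 1 :: _ => True
  | _ => False

/-- A cycle of length three or four through a pair of siblings. -/
def SiblingCycle (es : List (ℕ × ℕ × ℕ)) : Prop :=
  (∃ x y, (x, y, 0) ∈ es ∧ sameHalf x y = true) ∨
    ∃ z x y t₀ t₁, (z, x, t₀) ∈ es ∧ (x, y, t₁) ∈ es ∧ sameHalf z y = true ∧ col3 (t₀ + t₁) = 0

/-- For all voltages of the remaining steps that are consistent with the pruning, a successful search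
finds a short cycle, or a colouring with signs, or a full assignment that passes the test `fin`. -/
theorem tsearch_sound {full : ℕ} {fin : List (ℕ × ℕ × ℕ) → Bool} {M : ℕ → ℕ → ℕ}
    (st : List (ℕ × ℕ × Bool)) : ∀ {p : Option (ℕ × ℕ)} {seen : Bool} {pt acc pp pm mp mm : ℕ}
    {es : List (ℕ × ℕ × ℕ)} {ts : List ℕ},
    tsearch full fin (annotate M p st) seen pt acc pp pm mp mm es = true →
    (∀ e ∈ st.getLast?, e.2.2 = true) →
    ts.length = st.length → (∀ t ∈ ts, t < 3) → (seen = true ∨ FirstOne ts) →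
    (∀ z w, p = some (z, w) → (z, w, pt) ∈ es) →
    SiblingCycle (es.reverse ++ zipSteps st ts) ∨
    (∃ j, acc.testBit j = true ∧ (st = [] ∨ ∃ a b, (stateMask pp pm mp mm a b).testBit j = true ∧
      Signed M j a b st ts)) ∨ fin (es.reverse ++ zipSteps st ts) = true := by
  induction st with
  | nil =>
    intro p seen pt acc pp pm mp mm es ts h _ hl _ _ _
    rw [annotate, tsearch] at h
    by_cases h0 : acc = 0
    · subst h0
      right; right
      simpa [zipSteps] using h
    · right; left
      obtain ⟨j, hj⟩ := Nat.exists_testBit_of_ne_zero h0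
      exact ⟨j, hj, .inl rfl⟩
  | cons e l ih =>
    intro p seen pt acc pp pm mp mm es ts h hend hl hts hseen hp
    obtain ⟨x, y, cl⟩ := e
    obtain ⟨t, ts, rfl⟩ : ∃ t ts', ts = t :: ts' := by
      cases ts with
      | nil => simp at hl
      | cons t ts => exact ⟨t, ts, rfl⟩
    have hl' : ts.length = l.length := by simpa using hl
    have ht3 : t < 3 := hts t (by simp)
    have hts' : ∀ t ∈ ts, t < 3 := fun t ht => hts t (by simp [ht])
    have hend' : ∀ e ∈ l.getLast?, e.2.2 = true := by
      cases l with
      | nil => simp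
      | cons e l => simpa using hend
    have hz : es.reverse ++ zipSteps ((x, y, cl) :: l) (t :: ts) =
      ((x, y, t) :: es).reverse ++ zipSteps l ts := by simp [zipSteps]
    rw [hz]
    have hp' : ∀ z w, some (x, y) = some (z, w) → (z, w, t) ∈ (x, y, t) :: es := by
      intro z w h; simp only [Option.some.injEq, Prod.mk.injEq] at h
      obtain ⟨rfl, rfl⟩ := h; simp
    -- the part of the argument that is common to the three voltages
    have main : ∀ (seen' : Bool) (E : ℕ → ℕ), (∀ i j, (E i).testBit j = true → i < 3 →
          ∃ d < 3, (diffMask M d x y).testBit j = true ∧ (t + d) % 3 = i) →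
        (seen' = true ∨ FirstOne ts) →
        tnext (fun acc pp pm mp mm =>
          tsearch full fin (annotate M (some (x, y)) l) seen' t acc pp pm mp mm ((x, y, t) :: es))
          full acc pp pm mp mm (prevSib p x y && Nat.beq (col3 (Nat.add pt t)) 0) cl
            (E 0) (E 1) (E 2) = true →
        SiblingCycle (((x, y, t) :: es).reverse ++ zipSteps l ts) ∨
        (∃ j, acc.testBit j = true ∧ ((x, y, cl) :: l = [] ∨
          ∃ a b, (stateMask pp pm mp mm a b).testBit j = true ∧
          Signed M j a b ((x, y, cl) :: l) (t :: ts))) ∨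
        fin (((x, y, t) :: es).reverse ++ zipSteps l ts) = true := by
      intro seen' E hE hs' hgo
      have hsum : ∀ b b', signSum b b' < 3 := by decide
      cases hb : prevSib p x y && Nat.beq (col3 (Nat.add pt t)) 0 with
      | true =>
        left; right
        rw [Bool.and_eq_true] at hb
        obtain ⟨h1, h2⟩ := hb
        cases p with
        | none => simp [prevSib] at h1
        | some q =>
          obtain ⟨z, w⟩ := q
          simp only [prevSib, Bool.and_eq_true] at h1
          have hw := Nat.eq_of_beq_eq_true h1.1
          subst hw
          refine ⟨z, w, y, pt, t, ?_, by simp, h1.2, Nat.eq_of_beq_eq_true h2⟩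
          have := hp z w rfl
          simp [this]
      | false =>
        rw [hb, tnext, cond_false, signStep_eq] at hgo
        cases cl with
        | true =>
          simp only [force_eq] at hgo
          rcases ih hgo hend' hl' hts' hs' hp' with h | ⟨j, hj, hj2⟩ | h
          · exact .inl h
          · right; left
            change (acc &&& (_ ||| _)).testBit j = true at hj
            rw [Nat.testBit_and, Bool.and_eq_true, Nat.testBit_or, Bool.or_eq_true] at hj
            have hrest : l = [] ∨ ∃ a', Signed M j a' a' l ts := by
              rcases hj2 with h | ⟨a, b, h1, h2⟩
              · exact .inl h
              · right
                cases a <;> cases b <;> simp only [stateMask, Nat.zero_testBit] at h1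
                · exact ⟨_, h2⟩
                · simp at h1
                · simp at h1
                · exact ⟨_, h2⟩
            have : ∃ a, (stateMask (pp &&& E 2 ||| pm &&& E 0) (pp &&& E 0 ||| pm &&& E 1)
                (mp &&& E 2 ||| mm &&& E 0) (mp &&& E 0 ||| mm &&& E 1) a a).testBit j = true := by
              rcases hj.2 with h | h
              · exact ⟨true, h⟩
              · exact ⟨false, h⟩
            obtain ⟨a, ha⟩ := this
            obtain ⟨b₀, h3, h4⟩ := stateMask_step ha
            exact ⟨j, hj.1, .inr ⟨a, b₀, h3, a, hE _ _ h4 (hsum _ _), by simpa using hrest⟩⟩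
          · exact .inr (.inr h)
        | false =>
          rcases ih hgo hend' hl' hts' hs' hp' with h | ⟨j, hj, hj2⟩ | h
          · exact .inl h
          · right; left
            rcases hj2 with h | ⟨a, b, h1, h2⟩
            · subst h
              simp at hend
            · obtain ⟨b₀, h3, h4⟩ := stateMask_step h1
              exact ⟨j, hj, .inr ⟨a, b₀, h3, b, hE _ _ h4 (hsum _ _), by simpa using h2⟩⟩
          · exact .inr (.inr h)
    rw [annotate_cons, tsearch] at h
    simp only [Bool.and_eq_true, Bool.or_eq_true, Bool.not_eq_true'] at h
    obtain ⟨⟨h0, h1⟩, h2⟩ := h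
    interval_cases t
    · rcases h0 with h0 | h0
      · left; left; exact ⟨x, y, by simp, h0⟩
      · refine main seen (fun i => diffMask M i x y) (fun i j h hi => ⟨i, hi, h, ?_⟩) hseen h0
        interval_cases i <;> rfl
    · refine main true (fun i => diffMask M ((i + 2) % 3) x y)
        (fun i j h hi => ⟨(i + 2) % 3, Nat.mod_lt _ (by norm_num), h, ?_⟩) (.inl rfl) h1
      interval_cases i <;> rfl
    · have hs : seen = true := by
        rcases hseen with h | h
        · exact h
        · exact h.elim
      rcases h2 with h2 | h2
      · simp [hs] at h2
      refine main true (fun i => diffMask M ((i + 1) % 3) x y)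
        (fun i j h hi => ⟨(i + 1) % 3, Nat.mod_lt _ (by norm_num), h, ?_⟩) (.inl rfl) h2
      interval_cases i <;> rfl

/-! ### From the search to signs -/

/-- The pair of end points of a step. -/
def ends (e : ℕ × ℕ × ℕ) : ℕ × ℕ := (e.1, e.2.1)

theorem zipSteps_of_pairs {st : List (ℕ × ℕ × Bool)} : ∀ {es : List (ℕ × ℕ × ℕ)},
    es.map ends = st.map (fun s => (s.1, s.2.1)) → zipSteps st (es.map fun e => e.2.2) = es := by
  induction st with
  | nil => intro es h; simpa [zipSteps] using h.symm
  | cons s st ih =>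
    intro es h
    cases es with
    | nil => simp at h
    | cons e es =>
      obtain ⟨x, y, cl⟩ := s
      simp only [List.map_cons, List.cons.injEq] at h
      rw [List.map_cons, zipSteps, ih h.2]
      simp only [ends, Prod.mk.injEq] at h
      rw [← h.1.1, ← h.1.2]

theorem isWalk_openPairs (v : ℕ) (ys : List ℕ) (r : ℕ) :
    IsWalk v (openPairs v ys ++ [((v :: ys).getLast (by simp), r)]) r := by
  induction ys generalizing v with
  | nil => simp [openPairs, IsWalk]
  | cons y ys ih => simpa [openPairs, IsWalk] using ih y

theorem length_stepsFrom (r v : ℕ) (ys : List ℕ) : (stepsFrom r v ys).length = ys.length + 1 := by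
  induction ys generalizing v with
  | nil => rfl
  | cons y ys ih => simp [stepsFrom, ih]

theorem length_cycleSteps (c : List ℕ) : (cycleSteps c).length = c.length := by
  cases c with
  | nil => rfl
  | cons x xs => exact length_stepsFrom x x xs

theorem splitCycles_spec {cs : List (List ℕ)} : ∀ {es : List (ℕ × ℕ × ℕ)},
    es.map ends = (steps cs).map (fun s => (s.1, s.2.1)) →
    (splitCycles cs es).flatten = es ∧
      ∀ c ∈ splitCycles cs es, ∃ v, IsWalk v (c.map ends) v := by
  induction cs with
  | nil => intro es h; simpa [splitCycles, steps] using h.symm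
  | cons c cs ih =>
    intro es h
    have e1 : steps (c :: cs) = cycleSteps c ++ steps cs := rfl
    rw [e1, List.map_append] at h
    have h1 : (es.take c.length).map ends = (cycleSteps c).map (fun s => (s.1, s.2.1)) := by
      rw [List.map_take, h, List.take_left' (by simp [length_cycleSteps])]
    have h2 : (es.drop c.length).map ends = (steps cs).map (fun s => (s.1, s.2.1)) := by
      rw [List.map_drop, h, List.drop_left' (by simp [length_cycleSteps])]
    obtain ⟨h3, h4⟩ := ih h2
    rw [splitCycles]
    refine ⟨by rw [List.flatten_cons, h3, List.take_append_drop], fun c' hc' => ?_⟩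
    rcases List.mem_cons.1 hc' with rfl | hc'
    · rw [h1]
      cases c with
      | nil => exact ⟨0, rfl⟩
      | cons x xs =>
        refine ⟨x, ?_⟩
        change IsWalk x ((stepsFrom x x xs).map _) x
        rw [map_stepsFrom]
        exact isWalk_openPairs x xs x
    · exact h4 c' hc'

theorem signed_cycle {M : ℕ → ℕ → ℕ} {j : ℕ} {rest : List (ℕ × ℕ × Bool)} {ts' : List ℕ}
    (r : ℕ) (ys : List ℕ) : ∀ {v : ℕ} {a b : Bool} {ts : List ℕ}, ts.length = ys.length + 1 →
    Signed M j a b (stepsFrom r v ys ++ rest) (ts ++ ts') →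
    Chain (StepOk M j) b (zipSteps (stepsFrom r v ys) ts) a ∧
      (rest = [] ∨ ∃ a', Signed M j a' a' rest ts') := by
  induction ys with
  | nil =>
    intro v a b ts hl h
    obtain ⟨t, rfl⟩ := List.length_eq_one_iff.1 hl
    simp only [stepsFrom, List.cons_append, List.nil_append, Signed, if_true] at h
    obtain ⟨b', h1, rfl, h2⟩ := h
    exact ⟨.cons h1 (.nil _), h2⟩
  | cons y ys ih =>
    intro v a b ts hl h
    cases ts with
    | nil => simp at hl
    | cons t ts =>
      simp only [stepsFrom, List.cons_append, Signed, Bool.false_eq_true, if_false] at h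
      obtain ⟨b', h1, h2⟩ := h
      obtain ⟨h3, h4⟩ := ih (by simpa using hl) h2
      exact ⟨.cons h1 h3, h4⟩

theorem signed_chains {M : ℕ → ℕ → ℕ} {j : ℕ} (cs : List (List ℕ)) :
    ∀ {es : List (ℕ × ℕ × ℕ)}, es.map ends = (steps cs).map (fun s => (s.1, s.2.1)) →
    (steps cs = [] ∨ ∃ a, Signed M j a a (steps cs) (es.map fun e => e.2.2)) →
    ∀ c ∈ splitCycles cs es, ∃ b, Chain (StepOk M j) b c b := by
  induction cs with
  | nil => intro es _ _ c hc; simp [splitCycles] at hc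
  | cons c cs ih =>
    intro es h hs c' hc'
    have e1 : steps (c :: cs) = cycleSteps c ++ steps cs := rfl
    rw [e1] at hs
    rw [e1, List.map_append] at h
    have h1 : (es.take c.length).map ends = (cycleSteps c).map (fun s => (s.1, s.2.1)) := by
      rw [List.map_take, h, List.take_left' (by simp [length_cycleSteps])]
    have h2 : (es.drop c.length).map ends = (steps cs).map (fun s => (s.1, s.2.1)) := by
      rw [List.map_drop, h, List.drop_left' (by simp [length_cycleSteps])]
    have hlen : c.length ≤ es.length := by
      have := congrArg List.length h
      simp [length_cycleSteps] at this
      omega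
    cases c with
    | nil =>
      simp only [splitCycles, List.mem_cons] at hc'
      rcases hc' with rfl | hc'
      · exact ⟨true, .nil _⟩
      · exact ih (by simpa using h2) (by simpa [cycleSteps] using hs) c' (by simpa using hc')
    | cons x xs =>
      rcases hs with hs | ⟨a, hs⟩
      · have := congrArg List.length hs
        simp [length_cycleSteps] at this
      have e2 : (es.map fun e => e.2.2) =
          ((es.take (x :: xs).length).map fun e => e.2.2) ++
            (es.drop (x :: xs).length).map fun e => e.2.2 := by
        rw [← List.map_append, List.take_append_drop]
      rw [e2] at hs
      obtain ⟨h3, h4⟩ := signed_cycle x xs (by simpa using hlen) hs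
      rw [splitCycles] at hc'
      rcases List.mem_cons.1 hc' with rfl | hc'
      · have := zipSteps_of_pairs h1
        change zipSteps (stepsFrom x x xs) _ = _ at this
        rw [this] at h3
        exact ⟨a, h3⟩
      · exact ih h2 h4 c' hc'

theorem steps_getLast (cs : List (List ℕ)) : ∀ e ∈ (steps cs).getLast?, e.2.2 = true := by
  have hc : ∀ c, ∀ e ∈ (cycleSteps c).getLast?, e.2.2 = true := by
    intro c
    cases c with
    | nil => simp [cycleSteps]
    | cons x xs =>
      have : ∀ (r v : ℕ) ys, ∀ e ∈ (stepsFrom r v ys).getLast?, e.2.2 = true := by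
        intro r v ys
        induction ys generalizing v with
        | nil => simp [stepsFrom]
        | cons y ys ih =>
          intro e he
          refine ih y e ?_
          cases h : stepsFrom r y ys with
          | nil => have := congrArg List.length h; simp [length_stepsFrom] at this
          | cons a l => rw [stepsFrom, h] at he; simpa using he
      exact this x x xs
  induction cs with
  | nil => simp [steps]
  | cons c cs ih =>
    have e1 : steps (c :: cs) = cycleSteps c ++ steps cs := rfl
    rw [e1]
    intro e he
    rw [List.getLast?_append] at he
    cases h : (steps cs).getLast? with
    | none => rw [h] at he; exact hc c e (by simpa using he)
    | some e' => rw [h] at he ih; exact ih e (by simpa using he)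

/-- Outcome of the search through the voltages of the quotient cycles `cs`. -/
theorem tstart_sound {full : ℕ} {fin : List (ℕ × ℕ × ℕ) → Bool} {M : ℕ → ℕ → ℕ} {cs : List (List ℕ)}
    (h : tstart M full fin cs = true) {es : List (ℕ × ℕ × ℕ)}
    (hes : es.map ends = (steps cs).map (fun s => (s.1, s.2.1))) (hn : cs.flatten.Nodup)
    (ht : ∀ e ∈ es, e.2.2 < 3) (h1 : FirstOne (es.map fun e => e.2.2)) :
    SiblingCycle es ∨ (∃ j, full.testBit j = true ∧
      ∃ s : ℕ → Bool, ∀ e ∈ es, StepOk M j e (s e.1) (s e.2.1)) ∨ fin es = true := by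
  have hlen : (es.map fun e => e.2.2).length = (steps cs).length := by
    have := congrArg List.length hes; simpa using this
  have := tsearch_sound (steps cs) h (steps_getLast cs) hlen
    (by simpa [List.mem_map] using fun a b c h => ht (b, c, a) h) (.inr h1) (by simp)
  rw [zipSteps_of_pairs hes, List.reverse_nil, List.nil_append] at this
  refine this.imp_right (Or.imp_left ?_)
  rintro ⟨j, hj, hs⟩
  refine ⟨j, hj, ?_⟩
  have hs' : steps cs = [] ∨ ∃ a, Signed M j a a (steps cs) (es.map fun e => e.2.2) := by
    refine hs.imp_right ?_
    rintro ⟨a, b, h2, h3⟩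
    cases a <;> cases b <;> simp only [stateMask, Nat.zero_testBit] at h2
    · exact ⟨_, h3⟩
    · simp at h2
    · simp at h2
    · exact ⟨_, h3⟩
  obtain ⟨hf, hw⟩ := splitCycles_spec hes
  have := exists_sign_of_chains (pr := ends) (ok := StepOk M j) (splitCycles cs es)
    (by rw [hf, hes, List.map_map]; exact (steps_fst cs).symm ▸ hn)
    fun c hc => ⟨signed_chains cs hes hs' c hc, hw c hc⟩
  rwa [hf] at this

/-! ### The lift of a quotient -/

/-- The three leaf edges over a quotient dart. -/
def liftDart (m : ℕ) (e : ℕ × ℕ × ℕ) : List (ℕ × ℕ) :=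
  [0, 1, 2].map fun k => (leafIx m e.1 k, leafIx m e.2.1 (col3 (k + e.2.2)))

theorem strand_perm {m : ℕ} (es : List (ℕ × ℕ × ℕ)) : ∀ {ks : List ℕ}, ks.Perm [0, 1, 2] →
    (∀ e ∈ es, e.2.2 < 3) → (ks.flatMap fun k => strand m k es).Perm (es.flatMap (liftDart m)) := by
  induction es with
  | nil => intro ks _ _; simp [strand]
  | cons e es ih =>
    intro ks hk ht
    obtain ⟨x, y, t⟩ := e
    have ht3 : t < 3 := ht (x, y, t) (by simp)
    simp only [strand, List.flatMap_cons]
    refine (List.map_append_flatMap_perm ks _ _).symm.trans ?_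
    refine List.Perm.append (hk.map _) ?_
    have := ih (ks := ks.map fun k => col3 (k + t)) ?_ fun e he => ht e (by simp [he])
    · rw [List.flatMap_map] at this; exact this
    · refine (hk.map _).trans ?_
      interval_cases t <;> decide

theorem isWalk_append {l l' : List (ℕ × ℕ)} : ∀ {v w r : ℕ}, IsWalk v l w → IsWalk w l' r →
    IsWalk v (l ++ l') r := by
  induction l with
  | nil => intro v w r h h'; obtain rfl : v = w := h; exact h'
  | cons p l ih => intro v w r h h'; exact ⟨h.1, ih h.2 h'⟩

theorem isWalk_strand {m : ℕ} (es : List (ℕ × ℕ × ℕ)) : ∀ {v r k : ℕ}, IsWalk v (es.map ends) r →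
    k < 3 → IsWalk (leafIx m v k) (strand m k es) (leafIx m r (col3 (k + voltage es))) := by
  induction es with
  | nil =>
    intro v r k h hk
    obtain rfl : v = r := h
    change leafIx m v k = leafIx m v ((k + 0) % 3)
    rw [Nat.add_zero, Nat.mod_eq_of_lt hk]
  | cons e es ih =>
    intro v r k h hk
    obtain ⟨x, y, t⟩ := e
    have hx : x = v := h.1
    have e : col3 (k + voltage ((x, y, t) :: es)) = col3 (col3 (k + t) + voltage es) := by
      change (k + (t + voltage es) % 3) % 3 = ((k + t) % 3 + voltage es) % 3
      omega
    rw [e]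
    exact ⟨by rw [hx], ih (k := col3 (k + t)) h.2 (Nat.mod_lt _ (by norm_num))⟩

theorem voltage_lt (es : List (ℕ × ℕ × ℕ)) : voltage es < 3 := by
  cases es with
  | nil => simp [voltage]
  | cons e es => exact Nat.mod_lt _ (by norm_num)

theorem liftMask_sound {m : ℕ} {M : ℕ → ℕ → ℕ} {full j : ℕ} {es : List (ℕ × ℕ × ℕ)}
    (h : (liftMask m M full es).testBit j = true) (ht : ∀ e ∈ es, e.2.2 < 3) {v : ℕ}
    (hv : IsWalk v (es.map ends) v) : ∃ L : List (List (ℕ × ℕ)),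
      L.flatten.Perm (es.flatMap (liftDart m)) ∧
      ∀ c ∈ L, (∃ b, Chain (PairOk M j) b c b) ∧ ∃ w, IsWalk w (c.map id) w := by
  have hw : ∀ k < 3, IsWalk (leafIx m v k) (strand m k es) (leafIx m v (col3 (k + voltage es))) :=
    fun k hk => isWalk_strand es hv hk
  rw [liftMask] at h
  have hlt := voltage_lt es
  cases hT : voltage es with
  | zero =>
    rw [hT] at h
    change Nat.testBit (_ &&& (_ &&& _)) j = true at h
    simp only [Nat.testBit_and, Bool.and_eq_true] at h
    refine ⟨[0, 1, 2].map fun k => strand m k es, ?_, ?_⟩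
    · rw [← List.flatMap_def]; exact strand_perm es (.refl _) ht
    · intro c hc
      simp only [List.map_cons, List.map_nil, List.mem_cons, List.not_mem_nil, or_false] at hc
      have h0 := hw 0 (by norm_num)
      have h1 := hw 1 (by norm_num)
      have h2 := hw 2 (by norm_num)
      rw [hT] at h0 h1 h2
      rw [List.map_id]
      rcases hc with rfl | rfl | rfl
      · exact ⟨cycleMask_sound h.1, _, h0⟩
      · exact ⟨cycleMask_sound h.2.1, _, h1⟩
      · exact ⟨cycleMask_sound h.2.2, _, h2⟩
  | succ t =>
    rw [hT] at h hw hlt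
    simp only at h
    refine ⟨[strand m 0 es ++ (strand m (col3 (t + 1)) es ++ strand m (col3 (2 * (t + 1))) es)], ?_, ?_⟩
    · have := strand_perm (m := m) es (ks := [0, col3 (t + 1), col3 (2 * (t + 1))])
        (by have : t < 2 := by omega
            interval_cases t <;> decide) ht
      simpa using this
    · intro c hc
      rw [List.mem_singleton] at hc
      subst hc
      refine ⟨cycleMask_sound h, leafIx m v 0, ?_⟩
      rw [List.map_id]
      have ht : t < 2 := by omega
      have h0 := hw 0 (by norm_num)
      have h1 := hw 1 (by norm_num)
      have h2 := hw 2 (by norm_num)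
      interval_cases t
      · exact isWalk_append h0 (isWalk_append h1 h2)
      · exact isWalk_append h0 (isWalk_append h2 h1)

theorem foldr_land_testBit {f : List (ℕ × ℕ × ℕ) → ℕ} {full j : ℕ} (L : List (List (ℕ × ℕ × ℕ)))
    (h : (L.foldr (fun c r => Nat.land (f c) r) full).testBit j = true) :
    full.testBit j = true ∧ ∀ c ∈ L, (f c).testBit j = true := by
  induction L with
  | nil => exact ⟨h, by simp⟩
  | cons c L ih =>
    rw [List.foldr_cons] at h
    change Nat.testBit (_ &&& _) j = true at h
    rw [Nat.testBit_and, Bool.and_eq_true] at h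
    obtain ⟨h1, h2⟩ := ih h.2
    exact ⟨h1, by simpa using ⟨h.1, h2⟩⟩

theorem leafIx_inj {m x y k l : ℕ} (hx : x < m) (hy : y < m) (h : leafIx m x k = leafIx m y l) :
    x = y ∧ k = l := by
  change x + m * k = y + m * l at h
  have h1 := congrArg (· % m) h
  simp only [Nat.add_mul_mod_self_left, Nat.mod_eq_of_lt hx, Nat.mod_eq_of_lt hy] at h1
  subst h1
  refine ⟨rfl, ?_⟩
  have : m * k = m * l := by omega
  exact Nat.eq_of_mul_eq_mul_left (by omega) this

theorem nodup_lift_fst {m : ℕ} {es : List (ℕ × ℕ × ℕ)} (hn : (es.map fun e => e.1).Nodup)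
    (hm : ∀ e ∈ es, e.1 < m) : ((es.flatMap (liftDart m)).map Prod.fst).Nodup := by
  induction es with
  | nil => simp
  | cons e es ih =>
    rw [List.map_cons, List.nodup_cons] at hn
    rw [List.flatMap_cons, List.map_append, List.nodup_append]
    refine ⟨?_, ih hn.2 fun e he => hm e (by simp [he]), ?_⟩
    · have he := hm e (by simp)
      simp only [liftDart, List.map_map]
      refine List.Nodup.map_on (fun a _ b _ h => (leafIx_inj he he h).2) (by decide)
    · intro a ha b hb hab
      subst hab
      simp only [liftDart, List.map_map, List.mem_map, Function.comp_apply] at ha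
      obtain ⟨k, -, rfl⟩ := ha
      simp only [List.mem_map, List.mem_flatMap, liftDart] at hb
      obtain ⟨p, ⟨e', he', k', -, rfl⟩, h⟩ := hb
      have := (leafIx_inj (hm e' (by simp [he'])) (hm e (by simp)) h).1
      exact hn.1 (by rw [← this]; exact List.mem_map_of_mem he')

theorem nodup_lift_snd {m : ℕ} {es : List (ℕ × ℕ × ℕ)} (hn : (es.map fun e => e.2.1).Nodup)
    (hm : ∀ e ∈ es, e.2.1 < m) (ht : ∀ e ∈ es, e.2.2 < 3) :
    ((es.flatMap (liftDart m)).map Prod.snd).Nodup := by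
  induction es with
  | nil => simp
  | cons e es ih =>
    rw [List.map_cons, List.nodup_cons] at hn
    rw [List.flatMap_cons, List.map_append, List.nodup_append]
    refine ⟨?_, ih hn.2 (fun e he => hm e (by simp [he])) fun e he => ht e (by simp [he]), ?_⟩
    · have he := hm e (by simp)
      have hte := ht e (by simp)
      simp only [liftDart, List.map_map]
      refine List.Nodup.map_on (fun a ha b hb h => ?_) (by decide)
      have := (leafIx_inj he he h).2
      change (a + e.2.2) % 3 = (b + e.2.2) % 3 at this
      simp only [List.mem_cons, List.not_mem_nil, or_false] at ha hb
      omega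
    · intro a ha b hb hab
      subst hab
      simp only [liftDart, List.map_map, List.mem_map, Function.comp_apply] at ha
      obtain ⟨k, -, rfl⟩ := ha
      simp only [List.mem_map, List.mem_flatMap, liftDart] at hb
      obtain ⟨p, ⟨e', he', k', -, rfl⟩, h⟩ := hb
      have := (leafIx_inj (hm e' (by simp [he'])) (hm e (by simp)) h).1
      exact hn.1 (by rw [← this]; exact List.mem_map_of_mem he')

theorem liftRun_eq {m : ℕ} {M : ℕ → ℕ → ℕ} (l : List (ℕ × ℕ × ℕ)) (k pp pm mp mm : ℕ)
    (r : ℕ → ℕ → ℕ → ℕ → ℕ) : liftRun m M l k pp pm mp mm r = signRun M (strand m k l) pp pm mp mm r := by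
  induction l generalizing k pp pm mp mm with
  | nil => rfl
  | cons e l ih =>
    obtain ⟨x, y, t⟩ := e
    change force (col3 (Nat.add k t)) (fun k' =>
      signStep (diffMask M 0 (leafIx m x k) (leafIx m y k')) (diffMask M 1 (leafIx m x k) (leafIx m y k'))
        (diffMask M 2 (leafIx m x k) (leafIx m y k')) pp pm mp mm
        fun pp' pm' mp' mm' => liftRun m M l k' pp' pm' mp' mm' r) = _
    rw [force_eq, strand, signRun, force_eq, force_eq]
    exact congrArg _ (funext fun _ => funext fun _ => funext fun _ => funext fun _ => ih _ _ _ _ _)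

theorem signRun_append {α : Type} {M : ℕ → ℕ → ℕ} (l l' : List (ℕ × ℕ)) (pp pm mp mm : ℕ)
    (r : ℕ → ℕ → ℕ → ℕ → α) : signRun M (l ++ l') pp pm mp mm r =
      signRun M l pp pm mp mm fun pp pm mp mm => signRun M l' pp pm mp mm r := by
  induction l generalizing pp pm mp mm with
  | nil => rfl
  | cons p l ih =>
    rw [List.cons_append, signRun, signRun, force_eq, force_eq, force_eq, force_eq]
    exact congrArg _ (funext fun _ => funext fun _ => funext fun _ => funext fun _ => ih _ _ _ _)

theorem fastLiftMask_eq {m : ℕ} {M : ℕ → ℕ → ℕ} {full : ℕ} (es : List (ℕ × ℕ × ℕ)) :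
    fastLiftMask m M full es = liftMask m M full es := by
  rw [fastLiftMask, liftMask]
  cases voltage es with
  | zero =>
    simp only [liftRun_eq, force_eq]
    exact Nat.land_assoc _ _ _
  | succ t => simp only [liftRun_eq, cycleMask, signRun_append]

/-- A colouring in the family with signs at the leaves. -/
theorem liftColourable_sound {m : ℕ} {M : ℕ → ℕ → ℕ} {full : ℕ} {cs : List (List ℕ)}
    {es : List (ℕ × ℕ × ℕ)} (h : liftColourable m M full cs es = true)
    (hes : es.map ends = (steps cs).map (fun s => (s.1, s.2.1))) (hn : cs.flatten.Nodup)
    (ht : ∀ e ∈ es, e.2.2 < 3) (hm : ∀ e ∈ es, e.1 < m) :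
    ∃ j, full.testBit j = true ∧
      ∃ s : ℕ → Bool, ∀ p ∈ es.flatMap (liftDart m), PairOk M j p (s p.1) (s p.2) := by
  rw [liftColourable, Bool.not_eq_true'] at h
  simp only [fastLiftMask_eq] at h
  have h0 : (splitCycles cs es).foldr (fun c r => Nat.land (liftMask m M full c) r) full ≠ 0 :=
    fun h0 => by rw [h0] at h; simp at h
  replace h0 := Nat.exists_testBit_of_ne_zero h0
  obtain ⟨j, hj⟩ := h0
  obtain ⟨hf, hc⟩ := foldr_land_testBit (f := liftMask m M full) _ hj
  obtain ⟨hfl, hw⟩ := splitCycles_spec hes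
  refine ⟨j, hf, ?_⟩
  have key : ∀ L : List (List (ℕ × ℕ × ℕ)), (∀ c ∈ L, (liftMask m M full c).testBit j = true) →
      (∀ c ∈ L, ∃ v, IsWalk v (c.map ends) v) → (∀ e ∈ L.flatten, e.2.2 < 3) →
      ∃ L' : List (List (ℕ × ℕ)), L'.flatten.Perm (L.flatten.flatMap (liftDart m)) ∧
        ∀ c ∈ L', (∃ b, Chain (PairOk M j) b c b) ∧ ∃ w, IsWalk w (c.map id) w := by
    intro L
    induction L with
    | nil => intro _ _ _; exact ⟨[], by simp, by simp⟩
    | cons c L ih =>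
      intro h1 h2 h3
      obtain ⟨L', h4, h5⟩ := ih (fun c hc => h1 c (by simp [hc])) (fun c hc => h2 c (by simp [hc]))
        fun e he => h3 e (by rw [List.flatten_cons]; exact List.mem_append_right _ he)
      obtain ⟨v, hv⟩ := h2 c (by simp)
      obtain ⟨L₀, h6, h7⟩ := liftMask_sound (h1 c (by simp))
        (fun e he => h3 e (by rw [List.flatten_cons]; exact List.mem_append_left _ he)) hv
      refine ⟨L₀ ++ L', ?_, fun c hc => (List.mem_append.1 hc).elim (h7 c) (h5 c)⟩
      rw [List.flatten_append, List.flatten_cons, List.flatMap_append]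
      exact h6.append h4
  obtain ⟨L', h1, h2⟩ := key (splitCycles cs es) hc hw (by rwa [hfl])
  rw [hfl] at h1
  have hsrc : (es.map fun e => e.1).Nodup := by rw [map_fst_of_pairs hes]; exact hn
  obtain ⟨s, hs⟩ := exists_sign_of_chains (pr := id) L'
    (by rw [List.map_id, (h1.map _).nodup_iff]; exact nodup_lift_fst hsrc hm) h2
  exact ⟨s, fun p hp => hs p (h1.symm.subset hp)⟩

/-! ### Colourings of the tree given by masks -/

/-- The parent of a vertex in the standard numbering of the tree with `3 * m` leaves: the leaves
come first, level by level, and the central vertex is `6 * m - 3`. -/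
def par (m v : ℕ) : ℕ := Nat.min (Nat.add (Nat.mul 3 m) (Nat.div v 2)) (Nat.sub (Nat.mul 6 m) 3)

theorem par_def (m v : ℕ) : par m v = min (3 * m + v / 2) (6 * m - 3) := rfl

/-- For each `v`, the edge from `v` to its parent has the colour `c` in the colourings of the mask
`M v c`, and each of these is a proper colouring. -/
structure TreeMasks (m : ℕ) (M : ℕ → ℕ → ℕ) (full : ℕ) : Prop where
  cover : ∀ v < 6 * m - 3, M v 0 ||| (M v 1 ||| M v 2) = full
  disj : ∀ v < 6 * m - 3, ∀ c < 3, ∀ c' < 3, c ≠ c' → M v c &&& M v c' = 0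
  proper : ∀ v < 6 * m - 3, ∀ w < 6 * m - 3, v ≠ w → (par m v = par m w ∨ par m v = w) →
    ∀ c < 3, M v c &&& M w c = 0

/-- The colouring with the index `j` of the family. -/
theorem TreeMasks.exists_colour {m : ℕ} {M : ℕ → ℕ → ℕ} {full j : ℕ} (hM : TreeMasks m M full)
    (hj : full.testBit j = true) : ∃ κ : ℕ → ℕ, (∀ v < 6 * m - 3, κ v < 3) ∧
      (∀ v < 6 * m - 3, ∀ c < 3, (M v c).testBit j = true ↔ c = κ v) ∧
      ∀ v < 6 * m - 3, ∀ w < 6 * m - 3, v ≠ w → (par m v = par m w ∨ par m v = w) → κ v ≠ κ w := by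
  have ex : ∀ v, ∃ c, v < 6 * m - 3 → c < 3 ∧ (M v c).testBit j = true := by
    intro v
    by_cases hv : v < 6 * m - 3
    · rw [← hM.cover v hv] at hj
      simp only [Nat.testBit_or, Bool.or_eq_true] at hj
      rcases hj with h | h | h
      · exact ⟨0, fun _ => ⟨by norm_num, h⟩⟩
      · exact ⟨1, fun _ => ⟨by norm_num, h⟩⟩
      · exact ⟨2, fun _ => ⟨by norm_num, h⟩⟩
    · exact ⟨0, fun h => absurd h hv⟩
  choose κ hκ using ex
  refine ⟨κ, fun v hv => (hκ v hv).1, fun v hv c hc => ⟨fun h => ?_, fun h => h ▸ (hκ v hv).2⟩,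
    fun v hv w hw hvw h heq => ?_⟩
  · by_contra hne
    have := congrArg (Nat.testBit · j) (hM.disj v hv c hc (κ v) (hκ v hv).1 hne)
    simp [h, (hκ v hv).2] at this
  · have := congrArg (Nat.testBit · j) (hM.proper v hv w hw hvw h (κ v) (hκ v hv).1)
    simp [(hκ v hv).2] at this
    rw [heq, (hκ w hw).2] at this
    exact absurd this (by simp)

theorem diffMask_sound {M : ℕ → ℕ → ℕ} {j d a b : ℕ} (h : (diffMask M d a b).testBit j = true) :
    ∃ c < 3, (M a c).testBit j = true ∧ (M b ((c + d) % 3)).testBit j = true := by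
  change Nat.testBit (_ &&& _ ||| (_ &&& _ ||| _ &&& _)) j = true at h
  simp only [Nat.testBit_or, Nat.testBit_and, Bool.or_eq_true, Bool.and_eq_true] at h
  rcases h with h | h | h
  · exact ⟨0, by norm_num, h.1, by rw [Nat.zero_add]; exact h.2⟩
  · exact ⟨1, by norm_num, h⟩
  · exact ⟨2, by norm_num, h⟩

/-! ### Graphs with a rotation symmetry -/

theorem par_ge (m v : ℕ) (hm : 1 ≤ m) : 3 * m ≤ par m v := by rw [par_def]; omega

/-- The tree with `3 * m` leaves in the standard numbering. -/
def stdTree (m : ℕ) : SimpleGraph (Fin (6 * m - 2)) where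
  Adj a b := a ≠ b ∧ (b.val = par m a.val ∨ a.val = par m b.val)
  symm := ⟨fun _ _ h => ⟨h.1.symm, h.2.symm⟩⟩
  loopless := ⟨fun _ h => h.1 rfl⟩

/-- Adjacency of vertices given by their numbers. -/
def rel {n : ℕ} (G : SimpleGraph (Fin n)) (a b : ℕ) : Prop :=
  ∃ (ha : a < n) (hb : b < n), G.Adj ⟨a, ha⟩ ⟨b, hb⟩

/-- A cubic graph that contains the standard tree as a spanning tree and whose edges between leaves
are invariant under the rotation. -/
structure RotGraph (m : ℕ) (G : SimpleGraph (Fin (6 * m - 2))) : Prop where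
  tree_le : stdTree m ≤ G
  cubic : ∀ v, deg G v = 3
  rot : ∀ a b, a < 3 * m → b < 3 * m → rel G a b → rel G ((a + m) % (3 * m)) ((b + m) % (3 * m))

/-- The pairs of leaves in `E` are the edges of `G` outside of the tree. -/
structure LeafEdges (m : ℕ) (G : SimpleGraph (Fin (6 * m - 2))) (E : List (ℕ × ℕ)) : Prop where
  fst : (E.map Prod.fst).Nodup
  snd : (E.map Prod.snd).Nodup
  lt : ∀ p ∈ E, p.1 < 3 * m ∧ p.2 < 3 * m
  adj : ∀ a b : Fin (6 * m - 2), G.Adj a b →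
    (stdTree m).Adj a b ∨ (a.val, b.val) ∈ E ∨ (b.val, a.val) ∈ E

/-- The sign as a residue. -/
def sgn : Bool → ℕ
  | true => 1
  | false => 2

theorem signSum_eq (b b' : Bool) : signSum b b' = (sgn b + sgn b') % 3 := by
  cases b <;> cases b' <;> rfl

/-- A colouring `κ` of the tree edges (given at the lower ends) extends to a `3`-edge colouring if
there are signs at the leaves such that the colour difference along each leaf edge is the sum of
the signs: the leaf edge `(a, b)` gets the colour `κ a + s a = κ b - s b`. -/
theorem colorable_of_signs {m : ℕ} (hm : 1 ≤ m) {G : SimpleGraph (Fin (6 * m - 2))}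
    {E : List (ℕ × ℕ)} (hE : LeafEdges m G E) {κ : ℕ → ℕ} {s : ℕ → Bool} (h3 : ∀ v < 6 * m - 3, κ v < 3)
    (hκ : ∀ v < 6 * m - 3, ∀ w < 6 * m - 3, v ≠ w → (par m v = par m w ∨ par m v = w) → κ v ≠ κ w)
    (hs : ∀ p ∈ E, κ p.2 = (κ p.1 + signSum (s p.1) (s p.2)) % 3) : G.lineGraph.Colorable 3 := by
  let P : Sym2 (Fin (6 * m - 2)) → ℕ → Prop := fun e c =>
    (∃ v w : Fin (6 * m - 2), v.val < 6 * m - 3 ∧ w.val = par m v ∧ e = s(v, w) ∧ c = κ v) ∨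
    ∃ a b : Fin (6 * m - 2), (a.val, b.val) ∈ E ∧ e = s(a, b) ∧ c = (κ a + sgn (s a)) % 3
  have ex : ∀ e : G.edgeSet, ∃ c, c < 3 ∧ P e c := by
    rintro ⟨e, he⟩
    induction e with
    | _ a b =>
      rw [SimpleGraph.mem_edgeSet] at he
      have hpar : ∀ v : Fin (6 * m - 2), ∀ w : Fin (6 * m - 2), v ≠ w → w.val = par m v →
          v.val < 6 * m - 3 := by
        intro v w hvw h
        by_contra hlt
        apply hvw; ext
        rw [par_def] at h; omega
      rcases hE.adj a b he with h | h | h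
      · rcases h.2 with h' | h'
        · have := hpar a b h.1 h'
          exact ⟨_, h3 _ this, .inl ⟨a, b, this, h', rfl, rfl⟩⟩
        · have := hpar b a h.1.symm h'
          exact ⟨_, h3 _ this, .inl ⟨b, a, this, h', Sym2.eq_swap, rfl⟩⟩
      · exact ⟨_, Nat.mod_lt _ (by norm_num), .inr ⟨a, b, h, rfl, rfl⟩⟩
      · exact ⟨_, Nat.mod_lt _ (by norm_num), .inr ⟨b, a, h, Sym2.eq_swap, rfl⟩⟩
  choose col hcol hP using ex
  have hsg : ∀ b, sgn b = 1 ∨ sgn b = 2 := by decide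
  -- the colour of a leaf edge, computed at its second end
  have hsnd : ∀ a b : ℕ, (a, b) ∈ E → (κ a + sgn (s a) + sgn (s b)) % 3 = κ b % 3 := by
    intro a b h
    have := hs _ h
    simp only [signSum_eq] at this
    omega
  have lt3 : ∀ a b : ℕ, (a, b) ∈ E → κ a < 3 ∧ κ b < 3 := by
    intro a b h
    have := hE.lt _ h
    exact ⟨h3 _ (by simp only at this; omega), h3 _ (by simp only at this; omega)⟩
  have leafge : ∀ v, 3 * m ≤ par m v := fun v => par_ge m v hm
  have fstinj : ∀ {a b b' : ℕ}, (a, b) ∈ E → (a, b') ∈ E → b = b' := by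
    intro a b b' h h'
    have := List.inj_on_of_nodup_map hE.fst h h' rfl
    simpa using this
  have sndinj : ∀ {a a' b : ℕ}, (a, b) ∈ E → (a', b) ∈ E → a = a' := by
    intro a b b' h h'
    have := List.inj_on_of_nodup_map hE.snd h h' rfl
    simpa using this
  -- a tree edge and a leaf edge
  have TL : ∀ (v w a b z : Fin (6 * m - 2)), w.val = par m v → (a.val, b.val) ∈ E →
      z ∈ s(v, w) → z ∈ s(a, b) → κ v ≠ (κ a + sgn (s a)) % 3 := by
    intro v w a b z hw hab hz hz' h
    have h1 := hE.lt _ hab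
    have h2 := lt3 _ _ hab
    have h4 := hsnd _ _ hab
    have h5 := hsg (s a)
    have h6 := hsg (s b)
    simp only [Sym2.mem_iff] at hz hz'
    have hwz : z ≠ w := by
      rintro rfl
      have := leafge v
      rcases hz' with rfl | rfl <;> simp only at h1 <;> omega
    obtain rfl : z = v := by tauto
    rcases hz' with rfl | rfl <;> omega
  refine ⟨SimpleGraph.Coloring.mk (fun e => (⟨col e, hcol e⟩ : Fin 3)) ?_⟩
  rintro e f ⟨hne, z, hz, hz'⟩ heq
  simp only [Fin.mk.injEq] at heq
  have hne' : e.1 ≠ f.1 := fun h => hne (Subtype.ext h)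
  have hPe := hP e
  have hPf := hP f
  rw [← heq] at hPf
  generalize col e = c at hPe hPf
  change z ∈ e.1 at hz
  change z ∈ f.1 at hz'
  rcases hPe with ⟨v, w, hv, hw, he, hc⟩ | ⟨a, b, hab, he, hc⟩ <;>
    rcases hPf with ⟨v', w', hv', hw', hf, hc'⟩ | ⟨a', b', hab', hf, hc'⟩
  · have hvv : v ≠ v' := by
      rintro rfl
      exact hne' (by rw [he, hf, Fin.ext (hw.trans hw'.symm)])
    have hvv' : v.val ≠ v'.val := fun h => hvv (Fin.ext h)
    rw [he] at hz; rw [hf] at hz'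
    simp only [Sym2.mem_iff] at hz hz'
    rcases hz with rfl | rfl <;> rcases hz' with h | h
    · exact hvv h
    · exact hκ _ hv' _ hv hvv'.symm (.inr (by rw [← hw', h])) (hc'.symm.trans hc)
    · exact hκ _ hv _ hv' hvv' (.inr (by rw [← hw, h])) (hc.symm.trans hc')
    · exact hκ _ hv _ hv' hvv' (.inl (by rw [← hw, ← hw', h])) (hc.symm.trans hc')
  · exact TL v w a' b' z hw hab' (he ▸ hz) (hf ▸ hz') (hc.symm.trans hc')
  · exact TL v' w' a b z hw' hab (hf ▸ hz') (he ▸ hz) (hc'.symm.trans hc)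
  · rw [he] at hz; rw [hf] at hz'
    have e1 := hsnd _ _ hab
    have e2 := hsnd _ _ hab'
    have l1 := lt3 _ _ hab
    have l2 := lt3 _ _ hab'
    have s1 := hsg (s a)
    have s2 := hsg (s b)
    have s3 := hsg (s a')
    have s4 := hsg (s b')
    simp only [Sym2.mem_iff] at hz hz'
    rcases hz with rfl | rfl <;> rcases hz' with h | h
    · subst h
      exact hne' (by rw [he, hf, Fin.ext (fstinj hab hab')])
    · subst h; omega
    · subst h; omega
    · subst h
      exact hne' (by rw [he, hf, Fin.ext (sndinj hab hab')])

/-! ### Short cycles and small cuts -/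

section Girth
variable {V : Type*} {G : SimpleGraph V}

theorem not_triangle (hG : G.girth = 5) {a b c : V} (hab : G.Adj a b) (hbc : G.Adj b c)
    (hca : G.Adj c a) : False := by
  have h : (SimpleGraph.Walk.cons hab (.cons hbc (.cons hca .nil))).IsCycle := by
    rw [SimpleGraph.Walk.cons_isCycle_iff]
    have h1 := hab.ne; have h2 := hbc.ne; have h3 := hca.ne
    constructor
    · simp [SimpleGraph.Walk.isPath_def, h1.symm, h2, h3]
    · simp [h1.symm, h3.symm, h1, h2]
  have := SimpleGraph.girth_le_length h
  simp [hG] at this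

theorem not_four_cycle (hG : G.girth = 5) {a b c d : V} (hab : G.Adj a b) (hbc : G.Adj b c)
    (hcd : G.Adj c d) (hda : G.Adj d a) (hac : a ≠ c) (hbd : b ≠ d) : False := by
  have h : (SimpleGraph.Walk.cons hab (.cons hbc (.cons hcd (.cons hda .nil)))).IsCycle := by
    rw [SimpleGraph.Walk.cons_isCycle_iff]
    have h1 := hab.ne; have h2 := hbc.ne; have h3 := hcd.ne; have h4 := hda.ne
    constructor
    · simp [SimpleGraph.Walk.isPath_def, h1.symm, h2, h3, h4, hac.symm, hbd]
    · simp [h1.symm, h1, h2, h4.symm, hac, hbd]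
  have := SimpleGraph.girth_le_length h
  simp [hG] at this

end Girth

section RotGraph
variable {m : ℕ} {G : SimpleGraph (Fin (6 * m - 2))}

/-- The vertices that are not leaves have degree three in the standard tree. -/
def TreeDeg (m : ℕ) : Prop :=
  ∀ a : Fin (6 * m - 2), 3 * m ≤ a.val → ((stdTree m).neighborSet a).ncard = 3

theorem rel_symm {a b : ℕ} (h : rel G a b) : rel G b a := by
  obtain ⟨ha, hb, h⟩ := h; exact ⟨hb, ha, h.symm⟩

theorem rel_val {a b : Fin (6 * m - 2)} : rel G a b ↔ G.Adj a b :=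
  ⟨fun ⟨_, _, h⟩ => h, fun h => ⟨a.2, b.2, h⟩⟩

theorem RotGraph.adj_cases (hG : RotGraph m G) (hT : TreeDeg m) {a b : Fin (6 * m - 2)}
    (h : G.Adj a b) : (stdTree m).Adj a b ∨ (a.val < 3 * m ∧ b.val < 3 * m) := by
  have key : ∀ {a b : Fin (6 * m - 2)}, G.Adj a b → 3 * m ≤ a.val → (stdTree m).Adj a b := by
    intro a b h ha
    have hsub : (stdTree m).neighborSet a ⊆ G.neighborSet a := fun c hc => hG.tree_le hc
    have : (stdTree m).neighborSet a = G.neighborSet a :=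
      Set.eq_of_subset_of_ncard_le hsub (by rw [hT a ha]; exact (hG.cubic a).le)
    have hb : b ∈ G.neighborSet a := h
    rw [← this] at hb
    exact hb
  by_cases ha : a.val < 3 * m
  · by_cases hb : b.val < 3 * m
    · exact .inr ⟨ha, hb⟩
    · exact .inl (key h.symm (not_lt.1 hb)).symm
  · exact .inl (key h (not_lt.1 ha))

theorem stdTree_leaf (hm : 1 ≤ m) {a b : Fin (6 * m - 2)} (ha : a.val < 3 * m) :
    (stdTree m).Adj a b ↔ b.val = par m a := by
  have := par_ge m b hm
  have := par_ge m a hm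
  constructor
  · rintro ⟨h1, h2 | h2⟩
    · exact h2
    · omega
  · intro h
    refine ⟨?_, .inl h⟩
    rintro rfl
    omega

theorem leafIx_lt {x k : ℕ} (hx : x < m) (hk : k < 3) : leafIx m x k < 3 * m := by
  change x + m * k < 3 * m
  have : m * k ≤ m * 2 := Nat.mul_le_mul_left _ (by omega)
  omega

theorem exists_leafIx {a : ℕ} (ha : a < 3 * m) : ∃ x k, x < m ∧ k < 3 ∧ a = leafIx m x k := by
  have hm : 0 < m := by omega
  refine ⟨a % m, a / m, Nat.mod_lt _ hm, ?_, (Nat.mod_add_div a m).symm⟩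
  exact (Nat.div_lt_iff_lt_mul hm).2 ha

theorem leafIx_rot {x k : ℕ} (hx : x < m) (hk : k < 3) :
    (leafIx m x k + m) % (3 * m) = leafIx m x (col3 (k + 1)) := by
  have := leafIx_lt hx hk
  interval_cases k
  · change (x + m * 0 + m) % (3 * m) = x + m * 1
    rw [Nat.mod_eq_of_lt (by omega)]; ring
  · change (x + m * 1 + m) % (3 * m) = x + m * 2
    rw [Nat.mod_eq_of_lt (by omega)]; ring
  · change (x + m * 2 + m) % (3 * m) = x + m * 0
    rw [show x + m * 2 + m = x + 3 * m by ring, Nat.add_mod_right, Nat.mod_eq_of_lt (by omega)]; ring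

theorem RotGraph.rel_rot (hG : RotGraph m G) {x y k l : ℕ} (hx : x < m) (hy : y < m) (hk : k < 3)
    (hl : l < 3) (h : rel G (leafIx m x k) (leafIx m y l)) (s : ℕ) :
    rel G (leafIx m x (col3 (k + s))) (leafIx m y (col3 (l + s))) := by
  induction s with
  | zero =>
    change rel G (leafIx m x (k % 3)) (leafIx m y (l % 3))
    rwa [Nat.mod_eq_of_lt hk, Nat.mod_eq_of_lt hl]
  | succ s ih =>
    have h1 : col3 (k + s) < 3 := Nat.mod_lt _ (by norm_num)
    have h2 : col3 (l + s) < 3 := Nat.mod_lt _ (by norm_num)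
    have := hG.rot _ _ (leafIx_lt hx h1) (leafIx_lt hy h2) ih
    rw [leafIx_rot hx h1, leafIx_rot hy h2] at this
    have e : ∀ a, col3 (col3 (a + s) + 1) = col3 (a + (s + 1)) := by
      intro a; change ((a + s) % 3 + 1) % 3 = (a + (s + 1)) % 3; omega
    rwa [e, e] at this

/-- The quotient of the leaf edges by the rotation. -/
def quot (m : ℕ) (G : SimpleGraph (Fin (6 * m - 2))) (x y t : ℕ) : Prop :=
  x < m ∧ y < m ∧ t < 3 ∧ rel G (leafIx m x 0) (leafIx m y t)

theorem RotGraph.rel_iff (hG : RotGraph m G) {x y k l : ℕ} (hx : x < m) (hy : y < m) (hk : k < 3)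
    (hl : l < 3) : rel G (leafIx m x k) (leafIx m y l) ↔ quot m G x y (col3 (l + (3 - k))) := by
  constructor
  · intro h
    refine ⟨hx, hy, Nat.mod_lt _ (by norm_num), ?_⟩
    have := hG.rel_rot hx hy hk hl h (3 - k)
    rwa [show col3 (k + (3 - k)) = 0 by rw [show k + (3 - k) = 3 by omega]; rfl] at this
  · rintro ⟨-, -, h1, h⟩
    have := hG.rel_rot hx hy (by norm_num) h1 h k
    have e1 : col3 (0 + k) = k := by rw [zero_add]; exact Nat.mod_eq_of_lt hk
    have e2 : col3 (col3 (l + (3 - k)) + k) = l := by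
      change ((l + (3 - k)) % 3 + k) % 3 = l; omega
    rwa [e1, e2] at this

theorem RotGraph.isQuotient (hG : RotGraph m G) (hT : TreeDeg m) (hm : 1 ≤ m) (hg : G.girth = 5) :
    IsQuotient m (quot m G) where
  bound h := ⟨h.1, h.2.1, h.2.2.1⟩
  symm := by
    rintro x y t ⟨hx, hy, ht, h⟩
    have := (hG.rel_iff hy hx ht (by norm_num : 0 < 3)).1 (rel_symm h)
    rwa [zero_add] at this
  irrefl := by
    rintro x t ⟨hx, -, ht, h⟩
    have h1 := hG.rel_rot hx hx (by norm_num) ht h t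
    have h2 := hG.rel_rot hx hx (by norm_num) ht h (t + t)
    have e1 : col3 (0 + t) = t := by rw [zero_add]; exact Nat.mod_eq_of_lt ht
    have e2 : col3 (t + (t + t)) = 0 := by
      rw [show t + (t + t) = 3 * t by ring]; exact Nat.mul_mod_right 3 t
    have e3 : col3 (0 + (t + t)) = col3 (t + t) := by rw [zero_add]
    rw [e1] at h1
    rw [e2, e3] at h2
    obtain ⟨a1, a2, a⟩ := h
    obtain ⟨b1, b2, b⟩ := h1
    obtain ⟨c1, c2, c⟩ := h2
    exact not_triangle hg a b c
  two := by
    intro x hx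
    have hlt := leafIx_lt hx (by norm_num : 0 < 3)
    have hlt' : leafIx m x 0 < 6 * m - 2 := by omega
    set a : Fin (6 * m - 2) := ⟨leafIx m x 0, hlt'⟩ with ha
    have hp : par m a < 6 * m - 2 := by rw [par_def]; omega
    have hpa : (⟨par m a, hp⟩ : Fin (6 * m - 2)) ∈ G.neighborSet a :=
      hG.tree_le ((stdTree_leaf hm hlt).2 rfl)
    have h3 := hG.cubic a
    rw [deg] at h3
    have h2 : (G.neighborSet a \ {⟨par m a, hp⟩}).ncard = 2 := by
      rw [Set.ncard_sdiff_singleton_of_mem hpa, h3]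
    obtain ⟨b, c, hbc, heq⟩ := Set.ncard_eq_two.1 h2
    have key : ∀ d : Fin (6 * m - 2), d ∈ G.neighborSet a \ {⟨par m a, hp⟩} ↔
        d.val < 3 * m ∧ G.Adj a d := by
      intro d
      rw [Set.mem_sdiff, Set.mem_singleton_iff, SimpleGraph.mem_neighborSet]
      constructor
      · rintro ⟨h4, h5⟩
        rcases hG.adj_cases hT h4 with h | h
        · exact absurd (Fin.ext ((stdTree_leaf hm hlt).1 h)) h5
        · exact ⟨h.2, h4⟩
      · rintro ⟨h4, h5⟩
        refine ⟨h5, ?_⟩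
        rintro rfl
        have := par_ge m a hm
        simp only at h4
        omega
    have hb := (key b).1 (by rw [heq]; simp)
    have hc := (key c).1 (by rw [heq]; simp)
    obtain ⟨y, k, hy, hk, hby⟩ := exists_leafIx hb.1
    obtain ⟨z, l, hz, hl, hcz⟩ := exists_leafIx hc.1
    refine ⟨(y, k), (z, l), ?_, fun w t => ⟨?_, ?_⟩⟩
    · intro h
      simp only [Prod.mk.injEq] at h
      exact hbc (Fin.ext (by rw [hby, hcz, h.1, h.2]))
    · rintro ⟨-, hw, ht, h1, h2, h3⟩
      have := (key ⟨leafIx m w t, h2⟩).2 ⟨leafIx_lt hw ht, h3⟩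
      rw [heq] at this
      rcases this with h | h
      · left
        have := leafIx_inj hw hy ((congrArg Fin.val h).trans hby)
        rw [this.1, this.2]
      · right
        have := leafIx_inj hw hz ((congrArg Fin.val h).trans hcz)
        rw [this.1, this.2]
    · rintro (h | h) <;> simp only [Prod.mk.injEq] at h <;> obtain ⟨rfl, rfl⟩ := h
      · exact ⟨hx, hy, hk, hlt', hby ▸ b.2, by
          have := hb.2; rwa [show b = ⟨leafIx m w t, hby ▸ b.2⟩ from Fin.ext hby] at this⟩
      · exact ⟨hx, hz, hl, hlt', hcz ▸ c.2, by
          have := hc.2; rwa [show c = ⟨leafIx m w t, hcz ▸ c.2⟩ from Fin.ext hcz] at this⟩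

variable {cs : List (List ℕ)} {es : List (ℕ × ℕ × ℕ)}

theorem Lists.mem_range (h : Lists m (quot m G) cs es) {e : ℕ × ℕ × ℕ} (he : e ∈ es) :
    e.1 < m ∧ e.2.1 < m ∧ e.2.2 < 3 ∧ quot m G e.1 e.2.1 e.2.2 := by
  have := (h.mem e.1 e.2.1 e.2.2).2 (by rw [darts_eq]; exact List.mem_append_left _ he)
  exact ⟨this.1, this.2.1, this.2.2.1, this⟩

theorem Lists.nodup_cs {R : ℕ → ℕ → ℕ → Prop} (h : Lists m R cs es) : cs.flatten.Nodup :=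
  h.perm.nodup_iff.2 List.nodup_range

theorem Lists.leafEdges (hG : RotGraph m G) (hT : TreeDeg m) (h : Lists m (quot m G) cs es) :
    LeafEdges m G (es.flatMap (liftDart m)) where
  fst := nodup_lift_fst (by rw [map_fst_of_pairs h.pairs]; exact h.nodup_cs)
    fun e he => (h.mem_range he).1
  snd := nodup_lift_snd ((map_snd_of_pairs h.pairs).nodup_iff.2 h.nodup_cs)
    (fun e he => (h.mem_range he).2.1) fun e he => (h.mem_range he).2.2.1
  lt := by
    intro p hp
    simp only [List.mem_flatMap, liftDart, List.mem_map] at hp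
    obtain ⟨e, he, k, hk, rfl⟩ := hp
    have hk3 : k < 3 := by
      simp only [List.mem_cons, List.not_mem_nil, or_false] at hk; omega
    obtain ⟨h1, h2, h3, -⟩ := h.mem_range he
    exact ⟨leafIx_lt h1 hk3, leafIx_lt h2 (Nat.mod_lt _ (by norm_num))⟩
  adj := by
    intro a b hab
    rcases hG.adj_cases hT hab with h' | ⟨ha, hb⟩
    · exact .inl h'
    right
    obtain ⟨x, k, hx, hk, hax⟩ := exists_leafIx ha
    obtain ⟨y, l, hy, hl, hby⟩ := exists_leafIx hb
    have hr := rel_val.2 hab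
    rw [hax, hby, hG.rel_iff hx hy hk hl, h.mem, darts_eq, List.mem_append, List.mem_map] at hr
    have hmem : ∀ k, k < 3 → k ∈ [0, 1, 2] := by intro k hk; interval_cases k <;> simp
    rw [hax, hby]
    simp only [List.mem_flatMap, liftDart, List.mem_map]
    rcases hr with hr | ⟨e, he, hr⟩
    · left
      refine ⟨_, hr, k, hmem k hk, ?_⟩
      simp only [Prod.mk.injEq, true_and]
      congr 1
      change (k + (l + (3 - k)) % 3) % 3 = l
      omega
    · right
      refine ⟨e, he, l, hmem l hl, ?_⟩
      simp only [revDart, Prod.mk.injEq] at hr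
      obtain ⟨h1, h2, h3⟩ := hr
      rw [h1, h2]
      simp only [Prod.mk.injEq, true_and]
      congr 1
      change (3 - e.2.2) % 3 = (l + (3 - k)) % 3 at h3
      have := (h.mem_range he).2.2.1
      change (l + e.2.2) % 3 = k
      omega

/-! ### Consequences of the girth -/

theorem sameHalf_par {x y k : ℕ} (hm : 2 ∣ m) (h : sameHalf x y = true) :
    par m (leafIx m x k) = par m (leafIx m y k) := by
  have h : x / 2 = y / 2 := Nat.eq_of_beq_eq_true h
  obtain ⟨q, rfl⟩ := hm
  rw [par_def, par_def]
  change min (3 * (2 * q) + (x + 2 * q * k) / 2) _ = min (3 * (2 * q) + (y + 2 * q * k) / 2) _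
  have e : ∀ z, (z + 2 * q * k) / 2 = z / 2 + q * k := by
    intro z; rw [mul_assoc, Nat.add_mul_div_left _ _ (by norm_num)]
  rw [e, e, h]

theorem RotGraph.par_adj (hG : RotGraph m G) (hm : 1 ≤ m) {a : ℕ} (ha : a < 3 * m) :
    ∃ (h1 : a < 6 * m - 2) (h2 : par m a < 6 * m - 2), G.Adj ⟨a, h1⟩ ⟨par m a, h2⟩ := by
  have h1 : a < 6 * m - 2 := by omega
  have h2 : par m a < 6 * m - 2 := by rw [par_def]; omega
  exact ⟨h1, h2, hG.tree_le ((stdTree_leaf hm ha).2 rfl)⟩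

/-- A leaf has no two neighbours that are siblings. -/
theorem RotGraph.no_sibling_neighbours (hG : RotGraph m G) (hm : 1 ≤ m) (h2 : 2 ∣ m)
    (hg : G.girth = 5) {x y z s t : ℕ} (h : quot m G x y t) (h' : quot m G x z s) (hts : t = s)
    (hyz : y ≠ z) (hs : sameHalf y z = true) : False := by
  subst hts
  obtain ⟨hx, hy, ht, a1, a2, a⟩ := h
  obtain ⟨-, hz, -, b1, b2, b⟩ := h'
  obtain ⟨c1, c2, c⟩ := hG.par_adj hm (leafIx_lt hy ht)
  obtain ⟨d1, d2, d⟩ := hG.par_adj hm (leafIx_lt hz ht)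
  have e := sameHalf_par (k := t) h2 hs
  refine not_four_cycle hg a c (by simpa only [e] using d.symm) b.symm ?_ ?_
  · have h1 := leafIx_lt hx (by norm_num : 0 < 3)
    have h2 := par_ge m (leafIx m y t) hm
    simp only [ne_eq, Fin.mk.injEq]; omega
  · simp only [ne_eq, Fin.mk.injEq]
    exact fun h => hyz (leafIx_inj hy hz h).1

theorem Lists.not_siblingCycle (hG : RotGraph m G) (hm : 1 ≤ m) (h2 : 2 ∣ m) (hg : G.girth = 5)
    (hT : TreeDeg m) (h : Lists m (quot m G) cs es) : ¬ SiblingCycle es := by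
  have hQ := hG.isQuotient hT hm hg
  rintro (⟨x, y, h1, h3⟩ | ⟨z, x, y, t₀, t₁, h1, h3, h4, h5⟩)
  · obtain ⟨hx, hy, -, h⟩ := h.mem_range h1
    obtain ⟨-, -, -, a1, a2, a⟩ := h
    obtain ⟨c1, c2, c⟩ := hG.par_adj hm (leafIx_lt hx (by norm_num : 0 < 3))
    obtain ⟨d1, d2, d⟩ := hG.par_adj hm (leafIx_lt hy (by norm_num : 0 < 3))
    have e := sameHalf_par (k := 0) h2 h3
    exact not_triangle hg a d (by simpa only [e] using c.symm)
  · obtain ⟨hz, hx, ht0, q1⟩ := h.mem_range h1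
    obtain ⟨-, hy, ht1, q2⟩ := h.mem_range h3
    simp only at hz hx ht0 hy ht1 q1 q2
    have ht : t₁ = col3 (3 - t₀) := by
      change (t₀ + t₁) % 3 = 0 at h5
      change t₁ = (3 - t₀) % 3
      omega
    by_cases hzy : z = y
    · subst hzy
      have hn := h.nodup
      rw [darts_eq, List.nodup_append] at hn
      refine hn.2.2 _ h3 _ (List.mem_map_of_mem h1) ?_
      simp [revDart, ht]
    · exact hG.no_sibling_neighbours hm h2 hg (hQ.symm q1) q2 ht.symm hzy h4

theorem siblingNeighbours_sound (hG : RotGraph m G) (hm : 1 ≤ m) (h2 : 2 ∣ m) (hg : G.girth = 5)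
    (h : Lists m (quot m G) cs es) : siblingNeighbours (darts es) = false := by
  rw [Bool.eq_false_iff]
  intro hs
  simp only [siblingNeighbours, List.any_eq_true, Bool.and_eq_true, Bool.not_eq_true'] at hs
  obtain ⟨⟨x, y, t⟩, h1, ⟨x', z, s⟩, h3, h4, h5, h6, h7⟩ := hs
  obtain rfl := Nat.eq_of_beq_eq_true h4
  exact hG.no_sibling_neighbours hm h2 hg ((h.mem _ _ _).2 h1) ((h.mem _ _ _).2 h3)
    (Nat.eq_of_beq_eq_true h5) (fun h => by subst h; simp at h6) h7

theorem quot_adj (hG : RotGraph m G) {x y t k : ℕ} (h : quot m G x y t) (hk : k < 3) :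
    rel G (leafIx m x k) (leafIx m y (col3 (k + t))) := by
  have := hG.rel_rot h.1 h.2.1 (by norm_num : 0 < 3) h.2.2.1 h.2.2.2 k
  have e1 : col3 (0 + k) = k := by rw [zero_add]; exact Nat.mod_eq_of_lt hk
  rwa [e1, add_comm t k] at this

theorem shortCycle_sound (hG : RotGraph m G) (hg : G.girth = 5)
    (h : Lists m (quot m G) cs es) : (splitCycles cs es).any shortCycle = false := by
  rw [Bool.eq_false_iff]
  intro hs
  rw [List.any_eq_true] at hs
  obtain ⟨c, hc, hsh⟩ := hs
  obtain ⟨hfl, hw⟩ := splitCycles_spec h.pairs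
  obtain ⟨v, hv⟩ := hw c hc
  have hmem : ∀ e ∈ c, e ∈ es := fun e he => by rw [← hfl]; exact List.mem_flatten.2 ⟨c, hc, he⟩
  have hsub : c.Sublist es := hfl ▸ List.sublist_flatten_of_mem hc
  have hn : (c.map fun e => e.1).Nodup :=
    (List.Sublist.map _ hsub).nodup (by rw [map_fst_of_pairs h.pairs]; exact h.nodup_cs)
  match c, hsh, hv, hmem, hn with
  | [(x, y, t), (x', y', t')], hsh, hv, hmem, hn =>
    have hv0 := Nat.eq_of_beq_eq_true hsh
    simp only [List.map_cons, List.map_nil, ends, IsWalk] at hv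
    obtain ⟨rfl, rfl, rfl⟩ := hv
    have q1 := h.mem_range (hmem _ (List.mem_cons_self))
    have q2 := h.mem_range (hmem (x', y', t') (by simp))
    simp only at q1 q2
    have ht : t' = col3 (3 - t) := by
      change (t + (t' + 0) % 3) % 3 = 0 at hv0
      change t' = (3 - t) % 3
      omega
    have hn := h.nodup
    rw [darts_eq, List.nodup_append] at hn
    refine hn.2.2 _ (hmem (x', y', t') (by simp)) _ (List.mem_map_of_mem (hmem _ (List.mem_cons_self))) ?_
    simp [revDart, ht]
  | [(x, y, t), (x', y', t'), (x'', y'', t'')], hsh, hv, hmem, hn =>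
    have hv0 := Nat.eq_of_beq_eq_true hsh
    simp only [List.map_cons, List.map_nil, ends, IsWalk] at hv
    obtain ⟨rfl, rfl, rfl, rfl⟩ := hv
    have q1 := (h.mem_range (hmem (y'', x', t) (by simp))).2.2
    have q2 := (h.mem_range (hmem (x', x'', t') (by simp))).2.2
    have q3 := (h.mem_range (hmem (x'', y'', t'') (by simp))).2.2
    have l : ∀ a, col3 a < 3 := fun a => Nat.mod_lt _ (by norm_num)
    obtain ⟨a1, a2, a⟩ := quot_adj hG q1.2 (k := 0) (by norm_num)
    obtain ⟨b1, b2, b⟩ := quot_adj hG q2.2 (l (0 + t))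
    obtain ⟨c1, c2, c⟩ := quot_adj hG q3.2 (l (col3 (0 + t) + t'))
    refine not_triangle hg a b ?_
    convert c using 2
    refine congrArg (leafIx m y'') ?_
    change 0 = (((0 + t) % 3 + t') % 3 + t'') % 3
    change (t + (t' + (t'' + 0) % 3) % 3) % 3 = 0 at hv0
    omega
  | [(x, y, t), (x', y', t'), (x'', y'', t''), (x₃, y₃, t₃)], hsh, hv, hmem, hn =>
    have hv0 := Nat.eq_of_beq_eq_true hsh
    simp only [List.map_cons, List.map_nil, ends, IsWalk] at hv
    obtain ⟨rfl, rfl, rfl, rfl, rfl⟩ := hv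
    have q1 := (h.mem_range (hmem (y₃, x', t) (by simp))).2.2
    have q2 := (h.mem_range (hmem (x', x'', t') (by simp))).2.2
    have q3 := (h.mem_range (hmem (x'', x₃, t'') (by simp))).2.2
    have q4 := (h.mem_range (hmem (x₃, y₃, t₃) (by simp))).2.2
    have l : ∀ a, col3 a < 3 := fun a => Nat.mod_lt _ (by norm_num)
    obtain ⟨a1, a2, a⟩ := quot_adj hG q1.2 (k := 0) (by norm_num)
    obtain ⟨b1, b2, b⟩ := quot_adj hG q2.2 (l (0 + t))
    obtain ⟨c1, c2, c⟩ := quot_adj hG q3.2 (l (col3 (0 + t) + t'))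
    obtain ⟨d1, d2, d⟩ := quot_adj hG q4.2 (l (col3 (col3 (0 + t) + t') + t''))
    simp only [List.map_cons, List.map_nil, List.nodup_cons, List.mem_cons, List.not_mem_nil,
      or_false, not_or] at hn
    refine not_four_cycle hg a b c ?_ ?_ ?_
    · convert d using 2
      refine congrArg (leafIx m y₃) ?_
      change 0 = ((((0 + t) % 3 + t') % 3 + t'') % 3 + t₃) % 3
      change (t + (t' + (t'' + (t₃ + 0) % 3) % 3) % 3) % 3 = 0 at hv0
      omega
    · simp only [ne_eq, Fin.mk.injEq]
      exact fun h => hn.1.2.1 (leafIx_inj q1.2.1 q2.2.2.1 h).1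
    · simp only [ne_eq, Fin.mk.injEq]
      exact fun h => hn.2.1.2 (leafIx_inj q2.2.1 q3.2.2.1 h).1

/-! ### Small cuts -/

/-- A set of vertices that is joined to its complement by at most three edges, all of them in the
tree, with leaves on both sides, contradicts cyclic connectivity: as every leaf lies on a cycle of
leaves, there are cycles on both sides. -/
theorem RotGraph.no_cut (hG : RotGraph m G) (hT : TreeDeg m) (hm : 1 ≤ m)
    (hc : CyclicallyEdgeConnected 4 G) (X : ℕ → Prop) {ws : List ℕ} (hws : ws.length ≤ 3)
    (htree : ∀ v < 6 * m - 3, v ∉ ws → (X v ↔ X (par m v)))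
    (hleaf : ∀ a b, a < 3 * m → b < 3 * m → rel G a b → (X a ↔ X b))
    {a b : ℕ} (ha : a < 3 * m) (hb : b < 3 * m) (hXa : X a) (hXb : ¬ X b) : False := by
  classical
  let par' : ℕ → Fin (6 * m - 2) := fun v => ⟨par m v, by rw [par_def]; omega⟩
  let mk : ℕ → Fin (6 * m - 2) := fun v => ⟨min v (6 * m - 3), by omega⟩
  let S : Set (Sym2 (Fin (6 * m - 2))) := {e | e ∈ G.edgeSet ∧ ∃ w ∈ ws, e = s(mk w, par' w)}
  have hS : S.encard < 4 := by
    have hsub : S ⊆ ((ws.map fun w => s(mk w, par' w)).toFinset : Set _) := by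
      rintro e ⟨-, w, hw, rfl⟩
      simp only [List.coe_toFinset, List.mem_map, Set.mem_ofPred_eq]
      exact ⟨w, hw, rfl⟩
    refine (Set.encard_le_encard hsub).trans_lt ?_
    rw [Set.encard_coe_eq_coe_finsetCard]
    have := List.toFinset_card_le (ws.map fun w => s(mk w, par' w))
    rw [List.length_map] at this
    have : (ws.map fun w => s(mk w, par' w)).toFinset.card < 4 := by omega
    exact_mod_cast this
  -- the cycles formed by the leaves
  let K : SimpleGraph (Fin (6 * m - 2)) :=
    { Adj := fun a b => a.val < 3 * m ∧ b.val < 3 * m ∧ G.Adj a b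
      symm := ⟨fun a b h => ⟨h.2.1, h.1, h.2.2.symm⟩⟩
      loopless := ⟨fun a h => G.loopless.irrefl a h.2.2⟩ }
  have hKdeg : ∀ a : Fin (6 * m - 2), a.val < 3 * m → (K.neighborSet a).ncard = 2 := by
    intro a ha
    have hp : par m a < 6 * m - 2 := by rw [par_def]; omega
    have hpa : (⟨par m a, hp⟩ : Fin (6 * m - 2)) ∈ G.neighborSet a :=
      hG.tree_le ((stdTree_leaf hm ha).2 rfl)
    have : K.neighborSet a = G.neighborSet a \ {⟨par m a, hp⟩} := by
      ext d
      rw [Set.mem_sdiff, Set.mem_singleton_iff, SimpleGraph.mem_neighborSet,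
        SimpleGraph.mem_neighborSet]
      constructor
      · rintro ⟨-, h4, h5⟩
        refine ⟨h5, ?_⟩
        rintro rfl
        have := par_ge m a hm
        simp only at h4
        omega
      · rintro ⟨h4, h5⟩
        rcases hG.adj_cases hT h4 with h | h
        · exact absurd (Fin.ext ((stdTree_leaf hm ha).1 h)) h5
        · exact ⟨h.1, h.2, h4⟩
    have h3 := hG.cubic a
    rw [deg] at h3
    rw [this, Set.ncard_sdiff_singleton_of_mem hpa, h3]
  have hKc : K.IsCycles := fun v ⟨w, hw⟩ => hKdeg v hw.1
  have hle : K ≤ G.deleteEdges S := by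
    intro v w h
    rw [SimpleGraph.deleteEdges_adj]
    refine ⟨h.2.2, ?_⟩
    rintro ⟨-, u, -, he⟩
    have h1 := par_ge m u hm
    have h2 := h.1
    have h3 := h.2.1
    rcases Sym2.eq_iff.1 he with ⟨rfl, rfl⟩ | ⟨rfl, rfl⟩ <;> simp only [par'] at h2 h3 <;> omega
  have hX : ∀ {u v : Fin (6 * m - 2)}, (G.deleteEdges S).Adj u v → (X u ↔ X v) := by
    intro u v h
    rw [SimpleGraph.deleteEdges_adj] at h
    have tree : ∀ {u v : Fin (6 * m - 2)}, G.Adj u v → s(u, v) ∉ S → v.val = par m u → (X u ↔ X v) := by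
      intro u v h h' hv
      have hu : u.val < 6 * m - 3 := by
        have := h.ne
        by_contra hlt
        exact this (Fin.ext (by rw [hv, par_def]; omega))
      rw [hv]
      refine htree u hu fun hw => h' ⟨h, u, hw, ?_⟩
      rw [Sym2.eq_iff]
      left
      exact ⟨Fin.ext (by simp only [mk]; omega), Fin.ext hv⟩
    rcases hG.adj_cases hT h.1 with h' | h'
    · rcases h'.2 with h' | h'
      · exact tree h.1 h.2 h'
      · exact (tree h.1.symm (by rw [Sym2.eq_swap]; exact h.2) h').symm
    · exact hleaf _ _ h'.1 h'.2 (rel_val.2 h.1)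
  have cyc : ∀ a : Fin (6 * m - 2), a.val < 3 * m → ∃ p : (G.deleteEdges S).Walk a a, p.IsCycle := by
    intro a ha
    have hne : (K.neighborSet a).Nonempty := by
      rw [← Set.ncard_pos, hKdeg a ha]; norm_num
    obtain ⟨p, hp, -⟩ := hKc.exists_cycle_toSubgraph_verts_eq_connectedComponentSupp
      (c := K.connectedComponentMk a) rfl hne
    exact ⟨p.mapLe hle, hp.mapLe hle⟩
  obtain ⟨p, hp⟩ := cyc ⟨a, by omega⟩ ha
  obtain ⟨q, hq⟩ := cyc ⟨b, by omega⟩ hb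
  obtain ⟨w⟩ := hc S (fun e he => he.1) hS _ _ p q hp hq
  have : ∀ {u v : Fin (6 * m - 2)}, (G.deleteEdges S).Walk u v → (X u ↔ X v) := by
    intro u v w
    induction w with
    | nil => rfl
    | cons h _ ih => exact (hX h).trans ih
  exact hXb ((this w).1 hXa)

end RotGraph

/-! ### Symmetries of the standard tree -/

/-- The image of the vertex `v` under the tree automorphism that is given on the leaves by
`(x, k) ↦ (p x, s * k)`; the first argument bounds the height of `v`. -/
def extendAuto (m : ℕ) (p : List ℕ) (s : ℕ) : ℕ → ℕ → ℕ
  | 0, v => v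
  | f + 1, v =>
    bif Nat.blt v (Nat.mul 3 m) then leafIx m (nthD p (Nat.mod v m)) (col3 (Nat.mul s (Nat.div v m)))
    else bif Nat.beq v (Nat.sub (Nat.mul 6 m) 3) then v
    else par m (extendAuto m p s f (Nat.mul 2 (Nat.sub v (Nat.mul 3 m))))

/-- The set of the images under `f`, as a bit mask. -/
def imageMask (f : ℕ → ℕ) (l : List ℕ) : ℕ :=
  l.foldr (fun v acc => Nat.lor (Nat.shiftLeft 1 (f v)) acc) 0

/-- The leaf permutation `(x, k) ↦ (p x, s * k)` extends to an automorphism of the standard tree. -/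
def symmOk (m : ℕ) (p : List ℕ) (s : ℕ) : Bool :=
  let f := extendAuto m p s 4
  ((List.range (6 * m - 2)).all fun v =>
    Nat.blt (f v) (Nat.sub (Nat.mul 6 m) 2) && (Nat.beq (par m (f v)) (f (par m v)) &&
      (bif Nat.blt v (Nat.mul 3 m) then Nat.blt (f v) (Nat.mul 3 m)
        else Nat.ble (Nat.mul 3 m) (f v)))) &&
    (Nat.beq (imageMask f (List.range (6 * m - 2))) (Nat.sub (Nat.shiftLeft 1 (Nat.sub (Nat.mul 6 m) 2)) 1) &&
      (List.range m).all fun x => Nat.blt (nthD p x) m)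

/-- `φ` is the automorphism of the standard tree that is given on the leaves by `(x, k) ↦ (p x, s * k)`.
-/
structure TreeSymm (m : ℕ) (p : List ℕ) (s : ℕ) (φ : Equiv.Perm (Fin (6 * m - 2))) : Prop where
  tree : ∀ a b, (stdTree m).Adj (φ a) (φ b) ↔ (stdTree m).Adj a b
  isLeaf : ∀ a, (φ a).val < 3 * m ↔ a.val < 3 * m
  lt : ∀ x < m, nthD p x < m
  leaf : ∀ (x k : ℕ) (h : leafIx m x k < 6 * m - 2), x < m → k < 3 →
    (φ ⟨leafIx m x k, h⟩).val = leafIx m (nthD p x) (col3 (s * k))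

theorem imageMask_testBit (f : ℕ → ℕ) (l : List ℕ) (i : ℕ) :
    (imageMask f l).testBit i = true ↔ ∃ v ∈ l, f v = i := by
  induction l with
  | nil => simp [imageMask]
  | cons v l ih =>
    have : imageMask f (v :: l) = (1 <<< f v) ||| imageMask f l := rfl
    rw [this, Nat.testBit_or, Bool.or_eq_true, ih, Nat.one_shiftLeft, Nat.testBit_two_pow]
    simp

theorem leafIx_mod {m x k : ℕ} (hx : x < m) : leafIx m x k % m = x := by
  change (x + m * k) % m = x
  rw [Nat.add_mul_mod_self_left, Nat.mod_eq_of_lt hx]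

theorem leafIx_div {m x k : ℕ} (hx : x < m) : leafIx m x k / m = k := by
  change (x + m * k) / m = k
  rw [Nat.add_mul_div_left _ _ (by omega), Nat.div_eq_of_lt hx, zero_add]

theorem exists_treeSymm {m : ℕ} {p : List ℕ} {s : ℕ} (h : symmOk m p s = true) :
    ∃ φ, TreeSymm m p s φ := by
  simp only [symmOk, Bool.and_eq_true, List.all_eq_true, List.mem_range] at h
  obtain ⟨hv, hmask, hp⟩ := h
  have hlt : ∀ v : Fin (6 * m - 2), extendAuto m p s 4 v < 6 * m - 2 := fun v =>
    Nat.le_of_ble_eq_true (hv v v.2).1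
  let f : Fin (6 * m - 2) → Fin (6 * m - 2) := fun v => ⟨extendAuto m p s 4 v, hlt v⟩
  have hsurj : Function.Surjective f := by
    intro i
    have hm := Nat.eq_of_beq_eq_true hmask
    have : (imageMask (extendAuto m p s 4) (List.range (6 * m - 2))).testBit i = true := by
      rw [hm]
      change (1 <<< (6 * m - 2) - 1).testBit i = true
      rw [Nat.one_shiftLeft, Nat.testBit_two_pow_sub_one]
      simp [i.2]
    obtain ⟨v, hv', h⟩ := (imageMask_testBit _ _ _).1 this
    exact ⟨⟨v, List.mem_range.1 hv'⟩, Fin.ext h⟩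
  let φ := Equiv.ofBijective f ((Finite.injective_iff_surjective).2 hsurj |> fun hi => ⟨hi, hsurj⟩)
  have hφ : ∀ v, (φ v).val = extendAuto m p s 4 v := fun v => rfl
  have hpar : ∀ v : Fin (6 * m - 2), par m (φ v) = extendAuto m p s 4 (par m v) := fun v =>
    Nat.eq_of_beq_eq_true (hv v v.2).2.1
  have key : ∀ a b : Fin (6 * m - 2), (φ b).val = par m (φ a) ↔ b.val = par m a := by
    intro a b
    have hpa : par m a < 6 * m - 2 := by have := a.2; rw [par_def]; omega
    rw [hpar, ← hφ ⟨par m a, hpa⟩]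
    constructor
    · intro h; exact congrArg Fin.val (φ.injective (Fin.ext h))
    · intro h
      have : b = ⟨par m a, hpa⟩ := Fin.ext h
      rw [this]
  refine ⟨φ, ⟨fun a b => ?_, fun a => ?_, fun x hx => Nat.le_of_ble_eq_true (hp x hx), fun x k h hx hk => ?_⟩⟩
  · change (φ a ≠ φ b ∧ _) ↔ (a ≠ b ∧ _)
    rw [φ.injective.ne_iff, key, key]
  · have := (hv a a.2).2.2
    rw [hφ]
    cases hb : Nat.blt a (Nat.mul 3 m) with
    | true =>
      rw [hb, cond_true] at this
      exact ⟨fun _ => Nat.le_of_ble_eq_true hb, fun _ => Nat.le_of_ble_eq_true this⟩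
    | false =>
      rw [hb, cond_false] at this
      have h1 : 3 * m ≤ extendAuto m p s 4 a := Nat.le_of_ble_eq_true this
      have h2 : ¬ a.val < 3 * m := fun h => by
        have : Nat.blt a (Nat.mul 3 m) = true := Nat.ble_eq_true_of_le h
        rw [hb] at this; simp at this
      exact ⟨fun h => by omega, fun h => absurd h h2⟩
  · rw [hφ]
    have hb : Nat.blt (leafIx m x k) (Nat.mul 3 m) = true := Nat.ble_eq_true_of_le (leafIx_lt hx hk)
    simp only [extendAuto, hb, cond_true]
    change leafIx m (nthD p (leafIx m x k % m)) (col3 (s * (leafIx m x k / m))) = _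
    rw [leafIx_mod hx, leafIx_div hx]

/-! ### Isomorphisms that preserve the tree -/

/-- There is an isomorphism that maps the standard tree to itself. -/
def TreeIso (m : ℕ) (G H : SimpleGraph (Fin (6 * m - 2))) : Prop :=
  ∃ e : G ≃g H, ∀ a b, (stdTree m).Adj (e a) (e b) ↔ (stdTree m).Adj a b

section
variable {m : ℕ} {G H K : SimpleGraph (Fin (6 * m - 2))}

theorem TreeIso.trans (h : TreeIso m G H) (h' : TreeIso m H K) : TreeIso m G K := by
  obtain ⟨e, he⟩ := h
  obtain ⟨f, hf⟩ := h'
  exact ⟨e.trans f, fun a b => (hf _ _).trans (he _ _)⟩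

/-- The graph `G` with its vertices renamed by `φ`. -/
def relabel (φ : Equiv.Perm (Fin (6 * m - 2))) (G : SimpleGraph (Fin (6 * m - 2))) :
    SimpleGraph (Fin (6 * m - 2)) := G.comap φ.symm

theorem relabel_adj (φ : Equiv.Perm (Fin (6 * m - 2))) {a b : Fin (6 * m - 2)} :
    (relabel φ G).Adj (φ a) (φ b) ↔ G.Adj a b := by simp [relabel]

variable {p : List ℕ} {s : ℕ} {φ : Equiv.Perm (Fin (6 * m - 2))}

theorem TreeSymm.treeIso (h : TreeSymm m p s φ) : TreeIso m G (relabel φ G) :=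
  ⟨⟨φ, relabel_adj φ⟩, h.tree⟩

theorem deg_iso {V W : Type*} {G : SimpleGraph V} {H : SimpleGraph W} (e : G ≃g H) (v : V) :
    deg H (e v) = deg G v := by
  rw [deg, deg]
  have : H.neighborSet (e v) = e '' G.neighborSet v := by
    ext w
    constructor
    · intro hw
      refine ⟨e.symm w, ?_, by simp⟩
      have : H.Adj (e v) (e (e.symm w)) := by simpa using hw
      exact e.map_adj_iff.1 this
    · rintro ⟨u, hu, rfl⟩
      exact e.map_adj_iff.2 hu
  rw [this, Set.ncard_image_of_injective _ e.injective]

theorem TreeSymm.rel_iff (h : TreeSymm m p s φ) {x y k l : ℕ} (hx : x < m) (hy : y < m) (hk : k < 3)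
    (hl : l < 3) : rel (relabel φ G) (leafIx m (nthD p x) (col3 (s * k)))
      (leafIx m (nthD p y) (col3 (s * l))) ↔ rel G (leafIx m x k) (leafIx m y l) := by
  have h1 : leafIx m x k < 6 * m - 2 := by have := leafIx_lt hx hk; omega
  have h2 : leafIx m y l < 6 * m - 2 := by have := leafIx_lt hy hl; omega
  rw [← h.leaf x k h1 hx hk, ← h.leaf y l h2 hy hl, rel_val, relabel_adj]
  exact (rel_val (a := ⟨_, h1⟩) (b := ⟨_, h2⟩)).symm

theorem TreeSymm.rotGraph (h : TreeSymm m p s φ) (hs : s = 1 ∨ s = 2) (hG : RotGraph m G) :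
    RotGraph m (relabel φ G) where
  tree_le := by
    intro a b hab
    rw [← φ.apply_symm_apply a, ← φ.apply_symm_apply b] at hab ⊢
    rw [relabel_adj]
    exact hG.tree_le ((h.tree _ _).1 hab)
  cubic v := by
    have := deg_iso (⟨φ, relabel_adj φ⟩ : G ≃g relabel φ G) (φ.symm v)
    rw [hG.cubic] at this
    rw [← this]
    exact congrArg (deg (relabel φ G)) (φ.apply_symm_apply v).symm
  rot := by
    intro a b ha hb hab
    obtain ⟨h1, h2, hab⟩ := hab
    have lf : ∀ a (h1 : a < 6 * m - 2), a < 3 * m → ∃ x k, x < m ∧ k < 3 ∧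
        a = leafIx m (nthD p x) (col3 (s * k)) := by
      intro a h1 ha
      have : (φ.symm ⟨a, h1⟩).val < 3 * m := by rw [← h.isLeaf]; simpa using ha
      obtain ⟨x, k, hx, hk, he⟩ := exists_leafIx this
      refine ⟨x, k, hx, hk, ?_⟩
      have h2 : leafIx m x k < 6 * m - 2 := by omega
      rw [← h.leaf x k h2 hx hk]
      have : (⟨leafIx m x k, h2⟩ : Fin (6 * m - 2)) = φ.symm ⟨a, h1⟩ := Fin.ext he.symm
      rw [this]; simp
    obtain ⟨x, k, hx, hk, rfl⟩ := lf a h1 ha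
    obtain ⟨y, l, hy, hl, rfl⟩ := lf b h2 hb
    have l3 : ∀ a, col3 a < 3 := fun a => Nat.mod_lt _ (by norm_num)
    rw [leafIx_rot (h.lt x hx) (l3 _), leafIx_rot (h.lt y hy) (l3 _)]
    have e : ∀ a, col3 (col3 (s * a) + 1) = col3 (s * col3 (a + s)) := by
      intro a
      change ((s * a) % 3 + 1) % 3 = (s * ((a + s) % 3)) % 3
      rcases hs with rfl | rfl <;> omega
    rw [e, e, h.rel_iff hx hy (l3 _) (l3 _)]
    exact hG.rel_rot hx hy hk hl ((h.rel_iff hx hy hk hl).1 ⟨h1, h2, hab⟩) s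

theorem TreeSymm.quot_iff (h : TreeSymm m p s φ) {x y t : ℕ} (hx : x < m) (hy : y < m) (ht : t < 3) :
    quot m (relabel φ G) (nthD p x) (nthD p y) (col3 (s * t)) ↔ quot m G x y t := by
  have := h.rel_iff (G := G) hx hy (by norm_num : 0 < 3) ht
  rw [mul_zero] at this
  constructor
  · rintro ⟨-, -, -, h'⟩; exact ⟨hx, hy, ht, this.1 h'⟩
  · rintro ⟨-, -, -, h'⟩; exact ⟨h.lt x hx, h.lt y hy, Nat.mod_lt _ (by norm_num), this.2 h'⟩

/-! ### Graphs given by a list of quotient darts -/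

/-- The graph with the leaf edges over the darts in the mask `R`. -/
def mkG (m R : ℕ) : SimpleGraph (Fin (6 * m - 2)) where
  Adj a b := (stdTree m).Adj a b ∨ (a ≠ b ∧ a.val < 3 * m ∧ b.val < 3 * m ∧
    (R.testBit (dartKey m (a % m) (b % m) (col3 (b / m + (3 - a / m)))) = true ∨
      R.testBit (dartKey m (b % m) (a % m) (col3 (a / m + (3 - b / m)))) = true))
  symm := ⟨fun _ _ h => h.imp (·.symm) fun h => ⟨h.1.symm, h.2.2.1, h.2.1, h.2.2.2.symm⟩⟩
  loopless := ⟨fun _ h => h.elim (fun h => h.1 rfl) fun h => h.1 rfl⟩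

/-- An edge-preserving permutation between cubic graphs is an isomorphism. -/
theorem iso_of_cubic {n : ℕ} {G H : SimpleGraph (Fin n)} (hG : ∀ v, deg G v = 3)
    (hH : ∀ v, deg H v = 3) (φ : Equiv.Perm (Fin n)) (h : ∀ a b, G.Adj a b → H.Adj (φ a) (φ b))
    (a b : Fin n) : H.Adj (φ a) (φ b) ↔ G.Adj a b := by
  refine ⟨fun hab => ?_, h a b⟩
  have hsub : φ '' G.neighborSet a ⊆ H.neighborSet (φ a) := by
    rintro _ ⟨c, hc, rfl⟩; exact h a c hc
  have := Set.eq_of_subset_of_ncard_le hsub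
    (by rw [Set.ncard_image_of_injective _ φ.injective]
        exact (hH _).le.trans (hG _).ge)
  have hb : φ b ∈ H.neighborSet (φ a) := hab
  rw [← this] at hb
  obtain ⟨c, hc, hcb⟩ := hb
  rwa [← φ.injective hcb]

variable {cs : List (List ℕ)} {es : List (ℕ × ℕ × ℕ)}

theorem matchRep_sound (hG : RotGraph m G) (hT : TreeDeg m)
    (h : Lists m (quot m G) cs es) {autos : List (List ℕ)} {reps : List ℕ}
    (hs : matchRep m autos reps es = true)
    (hautos : ∀ p ∈ autos, symmOk m p 1 = true ∧ symmOk m p 2 = true)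
    (hreps : ∀ R ∈ reps, RotGraph m (mkG m R)) : ∃ R ∈ reps, TreeIso m G (mkG m R) := by
  simp only [matchRep, List.any_eq_true, List.all_eq_true] at hs
  obtain ⟨p, hp, s, hs, R, hR, hall⟩ := hs
  have hs12 : s = 1 ∨ s = 2 := by simpa using hs
  have hok : symmOk m p s = true := by
    rcases hs12 with rfl | rfl
    · exact (hautos p hp).1
    · exact (hautos p hp).2
  obtain ⟨φ, hφ⟩ := exists_treeSymm hok
  have hhom : ∀ a b, G.Adj a b → (mkG m R).Adj (φ a) (φ b) := by
    have key : ∀ a b : Fin (6 * m - 2), G.Adj a b → (a.val, b.val) ∈ es.flatMap (liftDart m) →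
        (mkG m R).Adj (φ a) (φ b) := by
      intro a b hab hmem
      simp only [List.mem_flatMap, liftDart, List.mem_map] at hmem
      obtain ⟨⟨x, y, t⟩, he, k, hk, heq⟩ := hmem
      obtain ⟨hx, hy, ht, -⟩ := h.mem_range he
      simp only [Prod.mk.injEq] at heq hx hy ht
      have hk3 : k < 3 := by
        simp only [List.mem_cons, List.not_mem_nil, or_false] at hk; omega
      have l3 : ∀ a, col3 a < 3 := fun a => Nat.mod_lt _ (by norm_num)
      have ha : (φ a).val = leafIx m (nthD p x) (col3 (s * k)) := by
        rw [← hφ.leaf x k (heq.1 ▸ a.2) hx hk3]; congr 2; exact Fin.ext heq.1.symm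
      have hb : (φ b).val = leafIx m (nthD p y) (col3 (s * col3 (k + t))) := by
        rw [← hφ.leaf y _ (heq.2 ▸ b.2) hy (l3 _)]; congr 2; exact Fin.ext heq.2.symm
      refine .inr ⟨φ.injective.ne hab.ne, ?_, ?_, .inl ?_⟩
      · rw [ha]; exact leafIx_lt (hφ.lt x hx) (l3 _)
      · rw [hb]; exact leafIx_lt (hφ.lt y hy) (l3 _)
      · rw [ha, hb, leafIx_mod (hφ.lt x hx), leafIx_mod (hφ.lt y hy), leafIx_div (hφ.lt x hx),
          leafIx_div (hφ.lt y hy)]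
        have e : col3 (col3 (s * col3 (k + t)) + (3 - col3 (s * k))) = col3 (s * t) := by
          change ((s * ((k + t) % 3)) % 3 + (3 - (s * k) % 3)) % 3 = (s * t) % 3
          rcases hs12 with rfl | rfl <;> omega
        rw [e]
        exact hall _ he
    intro a b hab
    rcases (h.leafEdges hG hT).adj a b hab with h' | h' | h'
    · exact .inl ((hφ.tree a b).2 h')
    · exact key a b hab h'
    · exact (key b a hab.symm h').symm
  exact ⟨R, hR, ⟨φ, fun {a b} => iso_of_cubic hG.cubic (hreps R hR).cubic φ hhom a b⟩, hφ.tree⟩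

end

/-! ### Soundness of the test of voltages -/

theorem col3_lt (a : ℕ) : col3 a < 3 := Nat.mod_lt _ (by norm_num)

section
variable {m : ℕ} {G : SimpleGraph (Fin (6 * m - 2))} {cs : List (List ℕ)} {es : List (ℕ × ℕ × ℕ)}

/-- The vertex set `X` (a bit mask) contains some but not all leaves, and at most three tree edges
leave it. -/
def CutOk (m X : ℕ) : Prop :=
  ∃ ws : List ℕ, ws.length ≤ 3 ∧ (∀ v < 6 * m - 3, v ∉ ws → X.testBit v = X.testBit (par m v)) ∧
    (∃ a < 3 * m, X.testBit a = true) ∧ ∃ b < 3 * m, X.testBit b = false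

theorem Lists.not_closed (h : Lists m (quot m G) cs es) (hG : RotGraph m G) (hT : TreeDeg m)
    (hm : 1 ≤ m) (hc : CyclicallyEdgeConnected 4 G) {X : ℕ} (hX : CutOk m X)
    (hcl : ∀ e ∈ es, ∀ k < 3,
      X.testBit (leafIx m e.1 k) = X.testBit (leafIx m e.2.1 (col3 (k + e.2.2)))) : False := by
  obtain ⟨ws, hws, ht, ⟨a, ha, hXa⟩, b, hb, hXb⟩ := hX
  refine hG.no_cut hT hm hc (fun v => X.testBit v = true) hws
    (fun v hv hw => by rw [ht v hv hw]) (fun a b ha hb hab => ?_) ha hb hXa (by simp [hXb])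
  have key : ∀ a b, (a, b) ∈ es.flatMap (liftDart m) → X.testBit a = X.testBit b := by
    intro a b hmem
    simp only [List.mem_flatMap, liftDart, List.mem_map] at hmem
    obtain ⟨e, he, k, hk, heq⟩ := hmem
    have hk3 : k < 3 := by
      simp only [List.mem_cons, List.not_mem_nil, or_false] at hk; omega
    simp only [Prod.mk.injEq] at heq
    rw [← heq.1, ← heq.2]
    exact hcl e he k hk3
  obtain ⟨h1, h2, hab⟩ := hab
  rcases (h.leafEdges hG hT).adj _ _ hab with h' | h' | h'
  · have := (stdTree_leaf hm (show (⟨a, h1⟩ : Fin (6 * m - 2)).val < 3 * m from ha)).1 h'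
    have h3 := par_ge m a hm
    simp only at this
    omega
  · rw [key _ _ h']
  · rw [key _ _ h']

theorem closedMask_sound {X : ℕ} (h : closedMask m es X = true) : ∀ e ∈ es, ∀ k < 3,
    X.testBit (leafIx m e.1 k) = X.testBit (leafIx m e.2.1 (col3 (k + e.2.2))) := by
  intro e he k hk
  rw [closedMask, List.all_eq_true] at h
  have := h e he
  simp only [List.all_eq_true] at this
  have := this k (by interval_cases k <;> simp)
  cases hb : X.testBit (leafIx m e.1 k) with
  | true =>
    rw [hb] at this
    exact this.symm
  | false =>
    rw [hb] at this
    simp only [Bool.not_eq_true'] at this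
    exact this.symm

/-- What the data of a search have to satisfy. -/
structure LeafDataOk (D : LeafData) : Prop where
  masks : ∀ F ∈ D.families, TreeMasks D.m F.1 F.2
  cuts : ∀ X ∈ D.cuts, CutOk D.m X
  autos : ∀ p ∈ D.autos, symmOk D.m p 1 = true ∧ symmOk D.m p 2 = true
  reps : ∀ R ∈ D.reps, RotGraph D.m (mkG D.m R)
  deg : TreeDeg D.m
  even : 2 ∣ D.m
  pos : 1 ≤ D.m
  refl : symmOk D.m (List.range D.m) 2 = true

/-- The four reasons in `leafCheck` contradict the properties of a snark. -/
theorem leafCheck_sound {D : LeafData} (hD : LeafDataOk D) {G : SimpleGraph (Fin (6 * D.m - 2))}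
    (hG : RotGraph D.m G) (hs : IsSnark G) (h : Lists D.m (quot D.m G) cs es)
    (hc : leafCheck D cs es = true) : ∃ R ∈ D.reps, TreeIso D.m G (mkG D.m R) := by
  simp only [leafCheck, Bool.or_eq_true] at hc
  rcases hc with hc | hc | hc | hc | hc
  · rw [shortCycle_sound hG hs.girth_eq h] at hc; simp at hc
  · obtain ⟨F, hF, hc⟩ := List.any_eq_true.1 hc
    obtain ⟨j, hj, s, hs'⟩ := liftColourable_sound hc h.pairs h.nodup_cs
      (fun e he => (h.mem_range he).2.2.1) fun e he => (h.mem_range he).1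
    obtain ⟨κ, h3, hb, hp⟩ := (hD.masks F hF).exists_colour hj
    have hE := h.leafEdges hG hD.deg
    refine absurd (colorable_of_signs (s := s) hD.pos hE h3 hp fun p hp => ?_) hs.not_colorable
    obtain ⟨c, hc3, h4, h5⟩ := diffMask_sound (hs' p hp)
    have l1 : p.1 < 6 * D.m - 3 := by have := (hE.lt p hp).1; have := hD.pos; omega
    have l2 : p.2 < 6 * D.m - 3 := by have := (hE.lt p hp).2; have := hD.pos; omega
    rw [hb _ l1 _ hc3] at h4
    rw [hb _ l2 _ (Nat.mod_lt _ (by norm_num))] at h5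
    rw [← h4, ← h5]
  · rw [siblingNeighbours_sound hG hD.pos hD.even hs.girth_eq h] at hc; simp at hc
  · rw [List.any_eq_true] at hc
    obtain ⟨X, hX, hcl⟩ := hc
    exact (h.not_closed hG hD.deg hD.pos hs.cyclically_connected (hD.cuts X hX)
      (closedMask_sound hcl)).elim
  · exact matchRep_sound hG hD.deg h hc hD.autos hD.reps

/-- The image of a dart under a symmetry of the tree. -/
def mapDart (p : List ℕ) (s : ℕ) (e : ℕ × ℕ × ℕ) : ℕ × ℕ × ℕ :=
  (nthD p e.1, nthD p e.2.1, col3 (s * e.2.2))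

variable {p : List ℕ} {s : ℕ} {φ : Equiv.Perm (Fin (6 * m - 2))}

theorem TreeSymm.nthD_inj (h : TreeSymm m p s φ) {x y : ℕ} (hx : x < m) (hy : y < m)
    (hxy : nthD p x = nthD p y) : x = y := by
  have h1 : leafIx m x 0 < 6 * m - 2 := by have := leafIx_lt hx (by norm_num : 0 < 3); omega
  have h2 : leafIx m y 0 < 6 * m - 2 := by have := leafIx_lt hy (by norm_num : 0 < 3); omega
  have : φ ⟨_, h1⟩ = φ ⟨_, h2⟩ := Fin.ext (by
    rw [h.leaf x 0 h1 hx (by norm_num), h.leaf y 0 h2 hy (by norm_num), hxy])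
  exact (leafIx_inj hx hy (congrArg Fin.val (φ.injective this))).1

theorem mapDart_inj (h : TreeSymm m p s φ) (hs : s = 1 ∨ s = 2) {d e : ℕ × ℕ × ℕ}
    (hd : d.1 < m ∧ d.2.1 < m ∧ d.2.2 < 3) (he : e.1 < m ∧ e.2.1 < m ∧ e.2.2 < 3)
    (heq : mapDart p s d = mapDart p s e) : d = e := by
  simp only [mapDart, Prod.mk.injEq] at heq
  obtain ⟨h1, h2, h3⟩ := heq
  refine Prod.ext (h.nthD_inj hd.1 he.1 h1) (Prod.ext (h.nthD_inj hd.2.1 he.2.1 h2) ?_)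
  change (s * d.2.2) % 3 = (s * e.2.2) % 3 at h3
  rcases hs with rfl | rfl <;> omega

theorem Lists.dart_range (h : Lists m (quot m G) cs es) {d : ℕ × ℕ × ℕ} (hd : d ∈ darts es) :
    d.1 < m ∧ d.2.1 < m ∧ d.2.2 < 3 := by
  have := (h.mem d.1 d.2.1 d.2.2).2 hd
  exact ⟨this.1, this.2.1, this.2.2.1⟩

theorem nthD_range {m x : ℕ} (h : x < m) : nthD (List.range m) x = x := by
  have : ∀ (l : List ℕ) (i : ℕ) (h : i < l.length), nthD l i = l[i] := by
    intro l
    induction l with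
    | nil => intro i h; simp at h
    | cons a l ih =>
      intro i h
      cases i with
      | zero => rfl
      | succ i => simpa [nthD] using ih i (by simpa using h)
  rw [this _ _ (by simpa)]; simp

theorem darts_map {f : ℕ × ℕ × ℕ → ℕ × ℕ × ℕ} (hf : ∀ e ∈ es, f (revDart e) = revDart (f e)) :
    darts (es.map f) = (darts es).map f := by
  rw [darts_eq, darts_eq, List.map_append, List.map_map, List.map_map]
  congr 1
  exact List.map_congr_left fun e he => (hf e he).symm

theorem mapDart_rev (hs : s = 1 ∨ s = 2) {e : ℕ × ℕ × ℕ} (he : e.2.2 < 3) :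
    mapDart p s (revDart e) = revDart (mapDart p s e) := by
  simp only [mapDart, revDart, Prod.mk.injEq, true_and]
  change (s * ((3 - e.2.2) % 3)) % 3 = (3 - (s * e.2.2) % 3) % 3
  rcases hs with rfl | rfl <;> omega

theorem Lists.length (h : Lists m (quot m G) cs es) : es.length = m := by
  have := congrArg List.length (map_fst_of_pairs h.pairs)
  rw [List.length_map, h.perm.length_eq, List.length_range] at this
  exact this

theorem length_darts (es : List (ℕ × ℕ × ℕ)) : (darts es).length = 2 * es.length := by
  rw [darts_eq, List.length_append, List.length_map]; ring

/-- The darts of the relabelled graph are the images of the darts. -/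
theorem Lists.map_perm (h : Lists m (quot m G) cs es) (hφ : TreeSymm m p s φ) (hs : s = 1 ∨ s = 2)
    {cs' : List (List ℕ)} {es' : List (ℕ × ℕ × ℕ)} (h' : Lists m (quot m (relabel φ G)) cs' es') :
    ((darts es).map (mapDart p s)).Perm (darts es') := by
  have hn : ((darts es).map (mapDart p s)).Nodup :=
    List.Nodup.map_on (fun d hd e he => mapDart_inj hφ hs (h.dart_range hd) (h.dart_range he)) h.nodup
  have hsub : (darts es).map (mapDart p s) ⊆ darts es' := by
    intro d hd
    obtain ⟨e, he, rfl⟩ := List.mem_map.1 hd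
    obtain ⟨h1, h2, h3⟩ := h.dart_range he
    refine (h'.mem _ _ _).1 ?_
    rw [hφ.quot_iff h1 h2 h3, h.mem]
    exact he
  refine (hn.subperm hsub).perm_of_length_le ?_
  rw [List.length_map, length_darts, length_darts, h.length, h'.length]

/-- The reflection reverses all voltages. -/
theorem Lists.reflect (h : Lists m (quot m G) cs es) (hφ : TreeSymm m (List.range m) 2 φ) :
    Lists m (quot m (relabel φ G)) cs (es.map (mapDart (List.range m) 2)) := by
  have hd : darts (es.map (mapDart (List.range m) 2)) = (darts es).map (mapDart (List.range m) 2) :=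
    darts_map fun e he => mapDart_rev (.inr rfl) (h.mem_range he).2.2.1
  refine ⟨?_, h.perm, ?_, fun x y t => ?_⟩
  · rw [List.map_map, ← h.pairs]
    refine List.map_congr_left fun e he => ?_
    obtain ⟨h1, h2, -⟩ := h.mem_range he
    simp [mapDart, nthD_range h1, nthD_range h2]
  · rw [hd]
    exact List.Nodup.map_on
      (fun d hd e he => mapDart_inj hφ (.inr rfl) (h.dart_range hd) (h.dart_range he)) h.nodup
  · rw [hd, List.mem_map]
    constructor
    · intro hq
      obtain ⟨hx, hy, ht, -⟩ := id hq
      refine ⟨(x, y, col3 (2 * t)), ?_, ?_⟩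
      · rw [← h.mem, ← hφ.quot_iff hx hy (col3_lt _), nthD_range hx, nthD_range hy]
        convert hq using 1
        change (2 * ((2 * t) % 3)) % 3 = t
        omega
      · simp only [mapDart, nthD_range hx, nthD_range hy, Prod.mk.injEq, true_and]
        change (2 * ((2 * t) % 3)) % 3 = t
        omega
    · rintro ⟨⟨x', y', t'⟩, he, heq⟩
      have hr := h.dart_range he
      simp only at hr
      have := (hφ.quot_iff hr.1 hr.2.1 hr.2.2).2 ((h.mem _ _ _).2 he)
      simp only [mapDart, Prod.mk.injEq] at heq
      rwa [heq.1, heq.2.1, heq.2.2] at this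

theorem isSnark_iso {V W : Type*} {G : SimpleGraph V} {H : SimpleGraph W} (e : G ≃g H)
    (h : IsSnark G) : IsSnark H := by
  refine ⟨fun v => ?_, ?_, ?_, ?_⟩
  · have := deg_iso e (e.symm v)
    rw [h.cubic] at this
    simpa using this
  · intro S hS hlt u v p q hp hq
    -- pull everything back along the isomorphism
    let S' : Set (Sym2 V) := Sym2.map e ⁻¹' S
    have hinj : Function.Injective (Sym2.map e) := Sym2.map.injective e.injective
    have hS' : S' ⊆ G.edgeSet := by
      intro x hx
      have := hS hx
      induction x with
      | _ a b => exact e.map_adj_iff.1 (by simpa using this)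
    have hc : S'.encard < 4 := by
      refine lt_of_le_of_lt ?_ hlt
      rw [← hinj.encard_image]
      exact Set.encard_le_encard (Set.image_preimage_subset _ _)
    let f : H.deleteEdges S ↪g G.deleteEdges S' :=
      ⟨e.symm.toEquiv.toEmbedding, by
        intro a b
        have := e.symm.map_adj_iff (v := a) (w := b)
        simp only [SimpleGraph.deleteEdges_adj, S', Set.mem_preimage]
        simpa using fun _ => this⟩
    have := h.cyclically_connected S' hS' hc _ _ (p.map f.toHom) (q.map f.toHom)
      (hp.map f.injective) (hq.map f.injective)
    obtain ⟨w⟩ := this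
    let g : G.deleteEdges S' →g H.deleteEdges S :=
      ⟨e, by
        intro a b
        have := e.map_adj_iff (v := a) (w := b)
        simp only [SimpleGraph.deleteEdges_adj, S', Set.mem_preimage]
        simpa using fun h1 h2 => ⟨this.2 h1, h2⟩⟩
    have hw := (w.map g).reachable
    have e1 : ∀ w, g (f.toHom w) = w := fun w => by simp [f, g]
    rw [e1, e1] at hw
    exact hw
  · rw [← h.girth_eq, SimpleGraph.girth, SimpleGraph.girth, e.egirth_eq]
  · intro ⟨c⟩
    apply h.not_colorable
    let F : G.lineGraph →g H.lineGraph :=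
      ⟨fun x => ⟨Sym2.map e x.1, by
          obtain ⟨x, hx⟩ := x
          induction x with
          | _ a b => exact e.map_adj_iff.2 hx⟩, by
        intro x y hxy
        rw [SimpleGraph.lineGraph_adj_iff_exists] at hxy ⊢
        obtain ⟨hne, v, h1, h2⟩ := hxy
        refine ⟨fun heq => hne (Subtype.ext (Sym2.map.injective e.injective (congrArg Subtype.val heq))),
          e v, ?_, ?_⟩
        · exact Sym2.mem_map.2 ⟨v, h1, rfl⟩
        · exact Sym2.mem_map.2 ⟨v, h2, rfl⟩⟩
    exact ⟨c.comp F⟩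

/-- Reversing all voltages exchanges the two possibilities for the first nonzero one. -/
theorem firstOne_or (l : List ℕ) (h : ∀ t ∈ l, t < 3) :
    FirstOne l ∨ FirstOne (l.map fun t => col3 (2 * t)) := by
  induction l with
  | nil => exact .inl trivial
  | cons t l ih =>
    have ht := h t (by simp)
    interval_cases t
    · exact ih fun t ht => h t (by simp [ht])
    · exact .inl trivial
    · exact .inr trivial

/-- The masks `M` belong to tree colourings that are equivariant: the rotation adds `1`. -/
def Equivariant (m : ℕ) (M : ℕ → ℕ → ℕ) : Prop :=
  ∀ x < m, ∀ k < 3, ∀ c < 3, M (leafIx m x k) (col3 (c + k)) = M x c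

theorem phase2_sound_of_firstOne {D : LeafData} (hD : LeafDataOk D)
    {G : SimpleGraph (Fin (6 * D.m - 2))} (hG : RotGraph D.m G) (hs : IsSnark G)
    (h : Lists D.m (quot D.m G) cs es) {M : ℕ → ℕ → ℕ} {full : ℕ} (hM : TreeMasks D.m M full)
    (hE : Equivariant D.m M) (hp : phase2 D M full cs = true)
    (h1 : FirstOne (es.map fun e => e.2.2)) : ∃ R ∈ D.reps, TreeIso D.m G (mkG D.m R) := by
  rcases tstart_sound hp h.pairs h.nodup_cs (fun e he => (h.mem_range he).2.2.1) h1 with h2 | h2 | h2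
  · exact absurd h2 (h.not_siblingCycle hG hD.pos hD.even hs.girth_eq hD.deg)
  · obtain ⟨j, hj, s, hs'⟩ := h2
    obtain ⟨κ, h3, hb, hpr⟩ := hM.exists_colour hj
    have hEd := h.leafEdges hG hD.deg
    have hm := hD.pos
    have hκ : ∀ x < D.m, ∀ k < 3, κ (leafIx D.m x k) = (κ x + k) % 3 := by
      intro x hx k hk
      have lx : x < 6 * D.m - 3 := by omega
      have ll : leafIx D.m x k < 6 * D.m - 3 := by have := leafIx_lt hx hk; omega
      have := hE x hx k hk (κ x) (h3 x lx)
      have hbit := (hb x lx _ (h3 x lx)).2 rfl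
      rw [← this] at hbit
      exact ((hb _ ll _ (Nat.mod_lt _ (by norm_num))).1 hbit).symm
    refine absurd (colorable_of_signs (s := fun a => s (a % D.m)) hD.pos hEd h3 hpr fun p hp => ?_)
      hs.not_colorable
    simp only [List.mem_flatMap, liftDart, List.mem_map] at hp
    obtain ⟨e, he, k, hk, rfl⟩ := hp
    have hk3 : k < 3 := by
      simp only [List.mem_cons, List.not_mem_nil, or_false] at hk; omega
    obtain ⟨hx, hy, ht, -⟩ := h.mem_range he
    obtain ⟨d, hd3, h4, h5⟩ := hs' e he
    obtain ⟨c, hc3, h6, h7⟩ := diffMask_sound h4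
    rw [hb _ (by omega) _ hc3] at h6
    rw [hb _ (by omega) _ (Nat.mod_lt _ (by norm_num))] at h7
    simp only [leafIx_mod hx, leafIx_mod hy]
    rw [hκ _ hx _ hk3, hκ _ hy _ (col3_lt _), ← h5, ← h7, ← h6]
    change ((c + d) % 3 + (k + e.2.2) % 3) % 3 = ((c + k) % 3 + (e.2.2 + d) % 3) % 3
    omega
  · exact leafCheck_sound hD hG hs h h2

theorem phase2_sound {D : LeafData} (hD : LeafDataOk D)
    {G : SimpleGraph (Fin (6 * D.m - 2))} (hG : RotGraph D.m G) (hs : IsSnark G)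
    (h : Lists D.m (quot D.m G) cs es) {M : ℕ → ℕ → ℕ} {full : ℕ} (hM : TreeMasks D.m M full)
    (hE : Equivariant D.m M) (hp : phase2 D M full cs = true) :
    ∃ R ∈ D.reps, TreeIso D.m G (mkG D.m R) := by
  rcases firstOne_or (es.map fun e => e.2.2)
    (by simpa [List.mem_map] using fun a b c h' => (h.mem_range h').2.2.1) with h1 | h1
  · exact phase2_sound_of_firstOne hD hG hs h hM hE hp h1
  · obtain ⟨φ, hφ⟩ := exists_treeSymm hD.refl
    obtain ⟨e, he⟩ := hφ.treeIso (G := G)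
    obtain ⟨R, hR, hI⟩ := phase2_sound_of_firstOne hD (hφ.rotGraph (.inr rfl) hG) (isSnark_iso e hs)
      (h.reflect hφ) hM hE hp (by rw [List.map_map] at h1 ⊢; exact h1)
    exact ⟨R, hR, TreeIso.trans ⟨e, he⟩ hI⟩

/-! ### Reduction to extremal quotients -/

theorem code_eq {S : ℕ} {st : List (ℕ × ℕ × Bool)} : ∀ {es : List (ℕ × ℕ × ℕ)},
    (es.map fun e => (e.1, e.2.1)) = st.map (fun s => (s.1, s.2.1)) →
    code S st = (es.map fun e => wt S e.1 * wt S e.2.1).sum := by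
  induction st with
  | nil => intro es h; have : es = [] := by simpa using h
           subst this; rfl
  | cons s st ih =>
    intro es h
    cases es with
    | nil => simp at h
    | cons e es =>
      obtain ⟨x, y, cl⟩ := s
      simp only [List.map_cons, List.cons.injEq, Prod.mk.injEq] at h
      rw [List.map_cons, List.sum_cons, ← ih h.2, h.1.1, h.1.2]
      rfl

/-- Each edge contributes two darts with the same weight, which makes the code independent of
orientations. -/
theorem sum_darts {S : ℕ} (es : List (ℕ × ℕ × ℕ)) :
    ((darts es).map fun e => wt S e.1 * wt S e.2.1).sum =
      2 * (es.map fun e => wt S e.1 * wt S e.2.1).sum := by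
  rw [darts_eq, List.map_append, List.sum_append, List.map_map, two_mul]
  congr 2
  exact List.map_congr_left fun e _ => mul_comm _ _

theorem wt_le (S x : ℕ) : wt S x ≤ 65535 := Nat.and_le_right

/-- Codes are bounded, so among the relabellings of a graph there is one with the largest code. -/
theorem code_le (S : ℕ) (st : List (ℕ × ℕ × Bool)) : code S st ≤ 65535 * 65535 * st.length := by
  induction st with
  | nil => simp [code]
  | cons s st ih =>
    obtain ⟨x, y, c⟩ := s
    have := Nat.mul_le_mul (wt_le S x) (wt_le S y)
    change wt S x * wt S y + code S st ≤ _
    rw [List.length_cons]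
    nlinarith

theorem beqL_eq : ∀ {l l' : List ℕ}, beqL l l' = true → l = l'
  | [], [], _ => rfl
  | x :: xs, y :: ys, h => by
    rw [beqL] at h
    cases hb : Nat.beq x y with
    | true => rw [hb] at h; rw [Nat.eq_of_beq_eq_true hb, beqL_eq h]
    | false => rw [hb] at h; simp at h

theorem beqLL_eq : ∀ {l l' : List (List ℕ)}, beqLL l l' = true → l = l'
  | [], [], _ => rfl
  | x :: xs, y :: ys, h => by
    rw [beqLL] at h
    cases hb : beqL x y with
    | true => rw [hb] at h; rw [beqL_eq hb, beqLL_eq h]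
    | false => rw [hb] at h; simp at h

/-- Classification by a search through those quotients whose code cannot be increased by the
symmetries in `perms`. -/
theorem classify {D : LeafData} (hD : LeafDataOk D) {M : ℕ → ℕ → ℕ} {full : ℕ}
    (hM : TreeMasks D.m M full) (hE : Equivariant D.m M) {blocks : List (ℕ × ℕ)}
    {canon : List (ℕ × List (List ℕ))} {perms : List (List ℕ)} {S₀ n : ℕ} {l : List ℕ}
    (hblocks : ∀ p ∈ blocks, ∃ X, CutOk D.m X ∧
      ∀ x < D.m, ∀ k < 3, X.testBit (leafIx D.m x k) = Nat.beq (Nat.div x p.1) p.2)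
    (hcanon : ∀ p ∈ canon, phase2 D M full p.2 = true)
    (hperms : ∀ p ∈ perms, symmOk D.m p 1 = true ∧
      ∀ x < D.m, wt (packPerm p) x = wt S₀ (nthD p x))
    (hl : List.range D.m = 0 :: l)
    (hq : qsearch (phase1 blocks canon (perms.map packPerm) S₀) n [] [] 0 0 l = true)
    {G : SimpleGraph (Fin (6 * D.m - 2))} (hG : RotGraph D.m G) (hs : IsSnark G) :
    ∃ R ∈ D.reps, TreeIso D.m G (mkG D.m R) := by
  have main : ∀ (N : ℕ) (G : SimpleGraph (Fin (6 * D.m - 2))), RotGraph D.m G → IsSnark G →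
      ∀ cs es, Lists D.m (quot D.m G) cs es →
      phase1 blocks canon (perms.map packPerm) S₀ cs = true →
      65535 * 65535 * D.m - code S₀ (steps cs) = N → ∃ R ∈ D.reps, TreeIso D.m G (mkG D.m R) := by
    intro N
    induction N using Nat.strong_induction_on with
    | _ N ih =>
    intro G hG hs cs es h hph hN
    simp only [phase1, force_eq, Bool.or_eq_true, List.any_eq_true, Bool.and_eq_true] at hph
    rcases hph with ⟨p, hp, hb⟩ | ⟨S, hS, hlt⟩ | ⟨p, hp, -, heq⟩
    · obtain ⟨X, hX, hXl⟩ := hblocks p hp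
      refine (h.not_closed hG hD.deg hD.pos hs.cyclically_connected hX fun e he k hk => ?_).elim
      obtain ⟨h1, h2, h3, -⟩ := h.mem_range he
      rw [hXl _ h1 _ hk, hXl _ h2 _ (col3_lt _)]
      rw [hasBlock, List.all_eq_true] at hb
      have hmem : (e.1, e.2.1) ∈ (steps cs).map fun s => (s.1, s.2.1) := by
        rw [← h.pairs]; exact List.mem_map_of_mem he
      obtain ⟨⟨x, y, c⟩, hst, hxy⟩ := List.mem_map.1 hmem
      simp only [Prod.mk.injEq] at hxy
      have := hb _ hst
      simp only [hxy.1, hxy.2] at this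
      cases hb1 : Nat.beq (Nat.div e.1 p.1) p.2 with
      | true => rw [hb1] at this; exact this.symm
      | false =>
        rw [hb1] at this
        simp only [Bool.not_eq_true'] at this
        exact this.symm
    · obtain ⟨p, hp, rfl⟩ := List.mem_map.1 hS
      obtain ⟨hsym, hwt⟩ := hperms p hp
      obtain ⟨φ, hφ⟩ := exists_treeSymm hsym
      have hG' := hφ.rotGraph (.inl rfl) hG
      obtain ⟨e, he⟩ := hφ.treeIso (G := G)
      have hs' := isSnark_iso e hs
      obtain ⟨cs', es', h', hph'⟩ := qsearch_sound
        (hG'.isQuotient hD.deg hD.pos hs'.girth_eq) hl hq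
      have hcode : code S₀ (steps cs') = code (packPerm p) (steps cs) := by
        have h1 := code_eq (S := S₀) h'.pairs
        have h2 := code_eq (S := packPerm p) h.pairs
        have h3 := sum_darts (S := S₀) es'
        have h4 := sum_darts (S := packPerm p) es
        have h5 := ((h.map_perm hφ (.inl rfl) h').map fun e => wt S₀ e.1 * wt S₀ e.2.1).sum_eq
        rw [List.map_map] at h5
        have h6 : ((darts es).map ((fun e => wt S₀ e.1 * wt S₀ e.2.1) ∘ mapDart p 1)).sum =
            ((darts es).map fun e => wt (packPerm p) e.1 * wt (packPerm p) e.2.1).sum := by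
          congr 1
          refine List.map_congr_left fun d hd => ?_
          obtain ⟨h1, h2, -⟩ := h.dart_range hd
          simp only [Function.comp_apply, mapDart, hwt _ h1, hwt _ h2]
        omega
      have hlt' : code S₀ (steps cs) < code (packPerm p) (steps cs) := Nat.le_of_ble_eq_true hlt
      have hlen : (steps cs').length = D.m := by
        have := congrArg List.length h'.pairs
        rw [List.length_map, List.length_map, h'.length] at this
        exact this.symm
      have hle := code_le S₀ (steps cs')
      rw [hlen] at hle
      obtain ⟨R, hR, hI⟩ := ih (65535 * 65535 * D.m - code S₀ (steps cs')) (by omega) _ hG' hs' cs'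
        es' h' hph' rfl
      exact ⟨R, hR, TreeIso.trans ⟨e, he⟩ hI⟩
    · have := hcanon p hp
      rw [beqLL_eq heq] at this
      exact phase2_sound hD hG hs h hM hE this
  obtain ⟨cs, es, h, hph⟩ := qsearch_sound (hG.isQuotient hD.deg hD.pos hs.girth_eq) hl hq
  exact main _ G hG hs cs es h hph rfl

/-- Classification by a search through all quotients. -/
theorem classify_of_phase2 {D : LeafData} (hD : LeafDataOk D) {M : ℕ → ℕ → ℕ} {full : ℕ}
    (hM : TreeMasks D.m M full) (hE : Equivariant D.m M) {n : ℕ} {l : List ℕ}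
    (hl : List.range D.m = 0 :: l) (hq : qsearch (phase2 D M full) n [] [] 0 0 l = true)
    {G : SimpleGraph (Fin (6 * D.m - 2))} (hG : RotGraph D.m G) (hs : IsSnark G) :
    ∃ R ∈ D.reps, TreeIso D.m G (mkG D.m R) := by
  obtain ⟨cs, es, h, hph⟩ := qsearch_sound (hG.isQuotient hD.deg hD.pos hs.girth_eq) hl hq
  exact phase2_sound hD hG hs h hM hE hph

end

/-! ### Decision procedures for the hypotheses of the classification -/

theorem blt_iff {a b : ℕ} : Nat.blt a b = true ↔ a < b :=
  ⟨Nat.le_of_ble_eq_true, Nat.ble_eq_true_of_le⟩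

theorem beq_iff {a b : ℕ} : Nat.beq a b = true ↔ a = b := Nat.beq_eq ▸ Iff.rfl

/-- Adjacency in the standard tree. -/
def treeAdj (m a b : ℕ) : Bool :=
  (Nat.beq b (par m a) || Nat.beq a (par m b)) && !(Nat.beq a b)

/-- Adjacency in the graph `mkG m R`. -/
def adjB (m R a b : ℕ) : Bool :=
  treeAdj m a b || (Nat.blt a (Nat.mul 3 m) && (Nat.blt b (Nat.mul 3 m) && (!(Nat.beq a b) &&
    (Nat.testBit R (dartKey m (Nat.mod a m) (Nat.mod b m)
        (col3 (Nat.add (Nat.div b m) (Nat.sub 3 (Nat.div a m))))) ||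
      Nat.testBit R (dartKey m (Nat.mod b m) (Nat.mod a m)
        (col3 (Nat.add (Nat.div a m) (Nat.sub 3 (Nat.div b m)))))))))

theorem beq_false_iff {a b : ℕ} : (!(Nat.beq a b)) = true ↔ a ≠ b := by
  rw [Bool.not_eq_true', ← Bool.not_eq_true, beq_iff]

theorem treeAdj_iff {m : ℕ} (a b : Fin (6 * m - 2)) :
    treeAdj m a b = true ↔ (stdTree m).Adj a b := by
  rw [treeAdj, Bool.and_eq_true, Bool.or_eq_true, beq_iff, beq_iff, beq_false_iff, and_comm, ne_eq, ← Fin.ext_iff]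
  rfl

theorem adjB_iff {m R : ℕ} (a b : Fin (6 * m - 2)) : adjB m R a b = true ↔ (mkG m R).Adj a b := by
  rw [adjB, Bool.or_eq_true, treeAdj_iff, Bool.and_eq_true, Bool.and_eq_true, Bool.and_eq_true,
    Bool.or_eq_true, blt_iff, blt_iff, beq_false_iff]
  change _ ↔ (stdTree m).Adj a b ∨ (a ≠ b ∧ _)
  have : a ≠ b ↔ a.val ≠ b.val := by rw [ne_eq, Fin.ext_iff]
  rw [this]
  exact or_congr_right ⟨fun ⟨h1, h2, h3, h4⟩ => ⟨h3, h1, h2, h4⟩, fun ⟨h3, h1, h2, h4⟩ => ⟨h1, h2, h3, h4⟩⟩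

/-- The numbers below `n` that are related to `v`. -/
def nbrs (n : ℕ) (f : ℕ → ℕ → Bool) (v : ℕ) : List ℕ := (List.range n).filter (f v)

theorem deg_eq_length {n : ℕ} {G : SimpleGraph (Fin n)} {f : ℕ → ℕ → Bool}
    (hf : ∀ a b : Fin n, f a b = true ↔ G.Adj a b) (v : Fin n) : deg G v = (nbrs n f v).length := by
  have : Fin.val '' G.neighborSet v = ((nbrs n f v).toFinset : Set ℕ) := by
    ext w
    simp only [Set.mem_image, SimpleGraph.mem_neighborSet, List.coe_toFinset, Set.mem_ofPred_eq, nbrs,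
      List.mem_filter, List.mem_range]
    constructor
    · rintro ⟨w, hw, rfl⟩; exact ⟨w.2, (hf v w).2 hw⟩
    · rintro ⟨hw, h⟩; exact ⟨⟨w, hw⟩, (hf v ⟨w, hw⟩).1 h, rfl⟩
  rw [deg, ← Set.ncard_image_of_injective _ Fin.val_injective, this, Set.ncard_coe_finset,
    List.toFinset_card_of_nodup]
  exact List.Nodup.filter _ List.nodup_range

/-- The vertices in the list have degree three. -/
def cubicOn (n : ℕ) (f : ℕ → ℕ → Bool) (l : List ℕ) : Bool :=
  l.all fun v => Nat.beq (nbrs n f v).length 3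

theorem treeDeg_of {m : ℕ}
    (h : cubicOn (6 * m - 2) (treeAdj m) ((List.range (6 * m - 2)).drop (3 * m)) = true) : TreeDeg m := by
  intro a ha
  have := deg_eq_length (G := stdTree m) (f := treeAdj m) treeAdj_iff a
  rw [deg] at this
  rw [this]
  rw [cubicOn, List.all_eq_true] at h
  refine beq_iff.1 (h a ?_)
  rw [List.mem_drop_iff_getElem]
  exact ⟨a - 3 * m, by have := a.2; simp; omega, by simp; omega⟩

theorem stdTree_le_mkG (m R : ℕ) : stdTree m ≤ mkG m R := fun _ _ h => .inl h

theorem rotGraph_mkG {m R : ℕ} (hm : 1 ≤ m)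
    (h : cubicOn (6 * m - 2) (adjB m R) (List.range (6 * m - 2)) = true) : RotGraph m (mkG m R) where
  tree_le := stdTree_le_mkG m R
  cubic v := by
    rw [deg_eq_length (f := adjB m R) adjB_iff]
    rw [cubicOn, List.all_eq_true] at h
    exact beq_iff.1 (h v (by simp))
  rot := by
    rintro a b ha hb ⟨h1, h2, h3⟩
    obtain ⟨x, k, hx, hk, rfl⟩ := exists_leafIx ha
    obtain ⟨y, l, hy, hl, rfl⟩ := exists_leafIx hb
    rw [leafIx_rot hx hk, leafIx_rot hy hl]
    have la := leafIx_lt hx (col3_lt (k + 1))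
    have lb := leafIx_lt hy (col3_lt (l + 1))
    refine ⟨by omega, by omega, ?_⟩
    rcases h3 with h3 | ⟨h3, -, -, h4⟩
    · have := (stdTree_leaf hm ha).1 h3
      simp only at this
      have := par_ge m (leafIx m x k) hm
      omega
    · refine .inr ⟨fun he => h3 ?_, la, lb, ?_⟩
      · have := leafIx_inj hx hy (congrArg Fin.val he)
        have e : (k + 1) % 3 = (l + 1) % 3 := this.2
        apply Fin.ext
        simp only
        rw [this.1, show k = l by omega]
      · simp only [leafIx_mod hx, leafIx_mod hy, leafIx_div hx, leafIx_div hy] at h4 ⊢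
        have e : ∀ k < 3, ∀ l < 3, col3 (col3 (l + 1) + (3 - col3 (k + 1))) = col3 (l + (3 - k)) := by
          decide
        rw [e k hk l hl, e l hl k hk]
        exact h4

/-- The decision procedure for `TreeMasks`. -/
def treeMasksOk (m : ℕ) (M : ℕ → ℕ → ℕ) (full : ℕ) : Bool :=
  (List.range (6 * m - 3)).all fun v =>
    Nat.beq (Nat.lor (M v 0) (Nat.lor (M v 1) (M v 2))) full &&
    (Nat.beq (Nat.land (M v 0) (M v 1)) 0 && (Nat.beq (Nat.land (M v 0) (M v 2)) 0 &&
    (Nat.beq (Nat.land (M v 1) (M v 2)) 0 &&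
    (List.range (6 * m - 3)).all fun w => Nat.beq v w ||
      (!(Nat.beq (par m v) (par m w) || Nat.beq (par m v) w) ||
      (Nat.beq (Nat.land (M v 0) (M w 0)) 0 && (Nat.beq (Nat.land (M v 1) (M w 1)) 0 &&
        Nat.beq (Nat.land (M v 2) (M w 2)) 0))))))

theorem treeMasks_of {m : ℕ} {M : ℕ → ℕ → ℕ} {full : ℕ} (h : treeMasksOk m M full = true) :
    TreeMasks m M full := by
  simp only [treeMasksOk, List.all_eq_true, List.mem_range, Bool.and_eq_true, Bool.or_eq_true,
    beq_iff, Bool.not_eq_true', ← Bool.not_eq_true] at h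
  refine ⟨fun v hv => (h v hv).1, fun v hv c hc c' hc' hne => ?_, fun v hv w hw hne hp c hc => ?_⟩
  · obtain ⟨-, h1, h2, h3, -⟩ := h v hv
    have comm : ∀ a b, Nat.land a b = 0 → Nat.land b a = 0 := fun a b h => (Nat.land_comm b a).trans h
    interval_cases c <;> interval_cases c' <;>
      first | exact absurd rfl hne | exact h1 | exact h2 | exact h3 | exact comm _ _ h1 |
        exact comm _ _ h2 | exact comm _ _ h3
  · obtain ⟨-, -, -, -, h4⟩ := h v hv
    rcases h4 w hw with h4 | h4 | h4
    · exact absurd h4 hne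
    · tauto
    · interval_cases c
      · exact h4.1
      · exact h4.2.1
      · exact h4.2.2

/-- The decision procedure for `Equivariant`. -/
def equivariantOk (m : ℕ) (M : ℕ → ℕ → ℕ) : Bool :=
  (List.range m).all fun x => (List.range 3).all fun k => (List.range 3).all fun c =>
    Nat.beq (M (leafIx m x k) (col3 (Nat.add c k))) (M x c)

theorem equivariant_of {m : ℕ} {M : ℕ → ℕ → ℕ} (h : equivariantOk m M = true) : Equivariant m M := by
  simp only [equivariantOk, List.all_eq_true, List.mem_range, beq_iff] at h
  exact h

/-- The edges in `ws` (given by their lower ends) contain the boundary of `X`, which separates two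
leaves. -/
def cutCheck (m X : ℕ) (ws : List ℕ) : Bool :=
  Nat.ble ws.length 3 && (((List.range (6 * m - 3)).all fun v =>
    ws.any (Nat.beq v) || (Nat.testBit X v == Nat.testBit X (par m v))) &&
  ((List.range (3 * m)).any (Nat.testBit X) && (List.range (3 * m)).any fun b => !(Nat.testBit X b)))

theorem cutOk_of {m X : ℕ} {ws : List ℕ} (h : cutCheck m X ws = true) : CutOk m X := by
  simp only [cutCheck, List.all_eq_true, List.any_eq_true, List.mem_range, Bool.and_eq_true,
    Bool.or_eq_true, beq_iff_eq, Bool.not_eq_true'] at h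
  obtain ⟨h1, h2, h3, h4⟩ := h
  refine ⟨ws, Nat.le_of_ble_eq_true h1, fun v hv hw => ?_, h3, h4⟩
  rcases h2 v hv with ⟨w, hw', he⟩ | h
  · exact absurd (beq_iff.1 he ▸ hw') hw
  · exact h

/-- The set of the vertices below `w`, as a bit mask. -/
def subMask (m w : ℕ) : ℕ :=
  (List.range (6 * m - 2)).foldr (fun v acc =>
    bif Nat.beq v w || (Nat.beq (par m v) w || (Nat.beq (par m (par m v)) w ||
      Nat.beq (par m (par m (par m v))) w)) then Nat.lor (Nat.shiftLeft 1 v) acc else acc) 0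

/-- A vertex set whose boundary in the tree consists of the edges from `ws` to the parents. -/
def cutMask (m : ℕ) (ws : List ℕ) : ℕ := ws.foldl (fun s w => Nat.xor s (subMask m w)) 0

/-! ### The data of the searches -/

/-- The colourings `0, …, 2 ^ n - 1` of a family are given by `n` free binary choices; the `i`-th
mask consists of those colourings for which the `i`-th choice is positive. -/
def freeMasks (n : ℕ) : List ℕ := (List.range n).map fun i =>
  ((List.range (2 ^ n)).filter fun j => Nat.testBit j i).foldr
    (fun j s => Nat.lor (Nat.shiftLeft 1 j) s) 0

/-- The mask of all `n` colourings. -/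
def allOnes (n : ℕ) : ℕ := Nat.sub (Nat.shiftLeft 1 n) 1

/-- The masks in a packed table of `n` colourings. -/
def tableMask (n T v c : ℕ) : ℕ := lane n T (Nat.add (Nat.mul 3 v) c)

/-- The `128` equivariant colourings of the tree with `24` leaves: the choices in the three branches
agree. -/
def equiv8 : ℕ :=
  match freeMasks 7 with
  | [a, b, c, d, e, f, g] => packTable 128 (treeMasks (allOnes 128)
      [[a, a, a], [b, c, b, c, b, c], [d, e, f, g, d, e, f, g, d, e, f, g]])
  | _ => 0

/-- Choices at the inner vertices for six times `58` colourings of the tree with `24` leaves. One of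
these extends to the leaf edges whenever this is needed. The masks of a family fit into a machine word. -/
def choices8 : List (List (List ℕ)) :=
 [[[230528940839196421, 230528940839196421, 221521741584455429],
  [69311788289965989, 6187595365659054, 218695140047879564, 80621555626232432, 54510784951256690, 281937148782889821],
  [70992589292382442, 36133472016842814, 237429771191410517, 15755683526652334, 16635467137716997, 263892068814429668, 81055756553013874, 214928547261513711, 161529420724039304, 241541375728327607, 9429427835949128, 580542139498788]],
 [[184277741870879015, 197788542933504423, 184273345971851703],
  [171760814809874809, 9718879990650143, 166380557584608783, 265230655725689442, 110005018156428902, 94554229745170257],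
  [224473327136883566, 280279835109850517, 262897597892185827, 107692006078541181, 54574063190315799, 30574643907646744, 285974952668735861, 269582383930910655, 124909943604526284, 79068267947805908, 24935858635547139, 81091198785191952]],
 [[271421374178486652, 109356641901345148, 109433607413297500],
  [230770244124555074, 232580251298599887, 272553728548647950, 270829990344945673, 235744879566510032, 195686792207340289],
  [12962711320769752, 123263645054745379, 275985015630120576, 180017503273925631, 275798207881530274, 157994391473945950, 270122963490406325, 177327018686776138, 117716937982632717, 10336455157268704, 89157280485869080, 18296010925178880]],
 [[215337944593244781, 188540665899491372, 188416814005788781],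
  [159684551541171031, 117880032159086545, 214821843807808510, 284773024891267897, 67123103008321054, 220535723306218000],
  [145481135039057419, 238803838768336189, 198117816115493592, 64782902806097839, 142812864661211467, 137385702437446141, 190721814064948654, 169878420410013401, 283726882539791011, 99992225596, 19058918336, 2147484672]],
 [[242447996934640831, 77373326798360758, 35166799700497850],
  [31133347816357633, 6221767437916121, 284834033175251451, 169434575609141119, 251920623310461403, 108086936518975971],
  [59122279508868466, 9344979389984457, 278203241586610618, 121761743620161109, 103522228309159055, 123633805099841977, 268187862616697633, 18854443974621014, 144114638320729603, 144115188077133820, 229376, 0]],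
 [[266780895995875141, 266003447237889477, 123569679439540035],
  [1731858362766448, 118451659907963666, 49772662632890022, 73465303490910624, 155371988121356869, 51791395715150758],
  [208318087102835379, 45015808476124887, 221593600193554211, 91341143000677342, 164096287954764499, 243507472676251728, 231391148827966173, 40215771120834358, 54043195528854584, 216172782113898559, 131008, 393216]]]

/-- The colourings given by `choices8`. -/
def families8 : List ((ℕ → ℕ → ℕ) × ℕ) := choices8.map fun Bs =>
  (tableMask 58 (packTable 58 (treeMasks (allOnes 58) Bs)), allOnes 58)

/-- The quotients that remain after the reduction by symmetries. -/
def quotients8 : List (List (List ℕ)) := [[[4,6,7,5,3,2,1,0]],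
 [[5,3],[4,6,7,2,1,0]],
 [[7,5],[4,6,2,3,1,0]],
 [[4,5,7,6,2,3,1,0]],
 [[4,6,5,7,2,3,1,0]],
 [[4,6,7,2,5,3,1,0]],
 [[7,6,4],[2,3,5,1,0]],
 [[6,4],[7,2,3,5,1,0]],
 [[4,6,7,2,3,5,1,0]],
 [[6,7,3,2],[4,5,1,0]],
 [[7,3,2],[4,6,5,1,0]],
 [[4,6,2,3,7,5,1,0]],
 [[7,5,3,2],[4,6,1,0]],
 [[7,3,5,2],[4,6,1,0]],
 [[6,4],[5,3,2],[7,1,0]],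
 [[4,6,5,3,2,7,1,0]],
 [[4,6,2,3,5,7,1,0]],
 [[4,5,3,2,6,7,1,0]],
 [[5,3,2],[4,6,7,1,0]],
 [[6,4],[7,3,5,1],[2,0]],
 [[6,4],[7,5,3,1,2,0]],
 [[6,4,7,5,3,1,2,0]],
 [[4,6,7,5,3,1,2,0]],
 [[6,4],[7,3,5,1,2,0]],
 [[4,6,7,3,5,1,2,0]],
 [[6,4],[5,3],[7,1,2,0]],
 [[5,3],[6,4,7,1,2,0]],
 [[4,6,7,5,1,3,2,0]],
 [[4,6,7,1,5,3,2,0]],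
 [[4,6,7,3,1,5,2,0]],
 [[6,4],[7,1,3,5,2,0]],
 [[4,6,7,1,3,5,2,0]],
 [[4,6,1,7,3,5,2,0]],
 [[4,6,1,3,7,5,2,0]],
 [[3,1],[4,6,7,5,2,0]],
 [[7,5],[3,1],[4,6,2,0]],
 [[7,5,3,1],[4,6,2,0]],
 [[5,7,3,1],[4,6,2,0]],
 [[7,3,5,1],[4,6,2,0]],
 [[4,6,1,5,3,7,2,0]],
 [[4,6,3,1,5,7,2,0]],
 [[4,6,1,3,5,7,2,0]],
 [[5,3,1],[4,6,7,2,0]],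
 [[7,6,5],[3,2,1],[4,0]],
 [[5,3],[7,6,2,1],[4,0]],
 [[5,3,7,6,2,1],[4,0]],
 [[3,5,7,6,2,1],[4,0]],
 [[6,7,5,2],[3,1],[4,0]],
 [[7,5],[6,2],[3,1],[4,0]],
 [[5,7,6,2,3,1],[4,0]],
 [[7,6,2],[5,3,1],[4,0]],
 [[7,6,2,5,3,1],[4,0]],
 [[6,2],[7,5,3,1],[4,0]],
 [[6,2,7,5,3,1],[4,0]],
 [[6,2],[5,7,3,1],[4,0]],
 [[6,7,3,2],[5,1],[4,0]],
 [[7,3],[6,2],[5,1],[4,0]],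
 [[7,3,6,2],[5,1],[4,0]],
 [[7,6,2,3,5,1],[4,0]],
 [[6,2],[7,3,5,1],[4,0]],
 [[6,2,7,3,5,1],[4,0]],
 [[7,3,5,2,6,1],[4,0]],
 [[5,3],[7,2,6,1],[4,0]],
 [[5,3,2],[7,6,1],[4,0]],
 [[5,3],[6,2],[7,1],[4,0]],
 [[6,7,2,5,3,1,4,0]],
 [[6,7,3,2],[5,1,4,0]],
 [[7,3,6,2],[5,1,4,0]],
 [[6,7,2,3,5,1,4,0]],
 [[7,3,5,2],[6,1,4,0]],
 [[5,3,2],[6,7,1,4,0]],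
 [[6,7,3,5,1,2,4,0]],
 [[6,7,1,5,3,2,4,0]],
 [[6,7,1,3,5,2,4,0]],
 [[6,1,7,3,5,2,4,0]],
 [[3,1],[6,7,5,2,4,0]],
 [[7,3,5,1],[6,2,4,0]],
 [[6,3,5,1,7,2,4,0]],
 [[6,1,5,3,7,2,4,0]],
 [[5,3,1],[6,7,2,4,0]],
 [[7,5],[3,2,1],[6,4,0]],
 [[5,3,7,2,1],[6,4,0]],
 [[3,5,7,2,1],[6,4,0]],
 [[7,5,2],[3,1],[6,4,0]],
 [[7,2],[5,3,1],[6,4,0]],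
 [[5,3,2],[7,1,6,4,0]],
 [[7,5,3,1,2,6,4,0]],
 [[7,3,5,1,2,6,4,0]],
 [[7,1,5,3,2,6,4,0]],
 [[7,3,1,5,2,6,4,0]],
 [[7,1,3,5,2,6,4,0]],
 [[3,1],[7,5,2,6,4,0]],
 [[3,2,1],[7,5,6,4,0]],
 [[5,3,2,1],[7,6,4,0]],
 [[3,5,2,1],[7,6,4,0]],
 [[5,3,1,2,7,6,4,0]],
 [[5,1,3,2,7,6,4,0]],
 [[3,2,1],[5,7,6,4,0]],
 [[5,3],[6,2,1,7,4,0]],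
 [[6,2,1,3,5,7,4,0]],
 [[7,5,3,1,2,4,6,0]],
 [[5,3],[7,1,2,4,6,0]],
 [[7,1,3,5,2,4,6,0]],
 [[3,5,2,1],[7,4,6,0]]]

/-- Automorphisms of a branch that suffice to reduce the search to `quotients8`. -/
def perms8 : List (List ℕ) :=
  [43, 111, 4, 124, 32, 16, 64, 2, 125, 109, 98, 79, 88, 46, 87, 34, 1, 18, 26, 36, 60, 61].map
    fun i => (treeAutos 3).getD i []

/-- The weights of the positions, in their own order. -/
def weights8 : ℕ := packPerm (List.range 8)

/-- Blocks of leaves with a small boundary in the tree, and the tree edges in this boundary. -/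
def blocks8 : List ((ℕ × ℕ) × List ℕ) :=
  [((2, 0), [24, 28, 32]), ((2, 1), [25, 29, 33]), ((2, 2), [26, 30, 34]), ((2, 3), [27, 31, 35]),
    ((4, 0), [36, 38, 40])]

/-- The quotients of the list with their codes, which are compared first. -/
def codedQuotients8 : List (ℕ × List (List ℕ)) := quotients8.map fun cs => (code weights8 (steps cs), cs)

/-- Sets of at most three tree edges, given by their lower ends, that occur in small cuts. -/
def cutEdges8 : List (List ℕ) :=
  [[42], [26, 31, 40], [24, 33, 39], [0, 2, 37], [0, 18, 41], [0, 10, 39], [0, 10, 37], [0, 2, 41],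
    [0, 18, 39], [0, 18, 37], [0, 10, 41], [0, 2, 39], [24, 29, 41], [3, 5, 42]]

/-- The quotients of the leaf edges of the rotation `T_4`-snarks. -/
def reps8 : List (List (ℕ×ℕ×ℕ)) := [[(0, 2, 0), (0, 4, 1), (1, 3, 0), (1, 5, 0), (2, 5, 0), (3, 7, 0), (4, 6, 1), (6, 7, 1)],
 [(0, 2, 0), (0, 4, 0), (1, 3, 0), (1, 5, 0), (2, 5, 0), (3, 7, 2), (4, 6, 1), (6, 7, 1)],
 [(0, 2, 0), (0, 4, 2), (1, 3, 0), (1, 5, 0), (2, 5, 0), (3, 7, 1), (4, 6, 1), (6, 7, 1)],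
 [(0, 4, 0), (0, 6, 1), (1, 2, 0), (1, 5, 0), (2, 4, 0), (3, 5, 0), (3, 7, 2), (6, 7, 1)],
 [(0, 2, 0), (0, 7, 0), (1, 2, 1), (1, 3, 0), (3, 5, 0), (4, 6, 1), (4, 6, 2), (5, 7, 0)],
 [(0, 2, 0), (0, 4, 0), (1, 3, 0), (1, 5, 1), (2, 6, 2), (3, 7, 0), (4, 6, 0), (5, 7, 0)],
 [(0, 4, 0), (0, 7, 0), (1, 2, 1), (1, 3, 2), (2, 6, 0), (3, 5, 0), (4, 6, 0), (5, 7, 0)],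
 [(0, 4, 0), (0, 7, 0), (1, 2, 1), (1, 3, 2), (2, 6, 1), (3, 5, 0), (4, 6, 0), (5, 7, 0)],
 [(0, 2, 0), (0, 4, 2), (1, 3, 0), (1, 6, 0), (2, 5, 0), (3, 7, 1), (4, 6, 0), (5, 7, 0)],
 [(0, 4, 0), (0, 7, 0), (1, 2, 1), (1, 3, 2), (2, 6, 2), (3, 5, 2), (4, 6, 0), (5, 7, 0)],
 [(0, 4, 0), (0, 7, 0), (1, 2, 2), (1, 3, 1), (2, 6, 1), (3, 5, 2), (4, 6, 0), (5, 7, 0)],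
 [(0, 2, 2), (0, 4, 0), (1, 5, 0), (1, 6, 0), (2, 7, 1), (3, 5, 2), (3, 7, 2), (4, 6, 0)],
 [(0, 4, 0), (0, 7, 2), (1, 3, 1), (1, 3, 2), (2, 5, 0), (2, 6, 2), (4, 6, 2), (5, 7, 2)],
 [(0, 4, 2), (0, 7, 1), (1, 3, 1), (1, 3, 2), (2, 5, 2), (2, 6, 1), (4, 6, 2), (5, 7, 2)],
 [(0, 4, 1), (0, 6, 0), (1, 2, 1), (1, 7, 0), (2, 6, 2), (3, 5, 1), (3, 5, 2), (4, 7, 2)]]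

/-- The representatives for `24` leaves, as masks of darts. -/
def repMasks8 : List ℕ := reps8.map fun r => dartMask 8 (darts r)

/-- The data for `24` leaves. -/
def data8 : LeafData :=
  ⟨8, families8, cutEdges8.map (cutMask 8), treeAutos 3, repMasks8⟩

/-- The equivariant colourings of the tree with `12` leaves. -/
def equiv4 : ℕ :=
  match freeMasks 3 with
  | [a, b, c] => packTable 8 (treeMasks (allOnes 8) [[a, a, a], [b, c, b, c, b, c]])
  | _ => 0

/-- All `512` colourings of the tree with `12` leaves. -/
def cover4 : ℕ :=
  match freeMasks 9 with
  | [a, b, c, d, e, f, g, h, i] =>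
    packTable 512 (treeMasks (allOnes 512) [[a, b, c], [d, e, f, g, h, i]])
  | _ => 0

/-- The quotients of the leaf edges of the two Loupekine snarks. -/
def reps4 : List (List (ℕ × ℕ × ℕ)) :=
  [[(0, 3, 0), (3, 0, 1), (1, 2, 0), (2, 1, 2)], [(0, 1, 2), (1, 2, 0), (2, 3, 2), (3, 0, 0)]]

/-- The representatives for `12` leaves, as masks of darts. -/
def repMasks4 : List ℕ := reps4.map fun r => dartMask 4 (darts r)

/-- The data for `12` leaves. -/
def data4 : LeafData := ⟨4, [(tableMask 512 cover4, allOnes 512)], [cutMask 4 [12, 14, 16]], treeAutos 2, repMasks4⟩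

/-- The equivariant colourings of the tree with `6` leaves. -/
def equiv2 : ℕ :=
  match freeMasks 1 with
  | [a] => packTable 2 (treeMasks (allOnes 2) [[a, a, a]])
  | _ => 0

/-- All `8` colourings of the tree with `6` leaves. -/
def cover2 : ℕ :=
  match freeMasks 3 with
  | [a, b, c] => packTable 8 (treeMasks (allOnes 8) [[a, b, c]])
  | _ => 0

/-- The representative for `6` leaves, as a mask of darts. -/
def repMasks2 : List ℕ := [dartMask 2 (darts [(0, 1, 1), (0, 1, 2)])]

/-- The data for `6` leaves. -/
def data2 : LeafData := ⟨2, [(tableMask 8 cover2, allOnes 8)], [], treeAutos 1, repMasks2⟩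

/-! ### The searches for six and twelve leaves -/

set_option maxRecDepth 100000

theorem symmOk_split {m : ℕ} {l : List (List ℕ)} (n : ℕ)
    (h1 : ((l.take n).all fun p => symmOk m p 1 && symmOk m p 2) = true)
    (h2 : ((l.drop n).all fun p => symmOk m p 1 && symmOk m p 2) = true) :
    (l.all fun p => symmOk m p 1 && symmOk m p 2) = true := by
  rw [← List.take_append_drop n l, List.all_append, h1, h2]; rfl

theorem symmOk_all {m : ℕ} {l : List (List ℕ)}
    (h : (l.all fun p => symmOk m p 1 && symmOk m p 2) = true) :
    ∀ p ∈ l, symmOk m p 1 = true ∧ symmOk m p 2 = true := by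
  intro p hp
  rw [List.all_eq_true] at h
  simpa using h p hp

theorem autos8_ok₁ : (((treeAutos 3).take 64).all fun p => symmOk 8 p 1 && symmOk 8 p 2) = true := by
  decide +kernel

theorem autos8_ok₂ : (((treeAutos 3).drop 64).all fun p => symmOk 8 p 1 && symmOk 8 p 2) = true := by
  decide +kernel

theorem cubic8 : (repMasks8.all fun R => cubicOn 46 (adjB 8 R) (List.range 46)) = true := by
  decide +kernel

theorem masks8 : (families8.all fun F => treeMasksOk 8 F.1 F.2) = true := by decide +kernel

theorem cuts8 : (cutEdges8.all fun ws => cutCheck 8 (cutMask 8 ws) ws) = true := by decide +kernel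

theorem treeDeg8 : TreeDeg 8 := treeDeg_of (by decide +kernel)

theorem data8_ok : LeafDataOk data8 where
  masks := fun F hF => by
    have := masks8
    rw [List.all_eq_true] at this
    exact treeMasks_of (this F hF)
  cuts := by
    intro X hX
    obtain ⟨ws, hws, rfl⟩ := List.mem_map.1 hX
    have := cuts8
    rw [List.all_eq_true] at this
    exact cutOk_of (this ws hws)
  autos := symmOk_all (symmOk_split 64 autos8_ok₁ autos8_ok₂)
  reps := fun R hR => rotGraph_mkG (by decide) (by
    have := cubic8
    rw [List.all_eq_true] at this
    exact this R hR)
  deg := treeDeg8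
  even := by decide
  pos := by decide
  refl := by decide +kernel

theorem data4_ok : LeafDataOk data4 where
  masks := by
    intro F hF
    obtain rfl := List.mem_singleton.1 hF
    exact treeMasks_of (by decide +kernel)
  cuts := by
    intro X hX
    obtain rfl := List.mem_singleton.1 hX
    exact cutOk_of (ws := [12, 14, 16]) (by decide +kernel)
  autos := symmOk_all (by decide +kernel)
  reps := fun R hR => rotGraph_mkG (by decide) (by
    have : (repMasks4.all fun R => cubicOn 22 (adjB 4 R) (List.range 22)) = true := by decide +kernel
    rw [List.all_eq_true] at this
    exact this R hR)
  deg := treeDeg_of (by decide +kernel)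
  even := by decide
  pos := by decide
  refl := by decide +kernel

theorem data2_ok : LeafDataOk data2 where
  masks := by
    intro F hF
    obtain rfl := List.mem_singleton.1 hF
    exact treeMasks_of (by decide +kernel)
  cuts := by intro X hX; cases hX
  autos := symmOk_all (by decide +kernel)
  reps := fun R hR => rotGraph_mkG (by decide) (by
    have : (repMasks2.all fun R => cubicOn 10 (adjB 2 R) (List.range 10)) = true := by decide +kernel
    rw [List.all_eq_true] at this
    exact this R hR)
  deg := treeDeg_of (by decide +kernel)
  even := by decide
  pos := by decide
  refl := by decide +kernel

theorem classify4 {G : SimpleGraph (Fin (6 * 4 - 2))} (hG : RotGraph 4 G) (hs : IsSnark G) :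
    ∃ R ∈ repMasks4, TreeIso 4 G (mkG 4 R) :=
  classify_of_phase2 (n := 17) data4_ok (M := tableMask 8 equiv4) (full := allOnes 8)
    (treeMasks_of (by decide +kernel)) (equivariant_of (by decide +kernel)) rfl
    (by decide +kernel) hG hs

theorem classify2 {G : SimpleGraph (Fin (6 * 2 - 2))} (hG : RotGraph 2 G) (hs : IsSnark G) :
    ∃ R ∈ repMasks2, TreeIso 2 G (mkG 2 R) :=
  classify_of_phase2 (n := 17) data2_ok (M := tableMask 2 equiv2) (full := allOnes 2)
    (treeMasks_of (by decide +kernel)) (equivariant_of (by decide +kernel)) rfl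
    (by decide +kernel) hG hs

/-! ### The search for twenty-four leaves -/

/-- The search over the voltages for the `n` quotients from number `k` on. -/
noncomputable def searchQuotients (k n : ℕ) : Bool :=
  ((quotients8.drop k).take n).all
    (phase2 data8 (tableMask 128 equiv8) (allOnes 128))

theorem searchQuotients₀ : searchQuotients 0 8 = true := by decide +kernel

theorem searchQuotients₈ : searchQuotients 8 8 = true := by decide +kernel

theorem searchQuotients₁₆ : searchQuotients 16 8 = true := by decide +kernel

theorem searchQuotients₂₄ : searchQuotients 24 8 = true := by decide +kernel

theorem searchQuotients₃₂ : searchQuotients 32 8 = true := by decide +kernel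

theorem searchQuotients₄₀ : searchQuotients 40 8 = true := by decide +kernel

theorem searchQuotients₄₈ : searchQuotients 48 8 = true := by decide +kernel

theorem searchQuotients₅₆ : searchQuotients 56 8 = true := by decide +kernel

theorem searchQuotients₆₄ : searchQuotients 64 8 = true := by decide +kernel

theorem searchQuotients₇₂ : searchQuotients 72 8 = true := by decide +kernel

theorem searchQuotients₈₀ : searchQuotients 80 8 = true := by decide +kernel

theorem searchQuotients₈₈ : searchQuotients 88 8 = true := by decide +kernel

theorem searchQuotients₉₆ : searchQuotients 96 8 = true := by decide +kernel

theorem all_of_drop {α : Type*} {l : List α} {P : α → Bool} {k : ℕ} (n : ℕ)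
    (h1 : ((l.drop k).take n).all P = true) (h2 : (l.drop (k + n)).all P = true) :
    (l.drop k).all P = true := by
  rw [← List.take_append_drop n (l.drop k), List.all_append, h1, List.drop_drop, h2]; rfl

theorem searchQuotients_all :
    quotients8.all (phase2 data8 (tableMask 128 equiv8) (allOnes 128)) = true :=
  all_of_drop (k := 0) 8 searchQuotients₀ <|
  all_of_drop (k := 8) 8 searchQuotients₈ <|
  all_of_drop (k := 16) 8 searchQuotients₁₆ <|
  all_of_drop (k := 24) 8 searchQuotients₂₄ <|
  all_of_drop (k := 32) 8 searchQuotients₃₂ <|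
  all_of_drop (k := 40) 8 searchQuotients₄₀ <|
  all_of_drop (k := 48) 8 searchQuotients₄₈ <|
  all_of_drop (k := 56) 8 searchQuotients₅₆ <|
  all_of_drop (k := 64) 8 searchQuotients₆₄ <|
  all_of_drop (k := 72) 8 searchQuotients₇₂ <|
  all_of_drop (k := 80) 8 searchQuotients₈₀ <|
  all_of_drop (k := 88) 8 searchQuotients₈₈ <|
  all_of_drop (k := 96) 8 searchQuotients₉₆ <|
  by rfl

/-- The part of the search in which the second vertex of the first cycle is `w`. -/
def searchFrom (w : ℕ) (l : List ℕ) : Bool :=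
  qsearch (phase1 (blocks8.map (·.1)) codedQuotients8 (perms8.map packPerm) weights8) 16 [] [0] w w l

theorem searchFrom₁ : searchFrom 1 [2, 3, 4, 5, 6, 7] = true := by decide +kernel

theorem searchFrom₂ : searchFrom 2 [1, 3, 4, 5, 6, 7] = true := by decide +kernel

theorem searchFrom₃ : searchFrom 3 [1, 2, 4, 5, 6, 7] = true := by decide +kernel

theorem searchFrom₄ : searchFrom 4 [1, 2, 3, 5, 6, 7] = true := by decide +kernel

theorem searchFrom₅ : searchFrom 5 [1, 2, 3, 4, 6, 7] = true := by decide +kernel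

theorem searchFrom₆ : searchFrom 6 [1, 2, 3, 4, 5, 7] = true := by decide +kernel

theorem searchFrom₇ : searchFrom 7 [1, 2, 3, 4, 5, 6] = true := by decide +kernel

theorem qsearch_start (fin : List (List ℕ) → Bool) (n v f : ℕ) (l : List ℕ) :
    qsearch fin (n + 1) [] [] v f l = l.all fun w => qsearch fin n [] [v] w w (eraseNat w l) := by
  rw [qsearch, Bool.true_and]

theorem search_all : qsearch (phase1 (blocks8.map (·.1)) codedQuotients8 (perms8.map packPerm) weights8)
    17 [] [] 0 0 [1, 2, 3, 4, 5, 6, 7] = true := by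
  rw [qsearch_start]
  change (searchFrom 1 [2, 3, 4, 5, 6, 7] && (searchFrom 2 [1, 3, 4, 5, 6, 7] &&
    (searchFrom 3 [1, 2, 4, 5, 6, 7] && (searchFrom 4 [1, 2, 3, 5, 6, 7] &&
    (searchFrom 5 [1, 2, 3, 4, 6, 7] && (searchFrom 6 [1, 2, 3, 4, 5, 7] &&
    (searchFrom 7 [1, 2, 3, 4, 5, 6] && true))))))) = true
  rw [searchFrom₁, searchFrom₂, searchFrom₃, searchFrom₄, searchFrom₅, searchFrom₆, searchFrom₇]
  rfl

theorem blocks8_ok : (blocks8.all fun p => cutCheck 8 (cutMask 8 p.2) p.2 &&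
    ((List.range 8).all fun x => (List.range 3).all fun k =>
      Nat.testBit (cutMask 8 p.2) (leafIx 8 x k) == Nat.beq (Nat.div x p.1.1) p.1.2)) = true := by
  decide +kernel

theorem perms8_ok : (perms8.all fun p => symmOk 8 p 1 &&
    (List.range 8).all fun x => Nat.beq (wt (packPerm p) x) (wt weights8 (nthD p x))) = true := by
  decide +kernel

theorem classify8 {G : SimpleGraph (Fin (6 * 8 - 2))} (hG : RotGraph 8 G) (hs : IsSnark G) :
    ∃ R ∈ repMasks8, TreeIso 8 G (mkG 8 R) := by
  refine classify (n := 17) data8_ok (M := tableMask 128 equiv8) (full := allOnes 128)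
    (treeMasks_of (by decide +kernel)) (equivariant_of (by decide +kernel))
    ?_ ?_ ?_ rfl search_all hG hs
  · intro p hp
    obtain ⟨q, hq, rfl⟩ := List.mem_map.1 hp
    have := blocks8_ok
    rw [List.all_eq_true] at this
    have := this q hq
    simp only [Bool.and_eq_true, List.all_eq_true, List.mem_range, beq_iff_eq] at this
    exact ⟨_, cutOk_of this.1, this.2⟩
  · intro p hp
    obtain ⟨cs, hcs, rfl⟩ := List.mem_map.1 hp
    have := searchQuotients_all
    rw [List.all_eq_true] at this
    exact this cs hcs
  · intro p hp
    have := perms8_ok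
    rw [List.all_eq_true] at this
    have := this p hp
    simp only [Bool.and_eq_true, List.all_eq_true, List.mem_range, beq_iff] at this
    exact this

/-! ### Curves in a disk -/

theorem arg_one_sub_exp {φ : ℝ} (h0 : 0 < φ) (h1 : φ < 2 * Real.pi) :
    Complex.arg (1 - Complex.exp (φ * Complex.I)) = (φ - Real.pi) / 2 := by
  have hs : 0 < 2 * Real.sin (φ / 2) :=
    mul_pos two_pos (Real.sin_pos_of_pos_of_lt_pi (by linarith) (by linarith))
  have : 1 - Complex.exp (φ * Complex.I) = ((2 * Real.sin (φ / 2) : ℝ) : ℂ) *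
      (Complex.cos (((φ - Real.pi) / 2 : ℝ)) + Complex.sin (((φ - Real.pi) / 2 : ℝ)) * Complex.I) := by
    have h2 : Real.cos ((φ - Real.pi) / 2) = Real.sin (φ / 2) := by
      rw [sub_div, Real.cos_sub_pi_div_two]
    have h3 : Real.sin ((φ - Real.pi) / 2) = - Real.cos (φ / 2) := by
      rw [sub_div, Real.sin_sub_pi_div_two]
    have h4 : Real.cos φ = 1 - 2 * Real.sin (φ / 2) ^ 2 := by
      have := Real.cos_sq_add_sin_sq (φ / 2)
      have h5 := Real.cos_two_mul (φ / 2)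
      rw [mul_div_cancel₀ _ two_ne_zero] at h5
      linarith
    have h6 : Real.sin φ = 2 * Real.sin (φ / 2) * Real.cos (φ / 2) := by
      have h5 := Real.sin_two_mul (φ / 2)
      rwa [mul_div_cancel₀ _ two_ne_zero] at h5
    rw [← Complex.ofReal_cos, ← Complex.ofReal_sin, h2, h3, Complex.exp_mul_I, ← Complex.ofReal_cos,
      ← Complex.ofReal_sin, h4, h6]
    push_cast
    ring
  rw [this, Complex.arg_mul_cos_add_sin_mul_I hs]
  constructor <;> linarith [Real.pi_pos]

theorem arg_one_sub_exp' {φ : ℝ} (h0 : φ < 0) (h1 : -(2 * Real.pi) < φ) :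
    Complex.arg (1 - Complex.exp (φ * Complex.I)) = (φ + Real.pi) / 2 := by
  have := arg_one_sub_exp (φ := φ + 2 * Real.pi) (by linarith) (by linarith)
  rw [show ((φ + 2 * Real.pi : ℝ) : ℂ) * Complex.I = φ * Complex.I + 2 * Real.pi * Complex.I by
    push_cast; ring, Complex.exp_periodic] at this
  rw [this]; ring

/-- The increment of a logarithm along a curve in an open half plane. -/
theorem log_increment {L w : ℝ → ℂ} {u : ℂ} (hL : Continuous L) (hw : Continuous w)
    (h : ∀ s, Complex.exp (L s) = u * w s) (hre : ∀ s, 0 < (w s).re) :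
    (L 1).im - (L 0).im = (w 1).arg - (w 0).arg := by
  have hlog : Continuous fun s => Complex.log (w s) :=
    hw.clog fun s => .inl (hre s)
  have hw0 : ∀ s, w s ≠ 0 := fun s h => by have := hre s; rw [h] at this; simp at this
  let g : ℝ → ℝ := fun s => ((L s).im - (w s).arg - ((L 0).im - (w 0).arg)) / (2 * Real.pi)
  have hg : Continuous g := by
    have h1 : Continuous fun s => (Complex.log (w s)).im := Complex.continuous_im.comp hlog
    simp only [Complex.log_im] at h1
    have h2 : Continuous fun s => (L s).im := Complex.continuous_im.comp hL
    fun_prop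
  have hint : ∀ s, ∃ n : ℤ, g s = n := by
    intro s
    have e : ∀ s, Complex.exp (L s - Complex.log (w s)) = u := by
      intro s
      rw [Complex.exp_sub, Complex.exp_log (hw0 s), h, mul_div_cancel_right₀ _ (hw0 s)]
    obtain ⟨n, hn⟩ := Complex.exp_eq_exp_iff_exists_int.1 ((e s).trans (e 0).symm)
    refine ⟨n, ?_⟩
    have := congrArg Complex.im hn
    simp [Complex.log_im] at this
    simp only [g]
    rw [this]
    field_simp
    ring
  have h01 : g 0 = 0 := by simp [g]
  have h1 : g 1 = 0 := by
    obtain ⟨n, hn⟩ := hint 1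
    by_contra hne
    have hn0 : n ≠ 0 := by rintro rfl; exact hne (by simpa using hn)
    have half : ∀ s (k : ℤ), g s ≠ k + 1 / 2 := by
      intro s k hk
      obtain ⟨n, hn⟩ := hint s
      rw [hn] at hk
      have : (2 * n : ℝ) = 2 * k + 1 := by linarith
      have : 2 * n = 2 * k + 1 := by exact_mod_cast this
      omega
    rcases lt_or_gt_of_ne hn0 with h' | h'
    · have : (n : ℝ) ≤ -1 := by exact_mod_cast (show n ≤ -1 by omega)
      obtain ⟨s, -, hs⟩ := intermediate_value_Icc' (zero_le_one (α := ℝ)) hg.continuousOn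
        (show (-1 / 2 : ℝ) ∈ Set.Icc (g 1) (g 0) by rw [hn, h01]; constructor <;> linarith)
      exact half s (-1) (by rw [hs]; push_cast; ring)
    · have : (1 : ℝ) ≤ n := by exact_mod_cast (show 1 ≤ n by omega)
      obtain ⟨s, -, hs⟩ := intermediate_value_Icc (zero_le_one (α := ℝ)) hg.continuousOn
        (show (1 / 2 : ℝ) ∈ Set.Icc (g 0) (g 1) by rw [hn, h01]; constructor <;> linarith)
      exact half s 0 (by rw [hs]; push_cast; ring)
  have hpi := Real.pi_pos
  simp only [g] at h1
  rw [div_eq_zero_iff] at h1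
  rcases h1 with h1 | h1
  · linarith
  · linarith

theorem re_one_sub_pos {z : ℂ} (hz : ‖z‖ ≤ 1) (h1 : z ≠ 1) : 0 < (1 - z).re := by
  rw [Complex.sub_re, Complex.one_re, sub_pos]
  refine lt_of_le_of_ne ((Complex.re_le_norm z).trans hz) fun h => h1 ?_
  have h2 : z.re ^ 2 + z.im ^ 2 ≤ 1 := by
    have := Complex.sq_norm z
    rw [Complex.normSq_apply] at this
    nlinarith [norm_nonneg z]
  have : z.im = 0 := by
    rw [h] at h2
    exact pow_eq_zero_iff two_ne_zero |>.1 (le_antisymm (by linarith) (sq_nonneg _))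
  exact Complex.ext h this

/-- Two curves in the closed unit disk whose ends are interleaved on the unit circle meet. -/
theorem curves_meet_unit {f g : ℝ → ℂ} (hf : Continuous f) (hg : Continuous g)
    (hf1 : ∀ s, ‖f s‖ ≤ 1) (hg1 : ∀ s, ‖g s‖ ≤ 1) {a b a' b' : ℝ}
    (hfa : f 0 = Complex.exp (a * Complex.I)) (hfa' : f 1 = Complex.exp (a' * Complex.I))
    (hgb : g 0 = Complex.exp (b * Complex.I)) (hgb' : g 1 = Complex.exp (b' * Complex.I))
    (h1 : b < a) (h2 : a' < b) (h3 : b' < a') (h4 : a - 2 * Real.pi < b') : ∃ s t, f s = g t := by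
  by_contra! hne
  have hF : Continuous fun p : ℝ × ℝ => f p.1 - g p.2 := by fun_prop
  have hsc : IsSimplyConnected (Set.univ : Set (ℝ × ℝ)) := by
    have := (Homeomorph.Set.univ (ℝ × ℝ)).contractibleSpace
    exact SimplyConnectedSpace.ofContractible _
  obtain ⟨L, hL, he⟩ := Complex.exists_continuousOn_eqOn_exp_comp hsc isOpen_univ hF.continuousOn
    (by rintro ⟨p, -, hp⟩; exact hne p.1 p.2 (sub_eq_zero.1 hp))
  rw [continuousOn_univ] at hL
  replace he : ∀ s t, Complex.exp (L (s, t)) = f s - g t := fun s t => he (Set.mem_univ (s, t))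
  have hexp : ∀ x : ℝ, Complex.exp (x * Complex.I) ≠ 0 := fun x => Complex.exp_ne_zero _
  have hsub : ∀ x y : ℝ, Complex.exp (x * Complex.I) / Complex.exp (y * Complex.I) =
      Complex.exp ((x - y : ℝ) * Complex.I) := by
    intro x y; rw [← Complex.exp_sub]; congr 1; push_cast; ring
  have nrm : ∀ {z : ℂ} (x : ℝ), ‖z‖ ≤ 1 → ‖z / Complex.exp (x * Complex.I)‖ ≤ 1 := by
    intro z x hz; rwa [norm_div, Complex.norm_exp_ofReal_mul_I, div_one]
  have side_f : ∀ (t x : ℝ), g t = Complex.exp (x * Complex.I) → (L (1, t)).im - (L (0, t)).im =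
      (1 - Complex.exp ((a' - x : ℝ) * Complex.I)).arg - (1 - Complex.exp ((a - x : ℝ) * Complex.I)).arg := by
    intro t x ht
    have := log_increment (L := fun s => L (s, t)) (w := fun s => 1 - f s / Complex.exp (x * Complex.I))
      (u := -Complex.exp (x * Complex.I)) (by fun_prop) (by fun_prop) (fun s => by
        rw [he, ht]; field_simp [hexp x]; ring) (fun s => re_one_sub_pos (nrm x (hf1 s)) fun h => by
          rw [div_eq_one_iff_eq (hexp x), ← ht] at h; exact hne _ _ h)
    simpa only [hfa, hfa', hsub] using this
  have side_g : ∀ (s x : ℝ), f s = Complex.exp (x * Complex.I) → (L (s, 1)).im - (L (s, 0)).im =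
      (1 - Complex.exp ((b' - x : ℝ) * Complex.I)).arg - (1 - Complex.exp ((b - x : ℝ) * Complex.I)).arg := by
    intro s x hs
    have := log_increment (L := fun t => L (s, t)) (w := fun t => 1 - g t / Complex.exp (x * Complex.I))
      (u := Complex.exp (x * Complex.I)) (by fun_prop) (by fun_prop) (fun t => by
        rw [he, hs]; field_simp [hexp x]) (fun t => re_one_sub_pos (nrm x (hg1 t)) fun h => by
          rw [div_eq_one_iff_eq (hexp x), ← hs] at h; exact hne _ _ h.symm)
    simpa only [hgb, hgb', hsub] using this
  have hpi := Real.pi_pos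
  have e1 := side_f 0 b hgb
  have e2 := side_f 1 b' hgb'
  have e3 := side_g 0 a hfa
  have e4 := side_g 1 a' hfa'
  rw [arg_one_sub_exp' (by linarith) (by linarith), arg_one_sub_exp (by linarith) (by linarith)] at e1
  rw [arg_one_sub_exp (by linarith) (by linarith), arg_one_sub_exp (by linarith) (by linarith)] at e2
  rw [arg_one_sub_exp' (by linarith) (by linarith), arg_one_sub_exp' (by linarith) (by linarith)] at e3
  rw [arg_one_sub_exp' (by linarith) (by linarith), arg_one_sub_exp (by linarith) (by linarith)] at e4
  linarith

/-- Two connections in a closed disk between points that are interleaved on its boundary meet. -/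
theorem joinedIn_meet {S S' : Set ℂ} {c : ℂ} {r : ℝ} (hr : 0 < r) (hS : S ⊆ Metric.closedBall c r)
    (hS' : S' ⊆ Metric.closedBall c r) {a b a' b' : ℝ}
    (h1 : b < a) (h2 : a' < b) (h3 : b' < a') (h4 : a - 2 * Real.pi < b')
    (hj : JoinedIn S (c + r * Complex.exp (a * Complex.I)) (c + r * Complex.exp (a' * Complex.I)))
    (hj' : JoinedIn S' (c + r * Complex.exp (b * Complex.I)) (c + r * Complex.exp (b' * Complex.I))) :
    (S ∩ S').Nonempty := by
  obtain ⟨γ, hγ⟩ := hj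
  obtain ⟨δ, hδ⟩ := hj'
  have hr0 : (r : ℂ) ≠ 0 := by exact_mod_cast hr.ne'
  have bd : ∀ z ∈ Metric.closedBall c r, ‖(z - c) / r‖ ≤ 1 := by
    intro z hz
    rw [norm_div, Complex.norm_real, Real.norm_of_nonneg hr.le, div_le_one hr]
    simpa [dist_eq_norm] using hz
  have hγ' : ∀ s, γ.extend s ∈ S := fun s => hγ _
  have hδ' : ∀ s, δ.extend s ∈ S' := fun s => hδ _
  obtain ⟨s, t, hst⟩ := curves_meet_unit (f := fun s => (γ.extend s - c) / r)
    (g := fun s => (δ.extend s - c) / r) (a := a) (a' := a') (b := b) (b' := b')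
    (by have := γ.continuous_extend; fun_prop) (by have := δ.continuous_extend; fun_prop)
    (fun s => bd _ (hS (hγ' s))) (fun s => bd _ (hS' (hδ' s)))
    (by simp [hr0]) (by simp [hr0]) (by simp [hr0]) (by simp [hr0]) h1 h2 h3 h4
  rw [div_left_inj' hr0, sub_left_inj] at hst
  exact ⟨_, hγ' s, hst ▸ hδ' t⟩

/-! ### The tree as seen from its center -/

section
variable {V : Type*} {T : SimpleGraph V} {i : ℕ} {x : V}

open Classical in
/-- The neighbour of `v` towards the root `x`. -/
noncomputable def up (T : SimpleGraph V) (x v : V) : V :=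
  if h : ∃ w, T.Adj w v ∧ T.dist x w + 1 = T.dist x v then h.choose else v

theorem closer_unique (hT : T.IsTree) {v w w' : V} (hw : T.Adj w v) (hw' : T.Adj w' v)
    (h : T.dist x w + 1 = T.dist x v) (h' : T.dist x w' + 1 = T.dist x v) : w = w' := by
  obtain ⟨p, hp⟩ := hT.connected.exists_walk_length_eq_dist x w
  obtain ⟨q, hq⟩ := hT.connected.exists_walk_length_eq_dist x w'
  have h1 := (p.concat hw).isPath_of_length_eq_dist (by rw [SimpleGraph.Walk.length_concat, hp, h])
  have h2 := (q.concat hw').isPath_of_length_eq_dist (by rw [SimpleGraph.Walk.length_concat, hq, h'])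
  have := (hT.isAcyclic.subsingleton_path x v).elim ⟨_, h1⟩ ⟨_, h2⟩
  have := congrArg SimpleGraph.Walk.penultimate (congrArg Subtype.val this)
  simpa using this

theorem up_root : up T x x = x := by
  rw [up, dif_neg]
  rintro ⟨w, -, h⟩
  simp at h

theorem up_spec (hT : T.IsTree) {v : V} (hv : v ≠ x) :
    T.Adj (up T x v) v ∧ T.dist x (up T x v) + 1 = T.dist x v := by
  have : ∃ w, T.Adj w v ∧ T.dist x w + 1 = T.dist x v := by
    obtain ⟨p, hp⟩ := hT.connected.exists_walk_length_eq_dist v x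
    cases p with
    | nil => exact absurd rfl hv
    | cons h q =>
      rename_i w
      refine ⟨w, h.symm, ?_⟩
      have h1 := SimpleGraph.dist_le q
      rw [SimpleGraph.Walk.length_cons] at hp
      have h2 := hT.dist_eq_dist_add_one_of_adj x h
      rw [SimpleGraph.dist_comm] at h1
      rw [SimpleGraph.dist_comm] at hp
      omega
  rw [up, dif_pos this]
  exact this.choose_spec

theorem up_eq (hT : T.IsTree) {v w : V} (hw : T.Adj w v) (h : T.dist x w + 1 = T.dist x v) :
    up T x v = w := by
  have hv : v ≠ x := by rintro rfl; simp at h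
  exact closer_unique hT (up_spec hT hv).1 hw (up_spec hT hv).2 h

theorem adj_iff_up (hT : T.IsTree) {u v : V} :
    T.Adj u v ↔ u ≠ v ∧ (v = up T x u ∨ u = up T x v) := by
  constructor
  · intro h
    refine ⟨h.ne, ?_⟩
    rcases hT.dist_eq_dist_add_one_of_adj x h with h' | h'
    · exact .inl (up_eq hT h.symm h'.symm).symm
    · exact .inr (up_eq hT h h'.symm).symm
  · rintro ⟨hne, rfl | rfl⟩
    · by_cases hu : u = x
      · subst hu; rw [up_root] at hne; exact absurd rfl hne
      · exact (up_spec hT hu).1.symm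
    · by_cases hv : v = x
      · subst hv; rw [up_root] at hne; exact absurd rfl hne
      · exact (up_spec hT hv).1

theorem dist_up (hT : T.IsTree) (v : V) : T.dist x (up T x v) = T.dist x v - 1 := by
  by_cases hv : v = x
  · subst hv; rw [up_root]; simp
  · have := (up_spec hT hv).2; omega

theorem dist_up_iterate (hT : T.IsTree) (k : ℕ) (v : V) :
    T.dist x ((up T x)^[k] v) = T.dist x v - k := by
  induction k with
  | zero => simp
  | succ k ih => rw [Function.iterate_succ_apply', dist_up hT, ih]; omega

/-- The neighbours of `v` away from the root `x`. -/
def children (T : SimpleGraph V) (x v : V) : Set V := {c | c ≠ v ∧ up T x c = v}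

theorem dist_child (hT : T.IsTree) {v c : V} (hc : c ∈ children T x v) :
    T.dist x c = T.dist x v + 1 := by
  have : c ≠ x := by
    rintro rfl
    exact hc.1 (up_root.symm.trans hc.2)
  have := (up_spec hT this).2
  rw [hc.2] at this
  exact this.symm

theorem ncard_children [Finite V] (hT : T.IsTree) {v : V} (hv : v ≠ x) :
    (children T x v).ncard + 1 = deg T v := by
  have : T.neighborSet v = insert (up T x v) (children T x v) := by
    ext w
    rw [SimpleGraph.mem_neighborSet, adj_iff_up hT, Set.mem_insert_iff]
    change _ ↔ w = up T x v ∨ (w ≠ v ∧ up T x w = v)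
    have := (up_spec hT hv).1.ne
    constructor
    · rintro ⟨h1, h2 | h2⟩
      · exact .inl h2
      · exact .inr ⟨h1.symm, h2.symm⟩
    · rintro (rfl | ⟨h1, h2⟩)
      · exact ⟨this.symm, .inl rfl⟩
      · exact ⟨h1.symm, .inr h2.symm⟩
  rw [deg, this, Set.ncard_insert_of_notMem _ (Set.toFinite _)]
  intro h
  have h1 := dist_child hT h
  have h2 := (up_spec hT hv).2
  omega

theorem ncard_children_root (hT : T.IsTree) : (children T x x).ncard = deg T x := by
  have : T.neighborSet x = children T x x := by
    ext w
    rw [SimpleGraph.mem_neighborSet, adj_iff_up hT, up_root]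
    change _ ↔ w ≠ x ∧ up T x w = x
    constructor
    · rintro ⟨h1, h2 | h2⟩
      · exact absurd h2.symm h1
      · exact ⟨h1.symm, h2.symm⟩
    · rintro ⟨h1, h2⟩
      exact ⟨h1.symm, .inr h2.symm⟩
  rw [deg, this]

namespace IsTreeT

theorem exists_child [Finite V] (h : IsTreeT i T x) {v : V} (hv : v ∉ leaves T) : ∃ c, c ∈ children T x v := by
  have h3 : deg T v = 3 := (h.deg_eq v).resolve_left hv
  by_cases hvx : v = x
  · subst hvx
    have := ncard_children_root (x := v) h.isTree
    exact Set.nonempty_of_ncard_ne_zero (by omega)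
  · have := ncard_children h.isTree hvx
    exact Set.nonempty_of_ncard_ne_zero (by omega)

theorem dist_lt [Finite V] (h : IsTreeT i T x) {v : V} (hv : v ∉ leaves T) : T.dist x v < i := by
  obtain ⟨N, hN⟩ : ∃ N, ∀ v, T.dist x v ≤ N := by
    obtain ⟨N, hN⟩ := (Set.finite_range fun v => T.dist x v).bddAbove
    exact ⟨N, fun v => hN ⟨v, rfl⟩⟩
  induction hk : N - T.dist x v using Nat.strong_induction_on generalizing v with
  | _ k ih =>
    obtain ⟨c, hc⟩ := h.exists_child hv
    have h1 := dist_child h.isTree hc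
    have h2 := hN c
    by_cases hcl : c ∈ leaves T
    · have := h.dist_center c hcl; omega
    · have := ih _ (by omega) hcl rfl
      omega

theorem mem_leaves_iff [Finite V] (h : IsTreeT i T x) {v : V} : v ∈ leaves T ↔ T.dist x v = i :=
  ⟨h.dist_center v, fun hv => by
    by_contra hl
    have := h.dist_lt hl
    omega⟩

theorem dist_le [Finite V] (h : IsTreeT i T x) (v : V) : T.dist x v ≤ i := by
  by_cases hv : v ∈ leaves T
  · exact (h.dist_center v hv).le
  · exact (h.dist_lt hv).le

theorem exists_leaf [Finite V] (h : IsTreeT i T x) (v : V) : ∃ w ∈ leaves T, (up T x)^[i - T.dist x v] w = v := by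
  induction hk : i - T.dist x v generalizing v with
  | zero => exact ⟨v, h.mem_leaves_iff.2 (by have := h.dist_le v; omega), rfl⟩
  | succ k ih =>
    have hv : v ∉ leaves T := fun hv => by have := h.dist_center v hv; omega
    obtain ⟨c, hc⟩ := h.exists_child hv
    have := dist_child h.isTree hc
    obtain ⟨w, hw, hwc⟩ := ih c (by omega)
    exact ⟨w, hw, by rw [Function.iterate_succ_apply', hwc, hc.2]⟩

theorem dist_iterate (h : IsTreeT i T x) {w : V} (hw : w ∈ leaves T) (k : ℕ) :
    T.dist x ((up T x)^[k] w) = i - k := by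
  rw [dist_up_iterate h.isTree, h.dist_center w hw]

theorem iterate_top (h : IsTreeT i T x) {w : V} (hw : w ∈ leaves T) : (up T x)^[i] w = x := by
  have := h.dist_iterate hw i
  rw [Nat.sub_self, h.isTree.connected.dist_eq_zero_iff] at this
  exact this.symm

/-- The leaves below `v`, if `v` has height `k`. -/
def below (T : SimpleGraph V) (x : V) (k : ℕ) (v : V) : Set V := {w | w ∈ leaves T ∧ (up T x)^[k] w = v}

theorem below_disjoint {k : ℕ} {c c' : V} (hne : c ≠ c') :
    Disjoint (below T x k c) (below T x k c') := by
  rw [Set.disjoint_left]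
  rintro w ⟨-, h1⟩ ⟨-, h2⟩
  exact hne (h1.symm.trans h2)

theorem below_succ (h : IsTreeT i T x) {k : ℕ} {v : V} (hk : T.dist x v + (k + 1) = i) :
    below T x (k + 1) v = ⋃ c ∈ children T x v, below T x k c := by
  ext w
  simp only [below, Set.mem_ofPred_eq, Set.mem_iUnion, exists_prop]
  constructor
  · rintro ⟨hw, hv⟩
    rw [Function.iterate_succ_apply'] at hv
    refine ⟨_, ⟨fun he => ?_, hv⟩, hw, rfl⟩
    have := h.dist_iterate hw k
    rw [he] at this
    omega
  · rintro ⟨c, hc, hw, rfl⟩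
    exact ⟨hw, by rw [Function.iterate_succ_apply', hc.2]⟩

theorem ncard_below [Finite V] (h : IsTreeT i T x) {k : ℕ} (hki : k < i) {v : V} (hk : T.dist x v + k = i) :
    (below T x k v).ncard = 2 ^ k := by
  induction k generalizing v with
  | zero =>
    have : below T x 0 v = {v} := by
      ext w
      simp only [below, Function.iterate_zero, id, Set.mem_ofPred_eq, Set.mem_singleton_iff]
      constructor
      · exact fun h => h.2
      · rintro rfl; exact ⟨h.mem_leaves_iff.2 hk, rfl⟩
    rw [this, Set.ncard_singleton, pow_zero]
  | succ k ih =>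
    have hv : v ∉ leaves T := fun hv => by have := h.dist_center v hv; omega
    have hvx : v ≠ x := by rintro rfl; simp at hk; omega
    have h3 : deg T v = 3 := (h.deg_eq v).resolve_left hv
    have h2 : (children T x v).ncard = 2 := by have := ncard_children h.isTree hvx; omega
    obtain ⟨c, c', hne, hC⟩ := Set.ncard_eq_two.1 h2
    have hc : c ∈ children T x v := hC ▸ Set.mem_insert _ _
    have hc' : c' ∈ children T x v := hC ▸ Set.mem_insert_of_mem _ rfl
    have d1 := dist_child h.isTree hc
    have d2 := dist_child h.isTree hc'
    rw [h.below_succ hk, hC, Set.biUnion_insert, Set.biUnion_singleton,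
      Set.ncard_union_eq (below_disjoint hne) (Set.toFinite _) (Set.toFinite _),
      ih (by omega) (by omega), ih (by omega) (by omega)]
    ring

theorem ncard_leaves [Finite V] (h : IsTreeT i T x) (hi : 1 ≤ i) : (leaves T).ncard = 3 * 2 ^ (i - 1) := by
  obtain ⟨k, rfl⟩ : ∃ k, i = k + 1 := ⟨i - 1, by omega⟩
  have h3 : (children T x x).ncard = 3 := (ncard_children_root h.isTree).trans h.deg_center
  obtain ⟨a, b, c, hab, hac, hbc, hC⟩ := Set.ncard_eq_three.1 h3
  have hd : ∀ v ∈ children T x x, T.dist x v = 1 := by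
    intro v hv
    have := dist_child h.isTree hv
    simpa using this
  have ha := hd a (hC ▸ by simp)
  have hb := hd b (hC ▸ by simp)
  have hc := hd c (hC ▸ by simp)
  have : leaves T = below T x (k + 1) x := by
    ext w
    exact ⟨fun hw => ⟨hw, h.iterate_top hw⟩, fun hw => hw.1⟩
  rw [this, h.below_succ (by simp), hC, Set.biUnion_insert, Set.biUnion_insert, Set.biUnion_singleton,
    Set.ncard_union_eq (by rw [Set.disjoint_union_right]; exact ⟨below_disjoint hab, below_disjoint hac⟩)
      (Set.toFinite _) (Set.toFinite _),
    Set.ncard_union_eq (below_disjoint hbc) (Set.toFinite _) (Set.toFinite _),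
    h.ncard_below (by omega) (by omega), h.ncard_below (by omega) (by omega),
    h.ncard_below (by omega) (by omega)]
  simp only [Nat.add_sub_cancel]
  ring

end IsTreeT
end

/-! ### The order of the leaves on the circle -/

section
variable {V : Type*} {G T : SimpleGraph V} {i : ℕ} {x : V}

/-- The drawing of the vertices in `A` and of the edges of `T` between them. -/
def region (D : Drawing G) (T : SimpleGraph V) (A : Set V) : Set ℂ :=
  D.pt '' A ∪ ⋃ e ∈ {e | e ∈ T.edgeSet ∧ ∀ v ∈ e, v ∈ A}, D.curve e

/-- Disjoint parts of a tree that is drawn without crossings are drawn disjointly. -/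
theorem region_disjoint {D : Drawing G} (hTG : T ≤ G) (hD : D.PlanarOn T) {A B : Set V}
    (hAB : ∀ v ∈ A, v ∉ B) : ¬ (region D T A ∩ region D T B).Nonempty := by
  rintro ⟨z, hA, hB⟩
  have hE : T.edgeSet ⊆ G.edgeSet := SimpleGraph.edgeSet_mono hTG
  simp only [region, Set.mem_union, Set.mem_image, Set.mem_iUnion, exists_prop,
    Set.mem_ofPred_eq] at hA hB
  rcases hA with ⟨a, ha, rfl⟩ | ⟨e, ⟨he, hea⟩, hz⟩ <;> rcases hB with ⟨b, hb, hab⟩ | ⟨f, ⟨hf, hfb⟩, hz'⟩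
  · exact hAB a ha (D.pt_injective hab ▸ hb)
  · exact hAB a ha (hfb a (D.curve_avoids f (hE hf) a hz'))
  · subst hab
    exact hAB b (hea b (D.curve_avoids e (hE he) b hz)) hb
  · have hne : e ≠ f := by
      rintro rfl
      induction e with
      | _ a b => exact hAB a (hea a (by simp)) (hfb a (by simp))
    obtain ⟨v, h1, h2, -⟩ := hD e he f hf hne z ⟨hz, hz'⟩
    exact hAB v (hea v h1) (hfb v h2)

theorem joinedIn_of_adj {D : Drawing G} (hTG : T ≤ G) {A : Set V} {u v : V} (h : T.Adj u v)
    (hu : u ∈ A) (hv : v ∈ A) : JoinedIn (region D T A) (D.pt u) (D.pt v) := by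
  obtain ⟨γ, hγ, -, h0, h1, hr⟩ := D.curve_simple u v (hTG h)
  refine ⟨⟨⟨γ, hγ⟩, h0, h1⟩, fun t => .inr ?_⟩
  simp only [Set.mem_iUnion, exists_prop]
  refine ⟨s(u, v), ⟨h, fun w hw => ?_⟩, hr ▸ ⟨t, rfl⟩⟩
  rcases Sym2.mem_iff.1 hw with rfl | rfl
  · exact hu
  · exact hv

theorem joinedIn_iterate {D : Drawing G} (hTG : T ≤ G) (hT : T.IsTree) {A : Set V} {w : V} {k : ℕ}
    (h : ∀ j ≤ k, (up T x)^[j] w ∈ A) : JoinedIn (region D T A) (D.pt w) (D.pt ((up T x)^[k] w)) := by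
  induction k with
  | zero => exact JoinedIn.refl (.inl ⟨w, h 0 le_rfl, rfl⟩)
  | succ k ih =>
    refine (ih fun j hj => h j (by omega)).trans ?_
    have hk := h k (by omega)
    have hk' := h (k + 1) le_rfl
    rw [Function.iterate_succ_apply'] at hk' ⊢
    by_cases hx : (up T x)^[k] w = x
    · rw [hx, up_root]
      rw [hx] at hk
      exact JoinedIn.refl (.inl ⟨x, hk, rfl⟩)
    · exact joinedIn_of_adj hTG (up_spec hT hx).1.symm hk hk'

/-- The drawing of the tree stays in the disk. -/
theorem region_subset {D : Drawing G} (hTG : T ≤ G) (hT : IsTreeT i T x) {c : ℂ} {r : ℝ}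
    (hin : ∀ e ∈ T.edgeSet, ∀ z ∈ D.curve e, z ∈ Metric.ball c r ∨ ∃ v ∈ leaves T, z = D.pt v)
    (hleaf : ∀ v ∈ leaves T, D.pt v ∈ Metric.sphere c r) (A : Set V) :
    region D T A ⊆ Metric.closedBall c r := by
  have key : ∀ e ∈ T.edgeSet, D.curve e ⊆ Metric.closedBall c r := by
    intro e he z hz
    rcases hin e he z hz with h | ⟨v, hv, rfl⟩
    · exact Metric.ball_subset_closedBall h
    · exact Metric.sphere_subset_closedBall (hleaf v hv)
  rintro z (⟨a, -, rfl⟩ | hz)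
  · obtain ⟨b, hb⟩ : ∃ b, T.Adj a b := by
      have : (T.neighborSet a).ncard ≠ 0 := by
        change deg T a ≠ 0
        rcases hT.deg_eq a with h | h <;> omega
      exact Set.nonempty_of_ncard_ne_zero this
    obtain ⟨γ, -, -, h0, -, hr⟩ := D.curve_simple a b (hTG hb)
    exact key s(a, b) hb (hr ▸ ⟨0, h0⟩)
  · simp only [Set.mem_iUnion, exists_prop] at hz
    obtain ⟨e, he, hz⟩ := hz
    exact key e he.1 hz

/-- The vertices from which the way to the root passes through `v`. -/
def subtree (T : SimpleGraph V) (x v : V) : Set V := {u | ∃ j, (up T x)^[j] u = v}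

/-- The leaves below a vertex and the other leaves are not interleaved on the circle. -/
theorem not_interleaved {D : Drawing G} (hTG : T ≤ G) (hT : IsTreeT i T x) (hD : D.PlanarOn T)
    {c : ℂ} {r : ℝ} (hr : 0 < r)
    (hin : ∀ e ∈ T.edgeSet, ∀ z ∈ D.curve e, z ∈ Metric.ball c r ∨ ∃ v ∈ leaves T, z = D.pt v)
    (hleaf : ∀ v ∈ leaves T, D.pt v ∈ Metric.sphere c r) {l : ℕ} {ν : ℕ → V}
    {φ : ℕ → ℝ} (hν : ∀ n < l, D.pt (ν n) = c + r * Complex.exp (φ n * Complex.I))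
    (hνl : ∀ n < l, ν n ∈ leaves T)
    (hφ : ∀ a b, a < b → b < l → φ b < φ a) (hφ2 : ∀ n < l, φ 0 - φ n < 2 * Real.pi)
    {v : V} {n₁ n₂ n₃ n₄ : ℕ} (h12 : n₁ < n₂) (h23 : n₂ < n₃) (h34 : n₃ < n₄) (h4 : n₄ < l)
    (h : (ν n₁ ∈ subtree T x v ∧ ν n₃ ∈ subtree T x v ∧ ν n₂ ∉ subtree T x v ∧ ν n₄ ∉ subtree T x v) ∨
      (ν n₁ ∉ subtree T x v ∧ ν n₃ ∉ subtree T x v ∧ ν n₂ ∈ subtree T x v ∧ ν n₄ ∈ subtree T x v)) :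
    False := by
  have inside : ∀ w, w ∈ subtree T x v →
      JoinedIn (region D T (subtree T x v)) (D.pt w) (D.pt v) := by
    rintro w ⟨k, hk⟩
    have := joinedIn_iterate (D := D) hTG hT.isTree (A := subtree T x v) (x := x) (w := w) (k := k)
      fun j hj => ⟨k - j, by rw [← Function.iterate_add_apply, Nat.sub_add_cancel hj, hk]⟩
    rwa [hk] at this
  have outside : ∀ w, w ∈ leaves T → w ∉ subtree T x v →
      JoinedIn (region D T (subtree T x v)ᶜ) (D.pt w) (D.pt x) := by
    intro w hw hwv
    have := joinedIn_iterate (D := D) hTG hT.isTree (A := (subtree T x v)ᶜ) (x := x) (w := w) (k := i)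
      fun j _ ⟨k, hk⟩ => hwv ⟨k + j, by rw [Function.iterate_add_apply, hk]⟩
    have e : (up T x)^[i] w = x := hT.iterate_top hw
    rwa [e] at this
  have hs := region_subset hTG hT hin hleaf
  have h1 := hφ n₁ n₂ h12 (by omega)
  have h2 := hφ n₂ n₃ h23 (by omega)
  have h3 := hφ n₃ n₄ h34 (by omega)
  have h0 : φ n₁ - 2 * Real.pi < φ n₄ := by
    have := hφ2 n₄ h4
    have : φ n₁ ≤ φ 0 := by
      rcases Nat.eq_zero_or_pos n₁ with h | h
      · rw [h]
      · exact (hφ 0 n₁ h (by omega)).le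
    linarith
  rcases h with ⟨ha, hc, hb, hd⟩ | ⟨ha, hc, hb, hd⟩
  · refine region_disjoint hTG hD (A := subtree T x v) (B := (subtree T x v)ᶜ) (fun v hv h => h hv)
      (joinedIn_meet hr (hs _) (hs _) h1 h2 h3 h0 ?_ ?_)
    · rw [← hν _ (by omega), ← hν _ (by omega)]
      exact (inside _ ha).trans (inside _ hc).symm
    · rw [← hν _ (by omega), ← hν _ (by omega)]
      exact (outside _ (hνl _ (by omega)) hb).trans (outside _ (hνl _ (by omega)) hd).symm
  · refine region_disjoint hTG hD (A := (subtree T x v)ᶜ) (B := subtree T x v) (fun v hv h => hv h)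
      (joinedIn_meet hr (hs _) (hs _) h1 h2 h3 h0 ?_ ?_)
    · rw [← hν _ (by omega), ← hν _ (by omega)]
      exact (outside _ (hνl _ (by omega)) ha).trans (outside _ (hνl _ (by omega)) hc).symm
    · rw [← hν _ (by omega), ← hν _ (by omega)]
      exact (inside _ hb).trans (inside _ hd).symm

theorem mem_subtree_iff [Finite V] (hT : IsTreeT i T x) {k : ℕ} (hk : k < i) {w u : V} (hw : w ∈ leaves T)
    (hu : u ∈ leaves T) : w ∈ subtree T x ((up T x)^[k] u) ↔ (up T x)^[k] w = (up T x)^[k] u := by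
  refine ⟨fun ⟨j, hj⟩ => ?_, fun h => ⟨k, h⟩⟩
  have h1 := hT.dist_iterate hw j
  have h2 := hT.dist_iterate hu k
  rw [hj, h2] at h1
  have : j = k := by omega
  rw [← this] at hj ⊢
  exact hj

/-- If all fibres of `f` are intervals of length `N`, they are aligned. -/
theorem aligned_fibres {α : Type*} [DecidableEq α] {f : ℕ → α} {N q : ℕ} (hN : 0 < N)
    (hconv : ∀ a b c, a ≤ b → b ≤ c → c < q * N → f a = f c → f b = f a)
    (hcard : ∀ a < q * N, ((Finset.range (q * N)).filter fun n => f n = f a).card = N) :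
    ∀ a < q * N, ∀ b < q * N, f a = f b ↔ a / N = b / N := by
  have main : ∀ j ≤ q, ∀ a < j * N, ∀ b < q * N, f a = f b ↔ a / N = b / N := by
    intro j
    induction j with
    | zero => intro _ a ha; omega
    | succ j ih =>
      intro hj
      have hjq : (j + 1) * N ≤ q * N := Nat.mul_le_mul_right N hj
      have hj1 : (j + 1) * N = j * N + N := by ring
      have hlow : ∀ n < j * N, f n ≠ f (j * N) := by
        intro n hn h
        have := (ih (by omega) n hn (j * N) (by omega)).1 h
        rw [Nat.mul_div_cancel _ hN] at this
        have := (Nat.div_lt_iff_lt_mul hN).2 hn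
        omega
      set C := (Finset.range (q * N)).filter fun n => f n = f (j * N) with hC
      have hCN : C.card = N := hcard _ (by omega)
      have hsub : Finset.Ico (j * N) (j * N + N) ⊆ C := by
        intro b hb
        rw [Finset.mem_Ico] at hb
        by_contra hbC
        have hbf : f b ≠ f (j * N) := fun h => hbC (by
          rw [hC, Finset.mem_filter, Finset.mem_range]; exact ⟨by omega, h⟩)
        have : C ⊆ Finset.Ico (j * N) b := by
          intro n hn
          rw [hC, Finset.mem_filter, Finset.mem_range] at hn
          rw [Finset.mem_Ico]
          refine ⟨not_lt.1 fun h => hlow n h hn.2, not_le.1 fun h => hbf ?_⟩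
          exact hconv _ _ _ hb.1 h hn.1 hn.2.symm
        have := Finset.card_le_card this
        rw [hCN, Nat.card_Ico] at this
        omega
      have hCeq : Finset.Ico (j * N) (j * N + N) = C :=
        Finset.eq_of_subset_of_card_le hsub (by rw [hCN, Nat.card_Ico]; omega)
      have hmem : ∀ b < q * N, f b = f (j * N) ↔ b / N = j := by
        intro b hb
        have h1 : f b = f (j * N) ↔ b ∈ C := by simp [hC, hb]
        rw [h1, ← hCeq, Finset.mem_Ico, Nat.div_eq_iff hN]
        omega
      intro a ha b hb
      by_cases haj : a < j * N
      · exact ih (by omega) a haj b hb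
      · have h1 : a / N = j := by rw [Nat.div_eq_iff hN]; omega
        rw [(hmem a (by omega)).2 h1, h1, eq_comm, hmem b hb, eq_comm]
  exact main q le_rfl

end

/-! ### The standard numbering of the tree -/

/-- The height of the vertex `v` of the standard tree. -/
def stdHeight (m i v : ℕ) : ℕ := ((List.range i).filter fun k => Nat.ble (6 * m - 6 * m / 2 ^ (k + 1)) v).length

/-- Properties of the standard numbering for a given `m`: ancestors, blocks of leaves and heights. -/
structure StdFacts (m i : ℕ) : Prop where
  two_pow : m = 2 ^ (i - 1)
  pos : 1 ≤ i
  block : ∀ a < 3 * m, ∀ b < 3 * m, ∀ k < i, (par m)^[k] a = (par m)^[k] b ↔ a / 2 ^ k = b / 2 ^ k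
  top : ∀ a < 3 * m, (par m)^[i] a = 6 * m - 3
  surj : ∀ v < 6 * m - 2, ∃ k < i + 1, ∃ a < 3 * m, (par m)^[k] a = v
  height : ∀ a < 3 * m, ∀ k < i + 1, stdHeight m i ((par m)^[k] a) = k
  lt : ∀ a < 3 * m, ∀ k < i + 1, (par m)^[k] a < 6 * m - 2

theorem stdFacts2 : StdFacts 2 2 := by constructor <;> decide +kernel

theorem stdFacts4 : StdFacts 4 3 := by constructor <;> decide +kernel

theorem stdFacts8 : StdFacts 8 4 := by constructor <;> decide +kernel

section
variable {V : Type*} [Finite V] {G T : SimpleGraph V} {i m : ℕ} {x : V}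

/-- A numbering of the leaves for which the leaves below the vertices of height `k` form consecutive
intervals of length `2 ^ k` extends to an isomorphism with the standard tree. -/
theorem exists_equiv (hT : IsTreeT i T x) (hs : StdFacts m i) {ν : ℕ → V}
    (hνl : ∀ n < 3 * m, ν n ∈ leaves T) (hsurj : ∀ w ∈ leaves T, ∃ n < 3 * m, ν n = w)
    (hb : ∀ k < i, ∀ a < 3 * m, ∀ b < 3 * m,
      (up T x)^[k] (ν a) = (up T x)^[k] (ν b) ↔ a / 2 ^ k = b / 2 ^ k) :
    ∃ e : V ≃ Fin (6 * m - 2), (∀ u v, (stdTree m).Adj (e u) (e v) ↔ T.Adj u v) ∧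
      ∀ n < 3 * m, (e (ν n)).val = n := by
  let R : V → ℕ → Prop := fun v w => ∃ k < i + 1, ∃ a < 3 * m, (up T x)^[k] (ν a) = v ∧ (par m)^[k] a = w
  have left : ∀ v, ∃ w : Fin (6 * m - 2), R v w := by
    intro v
    obtain ⟨u, hu, huv⟩ := hT.exists_leaf v
    obtain ⟨a, ha, rfl⟩ := hsurj u hu
    exact ⟨⟨_, hs.lt a ha (i - T.dist x v) (by omega)⟩, _, by omega, a, ha, huv, rfl⟩
  have right : ∀ w : Fin (6 * m - 2), ∃ v, R v w := by
    intro w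
    obtain ⟨k, hk, a, ha, h⟩ := hs.surj w w.2
    exact ⟨_, k, hk, a, ha, rfl, h⟩
  have iff : ∀ a < 3 * m, ∀ b < 3 * m, ∀ k < i + 1,
      (up T x)^[k] (ν a) = (up T x)^[k] (ν b) ↔ (par m)^[k] a = (par m)^[k] b := by
    intro a ha b hb' k hk
    by_cases hki : k < i
    · rw [hb k hki a ha b hb', hs.block a ha b hb' k hki]
    · obtain rfl : k = i := by omega
      rw [hT.iterate_top (hνl a ha), hT.iterate_top (hνl b hb'), hs.top a ha, hs.top b hb']
      exact ⟨fun _ => rfl, fun _ => rfl⟩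
  have fun_left : ∀ v w w', R v w → R v w' → w = w' := by
    rintro v w w' ⟨k, hk, a, ha, h1, rfl⟩ ⟨k', hk', a', ha', h2, rfl⟩
    have e1 := hT.dist_iterate (hνl a ha) k
    have e2 := hT.dist_iterate (hνl a' ha') k'
    rw [h1] at e1
    rw [h2] at e2
    obtain rfl : k = k' := by omega
    exact (iff a ha a' ha' k hk).1 (h1.trans h2.symm)
  have fun_right : ∀ v v' w, R v w → R v' w → v = v' := by
    rintro v v' w ⟨k, hk, a, ha, rfl, h1⟩ ⟨k', hk', a', ha', rfl, h2⟩
    have e1 := hs.height a ha k hk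
    have e2 := hs.height a' ha' k' hk'
    rw [h1] at e1
    rw [h2] at e2
    obtain rfl : k = k' := by omega
    exact (iff a ha a' ha' k hk).2 (h1.trans h2.symm)
  choose E hE using left
  have hEiff : ∀ v (w : Fin (6 * m - 2)), R v w → E v = w := fun v w h =>
    Fin.ext (fun_left v _ _ (hE v) h)
  let e := Equiv.ofBijective E ⟨fun v v' h => fun_right v v' _ (hE v) (h ▸ hE v'), fun w => by
    obtain ⟨v, hv⟩ := right w
    exact ⟨v, hEiff v w hv⟩⟩
  have hm : 1 ≤ m := by rw [hs.two_pow]; exact Nat.one_le_two_pow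
  have hup : ∀ v, (E (up T x v)).val = par m (E v) := by
    intro v
    obtain ⟨k, hk, a, ha, h1, h2⟩ := hE v
    refine fun_left _ _ _ (hE _) ?_
    by_cases hki : k < i
    · refine ⟨k + 1, by omega, a, ha, ?_, ?_⟩
      · rw [Function.iterate_succ_apply', h1]
      · rw [Function.iterate_succ_apply', h2]
    · obtain rfl : k = i := by omega
      rw [hT.iterate_top (hνl a ha)] at h1
      rw [hs.top a ha] at h2
      refine ⟨k, hk, a, ha, ?_, ?_⟩
      · rw [hT.iterate_top (hνl a ha), ← h1, up_root]
      · rw [hs.top a ha, ← h2, par_def]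
        omega
  refine ⟨e, fun u v => ?_, fun n hn => ?_⟩
  · rw [adj_iff_up (x := x) hT.isTree]
    change (e u ≠ e v ∧ ((E v).val = par m (E u) ∨ (E u).val = par m (E v))) ↔ _
    rw [e.injective.ne_iff, ← hup, ← hup, ← Fin.ext_iff, ← Fin.ext_iff]
    change u ≠ v ∧ (e v = e _ ∨ e u = e _) ↔ _
    rw [e.injective.eq_iff, e.injective.eq_iff]
  · exact fun_left _ _ _ (hE _) ⟨0, by omega, n, hn, rfl, rfl⟩

/-- A cubic graph with a rotation tree is isomorphic to a rotation graph on the standard tree. -/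
theorem exists_rotGraph (hs : StdFacts m i) (h : IsRotationHist i G T) (hc : ∀ v, deg G v = 3) :
    ∃ (G' : SimpleGraph (Fin (6 * m - 2))) (e : G ≃g G'), RotGraph m G' ∧
      ∀ a b, (stdTree m).Adj (e a) (e b) ↔ T.Adj a b := by
  classical
  obtain ⟨hTG, x, l, label, D, c, r, θ, hT, hlab, hD, hr, hin, hpt, hθ, hθ2, -, hrot⟩ := h
  have hm : m = 2 ^ (i - 1) := hs.two_pow
  have hi := hs.pos
  have hl : l = 3 * m := by
    have h1 := hT.ncard_leaves hs.pos
    rw [← hlab.image_eq, hlab.injOn.ncard_image, Set.ncard_univ, Nat.card_zmod] at h1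
    rw [h1, hm]
  have hm0 : 0 < m := by rw [hm]; positivity
  subst hl
  have : NeZero (3 * m) := ⟨by omega⟩
  have hleaf : ∀ a, label a ∈ leaves T := fun a => hlab.mapsTo (Set.mem_univ a)
  have hinj : Function.Injective label := fun a b hab => hlab.injOn (Set.mem_univ a) (Set.mem_univ b) hab
  -- a position `s` where a new branch at the center starts
  obtain ⟨s, hs1⟩ : ∃ s, (up T x)^[i - 1] (label s) ≠ (up T x)^[i - 1] (label (s - 1)) := by
    by_contra! hall
    have hconst : ∀ n : ℕ, (up T x)^[i - 1] (label n) = (up T x)^[i - 1] (label 0) := by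
      intro n
      induction n with
      | zero => simp
      | succ n ih => rw [hall, Nat.cast_succ, add_sub_cancel_right, ih]
    have hb : IsTreeT.below T x (i - 1) ((up T x)^[i - 1] (label 0)) = leaves T := by
      ext w
      refine ⟨fun h => h.1, fun hw => ⟨hw, ?_⟩⟩
      obtain ⟨a, -, rfl⟩ := hlab.surjOn hw
      rw [← ZMod.natCast_zmod_val a]
      exact hconst _
    have h1 := hT.ncard_below (k := i - 1) (by omega) (v := (up T x)^[i - 1] (label 0))
      (by rw [hT.dist_iterate (hleaf 0)]; omega)
    rw [hb, hT.ncard_leaves hi] at h1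
    have : 0 < 2 ^ (i - 1) := by positivity
    omega
  let ν : ℕ → V := fun n => label (s + n)
  let φ : ℕ → ℝ := fun n => if s.val + n < 3 * m then θ (s + n) else θ (s + n) - 2 * Real.pi
  have hval : ∀ n < 3 * m, (s + n : ZMod (3 * m)).val =
      if s.val + n < 3 * m then s.val + n else s.val + n - 3 * m := by
    intro n hn
    rw [ZMod.val_add, ZMod.val_natCast, Nat.mod_eq_of_lt hn]
    have := ZMod.val_lt s
    split_ifs with h
    · exact Nat.mod_eq_of_lt h
    · rw [Nat.mod_eq_sub_mod (by omega), Nat.mod_eq_of_lt (by omega)]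
  have hν : ∀ n < 3 * m, D.pt (ν n) = c + r * Complex.exp (φ n * Complex.I) := by
    intro n hn
    simp only [ν, φ]
    rw [hpt]
    split_ifs with h
    · rfl
    · rw [show ((θ (s + n) - 2 * Real.pi : ℝ) : ℂ) * Complex.I =
        θ (s + n) * Complex.I - 2 * Real.pi * Complex.I by push_cast; ring,
        Complex.exp_periodic.sub_eq]
  have hθ0 : ∀ a, θ a ≤ θ 0 := by
    intro a
    by_cases ha : a = 0
    · rw [ha]
    · refine (hθ 0 a ?_).le
      rw [ZMod.val_zero]
      exact Nat.pos_of_ne_zero fun h => ha ((ZMod.val_eq_zero a).1 h)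
  have hφ : ∀ a b, a < b → b < 3 * m → φ b < φ a := by
    intro a b hab hb
    have h1 := hval a (by omega)
    have h2 := hval b hb
    simp only [φ]
    split_ifs at h1 h2 ⊢ with h3 h4 h4
    · exact hθ _ _ (by omega)
    · omega
    · have := hθ2 (s + a)
      have := hθ0 (s + b)
      linarith
    · have := hθ (s + a) (s + b) (by omega)
      linarith
  have hφ2 : ∀ n < 3 * m, φ 0 - φ n < 2 * Real.pi := by
    intro n hn
    have h1 := hval n hn
    have h0 := ZMod.val_lt s
    simp only [φ, Nat.cast_zero, add_zero, h0, if_true]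
    split_ifs at h1 ⊢ with h3
    · have := hθ2 (s + n)
      have := hθ0 s
      linarith
    · have := hθ (s + n) s (by omega)
      linarith
  have hνl : ∀ n < 3 * m, ν n ∈ leaves T := fun n _ => hleaf _
  have hνinj : ∀ a < 3 * m, ∀ b < 3 * m, ν a = ν b → a = b := by
    intro a ha b hb h
    have := add_left_cancel (hinj h)
    have := congrArg ZMod.val this
    rwa [ZMod.val_natCast, ZMod.val_natCast, Nat.mod_eq_of_lt ha, Nat.mod_eq_of_lt hb] at this
  have hνsurj : ∀ w ∈ leaves T, ∃ n < 3 * m, ν n = w := by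
    intro w hw
    obtain ⟨a, -, rfl⟩ := hlab.surjOn hw
    refine ⟨(a - s).val, ZMod.val_lt _, ?_⟩
    simp only [ν]
    rw [ZMod.natCast_zmod_val, add_sub_cancel]
  have hsphere : ∀ v ∈ leaves T, D.pt v ∈ Metric.sphere c r := by
    intro v hv
    obtain ⟨a, -, rfl⟩ := hlab.surjOn hv
    rw [hpt, mem_sphere_iff_norm, add_sub_cancel_left, norm_mul, Complex.norm_exp_ofReal_mul_I,
      mul_one, Complex.norm_real, Real.norm_of_nonneg hr.le]
  -- the first and the last leaf are below different vertices of each height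
  have hends : ∀ k < i, (up T x)^[k] (ν 0) ≠ (up T x)^[k] (ν (3 * m - 1)) := by
    intro k hk h
    apply hs1
    have h1 : (s + ((3 * m - 1 : ℕ) : ZMod (3 * m))) = s - 1 := by
      rw [Nat.cast_sub (by omega), ZMod.natCast_self]; simp [sub_eq_add_neg]
    have h0 : ν 0 = label s := by simp only [ν, Nat.cast_zero, add_zero]
    have h2 : ν (3 * m - 1) = label (s - 1) := by simp only [ν]; rw [h1]
    rw [h0, h2] at h
    obtain ⟨d, hd⟩ : ∃ d, i - 1 = d + k := ⟨i - 1 - k, by omega⟩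
    rw [hd, Function.iterate_add_apply, Function.iterate_add_apply, h]
  have hblock : ∀ k < i, ∀ a < 3 * m, ∀ b < 3 * m,
      (up T x)^[k] (ν a) = (up T x)^[k] (ν b) ↔ a / 2 ^ k = b / 2 ^ k := by
    intro k hk
    obtain ⟨q, hq⟩ : ∃ q, 3 * m = q * 2 ^ k := by
      refine ⟨3 * 2 ^ (i - 1 - k), ?_⟩
      rw [hm, mul_assoc, ← pow_add]
      congr 2; omega
    rw [hq]
    refine aligned_fibres (f := fun n => (up T x)^[k] (ν n)) (by positivity) ?_ ?_
    · intro a b c' hab hbc hc' heq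
      by_contra hne
      rw [← hq] at hc'
      have hab' : a < b := lt_of_le_of_ne hab (by rintro rfl; exact hne rfl)
      have hbc' : b < c' := lt_of_le_of_ne hbc (by rintro rfl; exact hne heq.symm)
      have mem : ∀ n < 3 * m, ν n ∈ subtree T x ((up T x)^[k] (ν a)) ↔
          (up T x)^[k] (ν n) = (up T x)^[k] (ν a) := fun n hn =>
        mem_subtree_iff hT hk (hνl n hn) (hνl a (by omega))
      by_cases h0 : (up T x)^[k] (ν 0) = (up T x)^[k] (ν a)
      · have hlast : (up T x)^[k] (ν (3 * m - 1)) ≠ (up T x)^[k] (ν a) := fun h =>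
          hends k hk (h0.trans h.symm)
        have hcl : c' < 3 * m - 1 := by
          refine lt_of_le_of_ne (by omega) ?_
          rintro rfl
          exact hlast heq.symm
        refine not_interleaved hTG hT hD hr hin hsphere hν hνl hφ hφ2 hab' hbc' hcl (by omega)
          (v := (up T x)^[k] (ν a)) (.inl ⟨(mem a (by omega)).2 rfl, (mem c' hc').2 heq.symm, ?_, ?_⟩)
        · rw [mem b (by omega)]; exact hne
        · rw [mem _ (by omega)]; exact hlast
      · have ha0 : 0 < a := Nat.pos_of_ne_zero (by rintro rfl; exact h0 rfl)
        refine not_interleaved hTG hT hD hr hin hsphere hν hνl hφ hφ2 ha0 hab' hbc' hc'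
          (v := (up T x)^[k] (ν a)) (.inr ⟨?_, ?_, (mem a (by omega)).2 rfl, (mem c' hc').2 heq.symm⟩)
        · rw [mem 0 (by omega)]; exact h0
        · rw [mem b (by omega)]; exact hne
    · intro a ha
      rw [← hq] at ha ⊢
      have h1 := hT.ncard_below hk (v := (up T x)^[k] (ν a))
        (by rw [hT.dist_iterate (hνl a ha)]; omega)
      rw [← h1, ← Set.ncard_coe_finset]
      have himg : IsTreeT.below T x k ((up T x)^[k] (ν a)) = ν '' (((Finset.range (3 * m)).filter
          fun n => (up T x)^[k] (ν n) = (up T x)^[k] (ν a) : Finset ℕ) : Set ℕ) := by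
        ext w
        simp only [IsTreeT.below, Set.mem_ofPred_eq, Finset.coe_filter, Finset.mem_range, Set.mem_image]
        constructor
        · rintro ⟨hw, hwa⟩
          obtain ⟨n, hn, rfl⟩ := hνsurj w hw
          exact ⟨n, ⟨hn, hwa⟩, rfl⟩
        · rintro ⟨n, ⟨hn, hwa⟩, rfl⟩
          exact ⟨hνl n hn, hwa⟩
      rw [himg, Set.InjOn.ncard_image]
      intro a ha b hb h
      simp only [Finset.coe_filter, Finset.mem_range, Set.mem_ofPred_eq] at ha hb
      exact hνinj a ha.1 b hb.1 h
  obtain ⟨e, he, heν⟩ := exists_equiv hT hs hνl hνsurj hblock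
  let iso : G ≃g G.comap e.symm := ⟨e, by simp⟩
  refine ⟨G.comap e.symm, iso, ⟨?_, fun v => ?_, ?_⟩, he⟩
  · intro a b hab
    rw [SimpleGraph.comap_adj]
    refine hTG ((he _ _).1 ?_)
    simpa using hab
  · have := deg_iso iso (iso.symm v)
    rw [hc] at this
    rw [← this]
    congr 1
    exact (iso.apply_symm_apply v).symm
  · rintro a b ha hb ⟨h1, h2, hab⟩
    have hsymm : ∀ n (h : n < 6 * m - 2), n < 3 * m → e.symm ⟨n, h⟩ = ν n := by
      intro n h hn
      rw [Equiv.symm_apply_eq]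
      exact Fin.ext (heν n hn).symm
    rw [SimpleGraph.comap_adj] at hab
    change G.Adj (e.symm _) (e.symm _) at hab
    rw [hsymm a h1 ha, hsymm b h2 hb] at hab
    have h3 : (a + m) % (3 * m) < 3 * m := Nat.mod_lt _ (by omega)
    have h4 : (b + m) % (3 * m) < 3 * m := Nat.mod_lt _ (by omega)
    refine ⟨by omega, by omega, ?_⟩
    rw [SimpleGraph.comap_adj]
    rw [hsymm _ _ h3, hsymm _ _ h4]
    have hr := hrot _ _ hab
    rw [Nat.mul_div_cancel_left _ (by norm_num)] at hr
    simp only [ν, ZMod.natCast_mod, Nat.cast_add, ← add_assoc]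
    exact hr

end

/-! ### Checking that a graph is a snark -/

/-! These programs are written with recursors, which the kernel evaluates faster than the
compiled forms of structural recursion. -/

/-- `List.all` in terms of the recursor. -/
noncomputable def allR {α : Type} (p : α → Bool) (l : List α) : Bool :=
  @List.rec α (fun _ => Bool) true (fun x _ ih => @Bool.rec (fun _ => Bool) false ih (p x)) l

/-- `r` holds for all pairs of an earlier and a later entry of the list. -/
noncomputable def pairsR {α : Type} (r : α → α → Bool) (l : List α) : Bool :=
  @List.rec α (fun _ => Bool) true
    (fun x l ih => @Bool.rec (fun _ => Bool) false ih (allR (r x) l)) l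

/-- `force` in terms of the recursor. -/
noncomputable def forceR {α : Type} (n : ℕ) (f : ℕ → α) : α :=
  @Nat.rec (fun _ => α) (f 0) (fun k _ => f (Nat.succ k)) n

/-- The value `f l`, where the kernel evaluates all entries of `l` first. -/
noncomputable def forceList {α : Type} (l : List ℕ) : (List ℕ → α) → α :=
  @List.rec ℕ (fun _ => (List ℕ → α) → α) (fun f => f [])
    (fun x _ ih f => forceR x fun x => ih fun l => f (x :: l)) l

theorem allR_eq {α : Type} (p : α → Bool) (l : List α) : allR p l = l.all p := by
  induction l with
  | nil => rfl
  | cons x l ih =>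
    rw [List.all_cons, ← ih]
    change @Bool.rec (fun _ => Bool) false (allR p l) (p x) = _
    cases p x <;> rfl

theorem pairsR_iff {α : Type} {r : α → α → Bool} {l : List α} :
    pairsR r l = true ↔ l.Pairwise fun a b => r a b = true := by
  induction l with
  | nil => exact ⟨fun _ => .nil, fun _ => rfl⟩
  | cons x l ih =>
    rw [List.pairwise_cons, ← ih, ← List.all_eq_true, ← allR_eq]
    change @Bool.rec (fun _ => Bool) false (pairsR r l) (allR (r x) l) = _ ↔ _
    cases allR (r x) l <;> simp

theorem forceR_eq {α : Type} (n : ℕ) (f : ℕ → α) : forceR n f = f n := by cases n <;> rfl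

theorem forceList_eq {α : Type} (l : List ℕ) (f : List ℕ → α) : forceList l f = f l := by
  induction l generalizing f with
  | nil => rfl
  | cons x l ih =>
    change forceR x (fun x => forceList l fun l => f (x :: l)) = _
    rw [forceR_eq, ih]

/-- The `k`-th neighbour of `v` in a packed table of the neighbours. -/
def nbr (N v k : ℕ) : ℕ := Nat.mod (Nat.shiftRight N (Nat.add (Nat.mul 18 v) (Nat.mul 6 k))) 64

/-- `List.filter` in terms of the recursor. -/
noncomputable def filterR {α : Type} (p : α → Bool) (l : List α) : List α :=
  @List.rec α (fun _ => List α) [] (fun x _ ih => @Bool.rec (fun _ => List α) ih (x :: ih) (p x)) l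

/-- The packed list of the neighbours of `v`, where `I` is the list of the leaves. -/
noncomputable def tableRow (m R : ℕ) (I : List ℕ) (v : ℕ) : ℕ :=
  List.foldr (fun w t => Nat.add (Nat.shiftLeft t 6) w) 0 (bif Nat.blt v (Nat.mul 3 m) then
      par m v :: filterR (fun w =>
        Nat.testBit R (dartKey m (Nat.mod v m) (Nat.mod w m)
          (col3 (Nat.add (Nat.div w m) (Nat.sub 3 (Nat.div v m))))) ||
        Nat.testBit R (dartKey m (Nat.mod w m) (Nat.mod v m)
          (col3 (Nat.add (Nat.div v m) (Nat.sub 3 (Nat.div w m)))))) I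
    else forceR (Nat.mul 2 (Nat.sub v (Nat.mul 3 m))) fun w => [w, Nat.succ w,
      bif Nat.beq v (Nat.sub (Nat.mul 6 m) 3) then Nat.succ (Nat.succ w) else par m v])

/-- The packed table of the neighbours in `mkG m R`: eighteen bits for each vertex. -/
noncomputable def adjTable (m R : ℕ) : ℕ :=
  forceList (List.range (3 * m)) fun I =>
    (List.range (6 * m - 2)).foldr (fun v T => Nat.add (Nat.shiftLeft T 18) (tableRow m R I v)) 0

/-- Adjacency according to the table `N`. -/
def adjT (N a b : ℕ) : Bool := Nat.beq (nbr N a 0) b || (Nat.beq (nbr N a 1) b || Nat.beq (nbr N a 2) b)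

/-- The entries of the table are three different neighbours of each vertex. -/
def tableOk (m R N : ℕ) : Bool :=
  (List.range (6 * m - 2)).all fun v =>
    (!(Nat.beq (nbr N v 0) (nbr N v 1)) && (!(Nat.beq (nbr N v 0) (nbr N v 2)) &&
      !(Nat.beq (nbr N v 1) (nbr N v 2)))) &&
    [0, 1, 2].all fun k => Nat.blt (nbr N v k) (6 * m - 2) && adjB m R v (nbr N v k)

/-! #### The girth -/

/-- There are no cycles of length three or four. -/
def noShortCycle (n N : ℕ) : Bool :=
  (List.range n).all fun v => [(0, 1), (0, 2), (1, 2)].all fun p =>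
    force (nbr N v p.1) fun a => force (nbr N v p.2) fun b =>
      !(adjT N a b) && [0, 1, 2].all fun k => force (nbr N a k) fun w => Nat.beq w v || !(adjT N b w)

/-- The entries of the list are different. -/
noncomputable def nodupR (l : List ℕ) : Bool := pairsR (fun a b => !(Nat.beq a b)) l

/-- There is a cycle of length five. -/
noncomputable def hasPentagon (n N : ℕ) : Bool :=
  (List.range n).any fun v =>
    [0, 1, 2].any fun i => [0, 1, 2].any fun j => force (nbr N v 0) fun a => force (nbr N v 1) fun b =>
      force (nbr N a i) fun c => force (nbr N b j) fun d => adjT N c d && nodupR [v, a, c, d, b]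

/-! #### Edge cuts -/

/-- Are more than `b` bits set? -/
def manyBits : ℕ → ℕ → Bool
  | 0, C => !(Nat.beq C 0)
  | b + 1, C => !(Nat.beq C 0) && manyBits b (Nat.xor C (Nat.pow 2 (Nat.log2 C)))

/-- The mask `M` of a vertex set, preceded by one bit for each edge of the list, which is set if the
edge leaves the vertex set. -/
def cutCode : List ℕ → ℕ → ℕ
  | [], M => M
  | e :: L, M => Nat.add (Nat.mul 2 (cutCode L M))
      (bif Bool.xor (Nat.testBit M (Nat.div e 64)) (Nat.testBit M (Nat.mod e 64)) then 1 else 0)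

/-- In the code `Y` of a vertex set, more than `b` of the `w` edge bits are set, or the set or its
complement in `n` vertices has at most one element. -/
def cutFine (n w b Y : ℕ) : Bool :=
  manyBits b (Nat.mod Y (Nat.pow 2 w)) ||
    (!(manyBits 1 (Nat.shiftRight Y w)) ||
      !(manyBits 1 (Nat.xor (Nat.shiftRight Y w) (Nat.sub (Nat.pow 2 n) 1))))

/-- The set of the vertices below `v`, down to a depth of `k`. -/
noncomputable def belowMask (m k : ℕ) : ℕ → ℕ :=
  @Nat.rec (fun _ => ℕ → ℕ) (fun v => Nat.shiftLeft 1 v) (fun _ ih v => Nat.lor (Nat.shiftLeft 1 v)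
    (bif Nat.blt v (Nat.mul 3 m) then 0 else forceR (Nat.mul 2 (Nat.sub v (Nat.mul 3 m))) fun w =>
      Nat.lor (ih w) (ih (Nat.succ w)))) k

/-- The boundary in the tree of a set `belowMask` consists of one edge. -/
noncomputable def belowOk (m k : ℕ) : Bool :=
  (List.range (6 * m - 3)).all fun t => forceR (belowMask m k t) fun M =>
    !(Nat.testBit M (6 * m - 3)) && (Nat.blt M (Nat.pow 2 (6 * m - 2)) && (List.range (6 * m - 3)).all fun v =>
      Bool.xor (Nat.testBit M v) (Nat.testBit M (par m v)) == Nat.beq v t)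

/-- The edges `ab` between leaves, where `a < b`, encoded as `64 * a + b`. -/
def leafEdges (m N : ℕ) : List ℕ :=
  (List.range (3 * m)).flatMap fun a => [0, 1, 2].flatMap fun k => force (nbr N a k) fun b =>
    bif Nat.blt a b && Nat.blt b (Nat.mul 3 m) then [Nat.add (Nat.mul 64 a) b] else []

/-- A hash of the edge bits of a code. -/
def hash (w Y : ℕ) : ℕ := Nat.mod (Nat.mod Y (Nat.pow 2 w)) 4093

/-- The set of the hashes of the codes in the list. -/
def hashTable (w : ℕ) (l : List ℕ) : ℕ := l.foldr (fun c T => Nat.lor T (Nat.shiftLeft 1 (hash w c))) 0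

/-- Small cuts are trivial. A cut with one, two or three tree edges is the sum of that many of the sets
`belowMask`, whose codes are listed in `Ws`; it can then contain at most two, one or no leaf edges. A
pair of sets needs to be considered only if its edge bits are zero, a single bit, or those of a third
set, and most other pairs are discarded by a hash of the edge bits. -/
noncomputable def cutsFine (m k N : ℕ) : Bool :=
  forceList (leafEdges m N) fun L => forceR L.length fun w =>
    nodupR L && (L.all (fun e => Nat.blt (Nat.div e 64) (Nat.mod e 64) &&
      (Nat.blt (Nat.mod e 64) (Nat.mul 3 m) && adjT N (Nat.div e 64) (Nat.mod e 64))) &&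
    forceList ((List.range (6 * m - 3)).map fun v => forceR (belowMask m k v) (cutCode L)) fun Ws =>
      forceR (hashTable w (0 :: ((List.range w).map (Nat.pow 2) ++ Ws))) fun T =>
        allR (cutFine (6 * m - 2) w 2) Ws && pairsR (fun a b => forceR (Nat.xor a b) fun Y =>
          bif Nat.testBit T (hash w Y) then cutFine (6 * m - 2) w 1 Y &&
            forceR (Nat.mod Y (Nat.pow 2 w)) fun y => allR (fun c =>
              bif Nat.beq y (Nat.mod c (Nat.pow 2 w)) then cutFine (6 * m - 2) w 0 (Nat.xor Y c) else true) Ws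
          else true) Ws)

/-! #### Edge colourings -/

/-- The two ends of an edge, as a bit mask. -/
def edgeMask (e : ℕ) : ℕ := Nat.lor (Nat.shiftLeft 1 (Nat.div e 64)) (Nat.shiftLeft 1 (Nat.mod e 64))

/-- Can the edges with the given masks of their ends be coloured, when the colours `0, 1, 2` are already
used at the vertices in the masks `A`, `B`, `C`? -/
noncomputable def colourable (l : List ℕ) : ℕ → ℕ → ℕ → Bool :=
  @List.rec _ (fun _ => ℕ → ℕ → ℕ → Bool) (fun _ _ _ => true)
    (fun W _ ih A B C =>
      @Bool.rec (fun _ => Bool)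
        (@Bool.rec (fun _ => Bool)
          (@Bool.rec (fun _ => Bool) false (forceR (Nat.lor C W) fun C => ih A B C)
            (Nat.beq (Nat.land C W) 0)) true
          (@Bool.rec (fun _ => Bool) false (forceR (Nat.lor B W) fun B => ih A B C)
            (Nat.beq (Nat.land B W) 0))) true
        (@Bool.rec (fun _ => Bool) false (forceR (Nat.lor A W) fun A => ih A B C)
          (Nat.beq (Nat.land A W) 0))) l

/-- The edges from `v` to vertices outside of the set `O`. -/
def edgesFrom (N O v : ℕ) : List ℕ :=
  [0, 1, 2].flatMap fun k => force (nbr N v k) fun w =>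
    bif Nat.testBit O w then [] else [bif Nat.blt v w then Nat.add (Nat.mul 64 v) w else Nat.add (Nat.mul 64 w) v]

/-- The edges, in an order given by an order of the vertices. -/
def edgeOrder (N : ℕ) : List ℕ → ℕ → List ℕ
  | [], _ => []
  | v :: l, O => edgesFrom N O v ++ force (Nat.lor O (Nat.shiftLeft 1 v)) fun O => edgeOrder N l O

/-- There is no `3`-edge colouring. The colours of the first three edges, which pairwise share an end,
are fixed. -/
noncomputable def uncolourable (n N : ℕ) (order : List ℕ) : Bool :=
  forceList (edgeOrder N order 0) fun L =>
    nodupR L && (L.all (fun e => Nat.blt (Nat.div e 64) (Nat.mod e 64) && (Nat.blt (Nat.mod e 64) n &&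
      adjT N (Nat.div e 64) (Nat.mod e 64))) &&
    forceList (L.map edgeMask) fun Ws =>
      match Ws with
      | A :: B :: C :: l => !(Nat.beq (Nat.land A B) 0) && (!(Nat.beq (Nat.land A C) 0) &&
          (!(Nat.beq (Nat.land B C) 0) && !(colourable l A B C)))
      | _ => false)

/-! #### An invariant and the outer cycles -/

/-- The set of the ends of the walks of length `k` from `v`, as a bit mask. -/
noncomputable def walkMask (N k : ℕ) : ℕ → ℕ :=
  @Nat.rec (fun _ => ℕ → ℕ) (fun v => Nat.shiftLeft 1 v)
    (fun _ ih v => Nat.lor (ih (nbr N v 0)) (Nat.lor (ih (nbr N v 1)) (ih (nbr N v 2)))) k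

/-- The number of the elements of a set that is given as a bit mask. -/
def countBits (n M : ℕ) : ℕ :=
  (List.range n).foldr (fun i c => bif Nat.testBit M i then Nat.succ c else c) 0

/-- The value of `walkInv`, computed from the table. -/
noncomputable def walkInvB (n N k : ℕ) : ℕ :=
  (List.range n).foldr (fun v s => forceR (walkMask N k v) fun M => forceR (countBits n M) fun c =>
    Nat.add s (Nat.mul c c)) 0

/-- Consecutive vertices in the list are adjacent. -/
def chain (N : ℕ) : List ℕ → Bool
  | a :: b :: l => adjT N a b && chain N (b :: l)
  | _ => true

/-- The lists in `cs` partition the leaves into connected sets without edges between leaves of different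
sets. -/
noncomputable def cyclesOk (m N : ℕ) (cs : List (List ℕ)) : Bool :=
  nodupR cs.flatten && ((Nat.beq cs.flatten.length (Nat.mul 3 m)) && cs.all fun c =>
    Nat.blt 0 c.length && (chain N c && c.all fun a => Nat.blt a (Nat.mul 3 m) &&
      [0, 1, 2].all fun k => forceR (nbr N a k) fun b =>
        bif Nat.blt b (Nat.mul 3 m) then c.any (Nat.beq b) else true))

/-- All the properties of the graph `mkG m R` that are needed. -/
noncomputable def repOk (m k R : ℕ) (order : List ℕ) (cs : List (List ℕ)) (inv : ℕ) : Bool :=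
  forceR (adjTable m R) fun N => tableOk m R N && (noShortCycle (6 * m - 2) N &&
    (hasPentagon (6 * m - 2) N && (cutsFine m k N && (uncolourable (6 * m - 2) N order &&
    (Nat.beq (walkInvB (6 * m - 2) N 4) inv && cyclesOk m N cs)))))

/-! ### Soundness of the checks -/

/-- `N` is a packed table of the neighbours in `G`. -/
structure IsTable {n : ℕ} (G : SimpleGraph (Fin n)) (N : ℕ) : Prop where
  adj : ∀ v w : Fin n, adjT N v w = true ↔ G.Adj v w
  lt : ∀ v : Fin n, ∀ k < 3, nbr N v k < n

theorem adjT_iff {N a b : ℕ} : adjT N a b = true ↔ ∃ k < 3, nbr N a k = b := by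
  rw [adjT, Bool.or_eq_true, Bool.or_eq_true, beq_iff, beq_iff, beq_iff]
  constructor
  · rintro (h | h | h)
    exacts [⟨0, by norm_num, h⟩, ⟨1, by norm_num, h⟩, ⟨2, by norm_num, h⟩]
  · rintro ⟨k, hk, h⟩
    interval_cases k <;> simp [h]

theorem isTable_of {m R N : ℕ} (hc : ∀ v, deg (mkG m R) v = 3) (h : tableOk m R N = true) :
    IsTable (mkG m R) N := by
  simp only [tableOk, List.all_eq_true, List.mem_range, Bool.and_eq_true, beq_false_iff, blt_iff,
    List.forall_mem_cons, List.not_mem_nil, false_implies, implies_true, and_true] at h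
  have hlt : ∀ v : Fin (6 * m - 2), ∀ k < 3, nbr N v k < 6 * m - 2 := by
    intro v k hk
    obtain ⟨-, h0, h1, h2⟩ := h v v.2
    interval_cases k
    exacts [h0.1, h1.1, h2.1]
  refine ⟨fun v w => ?_, hlt⟩
  obtain ⟨⟨h01, h02, h12⟩, ⟨l0, a0⟩, ⟨l1, a1⟩, l2, a2⟩ := h v v.2
  let s : Finset (Fin (6 * m - 2)) := {⟨_, l0⟩, ⟨_, l1⟩, ⟨_, l2⟩}
  have hs : (s : Set _) ⊆ (mkG m R).neighborSet v := by
    intro x hx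
    simp only [s, Finset.coe_insert, Finset.coe_singleton, Set.mem_insert_iff, Set.mem_singleton_iff] at hx
    rcases hx with rfl | rfl | rfl
    exacts [(adjB_iff v ⟨_, l0⟩).1 a0, (adjB_iff v ⟨_, l1⟩).1 a1, (adjB_iff v ⟨_, l2⟩).1 a2]
  have hcard : s.card = 3 := by
    rw [Finset.card_eq_three]
    exact ⟨_, _, _, by simpa using h01, by simpa using h02, by simpa using h12, rfl⟩
  have heq := Set.eq_of_subset_of_ncard_le hs (by rw [Set.ncard_coe_finset, hcard]; exact (hc v).le)
  have : (mkG m R).Adj v w ↔ w ∈ (s : Set _) := by rw [heq]; rfl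
  rw [this, adjT, Bool.or_eq_true, Bool.or_eq_true, beq_iff, beq_iff, beq_iff]
  simp only [s, Finset.coe_insert, Finset.coe_singleton, Set.mem_insert_iff, Set.mem_singleton_iff, Fin.ext_iff]
  tauto

section
variable {n N : ℕ} {G : SimpleGraph (Fin n)}

theorem IsTable.exists_nbr (hT : IsTable G N) {v w : Fin n} (h : G.Adj v w) : ∃ k < 3, nbr N v k = w :=
  adjT_iff.1 ((hT.adj v w).2 h)

theorem noShortCycle_sound (hT : IsTable G N) (h : noShortCycle n N = true) {v a b : Fin n}
    (ha : G.Adj v a) (hb : G.Adj v b) (hab : a ≠ b) :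
    ¬ G.Adj a b ∧ ∀ w, G.Adj a w → G.Adj b w → w = v := by
  simp only [noShortCycle, List.all_eq_true, List.mem_range, force_eq, Bool.and_eq_true,
    Bool.or_eq_true, beq_iff, Bool.not_eq_true', ← Bool.not_eq_true] at h
  obtain ⟨i, hi, hi'⟩ := hT.exists_nbr ha
  obtain ⟨j, hj, hj'⟩ := hT.exists_nbr hb
  have key : ∀ {a b : Fin n}, ∀ p ∈ [(0, 1), (0, 2), (1, 2)], nbr N v p.1 = a → nbr N v p.2 = b →
      ¬ G.Adj a b ∧ ∀ w, G.Adj a w → G.Adj b w → w = v := by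
    intro a b p hp ha hb
    have h' := h v v.2 p hp
    rw [ha, hb, hT.adj] at h'
    refine ⟨h'.1, fun w haw hbw => ?_⟩
    obtain ⟨k, hk, hk'⟩ := hT.exists_nbr haw
    have := h'.2 k (by interval_cases k <;> simp)
    rw [hk', hT.adj] at this
    exact Fin.ext (this.resolve_right (not_not.2 hbw))
  have hij : i ≠ j := by
    rintro rfl
    exact hab (Fin.ext (hi'.symm.trans hj'))
  rcases lt_or_gt_of_ne hij with hij | hij
  · exact key (i, j) (by interval_cases j <;> interval_cases i <;> simp) hi' hj'
  · obtain ⟨h1, h2⟩ := key (j, i) (by interval_cases i <;> interval_cases j <;> simp) hj' hi'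
    exact ⟨fun h => h1 h.symm, fun w haw hbw => h2 w hbw haw⟩

theorem nodupR_iff {l : List ℕ} : nodupR l = true ↔ l.Nodup := by
  rw [nodupR, pairsR_iff]
  simp only [beq_false_iff]
  rfl

theorem girth_eq_five (hT : IsTable G N) (h : noShortCycle n N = true) (h' : hasPentagon n N = true) :
    G.girth = 5 := by
  have hge : 5 ≤ G.egirth := by
    rw [SimpleGraph.le_egirth]
    intro u p hp
    by_contra hlt
    have h3 := hp.three_le_length
    have h4 : p.length < 5 := by exact_mod_cast not_le.1 hlt
    have hn := hp.support_nodup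
    have ht := hp.isTrail.edges_nodup
    cases p with
    | nil => simp at h3
    | @cons _ b _ hub p =>
    cases p with
    | nil => simp at h3
    | @cons _ c _ hbc p =>
    cases p with
    | nil => simp at h3
    | @cons _ d _ hcd p =>
    cases p with
    | nil =>
      exact (noShortCycle_sound hT h hub hcd.symm hbc.ne).1 hbc
    | @cons _ e _ hde p =>
    cases p with
    | nil =>
      simp at hn
      refine hn.2.1.2 ?_ 
      exact ((noShortCycle_sound hT h hub hde.symm (by tauto)).2 c hbc hcd.symm)
    | cons _ p => simp at h4; omega
  have hle : G.egirth ≤ 5 := by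
    simp only [hasPentagon, List.any_eq_true, List.mem_range, force_eq, Bool.and_eq_true, nodupR_iff] at h'
    obtain ⟨v, hv, i, hi, j, hj, hcd, hn⟩ := h'
    have hi : i < 3 := by simp at hi; omega
    have hj : j < 3 := by simp at hj; omega
    let v' : Fin n := ⟨v, hv⟩
    let a : Fin n := ⟨_, hT.lt v' 0 (by norm_num)⟩
    let b : Fin n := ⟨_, hT.lt v' 1 (by norm_num)⟩
    let c : Fin n := ⟨_, hT.lt a i hi⟩
    let d : Fin n := ⟨_, hT.lt b j hj⟩
    have adj : ∀ (x : Fin n) k (hk : k < 3), G.Adj x ⟨_, hT.lt x k hk⟩ := fun x k hk =>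
      (hT.adj _ _).1 (adjT_iff.2 ⟨k, hk, rfl⟩)
    have e1 : G.Adj v' a := adj _ 0 (by norm_num)
    have e2 : G.Adj v' b := adj _ 1 (by norm_num)
    have e3 : G.Adj a c := adj _ i hi
    have e4 : G.Adj b d := adj _ j hj
    have e5 : G.Adj c d := (hT.adj c d).1 hcd
    have hn' : [v', a, c, d, b].Nodup := by
      refine List.Nodup.of_map Fin.val ?_
      exact hn
    have hcyc : (SimpleGraph.Walk.cons e1 (.cons e3 (.cons e5 (.cons e4.symm (.cons e2.symm .nil))))).IsCycle := by
      rw [SimpleGraph.Walk.cons_isCycle_iff]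
      simp only [List.nodup_cons, List.mem_cons, not_or, List.not_mem_nil, not_false_eq_true, and_true,
        List.nodup_nil] at hn'
      obtain ⟨⟨n1, n2, n3, n4⟩, ⟨n5, n6, n7⟩, ⟨n8, n9⟩, n10⟩ := hn'
      refine ⟨?_, ?_⟩
      · rw [SimpleGraph.Walk.isPath_def]
        simp [Ne.symm n1, Ne.symm n2, Ne.symm n3, Ne.symm n4, n5, n6, n7, n8, n9, n10]
      · simp [n1, n2, n3, n4, n5, n6, n7, Ne.symm n1]
    exact SimpleGraph.egirth_le_length hcyc
  rw [SimpleGraph.girth, le_antisymm hle hge]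
  rfl

end

theorem manyBits_eq_false {b : ℕ} : ∀ {C : ℕ} {s : Finset ℕ}, (∀ i, C.testBit i = true → i ∈ s) → s.card ≤ b →
    manyBits b C = false := by
  induction b with
  | zero =>
    intro C s hs hb
    rw [manyBits, Bool.not_eq_false', beq_iff]
    refine Nat.eq_of_testBit_eq fun i => ?_
    rw [Nat.zero_testBit, ← Bool.not_eq_true]
    intro hi
    have := hs i hi
    rw [Finset.card_eq_zero.1 (Nat.le_zero.1 hb)] at this
    simp at this
  | succ b ih =>
    intro C s hs hb
    rw [manyBits, Bool.and_eq_false_iff, Bool.not_eq_false', beq_iff]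
    by_cases hC : C = 0
    · exact .inl hC
    refine .inr (ih (s := s.erase C.log2) (fun i hi => ?_) ?_)
    · change Nat.testBit (C ^^^ 2 ^ C.log2) i = true at hi
      rw [Nat.testBit_xor, Nat.testBit_two_pow] at hi
      by_cases h : C.log2 = i
      · rw [← h, Nat.testBit_log2 hC] at hi
        simp at hi
      · simp only [h, decide_false, Bool.xor_false] at hi
        exact Finset.mem_erase.2 ⟨fun h' => h h'.symm, hs i hi⟩
    · have := hs _ (Nat.testBit_log2 hC)
      rw [Finset.card_erase_of_mem this]
      omega

theorem eq_of_manyBits {C : ℕ} (h : manyBits 1 C = false) {i j : ℕ} (hi : C.testBit i = true)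
    (hj : C.testBit j = true) : i = j := by
  rw [manyBits, manyBits, Bool.and_eq_false_iff, Bool.not_eq_false', Bool.not_eq_false', beq_iff, beq_iff] at h
  rcases h with rfl | h
  · simp at hi
  · have h : C = 2 ^ C.log2 := Nat.xor_eq_zero_iff.1 h
    rw [h, Nat.testBit_two_pow, decide_eq_true_iff] at hi hj
    exact hi.symm.trans hj

theorem cutCode_cons (e : ℕ) (L : List ℕ) (M : ℕ) : cutCode (e :: L) M =
    Nat.bit (Nat.testBit M (e / 64) ^^ Nat.testBit M (e % 64)) (cutCode L M) := by
  rw [Nat.bit_val, cutCode]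
  change 2 * _ + _ = _
  congr 1

/-- Codes are additive, so the codes of all small cuts are sums of the codes of the sets below a vertex.
-/
theorem cutCode_xor (L : List ℕ) (M M' : ℕ) :
    cutCode L (M ^^^ M') = cutCode L M ^^^ cutCode L M' := by
  induction L with
  | nil => rfl
  | cons e L ih =>
    rw [cutCode_cons, cutCode_cons, cutCode_cons, Nat.xor_bit, ih, Nat.testBit_xor, Nat.testBit_xor]
    congr 1
    cases Nat.testBit M (e / 64) <;> cases Nat.testBit M (e % 64) <;>
      cases Nat.testBit M' (e / 64) <;> cases Nat.testBit M' (e % 64) <;> rfl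

theorem cutCode_shiftRight (L : List ℕ) (M : ℕ) : cutCode L M >>> L.length = M := by
  induction L with
  | nil => rfl
  | cons e L ih =>
    rw [List.length_cons, add_comm, Nat.shiftRight_add, cutCode_cons]
    rw [Nat.shiftRight_one, Nat.bit_div_two, ih]

theorem cutCode_testBit (L : List ℕ) (M j : ℕ) (hj : j < L.length) : (cutCode L M).testBit j =
    (Nat.testBit M (L[j] / 64) ^^ Nat.testBit M (L[j] % 64)) := by
  induction L generalizing j with
  | nil => simp at hj
  | cons e L ih =>
    rw [cutCode_cons]
    cases j with
    | zero => rw [Nat.testBit_bit_zero]; rfl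
    | succ j => rw [Nat.testBit_bit_succ, ih j (by simpa using hj)]; rfl

/-- The mask `M` has at most one element, or at most one of the numbers below `n` is missing. -/
def TrivialMask (n M : ℕ) : Prop :=
  (∀ i j, M.testBit i = true → M.testBit j = true → i = j) ∨
    ∀ i < n, ∀ j < n, M.testBit i = false → M.testBit j = false → i = j

/-- The edges of the list that leave the set `M`. -/
def crossing (L : List ℕ) (M : ℕ) : Finset ℕ :=
  (Finset.range L.length).filter fun j => (cutCode L M).testBit j = true

theorem manyBits_cutCode {L : List ℕ} {M b : ℕ} (hJ : (crossing L M).card ≤ b) :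
    manyBits b (cutCode L M % 2 ^ L.length) = false := by
  refine manyBits_eq_false (s := crossing L M) (fun i hi => ?_) hJ
  rw [Nat.testBit_mod_two_pow, Bool.and_eq_true, decide_eq_true_iff] at hi
  exact Finset.mem_filter.2 ⟨Finset.mem_range.2 hi.1, hi.2⟩

theorem cutFine_sound {n b : ℕ} {L : List ℕ} {M : ℕ} (h : cutFine n L.length b (cutCode L M) = true)
    (hJ : (crossing L M).card ≤ b) : TrivialMask n M := by
  have e1 : Nat.shiftRight (cutCode L M) L.length = M := cutCode_shiftRight L M
  rw [cutFine, e1, Bool.or_eq_true, Bool.or_eq_true, Bool.not_eq_true', Bool.not_eq_true'] at h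
  rcases h with h | h | h
  · have := manyBits_cutCode hJ
    exact absurd (h.symm.trans this) (by simp)
  · exact .inl fun i j hi hj => eq_of_manyBits h hi hj
  · refine .inr fun i hi j hj hi' hj' => eq_of_manyBits h ?_ ?_
    · change Nat.testBit (M ^^^ (2 ^ n - 1)) i = true
      rw [Nat.testBit_xor, Nat.testBit_two_pow_sub_one, hi']; simpa using hi
    · change Nat.testBit (M ^^^ (2 ^ n - 1)) j = true
      rw [Nat.testBit_xor, Nat.testBit_two_pow_sub_one, hj']; simpa using hj

/-- The tree edges (from a vertex to its parent) that leave the set `M`. -/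
def treeCrossing (m M : ℕ) : Finset ℕ :=
  (Finset.range (6 * m - 3)).filter fun v => (M.testBit v ^^ M.testBit (par m v)) = true

/-- As the tree is connected, a set without boundary in the tree that misses the center is empty. -/
theorem eq_zero_of_treeCrossing {m M : ℕ} (hr : M.testBit (6 * m - 3) = false) (hM : M < 2 ^ (6 * m - 2))
    (h : treeCrossing m M = ∅) : M = 0 := by
  have key : ∀ k v, v ≤ 6 * m - 3 → 6 * m - 3 - v ≤ k → M.testBit v = false := by
    intro k
    induction k with
    | zero => intro v hv hk; rw [← hr]; congr 1; omega
    | succ k ih =>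
      intro v hv hk
      rcases hv.eq_or_lt with rfl | hv
      · exact hr
      have h1 : v ∉ treeCrossing m M := by rw [h]; simp
      rw [treeCrossing, Finset.mem_filter, Finset.mem_range, not_and] at h1
      have h2 := h1 hv
      rw [ih (par m v) (by rw [par_def]; omega) (by rw [par_def]; omega)] at h2
      simpa using h2
  refine Nat.eq_of_testBit_eq fun i => ?_
  rw [Nat.zero_testBit]
  by_cases hi : i ≤ 6 * m - 3
  · exact key _ i hi le_rfl
  · exact Nat.testBit_eq_false_of_lt (hM.trans_le (Nat.pow_le_pow_right (by norm_num) (by omega)))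

theorem treeCrossing_xor {m M M' : ℕ} :
    treeCrossing m (M ^^^ M') = symmDiff (treeCrossing m M) (treeCrossing m M') := by
  ext v
  simp only [treeCrossing, Finset.mem_filter, Finset.mem_symmDiff, Finset.mem_range, Nat.testBit_xor]
  cases M.testBit v <;> cases M.testBit (par m v) <;> cases M'.testBit v <;>
    cases M'.testBit (par m v) <;> simp <;> omega

theorem hash_eq (w Y : ℕ) : hash w Y = Y % 2 ^ w % 4093 := rfl

theorem hash_mem {w c : ℕ} {l : List ℕ} (hc : c ∈ l) : (hashTable w l).testBit (hash w c) = true := by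
  induction l with
  | nil => simp at hc
  | cons x l ih =>
    change Nat.testBit (hashTable w l ||| 1 <<< hash w x) _ = true
    rw [Nat.testBit_or, Bool.or_eq_true]
    rcases List.mem_cons.1 hc with rfl | hc
    · right
      rw [Nat.one_shiftLeft, Nat.testBit_two_pow]; simp
    · exact .inl (ih hc)

/-- The cuts of the whole graph with at most three edges. -/
theorem cut_trivial {m k N M : ℕ} {L : List ℕ} (hb : belowOk m k = true)
    (hL : L = leafEdges m N)
    (hc : cutsFine m k N = true) (hr : M.testBit (6 * m - 3) = false) (hM : M < 2 ^ (6 * m - 2))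
    (h3 : (treeCrossing m M).card + (crossing L M).card ≤ 3) : TrivialMask (6 * m - 2) M := by
  subst hL
  set L := leafEdges m N with hLdef
  simp only [cutsFine, forceList_eq, forceR_eq, ← hLdef, Bool.and_eq_true, allR_eq, List.all_eq_true,
    pairsR_iff, List.pairwise_map, List.forall_mem_map] at hc
  obtain ⟨-, -, h1, h2⟩ := hc
  simp only [belowOk, List.all_eq_true, List.mem_range, forceR_eq, Bool.and_eq_true, Bool.not_eq_true',
    beq_iff_eq, blt_iff] at hb
  have hD : ∀ t < 6 * m - 3, treeCrossing m (belowMask m k t) = {t} := by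
    intro t ht
    ext v
    rw [treeCrossing, Finset.mem_filter, Finset.mem_range, Finset.mem_singleton]
    constructor
    · rintro ⟨hv, h⟩
      rw [(hb t ht).2.2 v hv] at h
      exact beq_iff.1 h
    · rintro rfl
      exact ⟨ht, by rw [(hb v ht).2.2 v ht]; exact beq_iff.2 rfl⟩
  have hlt : ∀ {A B : ℕ}, A < 2 ^ (6 * m - 2) → B < 2 ^ (6 * m - 2) → A ^^^ B < 2 ^ (6 * m - 2) :=
    fun hA hB => Nat.xor_lt_two_pow hA hB
  have uniq : ∀ {M'}, M'.testBit (6 * m - 3) = false → M' < 2 ^ (6 * m - 2) →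
      treeCrossing m M' = treeCrossing m M → M = M' := by
    intro M' hr' hM' h
    refine Nat.xor_eq_zero_iff.1 (eq_zero_of_treeCrossing ?_ (hlt hM hM') ?_)
    · rw [Nat.testBit_xor, hr, hr']; rfl
    · rw [treeCrossing_xor, h, symmDiff_self]; rfl
  have hsub : ∀ v ∈ treeCrossing m M, v < 6 * m - 3 := fun v hv =>
    Finset.mem_range.1 (Finset.mem_filter.1 hv).1
  -- the checks for two tree edges are symmetric
  have pairs : ∀ a < 6 * m - 3, ∀ b < 6 * m - 3, a ≠ b → ∀ Y,
      Y = cutCode L (belowMask m k a) ^^^ cutCode L (belowMask m k b) →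
      (hashTable L.length (0 :: ((List.range L.length).map (Nat.pow 2) ++
        (List.range (6 * m - 3)).map fun v => cutCode L (belowMask m k v)))).testBit (hash L.length Y) = true →
      cutFine (6 * m - 2) L.length 1 Y = true ∧ ∀ c < 6 * m - 3,
        Y % 2 ^ L.length = cutCode L (belowMask m k c) % 2 ^ L.length →
        cutFine (6 * m - 2) L.length 0 (Y ^^^ cutCode L (belowMask m k c)) = true := by
    intro a ha b hb hab Y hY hT
    have hs : ∀ x y, Nat.xor x y = Nat.xor y x := Nat.xor_comm
    rw [List.pairwise_iff_getElem] at h2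
    have := h2 (min a b) (max a b) (by simp; omega) (by simp; omega) (by omega)
    simp only [List.getElem_range] at this
    have hY' : Nat.xor (cutCode L (belowMask m k (min a b))) (cutCode L (belowMask m k (max a b))) = Y := by
      rw [hY]
      rcases lt_or_gt_of_ne hab with h | h
      · rw [min_eq_left h.le, max_eq_right h.le]; rfl
      · rw [min_eq_right h.le, max_eq_left h.le]; exact hs _ _
    rw [hY', hT, cond_true, Bool.and_eq_true, List.all_eq_true] at this
    refine ⟨this.1, fun c hc he => ?_⟩
    have h4 := this.2 (cutCode L (belowMask m k c)) (List.mem_map.2 ⟨c, List.mem_range.2 hc, rfl⟩)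
    have he' : Nat.beq (Nat.mod Y (Nat.pow 2 L.length))
        (Nat.mod (cutCode L (belowMask m k c)) (Nat.pow 2 L.length)) = true := beq_iff.2 he
    rw [he', cond_true] at h4
    exact h4
  obtain h0 | h0 | h0 | h0 : (treeCrossing m M).card = 0 ∨ (treeCrossing m M).card = 1 ∨
      (treeCrossing m M).card = 2 ∨ (treeCrossing m M).card = 3 := by omega
  · rw [eq_zero_of_treeCrossing hr hM (Finset.card_eq_zero.1 h0)]
    exact .inl fun i j hi => by simp at hi
  · obtain ⟨a, ha⟩ := Finset.card_eq_one.1 h0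
    have ha' := hsub a (by rw [ha]; simp)
    have hMa := uniq (hb a ha').1 (hb a ha').2.1 (by rw [hD a ha', ha])
    refine cutFine_sound (L := L) (b := 2) ?_ (by omega)
    rw [hMa]
    exact h1 a (List.mem_range.2 ha')
  · obtain ⟨a, b, hab, he⟩ := Finset.card_eq_two.1 h0
    have ha := hsub a (by rw [he]; simp)
    have hb' := hsub b (by rw [he]; simp)
    have hMa := uniq (M' := belowMask m k a ^^^ belowMask m k b)
      (by rw [Nat.testBit_xor, (hb a ha).1, (hb b hb').1]; rfl) (hlt (hb a ha).2.1 (hb b hb').2.1) (by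
        rw [treeCrossing_xor, hD a ha, hD b hb', he]; ext x; simp [Finset.mem_symmDiff]; grind)
    have hJ : (crossing L M).card ≤ 1 := by omega
    refine cutFine_sound (L := L) (b := 1) ?_ hJ
    refine (pairs a ha b hb' hab _ (by rw [hMa, cutCode_xor]) ?_).1
    have hmb := manyBits_cutCode hJ
    by_cases hz : cutCode L M % 2 ^ L.length = 0
    · have : hash L.length (cutCode L M) = hash L.length 0 := by
        rw [hash_eq, hash_eq, hz]; simp
      rw [this]; exact hash_mem (by simp)
    · set l := (cutCode L M % 2 ^ L.length).log2 with hl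
      have hlb := Nat.testBit_log2 hz
      have hlw : l < L.length := by
        rw [← hl, Nat.testBit_mod_two_pow, Bool.and_eq_true, decide_eq_true_iff] at hlb
        exact hlb.1
      have heq : cutCode L M % 2 ^ L.length = 2 ^ l := by
        refine Nat.eq_of_testBit_eq fun i => ?_
        rw [Nat.testBit_two_pow, Bool.eq_iff_iff, decide_eq_true_iff]
        exact ⟨fun h => eq_of_manyBits hmb hlb h, fun h => h ▸ hlb⟩
      have : hash L.length (cutCode L M) = hash L.length (2 ^ l) := by
        rw [hash_eq, hash_eq, heq, Nat.mod_eq_of_lt (Nat.pow_lt_pow_right (by norm_num) hlw)]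
      rw [this]
      refine hash_mem (List.mem_cons_of_mem _ (List.mem_append_left _ (List.mem_map.2 ⟨l, ?_, rfl⟩)))
      exact List.mem_range.2 hlw
  · obtain ⟨a, b, c, hab, hac, hbc, he⟩ := Finset.card_eq_three.1 h0
    have ha := hsub a (by rw [he]; simp)
    have hb' := hsub b (by rw [he]; simp)
    have hc' := hsub c (by rw [he]; simp)
    have hMa := uniq (M' := belowMask m k a ^^^ belowMask m k b ^^^ belowMask m k c)
      (by rw [Nat.testBit_xor, Nat.testBit_xor, (hb a ha).1, (hb b hb').1, (hb c hc').1]; rfl)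
      (hlt (hlt (hb a ha).2.1 (hb b hb').2.1) (hb c hc').2.1) (by
        rw [treeCrossing_xor, treeCrossing_xor, hD a ha, hD b hb', hD c hc', he]; ext x
        simp [Finset.mem_symmDiff]; grind)
    have hJ : (crossing L M).card ≤ 0 := by omega
    refine cutFine_sound (L := L) (b := 0) ?_ hJ
    have hmb := manyBits_cutCode hJ
    rw [manyBits, Bool.not_eq_false', beq_iff, hMa, cutCode_xor, Nat.xor_mod_two_pow, Nat.xor_eq_zero_iff,
      cutCode_xor] at hmb
    rw [hMa, cutCode_xor, cutCode_xor]
    refine (pairs a ha b hb' hab _ rfl ?_).2 c hc' hmb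
    have : hash L.length (cutCode L (belowMask m k a) ^^^ cutCode L (belowMask m k b)) =
        hash L.length (cutCode L (belowMask m k c)) := by
      rw [hash_eq, hash_eq, hmb]
    rw [this]
    exact hash_mem (List.mem_cons_of_mem _ (List.mem_append_right _ (List.mem_map.2 ⟨c, List.mem_range.2 hc', rfl⟩)))

/-- A set of at most three edges that separates a vertex set from its complement leaves at most one
vertex on one side. -/
theorem separation_trivial {m k N : ℕ} {G : SimpleGraph (Fin (6 * m - 2))} (hm : 1 ≤ m) (hT : IsTable G N)
    (hG : stdTree m ≤ G) (hb : belowOk m k = true) (hc : cutsFine m k N = true)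
    {f : Fin (6 * m - 2) → Bool} (hr : f ⟨6 * m - 3, by omega⟩ = false) {S : Finset (Sym2 ℕ)}
    (hS : S.card ≤ 3) (hf : ∀ a b, G.Adj a b → f a ≠ f b → s(a.val, b.val) ∈ S) :
    (∀ a b, f a = true → f b = true → a = b) ∨ ∀ a b, f a = false → f b = false → a = b := by
  have hbit : ∀ v : Fin (6 * m - 2), (Nat.ofBits f).testBit v = f v := fun v => Nat.testBit_ofBits_lt f v v.2
  set M := Nat.ofBits f with hMdef
  set L := leafEdges m N with hLdef
  have hc' := hc
  simp only [cutsFine, forceList_eq, forceR_eq, ← hLdef, Bool.and_eq_true, nodupR_iff, List.all_eq_true,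
    blt_iff] at hc'
  obtain ⟨hnd, hL, -⟩ := hc'
  have hL' : ∀ j (hj : j < L.length), L[j] / 64 < L[j] % 64 ∧ L[j] % 64 < 3 * m ∧
      adjT N (L[j] / 64) (L[j] % 64) = true := fun j hj => hL _ (List.getElem_mem hj)
  let g : ℕ → Sym2 ℕ := fun v => s(v, par m v)
  let g' : ℕ → Sym2 ℕ := fun j => s(L.getD j 0 / 64, L.getD j 0 % 64)
  have hg' : ∀ j (hj : j < L.length), g' j = s(L[j] / 64, L[j] % 64) := by
    intro j hj
    simp only [g', List.getD_eq_getElem _ _ hj]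
  have hD : ∀ v ∈ treeCrossing m M, v < 6 * m - 3 ∧ (M.testBit v ^^ M.testBit (par m v)) = true := fun v hv =>
    ⟨Finset.mem_range.1 (Finset.mem_filter.1 hv).1, (Finset.mem_filter.1 hv).2⟩
  have hJ : ∀ j ∈ crossing L M, ∃ hj : j < L.length,
      (Nat.testBit M (L[j] / 64) ^^ Nat.testBit M (L[j] % 64)) = true := by
    intro j hj
    have hj' := Finset.mem_range.1 (Finset.mem_filter.1 hj).1
    refine ⟨hj', ?_⟩
    rw [← cutCode_testBit]; exact (Finset.mem_filter.1 hj).2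
  have hpar : ∀ v < 6 * m - 3, v < par m v ∧ par m v < 6 * m - 2 ∧ 3 * m ≤ par m v := by
    intro v hv; rw [par_def]; omega
  have hsub : (treeCrossing m M).image g ∪ (crossing L M).image g' ⊆ S := by
    intro e he
    rcases Finset.mem_union.1 he with he | he
    · obtain ⟨v, hv, rfl⟩ := Finset.mem_image.1 he
      obtain ⟨hv, hx⟩ := hD v hv
      have hp := hpar v hv
      refine hf ⟨v, by omega⟩ ⟨par m v, hp.2.1⟩ (hG ⟨fun h => ?_, .inl rfl⟩) fun h => ?_
      · exact absurd (Fin.ext_iff.1 h) hp.1.ne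
      · rw [← hbit, ← hbit] at h
        rw [h] at hx
        simp at hx
    · obtain ⟨j, hj, rfl⟩ := Finset.mem_image.1 he
      obtain ⟨hj, hx⟩ := hJ j hj
      obtain ⟨h1, h2, h3⟩ := hL' j hj
      rw [hg' j hj]
      refine hf ⟨L[j] / 64, by omega⟩ ⟨L[j] % 64, by omega⟩ ((hT.adj _ _).1 h3) fun h => ?_
      rw [← hbit, ← hbit] at h
      rw [h] at hx
      simp at hx
  have hcard : (treeCrossing m M).card + (crossing L M).card ≤ 3 := by
    refine le_trans (le_of_eq ?_) ((Finset.card_le_card hsub).trans hS)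
    rw [Finset.card_union_of_disjoint, Finset.card_image_of_injOn, Finset.card_image_of_injOn]
    · intro i hi j hj h
      obtain ⟨hi, -⟩ := hJ i hi
      obtain ⟨hj, -⟩ := hJ j hj
      have e1 := hL' i hi
      have e2 := hL' j hj
      simp only [hg' i hi, hg' j hj] at h
      refine (hnd.getElem_inj_iff (hi := hi) (hj := hj)).1 ?_
      rcases Sym2.eq_iff.1 h with h | h <;> omega
    · intro v hv w hw h
      have e1 := hpar v (hD v hv).1
      have e2 := hpar w (hD w hw).1
      rcases Sym2.eq_iff.1 h with h | h <;> omega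
    · rw [Finset.disjoint_left]
      intro e he he'
      obtain ⟨v, hv, rfl⟩ := Finset.mem_image.1 he
      obtain ⟨j, hj, h⟩ := Finset.mem_image.1 he'
      obtain ⟨hj, -⟩ := hJ j hj
      have e1 := hpar v (hD v hv).1
      have e2 := hL' j hj
      rw [hg' j hj] at h
      rcases Sym2.eq_iff.1 h with h | h <;> omega
  rcases cut_trivial hb rfl hc (by rw [← hr]; exact hbit ⟨6 * m - 3, by omega⟩) (Nat.ofBits_lt_two_pow f)
    hcard with h | h
  · exact .inl fun a b ha hb => Fin.ext (h a b (by rw [hbit, ha]) (by rw [hbit, hb]))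
  · exact .inr fun a b ha hb => Fin.ext (h a a.2 b b.2 (by rw [hbit, ha]) (by rw [hbit, hb]))

theorem cyclicallyEdgeConnected_four {m k N : ℕ} {G : SimpleGraph (Fin (6 * m - 2))} (hm : 1 ≤ m)
    (hT : IsTable G N) (hG : stdTree m ≤ G) (hb : belowOk m k = true) (hc : cutsFine m k N = true) :
    CyclicallyEdgeConnected 4 G := by
  classical
  intro S hSG hS u v p q hp hq
  by_contra hnr
  let S' : Finset (Sym2 ℕ) := (Set.toFinite S).toFinset.image (Sym2.map Fin.val)
  have hS' : S'.card ≤ 3 := by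
    refine Finset.card_image_le.trans ?_
    rw [← Set.ncard_eq_toFinset_card S]
    rw [← Set.Finite.cast_ncard_eq (Set.toFinite S)] at hS
    have : S.ncard < 4 := by exact_mod_cast hS
    omega
  have hedge : ∀ a b, G.Adj a b → (G.deleteEdges S).Reachable u a → ¬ (G.deleteEdges S).Reachable u b →
      s(a.val, b.val) ∈ S' := by
    intro a b hab ha hnb
    refine Finset.mem_image.2 ⟨s(a, b), ?_, rfl⟩
    rw [Set.Finite.mem_toFinset]
    by_contra hn
    exact hnb (ha.trans (SimpleGraph.Adj.reachable (SimpleGraph.deleteEdges_adj.2 ⟨hab, hn⟩)))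
  -- a cycle has two different vertices
  have two : ∀ {w} {c : (G.deleteEdges S).Walk w w}, c.IsCycle → ∃ w', w ≠ w' ∧ (G.deleteEdges S).Reachable w w' := by
    intro w c hc
    cases c with
    | nil => exact absurd rfl hc.ne_nil
    | cons h _ => exact ⟨_, h.ne, h.reachable⟩
  obtain ⟨u', hu, hu'⟩ := two hp
  obtain ⟨v', hv, hv'⟩ := two hq
  have hnv' : ¬ (G.deleteEdges S).Reachable u v' := fun h => hnr (h.trans hv'.symm)
  by_cases hroot : (G.deleteEdges S).Reachable u ⟨6 * m - 3, by omega⟩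
  · rcases separation_trivial hm hT hG hb hc (f := fun w => decide ¬ (G.deleteEdges S).Reachable u w)
      (by simpa using hroot) hS' (by
        intro a b hab hne
        by_cases ha : (G.deleteEdges S).Reachable u a
        · exact hedge a b hab ha (by simpa [ha] using hne)
        · rw [Sym2.eq_swap]
          exact hedge b a hab.symm (by simpa [ha] using hne) ha) with h | h
    · exact hv (h v v' (by simpa using hnr) (by simpa using hnv'))
    · exact hu (h u u' (by simp) (by simpa using hu'))
  · rcases separation_trivial hm hT hG hb hc (f := fun w => decide ((G.deleteEdges S).Reachable u w))
      (by simpa using hroot) hS' (by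
        intro a b hab hne
        by_cases ha : (G.deleteEdges S).Reachable u a
        · exact hedge a b hab ha (by simpa [ha] using hne)
        · rw [Sym2.eq_swap]
          exact hedge b a hab.symm (by simpa [ha] using hne) ha) with h | h
    · exact hu (h u u' (by simp) (by simpa using hu'))
    · exact hv (h v v' (by simpa using hnr) (by simpa using hnv'))

/-! ### Soundness of the edge colouring check -/

theorem colourable_cons (W : ℕ) (l : List ℕ) (A B C : ℕ) : colourable (W :: l) A B C =
    ((bif Nat.beq (Nat.land A W) 0 then colourable l (Nat.lor A W) B C else false) ||
    ((bif Nat.beq (Nat.land B W) 0 then colourable l A (Nat.lor B W) C else false) ||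
    (bif Nat.beq (Nat.land C W) 0 then colourable l A B (Nat.lor C W) else false))) := by
  rw [← forceR_eq (Nat.lor A W) fun A => colourable l A B C,
    ← forceR_eq (Nat.lor B W) fun B => colourable l A B C,
    ← forceR_eq (Nat.lor C W) fun C => colourable l A B C]
  have aux : ∀ a b c x y z : Bool, @Bool.rec (fun _ => Bool) (@Bool.rec (fun _ => Bool)
      (@Bool.rec (fun _ => Bool) false z c) true (@Bool.rec (fun _ => Bool) false y b)) true
      (@Bool.rec (fun _ => Bool) false x a) = ((bif a then x else false) ||
        ((bif b then y else false) || (bif c then z else false))) := by decide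
  exact aux _ _ _ _ _ _

theorem land_lor_eq_zero {a b c : ℕ} (h1 : Nat.land a c = 0) (h2 : Nat.land b c = 0) :
    Nat.land (Nat.lor a b) c = 0 := by
  change (a ||| b) &&& c = 0
  rw [Nat.and_or_distrib_right]
  change Nat.lor (Nat.land a c) (Nat.land b c) = 0
  rw [h1, h2]; rfl

/-- A proper colouring of the edges is found by the search. -/
theorem colourable_sound {col : ℕ → Fin 3} {es : List ℕ}
    (hp : es.Pairwise fun e f => col e = col f → Nat.land (edgeMask e) (edgeMask f) = 0) {U : Fin 3 → ℕ}
    (hU : ∀ e ∈ es, Nat.land (U (col e)) (edgeMask e) = 0) :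
    colourable (es.map edgeMask) (U 0) (U 1) (U 2) = true := by
  induction es generalizing U with
  | nil => rfl
  | cons e es ih =>
    rw [List.pairwise_cons] at hp
    have h := ih hp.2 (U := Function.update U (col e) (Nat.lor (U (col e)) (edgeMask e))) (by
      intro f hf
      by_cases hc : col f = col e
      · rw [hc, Function.update_self]
        exact land_lor_eq_zero (hc ▸ hU f (List.mem_cons_of_mem _ hf)) (hp.1 f hf hc.symm)
      · rw [Function.update_of_ne hc]
        exact hU f (List.mem_cons_of_mem _ hf))
    have he := hU e List.mem_cons_self
    rw [List.map_cons, colourable_cons]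
    generalize col e = c at h he
    fin_cases c
    · change Nat.land (U 0) _ = 0 at he
      rw [beq_iff.2 he]
      simp only [cond_true, Bool.or_eq_true]
      exact .inl h
    · change Nat.land (U 1) _ = 0 at he
      rw [beq_iff.2 he]
      simp only [cond_true, Bool.or_eq_true]
      exact .inr (.inl h)
    · change Nat.land (U 2) _ = 0 at he
      rw [beq_iff.2 he]
      simp only [cond_true, Bool.or_eq_true]
      exact .inr (.inr h)

theorem edgeMask_testBit (e i : ℕ) : (edgeMask e).testBit i = true ↔ e / 64 = i ∨ e % 64 = i := by
  change Nat.testBit (1 <<< (e / 64) ||| 1 <<< (e % 64)) i = true ↔ _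
  rw [Nat.testBit_or, Nat.one_shiftLeft, Nat.one_shiftLeft, Nat.testBit_two_pow, Nat.testBit_two_pow]
  simp

theorem exists_of_land_ne {e f : ℕ} (h : Nat.land (edgeMask e) (edgeMask f) ≠ 0) :
    ∃ i, (e / 64 = i ∨ e % 64 = i) ∧ (f / 64 = i ∨ f % 64 = i) := by
  obtain ⟨i, hi⟩ := Nat.exists_testBit_of_ne_zero h
  change Nat.testBit (edgeMask e &&& edgeMask f) i = true at hi
  rw [Nat.testBit_and, Bool.and_eq_true, edgeMask_testBit, edgeMask_testBit] at hi
  exact ⟨i, hi⟩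

section
variable {n N : ℕ} {G : SimpleGraph (Fin n)}

theorem not_colorable_of (hT : IsTable G N) {order : List ℕ} (h : uncolourable n N order = true) :
    ¬ G.lineGraph.Colorable 3 := by
  classical
  rintro ⟨C⟩
  simp only [uncolourable, forceList_eq, Bool.and_eq_true, nodupR_iff, List.all_eq_true, blt_iff] at h
  generalize edgeOrder N order 0 = L at h
  obtain ⟨hnd, hL, h⟩ := h
  have hadj : ∀ e ∈ L, ∃ (h1 : e / 64 < n) (h2 : e % 64 < n), G.Adj ⟨e / 64, h1⟩ ⟨e % 64, h2⟩ := by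
    intro e he
    obtain ⟨h1, h2, h3⟩ := hL e he
    exact ⟨lt_trans h1 h2, h2, (hT.adj _ _).1 h3⟩
  let col : ℕ → Fin 3 := fun e => if h : ∃ (h1 : e / 64 < n) (h2 : e % 64 < n), G.Adj ⟨e / 64, h1⟩ ⟨e % 64, h2⟩
    then C ⟨s(⟨e / 64, h.1⟩, ⟨e % 64, h.2.1⟩), h.2.2⟩ else 0
  have hcol : ∀ e ∈ L, ∀ f ∈ L, e ≠ f → Nat.land (edgeMask e) (edgeMask f) ≠ 0 → col e ≠ col f := by
    intro e he f hf hef hm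
    obtain ⟨i, hi1, hi2⟩ := exists_of_land_ne hm
    simp only [col, dif_pos (hadj e he), dif_pos (hadj f hf)]
    refine C.valid ?_
    rw [SimpleGraph.lineGraph_adj_iff_exists]
    have hin : i < n := by obtain ⟨h1, h2, -⟩ := hadj e he; omega
    refine ⟨fun heq => hef ?_, ⟨i, hin⟩, ?_, ?_⟩
    · have h1 : e / 64 < e % 64 := (hL e he).1
      have h2 : f / 64 < f % 64 := (hL f hf).1
      rcases Sym2.eq_iff.1 (congrArg Subtype.val heq) with h | h <;> simp only [Fin.mk.injEq] at h <;> omega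
    · simp only [Sym2.mem_iff, Fin.mk.injEq]; tauto
    · simp only [Sym2.mem_iff, Fin.mk.injEq]; tauto
  match L, h with
  | e0 :: e1 :: e2 :: es, h =>
    simp only [List.map_cons, Bool.and_eq_true, beq_false_iff, Bool.not_eq_true' (colourable _ _ _ _)] at h
    obtain ⟨h01, h02, h12, h⟩ := h
    have hn := hnd
    simp only [List.nodup_cons, List.mem_cons, not_or] at hn
    obtain ⟨⟨n01, n02, n0⟩, ⟨n12, n1⟩, n2, hes⟩ := hn
    let τ : Fin 3 → Fin 3 := ![col e0, col e1, col e2]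
    have c01 : col e0 ≠ col e1 := hcol _ (by simp) _ (by simp) n01 h01
    have c02 : col e0 ≠ col e2 := hcol _ (by simp) _ (by simp) n02 h02
    have c12 : col e1 ≠ col e2 := hcol _ (by simp) _ (by simp) n12 h12
    have hτ : Function.Injective τ := by
      intro a b hab
      fin_cases a <;> fin_cases b <;> simp [τ] at hab ⊢ <;> tauto
    let σ : Fin 3 ≃ Fin 3 := Equiv.ofBijective τ (Finite.injective_iff_bijective.1 hτ)
    let U : Fin 3 → ℕ := ![edgeMask e0, edgeMask e1, edgeMask e2]
    have := colourable_sound (col := fun e => σ.symm (col e)) (es := es) (U := U) (by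
      rw [List.pairwise_iff_getElem]
      intro i j hi hj hij heq
      by_contra hne
      refine hcol es[i] (by simp) es[j] (by simp) (fun h => ?_) hne (σ.symm.injective heq)
      exact hij.ne ((hes.getElem_inj_iff (hi := hi) (hj := hj)).1 h)) (by
      intro e he
      by_contra hne
      have hσ : σ (σ.symm (col e)) = col e := σ.apply_symm_apply _
      revert hne hσ
      generalize σ.symm (col e) = c
      intro hne hσ
      have hmem : e ∈ e0 :: e1 :: e2 :: es := by simp [he]
      fin_cases c
      · exact hcol e0 (by simp) e hmem (by rintro rfl; exact n0 he) hne hσ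
      · exact hcol e1 (by simp) e hmem (by rintro rfl; exact n1 he) hne hσ
      · exact hcol e2 (by simp) e hmem (by rintro rfl; exact n2 he) hne hσ)
    change colourable _ (edgeMask e0) (edgeMask e1) (edgeMask e2) = true at this
    rw [h] at this
    exact absurd this (by simp)

/-! ### An invariant -/

/-- The sum, over all vertices `v`, of the squares of the numbers of the ends of the walks of length `k`
that start at `v`. -/
noncomputable def walkInv {V : Type*} (G : SimpleGraph V) (k : ℕ) : ℕ :=
  ∑ᶠ v, {w | ∃ p : G.Walk v w, p.length = k}.ncard ^ 2

theorem walkInv_iso {V W : Type*} {G : SimpleGraph V} {H : SimpleGraph W} (e : G ≃g H) (k : ℕ) :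
    walkInv G k = walkInv H k := by
  refine finsum_eq_of_bijective e e.bijective fun v => ?_
  congr 1
  rw [← Set.ncard_image_of_injective _ e.injective]
  congr 1
  ext w
  constructor
  · rintro ⟨w, ⟨p, hp⟩, rfl⟩
    exact ⟨p.map e.toHom, by simpa using hp⟩
  · rintro ⟨p, hp⟩
    refine ⟨e.symm w, ⟨(p.map e.symm.toHom).copy (e.symm_apply_apply v) rfl, by simpa using hp⟩, e.apply_symm_apply w⟩

theorem walkMask_succ (N k v : ℕ) : walkMask N (k + 1) v = walkMask N k (nbr N v 0) |||
    (walkMask N k (nbr N v 1) ||| walkMask N k (nbr N v 2)) := rfl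

theorem walkMask_testBit (hT : IsTable G N) (k : ℕ) : ∀ (v : Fin n) (w : ℕ),
    (walkMask N k v).testBit w = true ↔ ∃ h : w < n, ∃ p : G.Walk v ⟨w, h⟩, p.length = k := by
  induction k with
  | zero =>
    intro v w
    change Nat.testBit (1 <<< v.val) w = true ↔ _
    rw [Nat.one_shiftLeft, Nat.testBit_two_pow, decide_eq_true_iff]
    constructor
    · rintro rfl; exact ⟨v.2, .nil, rfl⟩
    · rintro ⟨h, p, hp⟩; rw [SimpleGraph.Walk.eq_of_length_eq_zero hp]
  | succ k ih =>
    intro v w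
    have : (walkMask N (k + 1) v).testBit w = true ↔ ∃ i < 3, (walkMask N k (nbr N v i)).testBit w = true := by
      rw [walkMask_succ, Nat.testBit_or, Nat.testBit_or, Bool.or_eq_true, Bool.or_eq_true]
      constructor
      · rintro (h | h | h)
        exacts [⟨0, by norm_num, h⟩, ⟨1, by norm_num, h⟩, ⟨2, by norm_num, h⟩]
      · rintro ⟨i, hi, h⟩
        interval_cases i <;> simp [h]
    rw [this]
    constructor
    · rintro ⟨i, hi, h⟩
      obtain ⟨hw, p, hp⟩ := (ih ⟨_, hT.lt v i hi⟩ w).1 h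
      exact ⟨hw, .cons ((hT.adj _ _).1 (adjT_iff.2 ⟨i, hi, rfl⟩)) p, by simp [hp]⟩
    · rintro ⟨hw, p, hp⟩
      cases p with
      | nil => simp at hp
      | @cons _ u _ hvu p =>
        obtain ⟨i, hi, hu⟩ := hT.exists_nbr hvu
        exact ⟨i, hi, by rw [hu, ih]; exact ⟨hw, p, by simpa using hp⟩⟩

theorem ncard_eq_length {s : Set (Fin n)} {p : ℕ → Bool} (h : ∀ w : Fin n, p w = true ↔ w ∈ s) :
    s.ncard = ((List.range n).filter p).length := by
  have : Fin.val '' s = (((List.range n).filter p).toFinset : Set ℕ) := by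
    ext w
    simp only [Set.mem_image, List.coe_toFinset, Set.mem_ofPred_eq, List.mem_filter, List.mem_range]
    constructor
    · rintro ⟨w, hw, rfl⟩; exact ⟨w.2, (h w).2 hw⟩
    · rintro ⟨hw, hp⟩; exact ⟨⟨w, hw⟩, (h ⟨w, hw⟩).1 hp, rfl⟩
  rw [← Set.ncard_image_of_injective _ Fin.val_injective, this, Set.ncard_coe_finset,
    List.toFinset_card_of_nodup (List.nodup_range.filter _)]

theorem walkInv_eq (hT : IsTable G N) (k : ℕ) : walkInv G k = walkInvB n N k := by
  have h1 : ∀ M, countBits n M = ((List.range n).filter (Nat.testBit M)).length := by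
    intro M
    rw [countBits]
    induction List.range n with
    | nil => rfl
    | cons x l ih =>
      rw [List.foldr_cons, ih, List.filter_cons]
      cases Nat.testBit M x <;> rfl
  have h2 : ∀ l : List ℕ, l.foldr (fun v s => forceR (walkMask N k v) fun M => forceR (countBits n M) fun c =>
      Nat.add s (Nat.mul c c)) 0 = (l.map fun v => countBits n (walkMask N k v) ^ 2).sum := by
    intro l
    induction l with
    | nil => rfl
    | cons x l ih =>
      rw [List.foldr_cons, ih, forceR_eq, forceR_eq, List.map_cons, List.sum_cons, add_comm, sq]
      rfl
  rw [walkInv, finsum_eq_sum_of_fintype, walkInvB, h2]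
  have h3 : ∀ f : ℕ → ℕ, ((List.range n).map f).sum = ∑ v : Fin n, f v := by
    intro f
    rw [← Finset.sum_range]
    rfl
  rw [h3]
  refine Finset.sum_congr rfl fun v _ => ?_
  rw [h1, ncard_eq_length]
  intro w
  rw [walkMask_testBit hT]
  exact ⟨fun ⟨_, p⟩ => p, fun p => ⟨w.2, p⟩⟩

end

/-! ### Outer cycles -/

section
variable {m N : ℕ} {G : SimpleGraph (Fin (6 * m - 2))}

theorem mem_leaves_stdTree (hm : 1 ≤ m) (hd : TreeDeg m) (v : Fin (6 * m - 2)) :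
    v ∈ leaves (stdTree m) ↔ v.val < 3 * m := by
  constructor
  · intro h
    by_contra hv
    have := hd v (not_lt.1 hv)
    change ((stdTree m).neighborSet v).ncard = 1 at h
    omega
  · intro hv
    change ((stdTree m).neighborSet v).ncard = 1
    rw [Set.ncard_eq_one]
    refine ⟨⟨par m v, by have := v.2; rw [par_def]; omega⟩, ?_⟩
    ext w
    rw [SimpleGraph.mem_neighborSet, stdTree_leaf hm hv, Set.mem_singleton_iff, Fin.ext_iff]

/-- An inner vertex has no neighbours in `G` besides those in the tree. -/
theorem adj_of_inner (hG : stdTree m ≤ G) (hc : ∀ v, deg G v = 3) (hd : TreeDeg m) {v w : Fin (6 * m - 2)}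
    (hw : 3 * m ≤ w.val) (h : G.Adj v w) : (stdTree m).Adj v w := by
  have hsub : (stdTree m).neighborSet w ⊆ G.neighborSet w := fun x hx => hG hx
  have := Set.eq_of_subset_of_ncard_le hsub (by rw [hd w hw]; exact (hc w).le)
  have hv : v ∈ G.neighborSet w := h.symm
  rw [← this] at hv
  exact hv.symm

/-- The neighbours of a leaf that are leaves. -/
theorem ncard_leafNeighbours (hm : 1 ≤ m) (hG : stdTree m ≤ G) (hc : ∀ v, deg G v = 3) (hd : TreeDeg m)
    {v : Fin (6 * m - 2)} (hv : v.val < 3 * m) : {w : Fin (6 * m - 2) | G.Adj v w ∧ w.val < 3 * m}.ncard = 2 := by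
  let p : Fin (6 * m - 2) := ⟨par m v, by have := v.2; rw [par_def]; omega⟩
  have hp : 3 * m ≤ p.val := par_ge m v hm
  have hvp : (stdTree m).Adj v p := (stdTree_leaf hm hv).2 rfl
  have heq : G.neighborSet v = insert p {w : Fin (6 * m - 2) | G.Adj v w ∧ w.val < 3 * m} := by
    ext w
    simp only [SimpleGraph.mem_neighborSet, Set.mem_insert_iff, Set.mem_ofPred_eq]
    constructor
    · intro h
      by_cases hw : w.val < 3 * m
      · exact .inr ⟨h, hw⟩
      · exact .inl (Fin.ext ((stdTree_leaf hm hv).1 (adj_of_inner hG hc hd (not_lt.1 hw) h)))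
    · rintro (rfl | h)
      exacts [hG hvp, h.1]
  have h3 := hc v
  rw [deg, heq, Set.ncard_insert_of_notMem (fun h => absurd h.2 (not_lt.2 hp))] at h3
  omega

theorem all_mem_of_walk {V : Type*} {G : SimpleGraph V} {X Y : Set V}
    (hX : ∀ x ∈ X, ∀ y ∈ Y, G.Adj x y → y ∈ X) {u v : V} (p : G.Walk u v) (hp : ∀ x ∈ p.support, x ∈ Y)
    (h : ∃ x ∈ p.support, x ∈ X) : ∀ x ∈ p.support, x ∈ X := by
  induction p with
  | nil => simpa using h
  | @cons u v w huv p ih =>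
    simp only [SimpleGraph.Walk.support_cons, List.mem_cons, forall_eq_or_imp, exists_eq_or_imp] at hp h ⊢
    have hv : ∀ x ∈ p.support, x ∈ X := by
      refine ih hp.2 ?_
      rcases h with h | h
      · exact ⟨v, p.start_mem_support, hX u h v (hp.2 v p.start_mem_support) huv⟩
      · exact h
    exact ⟨hX v (hv v p.start_mem_support) u hp.1 huv.symm, hv⟩

theorem exists_walk_of_chain {n : ℕ} {G : SimpleGraph (Fin n)} (hT : IsTable G N) : ∀ {l : List ℕ} {a : Fin n},
    (∀ x ∈ l, x < n) → chain N (a.val :: l) = true → ∃ (b : Fin n) (p : G.Walk a b), p.support.map Fin.val = a.val :: l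
  | [], a, _, _ => ⟨a, .nil, rfl⟩
  | x :: l, a, hl, h => by
    rw [chain, Bool.and_eq_true] at h
    obtain ⟨b, p, hp⟩ := exists_walk_of_chain hT (a := ⟨x, hl x (by simp)⟩) (l := l)
      (fun y hy => hl y (by simp [hy])) h.2
    exact ⟨b, .cons ((hT.adj a ⟨x, hl x (by simp)⟩).1 h.1) p, by simp [hp]⟩

/-- The vertices in a list, and the edges between them. -/
def listSubgraph {n : ℕ} (G : SimpleGraph (Fin n)) (c : List ℕ) : G.Subgraph :=
  (⊤ : G.Subgraph).induce {v | v.val ∈ c}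

/-- A connected `2`-regular graph has no proper `2`-regular subgraph, so the outer cycles are exactly the
components of the graph of the leaf edges, which the lists in `cs` describe. -/
theorem oc_eq (hm : 1 ≤ m) (hT : IsTable G N) (hG : stdTree m ≤ G) (hc : ∀ v, deg G v = 3) (hd : TreeDeg m)
    {cs : List (List ℕ)} (h : cyclesOk m N cs = true) :
    oc G (stdTree m) = (cs.map List.length : Multiset ℕ) := by
  classical
  simp only [cyclesOk, Bool.and_eq_true, nodupR_iff, beq_iff, List.all_eq_true, blt_iff, forceR_eq] at h
  obtain ⟨hnd, hlen, h⟩ := h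
  have hlt : ∀ c ∈ cs, ∀ a ∈ c, a < 3 * m := fun c hcs a ha => ((h c hcs).2.2 a ha).1
  -- the lists are closed under the passage to neighbouring leaves
  have hclosed : ∀ c ∈ cs, ∀ v : Fin (6 * m - 2), v.val ∈ c → ∀ w : Fin (6 * m - 2), w.val < 3 * m →
      G.Adj v w → w.val ∈ c := by
    intro c hcs v hv w hw hvw
    obtain ⟨k, hk, hk'⟩ := hT.exists_nbr hvw
    have := ((h c hcs).2.2 v hv).2 k (by interval_cases k <;> simp)
    rw [hk'] at this
    have e : Nat.blt w (Nat.mul 3 m) = true := blt_iff.2 hw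
    rw [e, cond_true, List.any_eq_true] at this
    obtain ⟨x, hx, hx'⟩ := this
    rw [beq_iff] at hx'
    exact hx' ▸ hx
  have hcover : ∀ a < 3 * m, ∃ c ∈ cs, a ∈ c := by
    intro a ha
    have hsub : cs.flatten.toFinset ⊆ Finset.range (3 * m) := by
      intro x hx
      rw [List.mem_toFinset, List.mem_flatten] at hx
      obtain ⟨c, hcs, hx⟩ := hx
      exact Finset.mem_range.2 (hlt c hcs x hx)
    have := Finset.eq_of_subset_of_card_le hsub (by
      rw [Finset.card_range, List.toFinset_card_of_nodup hnd, hlen]; exact le_rfl)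
    have ha' : a ∈ cs.flatten.toFinset := by rw [this]; exact Finset.mem_range.2 ha
    rwa [List.mem_toFinset, List.mem_flatten] at ha'
  have hwalk : ∀ c ∈ cs, ∃ (a b : Fin (6 * m - 2)) (p : G.Walk a b), p.support.map Fin.val = c := by
    intro c hcs
    obtain ⟨h0, h1, -⟩ := h c hcs
    cases c with
    | nil => simp at h0
    | cons a l =>
      have hn : ∀ x ∈ a :: l, x < 6 * m - 2 := fun x hx => by have := hlt _ hcs x hx; omega
      obtain ⟨b, p, hp⟩ := exists_walk_of_chain hT (a := ⟨a, hn a (by simp)⟩)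
        (fun x hx => hn x (by simp [hx])) h1
      exact ⟨_, b, p, hp⟩
  have hmem : ∀ {c : List ℕ} {a b : Fin (6 * m - 2)} {p : G.Walk a b}, p.support.map Fin.val = c →
      ∀ x : Fin (6 * m - 2), x ∈ p.support ↔ x.val ∈ c := by
    rintro c a b p rfl x
    rw [List.mem_map_of_injective Fin.val_injective]
  -- the lists are outer cycles
  have houter : ∀ c ∈ cs, IsOuterCycle G (stdTree m) (listSubgraph G c) := by
    intro c hcs
    refine ⟨?_, ?_, fun v hv => (mem_leaves_stdTree hm hd v).2 (hlt c hcs _ hv)⟩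
    · obtain ⟨a, b, p, hp⟩ := hwalk c hcs
      refine p.toSubgraph_connected.mono' (fun v w hvw => ?_) ?_
      · have h1 := (p.mem_verts_toSubgraph).1 (p.toSubgraph.edge_vert hvw)
        have h2 := (p.mem_verts_toSubgraph).1 (p.toSubgraph.edge_vert hvw.symm)
        exact ⟨(hmem hp v).1 h1, (hmem hp w).1 h2, p.toSubgraph.adj_sub hvw⟩
      · ext v
        rw [p.mem_verts_toSubgraph, hmem hp]
        rfl
    · intro v hv
      refine Eq.trans (congrArg Set.ncard ?_) (ncard_leafNeighbours hm hG hc hd (hlt c hcs _ hv))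
      ext w
      constructor
      · rintro ⟨h1, h2, h3⟩
        exact ⟨h3, hlt c hcs _ h2⟩
      · rintro ⟨h1, h2⟩
        exact ⟨hv, hclosed c hcs v hv w h2 h1, h1⟩
  -- there are no others
  have hall : ∀ C : G.Subgraph, IsOuterCycle G (stdTree m) C → ∃ c ∈ cs, listSubgraph G c = C := by
    intro C hC
    have hl : ∀ v ∈ C.verts, v.val < 3 * m := fun v hv => (mem_leaves_stdTree hm hd v).1 (hC.verts_subset hv)
    have hadj : ∀ v ∈ C.verts, ∀ w : Fin (6 * m - 2), w.val < 3 * m → G.Adj v w → C.Adj v w := by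
      intro v hv w hw hvw
      have hsub : C.neighborSet v ⊆ {w : Fin (6 * m - 2) | G.Adj v w ∧ w.val < 3 * m} := fun w hw =>
        ⟨C.adj_sub hw, hl w (C.edge_vert (C.adj_symm hw))⟩
      have := Set.eq_of_subset_of_ncard_le hsub (by
        rw [ncard_leafNeighbours hm hG hc hd (hl v hv), hC.two_regular v hv])
      have hw' : w ∈ {w : Fin (6 * m - 2) | G.Adj v w ∧ w.val < 3 * m} := ⟨hvw, hw⟩
      rw [← this] at hw'
      exact hw'
    obtain ⟨v, hv⟩ : C.verts.Nonempty := hC.connected.nonempty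
    obtain ⟨c, hcs, hvc⟩ := hcover v.val (hl v hv)
    have hverts : ∀ w, w ∈ C.verts ↔ w.val ∈ c := by
      intro w
      constructor
      · intro hw
        obtain ⟨p⟩ := hC.connected.preconnected.coe ⟨v, hv⟩ ⟨w, hw⟩
        refine all_mem_of_walk (X := {v : Fin (6 * m - 2) | v.val ∈ c}) (Y := C.verts)
          (fun x hx y hy hxy => hclosed c hcs x hx y (hl y hy) hxy) (p.map C.hom) ?_
          ⟨v, SimpleGraph.Walk.start_mem_support _, hvc⟩ w (SimpleGraph.Walk.end_mem_support _)
        intro x hx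
        rw [SimpleGraph.Walk.support_map, List.mem_map] at hx
        obtain ⟨y, -, rfl⟩ := hx
        exact y.2
      · intro hw
        obtain ⟨a, b, p, hp⟩ := hwalk c hcs
        exact all_mem_of_walk (X := C.verts) (Y := {v : Fin (6 * m - 2) | v.val < 3 * m})
          (fun x hx y hy hxy => C.edge_vert (C.adj_symm (hadj x hx y hy hxy))) p
          (fun x hx => hlt c hcs _ ((hmem hp x).1 hx)) ⟨v, (hmem hp v).2 hvc, hv⟩ w ((hmem hp w).2 hw)
    refine ⟨c, hcs, SimpleGraph.Subgraph.ext (Set.ext fun w => (hverts w).symm) ?_⟩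
    ext x y
    constructor
    · rintro ⟨h1, h2, h3⟩
      exact hadj x ((hverts x).2 h1) y (hlt c hcs _ h2) h3
    · intro hxy
      exact ⟨(hverts x).1 (C.edge_vert hxy), (hverts y).1 (C.edge_vert (C.adj_symm hxy)), C.adj_sub hxy⟩
  have hinj : (cs.map (listSubgraph G)).Nodup := by
    rw [List.nodup_flatten] at hnd
    rw [List.Nodup, List.pairwise_map]
    refine hnd.2.imp_of_mem fun {c d} hcs hds hdis heq => ?_
    obtain ⟨a, b, p, hp⟩ := hwalk c hcs
    have ha := (hmem hp a).1 p.start_mem_support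
    have : a ∈ (listSubgraph G d).verts := by rw [← heq]; exact ha
    exact hdis ha this
  have hset : (Set.toFinite {C : G.Subgraph | IsOuterCycle G (stdTree m) C}).toFinset =
      (cs.map (listSubgraph G)).toFinset := by
    ext C
    rw [Set.Finite.mem_toFinset, List.mem_toFinset, List.mem_map]
    exact ⟨fun hC => hall C hC, by rintro ⟨c, hcs, rfl⟩; exact houter c hcs⟩
  rw [oc, hset, List.toFinset_val, List.dedup_eq_self.2 hinj, Multiset.map_coe, List.map_map]
  congr 1
  refine List.map_congr_left fun c hcs => ?_
  change {v : Fin (6 * m - 2) | v.val ∈ c}.ncard = c.length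
  have : Fin.val '' {v : Fin (6 * m - 2) | v.val ∈ c} = (c.toFinset : Set ℕ) := by
    ext x
    simp only [Set.mem_image, Set.mem_ofPred_eq, List.coe_toFinset]
    constructor
    · rintro ⟨v, hv, rfl⟩; exact hv
    · intro hx; exact ⟨⟨x, by have := hlt c hcs x hx; omega⟩, hx, rfl⟩
  rw [← Set.ncard_image_of_injective _ Fin.val_injective, this, Set.ncard_coe_finset,
    List.toFinset_card_of_nodup ((List.nodup_flatten.1 hnd).1 c hcs)]

end

/-! ### Certificates for the representatives -/

/-- A graph `mkG m R`, given by `R`, with an order of its vertices that is good for colouring the edges,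
its outer cycles, and the value of `walkInv`. -/
structure Rep where
  mask : ℕ
  order : List ℕ
  cycles : List (List ℕ)
  inv : ℕ

/-- The checks for all graphs in the list. -/
noncomputable def repsOk (m k : ℕ) (l : List Rep) : Bool :=
  belowOk m k && l.all fun r => forceR r.mask fun R => repOk m k R r.order r.cycles r.inv

theorem facts_of_repOk {m k : ℕ} {l : List Rep} (hm : 1 ≤ m) (hc : ∀ r ∈ l, RotGraph m (mkG m r.mask))
    (hd : TreeDeg m) (h : repsOk m k l = true) {r : Rep} (hr : r ∈ l) : IsSnark (mkG m r.mask) ∧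
      walkInv (mkG m r.mask) 4 = r.inv ∧
      oc (mkG m r.mask) (stdTree m) = (r.cycles.map List.length : Multiset ℕ) := by
  have hG := hc r hr
  simp only [repsOk, Bool.and_eq_true, List.all_eq_true, forceR_eq] at h
  obtain ⟨hb, h⟩ := h
  have h := h r hr
  simp only [repOk, Bool.and_eq_true, forceR_eq, beq_iff] at h
  obtain ⟨h1, h2, h3, h4, h5, h6, h7⟩ := h
  have hT := isTable_of hG.cubic h1
  exact ⟨⟨hG.cubic, cyclicallyEdgeConnected_four hm hT hG.tree_le hb h4, girth_eq_five hT h2 h3,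
    not_colorable_of hT h5⟩, (walkInv_eq hT 4).trans h6, oc_eq hm hT hG.tree_le hG.cubic hd h7⟩

/-- The certificate for the Petersen graph. -/
def certified2 : List Rep :=
  [⟨repMasks2.getD 0 0, [2, 1, 5, 8, 4, 7, 3, 0, 9, 6], [[0, 3, 4, 1, 2, 5]], 1000⟩]

/-- The certificates for the Loupekine snarks. -/
def certified4 : List Rep :=
  [⟨repMasks4.getD 0 0, [20, 16, 17, 8, 11, 9, 10, 5, 14, 19, 21, 15, 7, 6, 4, 3, 0, 18, 13, 2,
    12, 1], [[0, 3, 4, 7, 8, 11], [1, 2, 9, 10, 5, 6]], 7552⟩,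
   ⟨repMasks4.getD 1 0, [11, 17, 8, 16, 20, 10, 9, 0, 21, 18, 12, 13, 2, 1, 3, 5, 6, 14, 4, 19,
    7, 15], [[0, 3, 6, 5, 8, 11, 2, 1, 4, 7, 10, 9]], 9880⟩]

/-- The certificates for the rotation `T_4`-snarks. -/
def certified8 : List Rep :=
  [⟨repMasks8.getD 0 0, [20, 8, 34, 6, 28, 15, 10, 21, 38, 29, 11, 9, 13, 17, 18, 33, 19, 32,
    16, 40, 44, 41, 45, 43, 39, 30, 31, 4, 14, 23, 35, 12, 22, 26, 7, 27, 37, 42, 0, 36, 24, 3,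
    1, 25, 2, 5], [[0, 2, 5, 1, 3, 7, 22, 12], [4, 14, 23, 19, 17, 21, 18, 16], [6, 15, 11, 9,
    13, 10, 8, 20]], 26746⟩,
   ⟨repMasks8.getD 1 0, [18, 33, 21, 17, 19, 40, 32, 16, 20, 34, 15, 6, 27, 7, 11, 29, 38, 9,
    28, 8, 10, 13, 41, 44, 45, 43, 30, 12, 39, 31, 22, 35, 42, 37, 23, 14, 3, 36, 25, 4, 26, 2,
    0, 24, 1, 5], [[0, 2, 5, 1, 3, 23, 14, 4], [6, 15, 19, 17, 21, 18, 16, 20], [7, 11, 9, 13,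
    10, 8, 12, 22]], 23656⟩,
   ⟨repMasks8.getD 2 0, [32, 16, 40, 44, 33, 18, 21, 17, 19, 34, 41, 35, 22, 12, 7, 23, 11, 9,
    30, 13, 29, 10, 28, 38, 8, 4, 14, 20, 6, 27, 39, 31, 43, 45, 15, 26, 37, 42, 36, 5, 25, 2,
    3, 0, 24, 1], [[0, 2, 5, 1, 3, 15, 6, 20], [4, 8, 10, 13, 9, 11, 23, 14], [7, 19, 17, 21,
    18, 16, 12, 22]], 24670⟩,
   ⟨repMasks8.getD 3 0, [1, 2, 5, 3, 25, 4, 26, 37, 42, 36, 24, 0, 27, 23, 14, 7, 35, 22, 11, 8,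
    13, 28, 9, 10, 29, 12, 38, 30, 43, 45, 39, 31, 15, 6, 41, 44, 19, 16, 34, 21, 20, 33, 40,
    18, 32, 17], [[0, 4, 2, 1, 5, 3, 23, 14], [6, 15, 19, 21, 17, 18, 20, 16], [7, 11, 13, 9,
    10, 12, 8, 22]], 25144⟩,
   ⟨repMasks8.getD 4 0, [36, 24, 42, 37, 0, 26, 5, 7, 27, 4, 2, 25, 3, 1, 22, 35, 41, 12, 6, 34,
    20, 14, 23, 21, 16, 19, 17, 32, 33, 40, 44, 18, 45, 43, 39, 30, 31, 13, 15, 9, 11, 38, 29,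
    28, 8, 10], [[0, 2, 17, 19, 21, 23, 16, 18, 9, 11, 13, 15, 8, 10, 1, 3, 5, 7], [4, 14, 20,
    6, 12, 22]], 27196⟩,
   ⟨repMasks8.getD 5 0, [38, 29, 11, 28, 9, 10, 8, 15, 6, 43, 39, 31, 13, 30, 12, 14, 4, 0, 1,
    24, 2, 36, 25, 3, 45, 42, 37, 26, 27, 7, 5, 22, 21, 35, 23, 20, 34, 41, 44, 40, 33, 18, 19,
    16, 32, 17], [[0, 2, 22, 20, 16, 18, 14, 12, 8, 10, 6, 4], [1, 3, 7, 5, 17, 19, 23, 21, 9,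
    11, 15, 13]], 28222⟩,
   ⟨repMasks8.getD 6 0, [34, 21, 23, 41, 35, 44, 20, 22, 16, 18, 9, 45, 32, 40, 33, 19, 28, 38,
    43, 8, 12, 30, 39, 14, 31, 15, 13, 1, 10, 29, 11, 17, 24, 42, 36, 3, 25, 2, 5, 6, 4, 26, 37,
    0, 27, 7], [[0, 4, 6, 2, 17, 11, 13, 15, 8, 12, 14, 10, 1, 19, 21, 23, 16, 20, 22, 18, 9, 3,
    5, 7]], 25798⟩,
   ⟨repMasks8.getD 7 0, [4, 0, 7, 27, 6, 26, 37, 5, 42, 3, 45, 36, 25, 24, 18, 9, 28, 43, 38,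
    39, 2, 31, 14, 12, 30, 8, 15, 13, 1, 11, 29, 10, 17, 44, 19, 33, 40, 32, 16, 22, 20, 41, 34,
    21, 23, 35], [[0, 4, 6, 18, 9, 3, 5, 7], [1, 10, 22, 20, 16, 23, 21, 19], [2, 14, 12, 8, 15,
    13, 11, 17]], 26848⟩,
   ⟨repMasks8.getD 8 0, [22, 17, 19, 32, 33, 40, 35, 16, 18, 21, 23, 34, 41, 44, 20, 0, 7, 27,
    37, 5, 2, 26, 45, 42, 36, 24, 25, 6, 4, 1, 3, 15, 12, 13, 30, 39, 43, 31, 14, 11, 9, 38, 28,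
    29, 8, 10], [[0, 2, 5, 7, 19, 17, 22, 20], [1, 3, 15, 13, 10, 8, 4, 6], [9, 11, 23, 21, 18,
    16, 12, 14]], 27094⟩,
   ⟨repMasks8.getD 9 0, [23, 21, 35, 41, 34, 22, 20, 16, 32, 40, 44, 45, 42, 17, 2, 37, 3, 25,
    36, 27, 7, 11, 5, 26, 24, 0, 4, 6, 29, 10, 1, 38, 43, 28, 9, 18, 33, 19, 13, 30, 39, 14, 31,
    12, 15, 8], [[0, 4, 6, 10, 1, 19, 13, 15, 8, 12, 14, 18, 9, 3, 21, 23, 16, 20, 22, 2, 17,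
    11, 5, 7]], 25720⟩,
   ⟨repMasks8.getD 10 0, [27, 7, 5, 6, 4, 0, 26, 37, 11, 1, 24, 18, 33, 36, 42, 40, 45, 44, 41,
    35, 32, 23, 16, 21, 34, 20, 22, 17, 10, 29, 3, 25, 38, 43, 2, 19, 9, 28, 8, 12, 14, 15, 13,
    30, 31, 39], [[0, 4, 6, 18, 1, 11, 5, 7], [2, 9, 19, 13, 15, 8, 12, 14], [3, 17, 10, 22, 20,
    16, 23, 21]], 23584⟩,
   ⟨repMasks8.getD 11 0, [39, 30, 12, 31, 14, 15, 19, 13, 9, 8, 2, 28, 33, 38, 43, 18, 7, 29,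
    11, 27, 6, 1, 5, 37, 26, 4, 0, 24, 42, 45, 36, 25, 3, 10, 23, 40, 44, 32, 16, 17, 21, 34,
    41, 20, 35, 22], [[0, 4, 6, 1, 5, 11, 7, 18], [2, 8, 12, 14, 9, 13, 19, 15], [3, 21, 17, 22,
    20, 16, 10, 23]], 23506⟩,
   ⟨repMasks8.getD 12 0, [39, 31, 14, 18, 15, 21, 30, 34, 20, 16, 12, 13, 43, 7, 8, 27, 6, 10,
    32, 28, 38, 29, 9, 33, 40, 19, 11, 17, 1, 3, 44, 41, 45, 42, 37, 24, 36, 25, 0, 35, 23, 26,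
    4, 22, 5, 2], [[0, 4, 22, 2, 5, 23], [1, 11, 17, 3, 9, 19], [6, 10, 13, 7, 8, 12], [14, 18,
    21, 15, 16, 20]], 28780⟩,
   ⟨repMasks8.getD 13 0, [21, 2, 34, 20, 14, 15, 31, 0, 39, 30, 24, 36, 25, 12, 3, 13, 18, 6, 7,
    27, 16, 32, 17, 11, 1, 40, 33, 19, 9, 44, 41, 42, 37, 45, 43, 38, 29, 28, 8, 10, 23, 35, 22,
    5, 26, 4], [[0, 15, 21, 2, 14, 20], [1, 11, 17, 3, 9, 19], [4, 8, 23, 5, 10, 22], [6, 12,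
    16, 7, 13, 18]], 31228⟩,
   ⟨repMasks8.getD 14 0, [44, 41, 40, 32, 17, 33, 23, 35, 22, 2, 16, 4, 18, 14, 8, 34, 20, 31,
    15, 9, 28, 21, 39, 3, 25, 45, 43, 38, 29, 11, 30, 13, 19, 5, 26, 36, 42, 37, 24, 10, 1, 7,
    27, 6, 12, 0], [[0, 6, 10, 1, 7, 12], [2, 17, 23, 4, 16, 22], [3, 13, 19, 5, 11, 21], [8,
    14, 18, 9, 15, 20]], 28714⟩]

theorem certified2_mask : certified2.map Rep.mask = repMasks2 := rfl
theorem certified4_mask : certified4.map Rep.mask = repMasks4 := rfl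
theorem certified8_mask : certified8.map Rep.mask = repMasks8 := rfl

theorem certified2_ok : repsOk 2 1 certified2 = true := by decide +kernel
theorem certified4_ok : repsOk 4 2 certified4 = true := by decide +kernel
theorem certified8_ok : repsOk 8 3 certified8 = true := by decide +kernel

/-! ### The standard tree is a tree `T_i` -/

section
variable {m i : ℕ}

/-- The angle of the vertex `v` in the drawing of the standard tree, in units of which `6 * m` make
a full turn. -/
def stdAngle (m i v : ℕ) : ℕ :=
  2 ^ stdHeight m i v * (2 * (v - (6 * m - 6 * m / 2 ^ stdHeight m i v)) + 1)

/-- The angle at the end of the edge from `v` to its parent: edges to the center are radial. -/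
def endAngle (m i v : ℕ) : ℕ := if stdHeight m i v + 1 = i then stdAngle m i v else stdAngle m i (par m v)

/-- Properties of heights and angles in the standard tree for a given `m`. -/
structure DrawFacts (m i : ℕ) : Prop where
  height_root : stdHeight m i (6 * m - 3) = i
  height_leaf : ∀ v < 3 * m, stdHeight m i v = 0
  height_inner : ∀ v < 6 * m - 2, 3 * m ≤ v → stdHeight m i v ≠ 0
  height_lt : ∀ v < 6 * m - 3, stdHeight m i v < i
  height_par : ∀ v < 6 * m - 3, stdHeight m i (par m v) = stdHeight m i v + 1
  base_le : ∀ v < 6 * m - 3, 6 * m - 6 * m / 2 ^ stdHeight m i v ≤ v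
  angle : ∀ v < 6 * m - 3, 1 ≤ stdAngle m i v ∧ stdAngle m i v ≤ 6 * m - 1
  endAngle : ∀ v < 6 * m - 3, 1 ≤ endAngle m i v ∧ endAngle m i v ≤ 6 * m - 1

theorem drawFacts2 : DrawFacts 2 2 := by constructor <;> decide +kernel

theorem drawFacts4 : DrawFacts 4 3 := by constructor <;> decide +kernel

theorem drawFacts8 : DrawFacts 8 4 := by constructor <;> decide +kernel

theorem par_lt {m v : ℕ} (hv : v < 6 * m - 3) : v < par m v ∧ par m v ≤ 6 * m - 3 := by
  rw [par_def]; omega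

theorem stdTree_edge {e : Sym2 (Fin (6 * m - 2))} (he : e ∈ (stdTree m).edgeSet) :
    ∃ v w : Fin (6 * m - 2), e = s(v, w) ∧ v.val < 6 * m - 3 ∧ w.val = par m v := by
  induction e using Sym2.ind with
  | _ a b =>
  have key : ∀ a b : Fin (6 * m - 2), a ≠ b → b.val = par m a → a.val < 6 * m - 3 := by
    intro a b hab hb
    by_contra h
    have := a.2
    refine hab (Fin.ext ?_)
    rw [hb, par_def]; omega
  rcases (he : a ≠ b ∧ (b.val = par m a ∨ a.val = par m b)) with ⟨hab, h | h⟩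
  · exact ⟨a, b, rfl, key a b hab h, h⟩
  · exact ⟨b, a, Sym2.eq_swap, key b a hab.symm h, h⟩

theorem isTreeT_stdTree (hf : DrawFacts m i) (hd : TreeDeg m) (hm : 1 ≤ m) :
    IsTreeT i (stdTree m) ⟨6 * m - 3, by omega⟩ := by
  set x : Fin (6 * m - 2) := ⟨6 * m - 3, by omega⟩ with hx
  have hpar : ∀ v : Fin (6 * m - 2), v.val < 6 * m - 3 → ∃ w : Fin (6 * m - 2), w.val = par m v ∧ (stdTree m).Adj v w := by
    intro v hv
    have := par_lt hv
    exact ⟨⟨par m v, by omega⟩, rfl, fun h => this.1.ne (congrArg Fin.val h), .inl rfl⟩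
  -- the path to the center
  have hwalk : ∀ k, ∀ v : Fin (6 * m - 2), i - stdHeight m i v = k → ∃ p : (stdTree m).Walk v x, p.length = k := by
    intro k
    induction k with
    | zero =>
      intro v hv
      obtain rfl : v = x := by
        by_contra hne
        have hne : v.val ≠ 6 * m - 3 := fun h => hne (Fin.ext h)
        have := hf.height_lt v (by have := v.2; omega)
        omega
      exact ⟨.nil, rfl⟩
    | succ k ih =>
      intro v hv
      have hv' : v.val < 6 * m - 3 := by
        by_contra hn
        have h1 : v.val = 6 * m - 3 := by have := v.2; omega
        rw [h1, hf.height_root] at hv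
        omega
      obtain ⟨w, hw, hvw⟩ := hpar v hv'
      obtain ⟨p, hp⟩ := ih w (by rw [hw, hf.height_par v hv']; omega)
      exact ⟨.cons hvw p, by simp [hp]⟩
  have hconn : (stdTree m).Connected := by
    have : Nonempty (Fin (6 * m - 2)) := ⟨x⟩
    refine ⟨fun u v => ?_⟩
    obtain ⟨p, -⟩ := hwalk _ u rfl
    obtain ⟨q, -⟩ := hwalk _ v rfl
    exact ⟨p.append q.reverse⟩
  have hstep : ∀ {a b : Fin (6 * m - 2)}, (stdTree m).Adj a b → stdHeight m i b ≤ stdHeight m i a + 1 := by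
    intro a b hab
    obtain ⟨v, w, he, hv, hw⟩ := stdTree_edge (SimpleGraph.mem_edgeSet _ |>.2 hab)
    have := hf.height_par v hv
    rw [← hw] at this
    rcases Sym2.eq_iff.1 he with ⟨rfl, rfl⟩ | ⟨rfl, rfl⟩ <;> omega
  have hlen : ∀ {a b : Fin (6 * m - 2)} (p : (stdTree m).Walk a b), stdHeight m i b ≤ stdHeight m i a + p.length := by
    intro a b p
    induction p with
    | nil => simp
    | cons h p ih =>
      have := hstep h
      rw [SimpleGraph.Walk.length_cons]
      omega
  refine ⟨?_, fun v => ?_, hd x (by simp only [hx]; omega), fun v hv => ?_⟩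
  · rw [SimpleGraph.isTree_iff_connected_and_card]
    refine ⟨hconn, le_antisymm ?_ hconn.card_vert_le_card_edgeSet_add_one⟩
    choose v w he hv hw using fun e : (stdTree m).edgeSet => stdTree_edge e.2
    have : Nat.card (stdTree m).edgeSet ≤ Nat.card (Fin (6 * m - 3)) := by
      refine Nat.card_le_card_of_injective (fun e => ⟨v e, hv e⟩) fun e f hef => ?_
      have h1 : v e = v f := Fin.ext (Fin.mk.inj hef)
      have h2 : w e = w f := Fin.ext (by rw [hw, hw, h1])
      exact Subtype.ext (by rw [he, he, h1, h2])
    rw [Nat.card_fin] at this ⊢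
    omega
  · by_cases hv : v.val < 3 * m
    · exact .inl ((mem_leaves_stdTree hm hd v).2 hv)
    · exact .inr (hd v (not_lt.1 hv))
  · have hv0 := hf.height_leaf v ((mem_leaves_stdTree hm hd v).1 hv)
    obtain ⟨p, hp⟩ := hwalk _ v rfl
    obtain ⟨q, hq⟩ := hconn.exists_walk_length_eq_dist v x
    have h1 := SimpleGraph.dist_le p
    have h2 := hlen q
    have h3 : stdHeight m i x.val = i := hf.height_root
    rw [SimpleGraph.dist_comm]
    omega

end

/-! ### A drawing of a rotation graph -/

/-- The point with the given radius and (clockwise) angle, where `6 * m` is a full turn. -/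
noncomputable def polar (m : ℕ) (r θ : ℝ) : ℂ := r * Complex.exp ((-(θ * (Real.pi / (3 * m))) : ℝ) * Complex.I)

section
variable {m i : ℕ}

theorem norm_polar {r : ℝ} (hr : 0 ≤ r) (θ : ℝ) : ‖polar m r θ‖ = r := by
  rw [polar, norm_mul, Complex.norm_exp_ofReal_mul_I, mul_one, Complex.norm_real, Real.norm_of_nonneg hr]

theorem polar_zero (θ : ℝ) : polar m 0 θ = 0 := by simp [polar]

theorem polar_inj (hm : 1 ≤ m) {r s θ φ : ℝ} (hr : 0 < r) (hs : 0 ≤ s) (h : polar m r θ = polar m s φ)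
    (hθ : |θ - φ| < 6 * m) : r = s ∧ θ = φ := by
  have hrs : r = s := by rw [← norm_polar (m := m) hr.le θ, h, norm_polar hs]
  subst hrs
  refine ⟨rfl, ?_⟩
  have hm' : (0 : ℝ) < m := by exact_mod_cast hm
  have hr' : (r : ℂ) ≠ 0 := by exact_mod_cast hr.ne'
  have h1 := mul_left_cancel₀ hr' h
  obtain ⟨k, hk⟩ := Complex.exp_eq_exp_iff_exists_int.1 h1
  have h2 : -(θ * (Real.pi / (3 * m))) = -(φ * (Real.pi / (3 * m))) + k * (2 * Real.pi) := by
    generalize -(θ * (Real.pi / (3 * m))) = x at hk ⊢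
    generalize -(φ * (Real.pi / (3 * m))) = y at hk ⊢
    have := congrArg Complex.im hk
    simpa using this
  have h3 : θ - φ = -(k * (6 * m)) := by
    have : -(θ * (Real.pi / (3 * m))) - -(φ * (Real.pi / (3 * m))) = k * (2 * Real.pi) := by linarith
    have hpi := Real.pi_ne_zero
    field_simp at this
    linarith
  have hk0 : k = 0 := by
    rw [h3, abs_neg, abs_mul, abs_of_pos (by positivity : (0 : ℝ) < 6 * m)] at hθ
    have : |(k : ℝ)| < 1 := by
      by_contra hge
      nlinarith [not_lt.1 hge]
    rw [← Int.cast_abs] at this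
    have : |k| < 1 := by exact_mod_cast this
    exact Int.abs_lt_one_iff.1 this
  rw [hk0] at h3
  simp at h3
  linarith

theorem continuous_polar : Continuous fun p : ℝ × ℝ => polar m p.1 p.2 := by
  unfold polar; fun_prop

/-- Vertices are drawn on concentric circles according to their height. -/
noncomputable def radius (m i : ℕ) (v : ℕ) : ℝ := 1 - stdHeight m i v / i

/-- The point of the vertex `v`. -/
noncomputable def point (m i v : ℕ) : ℂ := polar m (radius m i v) (stdAngle m i v)

/-- The curve of an edge from `v` to `w`: in the tree, radius and angle change linearly; the other
edges run outside the unit circle. -/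
noncomputable def edgeRadius (m i v w : ℕ) (t : ℝ) : ℝ :=
  if w = par m v then 1 - (stdHeight m i v + t) / i else 1 + t * (1 - t)

/-- The angle along the curve of the edge from `v` to `w`. -/
noncomputable def edgeAngle (m i v w : ℕ) (t : ℝ) : ℝ :=
  if w = par m v then stdAngle m i v + t * ((endAngle m i v : ℝ) - stdAngle m i v)
  else stdAngle m i v + t * ((stdAngle m i w : ℝ) - stdAngle m i v)

/-- The curve of the edge from `v` to `w`. -/
noncomputable def edgePath (m i v w : ℕ) (t : ℝ) : ℂ := polar m (edgeRadius m i v w t) (edgeAngle m i v w t)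

theorem continuous_edgePath (v w : ℕ) : Continuous (edgePath m i v w) := by
  have h1 : Continuous (edgeRadius m i v w) := by unfold edgeRadius; split_ifs <;> fun_prop
  have h2 : Continuous (edgeAngle m i v w) := by unfold edgeAngle; split_ifs <;> fun_prop
  exact continuous_polar.comp (h1.prodMk h2)

theorem edgePath_tree (v : ℕ) (t : ℝ) : edgePath m i v (par m v) t =
    polar m (1 - (stdHeight m i v + t) / i) (stdAngle m i v + t * ((endAngle m i v : ℝ) - stdAngle m i v)) := by
  rw [edgePath, edgeRadius, edgeAngle, if_pos rfl, if_pos rfl]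

theorem edgePath_outer {v w : ℕ} (h : w ≠ par m v) (t : ℝ) : edgePath m i v w t =
    polar m (1 + t * (1 - t)) (stdAngle m i v + t * ((stdAngle m i w : ℝ) - stdAngle m i v)) := by
  rw [edgePath, edgeRadius, edgeAngle, if_neg h, if_neg h]

theorem stdAngle_lt (hf : DrawFacts m i) {v w : ℕ} (hw : w < 6 * m - 3) (hvw : v < w)
    (hh : stdHeight m i v = stdHeight m i w) : stdAngle m i v < stdAngle m i w := by
  have := hf.base_le v (hvw.trans hw)
  rw [stdAngle, stdAngle, ← hh]
  exact Nat.mul_lt_mul_of_pos_left (by omega) (by positivity)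

theorem endAngle_le (hf : DrawFacts m i) {v w : ℕ} (hw : w < 6 * m - 3) (hvw : v < w)
    (hh : stdHeight m i v = stdHeight m i w) : endAngle m i v ≤ endAngle m i w := by
  rw [endAngle, endAngle, hh]
  split_ifs with h
  · exact (stdAngle_lt hf hw hvw hh).le
  · have h1 := hf.height_par v (hvw.trans hw)
    have h2 := hf.height_par w hw
    have h3 : par m v ≤ par m w := by rw [par_def, par_def]; omega
    rcases h3.eq_or_lt with h3 | h3
    · rw [h3]
    · refine (stdAngle_lt hf ?_ h3 (by omega)).le
      by_contra hn
      have : par m w = 6 * m - 3 := by have := (par_lt hw).2; omega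
      rw [this, hf.height_root] at h2
      omega

theorem eq_of_height_eq (hf : DrawFacts m i) {v w : ℕ} (hv : v < 6 * m - 2) (hw : w < 6 * m - 2)
    (h : stdHeight m i v = stdHeight m i w) (ha : v < 6 * m - 3 → w < 6 * m - 3 → stdAngle m i v = stdAngle m i w) :
    v = w := by
  have hlt : ∀ {v}, v < 6 * m - 2 → (v < 6 * m - 3 ∧ stdHeight m i v < i) ∨ (v = 6 * m - 3 ∧ stdHeight m i v = i) := by
    intro v hv
    rcases Nat.lt_or_ge v (6 * m - 3) with h | h
    · exact .inl ⟨h, hf.height_lt v h⟩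
    · obtain rfl : v = 6 * m - 3 := by omega
      exact .inr ⟨rfl, hf.height_root⟩
  rcases hlt hv with ⟨h1, h1'⟩ | ⟨h1, h1'⟩ <;> rcases hlt hw with ⟨h2, h2'⟩ | ⟨h2, h2'⟩
  · have := ha h1 h2
    rcases lt_trichotomy v w with h3 | h3 | h3
    · exact absurd this (stdAngle_lt hf h2 h3 h).ne
    · exact h3
    · exact absurd this (stdAngle_lt hf h1 h3 h.symm).ne'
  all_goals omega

theorem stdHeight_le (hf : DrawFacts m i) {v : ℕ} (hv : v < 6 * m - 2) : stdHeight m i v ≤ i := by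
  rcases Nat.lt_or_ge v (6 * m - 3) with h | h
  · exact (hf.height_lt v h).le
  · obtain rfl : v = 6 * m - 3 := by omega
    exact hf.height_root.le

theorem radius_nonneg (hf : DrawFacts m i) (hi : 1 ≤ i) {v : ℕ} (hv : v < 6 * m - 2) : 0 ≤ radius m i v := by
  have hi' : (0 : ℝ) < i := by exact_mod_cast hi
  have : (stdHeight m i v : ℝ) ≤ i := by exact_mod_cast stdHeight_le hf hv
  rw [radius, sub_nonneg, div_le_one hi']
  exact this

theorem radius_pos (hf : DrawFacts m i) (hi : 1 ≤ i) {v : ℕ} (hv : v < 6 * m - 3) : 0 < radius m i v := by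
  have hi' : (0 : ℝ) < i := by exact_mod_cast hi
  have : (stdHeight m i v : ℝ) < i := by exact_mod_cast hf.height_lt v hv
  rw [radius, sub_pos, div_lt_one hi']
  exact this

theorem norm_point (hf : DrawFacts m i) (hi : 1 ≤ i) {v : ℕ} (hv : v < 6 * m - 2) : ‖point m i v‖ = radius m i v :=
  norm_polar (radius_nonneg hf hi hv) _

theorem abs_sub_lt_of_mem {a b : ℝ} (ha : 1 ≤ a ∧ a ≤ 6 * m - 1) (hb : 1 ≤ b ∧ b ≤ 6 * m - 1) : |a - b| < 6 * m := by
  rw [abs_lt]; constructor <;> linarith [ha.1, ha.2, hb.1, hb.2]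

theorem angle_mem (hf : DrawFacts m i) {v : ℕ} (hv : v < 6 * m - 3) :
    (1 : ℝ) ≤ stdAngle m i v ∧ (stdAngle m i v : ℝ) ≤ 6 * m - 1 := by
  obtain ⟨h1, h2⟩ := hf.angle v hv
  refine ⟨by exact_mod_cast h1, ?_⟩
  have : stdAngle m i v + 1 ≤ 6 * m := by omega
  have : (stdAngle m i v : ℝ) + 1 ≤ 6 * m := by exact_mod_cast this
  linarith

theorem endAngle_mem (hf : DrawFacts m i) {v : ℕ} (hv : v < 6 * m - 3) :
    (1 : ℝ) ≤ endAngle m i v ∧ (endAngle m i v : ℝ) ≤ 6 * m - 1 := by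
  obtain ⟨h1, h2⟩ := hf.endAngle v hv
  refine ⟨by exact_mod_cast h1, ?_⟩
  have : endAngle m i v + 1 ≤ 6 * m := by omega
  have : (endAngle m i v : ℝ) + 1 ≤ 6 * m := by exact_mod_cast this
  linarith

theorem treeAngle_mem (hf : DrawFacts m i) {v : ℕ} (hv : v < 6 * m - 3) {t : ℝ} (h0 : 0 ≤ t) (h1 : t ≤ 1) :
    1 ≤ stdAngle m i v + t * ((endAngle m i v : ℝ) - stdAngle m i v) ∧
      stdAngle m i v + t * ((endAngle m i v : ℝ) - stdAngle m i v) ≤ 6 * m - 1 := by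
  obtain ⟨a1, a2⟩ := angle_mem hf hv
  obtain ⟨b1, b2⟩ := endAngle_mem hf hv
  constructor <;> nlinarith

theorem point_injective (hf : DrawFacts m i) (hm : 1 ≤ m) (hi : 1 ≤ i) {v w : ℕ} (hv : v < 6 * m - 2) (hw : w < 6 * m - 2)
    (h : point m i v = point m i w) : v = w := by
  have hi' : (i : ℝ) ≠ 0 := by exact_mod_cast (by omega : i ≠ 0)
  have hh : stdHeight m i v = stdHeight m i w := by
    have := congrArg norm h
    rw [norm_point hf hi hv, norm_point hf hi hw, radius, radius, sub_right_inj, div_left_inj' hi'] at this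
    exact_mod_cast this
  refine eq_of_height_eq hf hv hw hh fun hv' hw' => ?_
  have := (polar_inj hm (radius_pos hf hi hv') (radius_nonneg hf hi hw) h
    (abs_sub_lt_of_mem (angle_mem hf hv') (angle_mem hf hw'))).2
  exact_mod_cast this

theorem edgePath_zero {v w : ℕ} (hvw : w = par m v ∨ stdHeight m i v = 0) : edgePath m i v w 0 = point m i v := by
  by_cases h : w = par m v
  · subst h
    rw [edgePath_tree, point, radius]; simp
  · rw [edgePath_outer h, point, radius, hvw.resolve_left h]; simp

theorem edgePath_one (hf : DrawFacts m i) (hi : 1 ≤ i) {v w : ℕ} (hv : v < 6 * m - 3)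
    (hvw : w = par m v ∨ stdHeight m i w = 0) : edgePath m i v w 1 = point m i w := by
  have hi' : (i : ℝ) ≠ 0 := by exact_mod_cast (by omega : i ≠ 0)
  by_cases h : w = par m v
  · subst h
    have hp := hf.height_par v hv
    rw [edgePath_tree, point, radius, hp]
    push_cast
    by_cases hr : stdHeight m i v + 1 = i
    · have : ((stdHeight m i v : ℝ) + 1) = i := by exact_mod_cast hr
      rw [this, div_self hi', sub_self, polar_zero, polar_zero]
    · rw [endAngle, if_neg hr]; congr 1; ring
  · rw [edgePath_outer h, point, radius, hvw.resolve_left h]; simp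

theorem norm_edgePath_tree (hf : DrawFacts m i) (hi : 1 ≤ i) {v : ℕ} (hv : v < 6 * m - 3) {t : ℝ} (h1 : t ≤ 1) :
    ‖edgePath m i v (par m v) t‖ = 1 - (stdHeight m i v + t) / i := by
  have hi' : (0 : ℝ) < i := by exact_mod_cast hi
  have h2 : (stdHeight m i v : ℝ) + 1 ≤ i := by exact_mod_cast hf.height_lt v hv
  rw [edgePath_tree, norm_polar]
  rw [sub_nonneg, div_le_one hi']
  linarith

theorem norm_edgePath_outer {v w : ℕ} (h : w ≠ par m v) {t : ℝ} (h0 : 0 ≤ t) (h1 : t ≤ 1) :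
    ‖edgePath m i v w t‖ = 1 + t * (1 - t) := by
  rw [edgePath_outer h, norm_polar]
  nlinarith

/-- A vertex on the curve of an edge is one of its ends. -/
theorem edgePath_eq_point (hf : DrawFacts m i) (hi : 1 ≤ i) {v w u : ℕ} (hv : v < 6 * m - 3)
    (hu : u < 6 * m - 2) {t : ℝ} (h0 : 0 ≤ t) (h1 : t ≤ 1) (h : edgePath m i v w t = point m i u) :
    t = 0 ∨ t = 1 := by
  have hi' : (0 : ℝ) < i := by exact_mod_cast hi
  have hn := congrArg norm h
  rw [norm_point hf hi hu, radius] at hn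
  by_cases hw : w = par m v
  · subst hw
    rw [norm_edgePath_tree hf hi hv h1, sub_right_inj, div_left_inj' hi'.ne'] at hn
    by_contra hne
    rw [not_or] at hne
    have h0' := lt_of_le_of_ne h0 (Ne.symm hne.1)
    have h1' := lt_of_le_of_ne h1 hne.2
    have e1 : (stdHeight m i v : ℝ) < stdHeight m i u := by linarith
    have e2 : (stdHeight m i u : ℝ) < stdHeight m i v + 1 := by linarith
    have e1 : stdHeight m i v < stdHeight m i u := by exact_mod_cast e1
    have e2 : stdHeight m i u < stdHeight m i v + 1 := by exact_mod_cast e2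
    omega
  · rw [norm_edgePath_outer hw h0 h1] at hn
    have : (0 : ℝ) ≤ stdHeight m i u / i := by positivity
    have h3 : t * (1 - t) ≤ 0 := by linarith
    rcases h0.eq_or_lt with h | h
    · exact .inl h.symm
    · right; nlinarith

theorem edgePath_injOn (hf : DrawFacts m i) (hm : 1 ≤ m) (hi : 1 ≤ i) {v w : ℕ} (hv : v < 6 * m - 3) (hvw : v ≠ w)
    (hw : w = par m v ∨ (v < 3 * m ∧ w < 3 * m)) {t s : ℝ} (ht : t ∈ Set.Icc (0 : ℝ) 1) (hs : s ∈ Set.Icc (0 : ℝ) 1)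
    (h : edgePath m i v w t = edgePath m i v w s) : t = s := by
  have hi' : (0 : ℝ) < i := by exact_mod_cast hi
  by_cases hp : w = par m v
  · subst hp
    have hn := congrArg norm h
    rw [norm_edgePath_tree hf hi hv ht.2, norm_edgePath_tree hf hi hv hs.2, sub_right_inj,
      div_left_inj' hi'.ne'] at hn
    linarith
  · obtain ⟨hv3, hw3⟩ := hw.resolve_left hp
    have a1 := angle_mem hf hv
    have a2 := angle_mem hf (v := w) (by omega)
    rw [edgePath_outer hp, edgePath_outer hp] at h
    have hpos : ∀ {t : ℝ}, t ∈ Set.Icc (0 : ℝ) 1 → 0 < 1 + t * (1 - t) := fun ht => by nlinarith [ht.1, ht.2]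
    have hang : ∀ {t : ℝ}, t ∈ Set.Icc (0 : ℝ) 1 →
        1 ≤ stdAngle m i v + t * ((stdAngle m i w : ℝ) - stdAngle m i v) ∧
        stdAngle m i v + t * ((stdAngle m i w : ℝ) - stdAngle m i v) ≤ 6 * m - 1 := fun ht => by
      constructor <;> nlinarith [ht.1, ht.2, a1.1, a1.2, a2.1, a2.2]
    have := (polar_inj hm (hpos ht) (hpos hs).le h (abs_sub_lt_of_mem (hang ht) (hang hs))).2
    have hne : (stdAngle m i w : ℝ) - stdAngle m i v ≠ 0 := by
      intro h0
      have : stdAngle m i v = stdAngle m i w := by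
        have : (stdAngle m i v : ℝ) = stdAngle m i w := by linarith
        exact_mod_cast this
      exact hvw (eq_of_height_eq hf (by omega) (by omega)
        (by rw [hf.height_leaf v hv3, hf.height_leaf w hw3]) fun _ _ => this)
    exact mul_right_cancel₀ hne (by linarith)

/-- Two curves of different tree edges meet in a common end. -/
theorem treePath_meet (hf : DrawFacts m i) (hm : 1 ≤ m) (hi : 1 ≤ i) {v w : ℕ} (hv : v < 6 * m - 3)
    (hw : w < 6 * m - 3) (hvw : v < w) {t s : ℝ} (ht : t ∈ Set.Icc (0 : ℝ) 1) (hs : s ∈ Set.Icc (0 : ℝ) 1)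
    (h : edgePath m i v (par m v) t = edgePath m i w (par m w) s) :
    (t = 1 ∧ s = 1) ∨ (t = 1 ∧ s = 0) ∨ (t = 0 ∧ s = 1) := by
  have hi' : (0 : ℝ) < i := by exact_mod_cast hi
  have hn := congrArg norm h
  rw [norm_edgePath_tree hf hi hv ht.2, norm_edgePath_tree hf hi hw hs.2, sub_right_inj,
    div_left_inj' hi'.ne'] at hn
  rcases lt_trichotomy (stdHeight m i v) (stdHeight m i w) with hh | hh | hh
  · have : (stdHeight m i v : ℝ) + 1 ≤ stdHeight m i w := by exact_mod_cast hh
    exact .inr (.inl ⟨by linarith [ht.2, hs.1], by linarith [ht.2, hs.1]⟩)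
  · have hts : t = s := by rw [hh] at hn; linarith
    subst hts
    by_contra hne
    have ht1 : t < 1 := lt_of_le_of_ne ht.2 fun h => hne (.inl ⟨h, h⟩)
    have hlt : (stdHeight m i v : ℝ) + 1 ≤ i := by exact_mod_cast hf.height_lt v hv
    rw [edgePath_tree, edgePath_tree] at h
    have hpos : 0 < 1 - ((stdHeight m i v : ℝ) + t) / i := by
      rw [sub_pos, div_lt_one hi']; linarith
    have := (polar_inj hm hpos (by rw [← hh]; exact hpos.le) h (abs_sub_lt_of_mem
      (treeAngle_mem hf hv ht.1 ht.2) (treeAngle_mem hf hw ht.1 ht.2))).2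
    have e1 : (stdAngle m i v : ℝ) < stdAngle m i w := by exact_mod_cast stdAngle_lt hf hw hvw hh
    have e2 : (endAngle m i v : ℝ) ≤ endAngle m i w := by exact_mod_cast endAngle_le hf hw hvw hh
    nlinarith [ht.1]
  · have : (stdHeight m i w : ℝ) + 1 ≤ stdHeight m i v := by exact_mod_cast hh
    exact .inr (.inr ⟨by linarith [ht.1, hs.2], by linarith [ht.1, hs.2]⟩)

end

theorem IsSimpleCurve.symm {S : Set ℂ} {p q : ℂ} (h : IsSimpleCurve S p q) : IsSimpleCurve S q p := by
  obtain ⟨γ, h1, h2, h3, h4, h5⟩ := h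
  refine ⟨γ ∘ unitInterval.symm, h1.comp unitInterval.continuous_symm,
    h2.comp unitInterval.symm_bijective.injective, by simp [h4], by simp [h3], ?_⟩
  rw [Set.range_comp, unitInterval.symm_bijective.surjective.range_eq, Set.image_univ, h5]

section
variable {m i : ℕ}

/-- The curve of an edge, which runs from the smaller to the larger end. -/
noncomputable def edgeCurve (m i : ℕ) (e : Sym2 (Fin (6 * m - 2))) : Set ℂ :=
  Set.range fun t : unitInterval => edgePath m i e.inf e.sup t

theorem edgeCurve_mk {a b : Fin (6 * m - 2)} (h : a < b) :
    edgeCurve m i s(a, b) = Set.range fun t : unitInterval => edgePath m i a b t := by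
  rw [edgeCurve, Sym2.inf_mk, Sym2.sup_mk, min_eq_left h.le, max_eq_right h.le]

theorem edge_cases {G : SimpleGraph (Fin (6 * m - 2))} (hm : 1 ≤ m) (hG : stdTree m ≤ G) (hc : ∀ v, deg G v = 3)
    (hd : TreeDeg m) {a b : Fin (6 * m - 2)} (hab : G.Adj a b) (h : a < b) :
    a.val < 6 * m - 3 ∧ (b.val = par m a ∨ (a.val < 3 * m ∧ b.val < 3 * m)) := by
  have h' : a.val < b.val := h
  refine ⟨by have := b.2; omega, ?_⟩
  by_cases hb : b.val < 3 * m
  · exact .inr ⟨by omega, hb⟩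
  · left
    have hT := adj_of_inner hG hc hd (not_lt.1 hb) hab
    rcases hT.2 with h1 | h1
    · exact h1
    · have := par_lt (m := m) (v := b)
      by_cases hb' : b.val < 6 * m - 3
      · have := (par_lt hb').1; omega
      · have := b.2; rw [par_def] at h1; omega

/-- The drawing of a rotation graph in which leaves lie on the unit circle and leaf edges outside of it.
-/
noncomputable def stdDrawing {G : SimpleGraph (Fin (6 * m - 2))} (hf : DrawFacts m i) (hm : 1 ≤ m) (hi : 1 ≤ i)
    (hG : stdTree m ≤ G) (hc : ∀ v, deg G v = 3) (hd : TreeDeg m) : Drawing G where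
  pt v := point m i v
  curve := edgeCurve m i
  pt_injective v w h := Fin.ext (point_injective hf hm hi v.2 w.2 h)
  curve_simple := by
    have key : ∀ a b, G.Adj a b → a < b → IsSimpleCurve (edgeCurve m i s(a, b)) (point m i a) (point m i b) := by
      intro a b hab h
      obtain ⟨ha, hb⟩ := edge_cases hm hG hc hd hab h
      rw [edgeCurve_mk h]
      refine ⟨_, (continuous_edgePath a b).comp continuous_subtype_val, fun t s hts => ?_, ?_, ?_, rfl⟩
      · exact Subtype.ext (edgePath_injOn hf hm hi ha (fun h' => h.ne (Fin.ext h')) hb t.2 s.2 hts)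
      · exact edgePath_zero (hb.imp_right fun h => hf.height_leaf _ h.1)
      · exact edgePath_one hf hi ha (hb.imp_right fun h => hf.height_leaf _ h.2)
    intro a b hab
    rcases lt_or_gt_of_ne hab.ne with h | h
    · exact key a b hab h
    · rw [Sym2.eq_swap]; exact (key b a hab.symm h).symm
  curve_avoids := by
    have key : ∀ a b, G.Adj a b → a < b → ∀ v : Fin (6 * m - 2), point m i v ∈ edgeCurve m i s(a, b) →
        v ∈ s(a, b) := by
      intro a b hab h v hv
      obtain ⟨ha, hb⟩ := edge_cases hm hG hc hd hab h
      rw [edgeCurve_mk h] at hv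
      obtain ⟨t, ht⟩ := hv
      simp only at ht
      rw [Sym2.mem_iff]
      rcases edgePath_eq_point hf hi ha v.2 t.2.1 t.2.2 ht with h0 | h1
      · rw [h0, edgePath_zero (hb.imp_right fun h => hf.height_leaf _ h.1)] at ht
        exact .inl (Fin.ext (point_injective hf hm hi a.2 v.2 ht).symm)
      · rw [h1, edgePath_one hf hi ha (hb.imp_right fun h => hf.height_leaf _ h.2)] at ht
        exact .inr (Fin.ext (point_injective hf hm hi b.2 v.2 ht).symm)
    intro e he v hv
    induction e using Sym2.ind with
    | _ a b =>
    have hab : G.Adj a b := he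
    rcases lt_or_gt_of_ne hab.ne with h | h
    · exact key a b hab h v hv
    · rw [Sym2.eq_swap] at hv ⊢; exact key b a hab.symm h v hv

/-- The points of a tree edge. -/
theorem mem_edgeCurve_tree {e : Sym2 (Fin (6 * m - 2))} (he : e ∈ (stdTree m).edgeSet) :
    ∃ v w : Fin (6 * m - 2), e = s(v, w) ∧ v.val < 6 * m - 3 ∧ w.val = par m v ∧
      ∀ z ∈ edgeCurve m i e, ∃ t ∈ Set.Icc (0 : ℝ) 1, z = edgePath m i v (par m v) t := by
  obtain ⟨v, w, rfl, hv, hw⟩ := stdTree_edge he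
  refine ⟨v, w, rfl, hv, hw, fun z hz => ?_⟩
  rw [edgeCurve_mk (by rw [Fin.lt_def, hw]; exact (par_lt hv).1)] at hz
  obtain ⟨t, rfl⟩ := hz
  exact ⟨t, t.2, by rw [← hw]⟩

theorem stdDrawing_planar {G : SimpleGraph (Fin (6 * m - 2))} (hf : DrawFacts m i) (hm : 1 ≤ m) (hi : 1 ≤ i)
    (hG : stdTree m ≤ G) (hc : ∀ v, deg G v = 3) (hd : TreeDeg m) :
    (stdDrawing hf hm hi hG hc hd).PlanarOn (stdTree m) := by
  rintro e he f hf' hef z ⟨hze, hzf⟩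
  obtain ⟨v, v', rfl, hv, hv', hz⟩ := mem_edgeCurve_tree (i := i) he
  obtain ⟨w, w', rfl, hw, hw', hz'⟩ := mem_edgeCurve_tree (i := i) hf'
  obtain ⟨t, ht, h1⟩ := hz z hze
  obtain ⟨s, hs, h2⟩ := hz' z hzf
  have hvw : v.val ≠ w.val := by
    intro h
    obtain rfl := Fin.ext h
    exact hef (by rw [Fin.ext (hv'.trans hw'.symm)])
  have start : ∀ u : ℕ, edgePath m i u (par m u) 0 = point m i u := fun u => edgePath_zero (.inl rfl)
  have path_end : ∀ u < 6 * m - 3, edgePath m i u (par m u) 1 = point m i (par m u) := fun u hu =>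
    edgePath_one hf hi hu (.inl rfl)
  have hmeet : (t = 1 ∧ s = 1) ∨ (t = 1 ∧ s = 0) ∨ (t = 0 ∧ s = 1) := by
    rcases lt_or_gt_of_ne hvw with h | h
    · exact treePath_meet hf hm hi hv hw h ht hs (h1.symm.trans h2)
    · rcases treePath_meet hf hm hi hw hv h hs ht (h2.symm.trans h1) with h | h | h
      exacts [.inl h.symm, .inr (.inr h.symm), .inr (.inl h.symm)]
  rcases hmeet with ⟨rfl, rfl⟩ | ⟨rfl, rfl⟩ | ⟨rfl, rfl⟩
  · rw [path_end _ hv, ← hv'] at h1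
    rw [path_end _ hw, ← hw'] at h2
    have : v' = w' := Fin.ext (point_injective hf hm hi v'.2 w'.2 (h1.symm.trans h2))
    exact ⟨v', Sym2.mem_mk_right _ _, by rw [this]; exact Sym2.mem_mk_right _ _, h1⟩
  · rw [path_end _ hv, ← hv'] at h1
    rw [start] at h2
    have : v' = w := Fin.ext (point_injective hf hm hi v'.2 w.2 (h1.symm.trans h2))
    exact ⟨v', Sym2.mem_mk_right _ _, by rw [this]; exact Sym2.mem_mk_left _ _, h1⟩
  · rw [start] at h1
    rw [path_end _ hw, ← hw'] at h2
    have : v = w' := Fin.ext (point_injective hf hm hi v.2 w'.2 (h1.symm.trans h2))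
    exact ⟨v, Sym2.mem_mk_left _ _, by rw [this]; exact Sym2.mem_mk_right _ _, h1⟩

/-- The open sector between the last leaf and the first one. -/
theorem sector {W : Set ℂ}
    (hW : ∀ r θ : ℝ, 0 < r → r < 1 → |θ| < 1 → polar m r θ ∉ W) :
    ∃ z ∈ Wᶜ, ∀ r θ : ℝ, 0 ≤ r → r ≤ 1 → |θ| ≤ 1 → polar m r θ ∈ W →
      polar m r θ ∈ frontier (connectedComponentIn Wᶜ z) := by
  let P : ℝ × ℝ → ℂ := fun p => polar m p.1 p.2
  let B : Set (ℝ × ℝ) := Set.Ioo 0 1 ×ˢ Set.Ioo (-1) 1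
  have hB : P '' B ⊆ Wᶜ := by
    rintro _ ⟨⟨r, θ⟩, ⟨h1, h2⟩, rfl⟩
    exact hW r θ h1.1 h1.2 (abs_lt.2 h2)
  have h0 : ((1 / 2, 0) : ℝ × ℝ) ∈ B := ⟨by norm_num, by norm_num⟩
  have hpre : IsPreconnected (P '' B) :=
    (isPreconnected_Ioo.prod isPreconnected_Ioo).image _ continuous_polar.continuousOn
  refine ⟨P (1 / 2, 0), hB ⟨_, h0, rfl⟩, fun r θ hr hr' hθ hz => ?_⟩
  have hsub := hpre.subset_connectedComponentIn ⟨_, h0, rfl⟩ hB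
  have hcl : P (r, θ) ∈ closure (P '' B) := by
    refine image_closure_subset_closure_image continuous_polar ⟨(r, θ), ?_, rfl⟩
    rw [closure_prod_eq, closure_Ioo (by norm_num), closure_Ioo (by norm_num)]
    exact ⟨⟨hr, hr'⟩, abs_le.1 hθ⟩
  exact ⟨closure_mono hsub hcl, fun hint => connectedComponentIn_subset _ _ (interior_subset hint) hz⟩

theorem polar_turn (hm : 1 ≤ m) (r θ : ℝ) : polar m r (θ + 6 * m) = polar m r θ := by
  have hm' : (m : ℝ) ≠ 0 := by exact_mod_cast (by omega : m ≠ 0)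
  have : -((θ + 6 * m) * (Real.pi / (3 * m))) = -(θ * (Real.pi / (3 * m))) - 2 * Real.pi := by
    field_simp; ring
  rw [polar, polar, this, Complex.ofReal_sub, sub_mul, Complex.exp_sub]
  have : Complex.exp (((2 * Real.pi : ℝ) : ℂ) * Complex.I) = 1 := by
    push_cast; exact Complex.exp_two_pi_mul_I
  rw [this, div_one]

theorem isRotationHist_std {G : SimpleGraph (Fin (6 * m - 2))} (hf : DrawFacts m i) (hm : 1 ≤ m) (hi : 1 ≤ i)
    (hd : TreeDeg m) (hG : RotGraph m G) : IsRotationHist i G (stdTree m) := by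
  have hm' : (0 : ℝ) < m := by exact_mod_cast hm
  have hm0 : NeZero (3 * m) := ⟨by omega⟩
  have hi' : (0 : ℝ) < i := by exact_mod_cast hi
  have hval : ∀ a : ZMod (3 * m), a.val < 3 * m := ZMod.val_lt
  let D := stdDrawing hf hm hi hG.tree_le hG.cubic hd
  let label : ZMod (3 * m) → Fin (6 * m - 2) := fun a => ⟨a.val, by have := hval a; omega⟩
  have hpt : ∀ a, D.pt (label a) = polar m 1 (2 * a.val + 1) := by
    intro a
    change point m i a.val = _
    have h := hf.height_leaf _ (hval a)
    rw [point, radius, stdAngle, h]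
    simp
  have hπ : 0 < Real.pi / (3 * m) := by have := Real.pi_pos; positivity
  -- the set of the points of the tree and the circle avoids the sector
  have hsector : ∀ r θ : ℝ, 0 < r → r < 1 → |θ| < 1 → polar m r θ ∉ D.withCircle (stdTree m) 0 1 := by
    rintro r θ hr hr1 hθ (hz | hz)
    · simp only [Set.mem_iUnion] at hz
      obtain ⟨e, he, hz⟩ := hz
      obtain ⟨v, w, rfl, hv, hw, h⟩ := mem_edgeCurve_tree (i := i) he
      obtain ⟨t, ht, h⟩ := h _ hz
      rw [edgePath_tree] at h
      have hang := treeAngle_mem hf hv ht.1 ht.2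
      have h2 : (stdHeight m i v : ℝ) + 1 ≤ i := by exact_mod_cast hf.height_lt v hv
      have := (polar_inj hm hr (by rw [sub_nonneg, div_le_one hi']; linarith [ht.2]) h (by
        rw [abs_lt] at hθ ⊢; constructor <;> linarith [hang.1, hang.2])).2
      rw [abs_lt] at hθ
      linarith [hang.1]
    · rw [mem_sphere_zero_iff_norm, norm_polar hr.le] at hz
      linarith
  obtain ⟨z, hz, hfr⟩ := sector hsector
  refine ⟨hG.tree_le, ⟨6 * m - 3, by omega⟩, 3 * m, label, D, 0, 1, fun a => -((2 * a.val + 1) * (Real.pi / (3 * m))),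
    isTreeT_stdTree hf hd hm, ⟨?_, ?_, ?_⟩, stdDrawing_planar hf hm hi hG.tree_le hG.cubic hd, one_pos, ?_, ?_, ?_,
    ?_, ⟨z, hz, ?_, ?_, ?_⟩, ?_⟩
  · intro a _
    exact (mem_leaves_stdTree hm hd _).2 (hval a)
  · intro a _ b _ h
    exact ZMod.val_injective _ (congrArg Fin.val h)
  · intro v hv
    have hv3 := (mem_leaves_stdTree hm hd v).1 hv
    exact ⟨(v.val : ZMod (3 * m)), trivial, Fin.ext (ZMod.val_cast_of_lt hv3)⟩
  · intro e he z hz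
    obtain ⟨v, w, rfl, hv, hw, h⟩ := mem_edgeCurve_tree (i := i) he
    obtain ⟨t, ht, rfl⟩ := h _ hz
    by_cases h0 : 0 < stdHeight m i v + t
    · left
      rw [mem_ball_zero_iff, norm_edgePath_tree hf hi hv ht.2]
      have : 0 < (stdHeight m i v + t) / i := by positivity
      linarith
    · right
      have hz : (0 : ℝ) ≤ stdHeight m i v := by positivity
      obtain rfl : t = 0 := by linarith [ht.1]
      refine ⟨v, (mem_leaves_stdTree hm hd v).2 ?_, edgePath_zero (.inl rfl)⟩
      by_contra hn
      have := hf.height_inner v v.2 (not_lt.1 hn)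
      have h1 : (1 : ℝ) ≤ stdHeight m i v := by exact_mod_cast Nat.one_le_iff_ne_zero.2 this
      linarith
  · intro a
    rw [hpt, polar, zero_add]
  · intro a b hab
    have : (a.val : ℝ) < b.val := by exact_mod_cast hab
    nlinarith
  · intro a
    have h1 : (a.val : ℝ) < 3 * m := by exact_mod_cast hval a
    have h2 : 2 * Real.pi = (2 * (3 * m)) * (Real.pi / (3 * m)) := by field_simp
    simp only [h2, ZMod.val_zero, Nat.cast_zero]
    nlinarith
  · have hmem : D.pt (label (-1)) ∈ D.withCircle (stdTree m) 0 1 := by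
      right; rw [hpt, mem_sphere_zero_iff_norm, norm_polar zero_le_one]
    have h1 : (-1 : ZMod (3 * m)).val = 3 * m - 1 := by
      obtain ⟨k, hk⟩ : ∃ k, 3 * m = k + 1 := ⟨3 * m - 1, by omega⟩
      rw [hk]; exact ZMod.val_neg_one k
    have h2 : polar m 1 (2 * (-1 : ZMod (3 * m)).val + 1) = polar m 1 (-1) := by
      rw [← polar_turn hm 1 (-1), h1, Nat.cast_sub (by omega)]
      congr 1; push_cast; ring
    rw [hpt, h2] at hmem ⊢
    exact hfr 1 (-1) zero_le_one le_rfl (by norm_num) hmem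
  · have hmem : D.pt (label 0) ∈ D.withCircle (stdTree m) 0 1 := by
      right; rw [hpt, mem_sphere_zero_iff_norm, norm_polar zero_le_one]
    rw [hpt] at hmem ⊢
    refine hfr 1 _ zero_le_one le_rfl ?_ hmem
    rw [ZMod.val_zero]; norm_num
  · have hp : D.pt ⟨6 * m - 3, by omega⟩ = polar m 0 0 := by
      change point m i (6 * m - 3) = _
      rw [point, radius, hf.height_root, div_self hi'.ne', sub_self, polar_zero, polar_zero]
    have hmem : D.pt ⟨6 * m - 3, by omega⟩ ∈ D.withCircle (stdTree m) 0 1 := by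
      left
      have hv : 6 * m - 4 < 6 * m - 3 := by omega
      have hpv : par m (6 * m - 4) = 6 * m - 3 := by have := (par_lt hv); omega
      have hadj : (stdTree m).Adj ⟨6 * m - 4, by omega⟩ ⟨6 * m - 3, by omega⟩ :=
        ⟨fun h => by have := congrArg Fin.val h; simp only at this; omega, .inl hpv.symm⟩
      refine Set.mem_biUnion (show s(_, _) ∈ (stdTree m).edgeSet from hadj) ?_
      change _ ∈ edgeCurve m i _
      rw [edgeCurve_mk (by rw [Fin.lt_def]; exact hv)]
      exact ⟨1, edgePath_one hf hi hv (.inl hpv.symm)⟩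
    rw [hp] at hmem ⊢
    exact hfr 0 0 le_rfl zero_le_one (by norm_num) hmem
  · intro a b hab
    have h3 : 3 * m / 3 = m := by omega
    have key : ∀ a : ZMod (3 * m), (label (a + ((3 * m / 3 : ℕ) : ZMod (3 * m)))).val = (a.val + m) % (3 * m) := by
      intro a
      change (a + _).val = _
      rw [h3, ZMod.val_add, ZMod.val_natCast, Nat.add_mod_mod]
    obtain ⟨h1, h2, h⟩ := hG.rot a.val b.val (hval a) (hval b) ⟨_, _, hab⟩
    convert h using 1
    · exact Fin.ext (key a)
    · exact Fin.ext (key b)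

end

/-! ### Transport along isomorphisms -/

section
variable {V W : Type*} {G T : SimpleGraph V} {H T' : SimpleGraph W} {i : ℕ}

theorem dist_iso_le (e : T ≃g T') (h : T.Connected) (a b : V) : T'.dist (e a) (e b) ≤ T.dist a b := by
  obtain ⟨p, hp⟩ := h.exists_walk_length_eq_dist a b
  rw [← hp, ← SimpleGraph.Walk.length_map e.toHom p]
  exact SimpleGraph.dist_le _

theorem dist_iso (e : T ≃g T') (h : T.Connected) (a b : V) : T'.dist (e a) (e b) = T.dist a b := by
  refine (dist_iso_le e h a b).antisymm ?_
  simpa using dist_iso_le e.symm (e.connected_iff.1 h) (e a) (e b)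

theorem mem_leaves_iso (e : T ≃g T') (v : V) : e v ∈ leaves T' ↔ v ∈ leaves T := by
  rw [leaves, leaves, Set.mem_ofPred_eq, Set.mem_ofPred_eq, deg_iso]

theorem IsTreeT.iso (e : T ≃g T') {x : V} (h : IsTreeT i T x) : IsTreeT i T' (e x) where
  isTree := e.isTree_iff.1 h.isTree
  deg_eq v := by
    obtain ⟨v, rfl⟩ := e.surjective v
    rw [deg_iso]
    exact h.deg_eq v
  deg_center := by rw [deg_iso, h.deg_center]
  dist_center v hv := by
    obtain ⟨v, rfl⟩ := e.surjective v
    rw [dist_iso e h.isTree.1, h.dist_center v ((mem_leaves_iso e v).1 hv)]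

/-- The drawing of an isomorphic graph by the same points and curves. -/
def Drawing.transport (D : Drawing G) (e : G ≃g H) : Drawing H where
  pt v := D.pt (e.symm v)
  curve s := D.curve (s.map e.symm)
  pt_injective := D.pt_injective.comp e.symm.injective
  curve_simple a b h := by
    rw [Sym2.map_mk]
    exact D.curve_simple _ _ (e.symm.map_adj_iff.2 h)
  curve_avoids s hs v hv := by
    induction s using Sym2.ind with
    | _ a b =>
    have := D.curve_avoids _ (e.symm.map_adj_iff.2 hs : s(e.symm a, e.symm b) ∈ G.edgeSet) _ hv
    simpa using this

theorem IsRotationHist.iso (e : G ≃g H) (ht : ∀ a b, T'.Adj (e a) (e b) ↔ T.Adj a b)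
    (h : IsRotationHist i G T) : IsRotationHist i H T' := by
  obtain ⟨hTG, x, l, label, D, c, r, θ, hT, hlab, hD, hr, hin, hpt, hθ, hθ2, hface, hrot⟩ := h
  let f : T ≃g T' := ⟨e.toEquiv, fun {a b} => ht a b⟩
  have hmem : ∀ s : Sym2 W, s ∈ T'.edgeSet ↔ s.map e.symm ∈ T.edgeSet := by
    intro s
    induction s using Sym2.ind with
    | _ a b =>
    have := ht (e.symm a) (e.symm b)
    rw [e.apply_symm_apply, e.apply_symm_apply] at this
    exact this
  have hleaf : ∀ v, v ∈ leaves T' ↔ e.symm v ∈ leaves T := by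
    intro v
    have := mem_leaves_iso f (e.symm v)
    rwa [show f (e.symm v) = v from e.apply_symm_apply v] at this
  have hcircle : (D.transport e).withCircle T' c r = D.withCircle T c r := by
    rw [Drawing.withCircle, Drawing.withCircle]
    congr 1
    ext z
    simp only [Set.mem_iUnion]
    constructor
    · rintro ⟨s, hs, hz⟩
      exact ⟨_, (hmem s).1 hs, hz⟩
    · rintro ⟨s, hs, hz⟩
      have h1 : (s.map e).map e.symm = s := by
        rw [Sym2.map_map]
        rw [show (e.symm ∘ e : V → V) = id from funext e.symm_apply_apply, Sym2.map_id, id]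
      refine ⟨s.map e, (hmem _).2 (by rwa [h1]), ?_⟩
      change z ∈ D.curve _
      rwa [h1]
  have hptl : ∀ v, (D.transport e).pt (e v) = D.pt v := fun v => congrArg D.pt (e.symm_apply_apply v)
  refine ⟨fun a b h => ?_, e x, l, fun a => e (label a), D.transport e, c, r, θ, hT.iso f, ⟨?_, ?_, ?_⟩, ?_, hr, ?_,
    ?_, hθ, hθ2, ?_, ?_⟩
  · rw [← e.symm.map_adj_iff]
    exact hTG ((hmem s(a, b)).1 h)
  · exact fun a ha => (mem_leaves_iso f _).2 (hlab.mapsTo ha)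
  · exact fun a ha b hb hab => hlab.injOn ha hb (e.injective hab)
  · intro v hv
    obtain ⟨a, ha, h⟩ := hlab.surjOn ((hleaf v).1 hv)
    exact ⟨a, ha, by change e (label a) = v; rw [h, e.apply_symm_apply]⟩
  · intro s hs t ht hst z hz
    obtain ⟨v, h1, h2, h3⟩ := hD _ ((hmem s).1 hs) _ ((hmem t).1 ht)
      (fun h => hst (Sym2.map.injective e.symm.injective h)) z hz
    refine ⟨e v, ?_, ?_, by rw [hptl]; exact h3⟩
    · obtain ⟨w, hw, rfl⟩ := Sym2.mem_map.1 h1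
      rwa [e.apply_symm_apply]
    · obtain ⟨w, hw, rfl⟩ := Sym2.mem_map.1 h2
      rwa [e.apply_symm_apply]
  · intro s hs z hz
    refine (hin _ ((hmem s).1 hs) z hz).imp id ?_
    rintro ⟨v, hv, rfl⟩
    exact ⟨e v, (mem_leaves_iso f v).2 hv, (hptl v).symm⟩
  · intro a
    rw [hptl, hpt]
  · simpa only [hcircle, hptl] using hface
  · intro a b h
    exact e.map_adj_iff.2 (hrot a b (e.map_adj_iff.1 h))

theorem map_map_symm (e : G ≃g H) (C : H.Subgraph) : (C.map e.symm.toHom).map e.toHom = C := by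
  have : e.toHom.comp e.symm.toHom = SimpleGraph.Hom.id := by
    ext v
    exact e.apply_symm_apply v
  rw [← SimpleGraph.Subgraph.map_comp, this, SimpleGraph.Subgraph.map_id]

theorem IsOuterCycle.iso (e : G ≃g H) (ht : ∀ a b, T'.Adj (e a) (e b) ↔ T.Adj a b) {C : G.Subgraph}
    (h : IsOuterCycle G T C) : IsOuterCycle H T' (C.map e.toHom) where
  connected := by
    let f : C.coe →g (C.map e.toHom).coe :=
      ⟨fun v => ⟨e v, v, v.2, rfl⟩, fun {a b} hab => ⟨a, b, hab, rfl, rfl⟩⟩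
    refine ⟨SimpleGraph.Connected.map f ?_ h.connected.coe⟩
    rintro ⟨_, v, hv, rfl⟩
    exact ⟨⟨v, hv⟩, rfl⟩
  two_regular := by
    rintro _ ⟨v, hv, rfl⟩
    have : (C.map e.toHom).neighborSet (e v) = e '' C.neighborSet v := by
      ext w
      constructor
      · rintro ⟨a, b, hab, ha, rfl⟩
        obtain rfl := e.injective ha
        exact ⟨b, hab, rfl⟩
      · rintro ⟨b, hb, rfl⟩
        exact ⟨v, b, hb, rfl, rfl⟩
    exact (congrArg Set.ncard this).trans ((Set.ncard_image_of_injective _ e.injective).trans (h.two_regular v hv))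
  verts_subset := by
    rintro _ ⟨v, hv, rfl⟩
    exact (mem_leaves_iso (⟨e.toEquiv, fun {a b} => ht a b⟩ : T ≃g T') v).2 (h.verts_subset hv)

theorem oc_iso [Finite V] [Finite W] (e : G ≃g H) (ht : ∀ a b, T'.Adj (e a) (e b) ↔ T.Adj a b) :
    oc G T = oc H T' := by
  have ht' : ∀ a b, T.Adj (e.symm a) (e.symm b) ↔ T'.Adj a b := by
    intro a b
    rw [← ht, e.apply_symm_apply, e.apply_symm_apply]
  refine Multiset.map_eq_map_of_bij_of_nodup _ _ (Finset.nodup _) (Finset.nodup _)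
    (fun C _ => C.map e.toHom) ?_ ?_ ?_ ?_
  · intro C hC
    simp only [Finset.mem_val, Set.Finite.mem_toFinset, Set.mem_ofPred_eq] at hC ⊢
    exact hC.iso e ht
  · intro C _ C' _ h
    have := congrArg (SimpleGraph.Subgraph.map e.symm.toHom) h
    exact (map_map_symm e.symm C).symm.trans (this.trans (map_map_symm e.symm C'))
  · intro C hC
    simp only [Finset.mem_val, Set.Finite.mem_toFinset, Set.mem_ofPred_eq] at hC ⊢
    exact ⟨C.map e.symm.toHom, hC.iso e.symm ht', map_map_symm e C⟩
  · intro C _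
    exact (Set.ncard_image_of_injective _ e.injective).symm

theorem IsRotationSnarkWith.iso [Finite V] [Finite W] (e : G ≃g H) {S : Multiset ℕ} (h : IsRotationSnarkWith i S G) :
    IsRotationSnarkWith i S H := by
  obtain ⟨hi, hs, T, hT, hS⟩ := h
  have ht : ∀ a b, (T.map e.toEquiv.toEmbedding).Adj (e a) (e b) ↔ T.Adj a b := fun a b =>
    SimpleGraph.map_adj_apply
  exact ⟨hi, isSnark_iso e hs, _, hT.iso e ht, by rw [← oc_iso e ht, hS]⟩

end

/-! ### The Petersen graph and the Loupekine snarks -/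

/-- Vertices of the Petersen graph in the order of the vertices `0, …, 9` of the rotation graph. -/
def petersenVertex : Fin 10 → Finset (Fin 5) :=
  ![{0, 1}, {0, 2}, {1, 3}, {2, 3}, {1, 4}, {2, 4}, {3, 4}, {0, 4}, {0, 3}, {1, 2}]

theorem petersenVertex_card (v : Fin 10) : (petersenVertex v).card = 2 := by
  revert v; decide

theorem petersenVertex_bijective : Function.Bijective
    fun v : Fin 10 => (⟨petersenVertex v, petersenVertex_card v⟩ : {s : Finset (Fin 5) // s.card = 2}) := by
  rw [Fintype.bijective_iff_injective_and_card]
  refine ⟨?_, by simp [Nat.choose]⟩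
  intro a b h
  have h := congrArg Subtype.val h
  revert a b; decide

theorem nonempty_iso_petersen {R : ℕ} (hR : R ∈ repMasks2) : Nonempty (mkG 2 R ≃g petersen) := by
  refine ⟨⟨Equiv.ofBijective _ petersenVertex_bijective, fun {a b} => ?_⟩⟩
  rw [← adjB_iff]
  change Disjoint (petersenVertex a) (petersenVertex b) ↔ _
  have : ∀ R ∈ repMasks2, ∀ a b : Fin 10, Disjoint (petersenVertex a) (petersenVertex b) ↔ adjB 2 R a b = true := by
    decide +kernel
  exact this R hR a b

/-- The masks of the two representatives give the Loupekine snarks, in this order. -/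
theorem mkG_eq_loupekine : mkG 4 (repMasks4.getD 0 0) = loupekine₁ ∧ mkG 4 (repMasks4.getD 1 0) = loupekine₂ := by
  have h1 : ∀ a b : Fin 22, adjB 4 (repMasks4.getD 0 0) a b = true ↔ a ≠ b ∧
      ((a, b) ∈ treeEdges ++ [(0, 3), (3, 4), (4, 7), (7, 8), (8, 11), (11, 0),
        (1, 2), (2, 9), (9, 10), (10, 5), (5, 6), (6, 1)] ∨
      (b, a) ∈ treeEdges ++ [(0, 3), (3, 4), (4, 7), (7, 8), (8, 11), (11, 0),
        (1, 2), (2, 9), (9, 10), (10, 5), (5, 6), (6, 1)]) := by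
    decide +kernel
  have h2 : ∀ a b : Fin 22, adjB 4 (repMasks4.getD 1 0) a b = true ↔ a ≠ b ∧
      ((a, b) ∈ treeEdges ++ [(0, 9), (9, 10), (10, 7), (7, 4), (4, 1), (1, 2), (2, 11), (11, 8),
        (8, 5), (5, 6), (6, 3), (3, 0)] ∨
      (b, a) ∈ treeEdges ++ [(0, 9), (9, 10), (10, 7), (7, 4), (4, 1), (1, 2), (2, 11), (11, 8),
        (8, 5), (5, 6), (6, 3), (3, 0)]) := by
    decide +kernel
  constructor
  · ext a b
    rw [← adjB_iff]
    exact h1 a b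
  · ext a b
    rw [← adjB_iff]
    exact h2 a b

/-! ### Counting -/

/-- The graphs of the list `l` are rotation `T_i`-snarks, and all rotation `T_i`-snarks are among them. -/
structure Classified (m i : ℕ) (l : List Rep) : Prop where
  two_le : 2 ≤ i
  std : StdFacts m i
  draw : DrawFacts m i
  pos : 1 ≤ m
  treeDeg : TreeDeg m
  rot : ∀ r ∈ l, RotGraph m (mkG m r.mask)
  snark : ∀ r ∈ l, IsSnark (mkG m r.mask)
  inv : ∀ r ∈ l, walkInv (mkG m r.mask) 4 = r.inv
  oc_eq : ∀ r ∈ l, oc (mkG m r.mask) (stdTree m) = (r.cycles.map List.length : Multiset ℕ)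
  exists_rep : ∀ G : SimpleGraph (Fin (6 * m - 2)), RotGraph m G → IsSnark G → ∃ r ∈ l, TreeIso m G (mkG m r.mask)
  nodup : (l.map Rep.inv).Nodup

theorem classified_of {D : LeafData} {i k : ℕ} {l : List Rep} (hi : 2 ≤ i) (hs : StdFacts D.m i)
    (hf : DrawFacts D.m i) (hD : LeafDataOk D) (hmask : l.map Rep.mask = D.reps) (hok : repsOk D.m k l = true)
    (hex : ∀ G : SimpleGraph (Fin (6 * D.m - 2)), RotGraph D.m G → IsSnark G → ∃ R ∈ D.reps, TreeIso D.m G (mkG D.m R))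
    (hnd : (l.map Rep.inv).Nodup) : Classified D.m i l := by
  have hrot : ∀ r ∈ l, RotGraph D.m (mkG D.m r.mask) := fun r hr =>
    hD.reps _ (hmask ▸ List.mem_map_of_mem hr)
  have h := fun r (hr : r ∈ l) => facts_of_repOk hD.pos hrot hD.deg hok hr
  refine ⟨hi, hs, hf, hD.pos, hD.deg, hrot, fun r hr => (h r hr).1, fun r hr => (h r hr).2.1,
    fun r hr => (h r hr).2.2, fun G hG hsn => ?_, hnd⟩
  obtain ⟨R, hR, hiso⟩ := hex G hG hsn
  rw [← hmask] at hR
  obtain ⟨r, hr, rfl⟩ := List.mem_map.1 hR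
  exact ⟨r, hr, hiso⟩

theorem classified_certified2 : Classified 2 2 certified2 :=
  classified_of (D := data2) le_rfl stdFacts2 drawFacts2 data2_ok certified2_mask certified2_ok
    (fun _ => classify2) (by decide)

theorem classified_certified4 : Classified 4 3 certified4 :=
  classified_of (D := data4) (by norm_num) stdFacts4 drawFacts4 data4_ok certified4_mask certified4_ok
    (fun _ => classify4) (by decide)

theorem classified_certified8 : Classified 8 4 certified8 :=
  classified_of (D := data8) (by norm_num) stdFacts8 drawFacts8 data8_ok certified8_mask certified8_ok
    (fun _ => classify8) (by decide)

section
variable {V : Type*} [Finite V] {G : SimpleGraph V} {m i : ℕ} {l : List Rep}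

/-- The rotation snarks with given outer cycle lengths, up to isomorphism. -/
theorem Classified.isRotationSnarkWith_iff (h : Classified m i l) (S : Multiset ℕ) :
    IsRotationSnarkWith i S G ↔
      ∃ r ∈ l, (r.cycles.map List.length : Multiset ℕ) = S ∧ Nonempty (G ≃g mkG m r.mask) := by
  constructor
  · rintro ⟨-, hs, T, hT, hS⟩
    obtain ⟨G', e, hG', he⟩ := exists_rotGraph h.std hT hs.cubic
    obtain ⟨r, hr, f, hf⟩ := h.exists_rep G' hG' (isSnark_iso e hs)
    refine ⟨r, hr, ?_, ⟨e.trans f⟩⟩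
    rw [← h.oc_eq r hr, ← hS, oc_iso (e.trans f) fun a b => (hf _ _).trans (he _ _)]
  · rintro ⟨r, hr, hS, ⟨e⟩⟩
    refine IsRotationSnarkWith.iso e.symm ⟨h.two_le, h.snark r hr, stdTree m, ?_, (h.oc_eq r hr).trans hS⟩
    exact isRotationHist_std h.draw h.pos (le_trans one_le_two h.two_le) h.treeDeg (h.rot r hr)

theorem isRotationSnark_iff_exists : IsRotationSnark i G ↔ ∃ S, IsRotationSnarkWith i S G :=
  ⟨fun ⟨hi, hs, T, hT⟩ => ⟨_, hi, hs, T, hT, rfl⟩, fun ⟨_, hi, hs, T, hT, _⟩ => ⟨hi, hs, T, hT⟩⟩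

theorem Classified.isRotationSnark_iff (h : Classified m i l) :
    IsRotationSnark i G ↔ ∃ r ∈ l, Nonempty (G ≃g mkG m r.mask) := by
  simp only [isRotationSnark_iff_exists, h.isRotationSnarkWith_iff]
  exact ⟨fun ⟨_, r, hr, _, e⟩ => ⟨r, hr, e⟩, fun ⟨r, hr, e⟩ => ⟨_, r, hr, rfl, e⟩⟩

/-- Representatives are distinguished by their walk counts, hence never isomorphic. -/
theorem Classified.eq_of_iso (h : Classified m i l) {r r' : Rep} (hr : r ∈ l) (hr' : r' ∈ l)
    (e : mkG m r.mask ≃g mkG m r'.mask) : r = r' := by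
  refine List.inj_on_of_nodup_map h.nodup hr hr' ?_
  rw [← h.inv r hr, ← h.inv r' hr', walkInv_iso e]

theorem Classified.existsUnique_oc (h : Classified m i l) (hG : IsRotationSnark i G) :
    ∃! S, IsRotationSnarkWith i S G := by
  obtain ⟨S, hS⟩ := isRotationSnark_iff_exists.1 hG
  refine ⟨S, hS, fun S' hS' => ?_⟩
  obtain ⟨r, hr, rfl, ⟨e⟩⟩ := (h.isRotationSnarkWith_iff S).1 hS
  obtain ⟨r', hr', rfl, ⟨e'⟩⟩ := (h.isRotationSnarkWith_iff S').1 hS'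
  rw [h.eq_of_iso hr hr' (e.symm.trans e')]

theorem Classified.ncard_isoClasses (h : Classified m i l) {P : FinGraph → Prop} {l' : List Rep} (hl : l'.Sublist l)
    (hP : ∀ G, P G ↔ ∃ r ∈ l', Nonempty (G.2 ≃g mkG m r.mask)) : (isoClasses P).ncard = l'.length := by
  classical
  let f : Rep → Quotient isoSetoid := fun r => Quotient.mk isoSetoid ⟨_, mkG m r.mask⟩
  have hset : isoClasses P = {q | q ∈ l'.map f} := by
    ext q
    constructor
    · rintro ⟨G, hG, rfl⟩
      obtain ⟨r, hr, e⟩ := (hP G).1 hG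
      exact List.mem_map.2 ⟨r, hr, (Quotient.sound e).symm⟩
    · intro hq
      obtain ⟨r, hr, rfl⟩ := List.mem_map.1 hq
      exact ⟨_, (hP _).2 ⟨r, hr, ⟨SimpleGraph.Iso.refl⟩⟩, rfl⟩
  have hnd : (l'.map f).Nodup := by
    refine ((h.nodup.sublist (hl.map _)).of_map _).map_on fun r hr r' hr' hrr => ?_
    obtain ⟨e⟩ := Quotient.exact hrr
    exact h.eq_of_iso (hl.subset hr) (hl.subset hr') e
  have : {q | q ∈ l'.map f} = ((l'.map f).toFinset : Set (Quotient isoSetoid)) := by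
    ext q; simp
  rw [hset, this, Set.ncard_coe_finset, List.toFinset_card_of_nodup hnd, List.length_map]

theorem Classified.ncard_isRotationSnark (h : Classified m i l) :
    (isoClasses fun G => IsRotationSnark i G.2).ncard = l.length :=
  h.ncard_isoClasses (List.Sublist.refl l) fun _ => h.isRotationSnark_iff

theorem Classified.ncard_isRotationSnarkWith (h : Classified m i l) (S : Multiset ℕ) :
    (isoClasses fun G => IsRotationSnarkWith i S G.2).ncard =
      (l.filter fun r => (r.cycles.map List.length : Multiset ℕ) = S).length := by
  refine h.ncard_isoClasses List.filter_sublist fun G => (h.isRotationSnarkWith_iff S).trans ?_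
  simp only [List.mem_filter, decide_eq_true_eq, and_assoc]

end

theorem isRotationSnark_le_three_iff {V : Type*} [Finite V] {G : SimpleGraph V} :
    (∃ i, i ≤ 3 ∧ IsRotationSnark i G) ↔
      (Nonempty (G ≃g petersen) ∨ Nonempty (G ≃g loupekine₁) ∨ Nonempty (G ≃g loupekine₂)) := by
  have h2 : IsRotationSnark 2 G ↔ Nonempty (G ≃g petersen) := by
    rw [classified_certified2.isRotationSnark_iff]
    obtain ⟨e⟩ := nonempty_iso_petersen (R := repMasks2.getD 0 0) (by decide)
    simp only [certified2, List.mem_singleton, exists_eq_left]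
    exact ⟨fun ⟨f⟩ => ⟨f.trans e⟩, fun ⟨f⟩ => ⟨f.trans e.symm⟩⟩
  have h3 : IsRotationSnark 3 G ↔ Nonempty (G ≃g loupekine₁) ∨ Nonempty (G ≃g loupekine₂) := by
    rw [classified_certified4.isRotationSnark_iff]
    simp only [certified4, List.mem_cons, List.not_mem_nil, or_false, exists_eq_or_imp, exists_eq_left]
    rw [mkG_eq_loupekine.1, mkG_eq_loupekine.2]
  rw [← h2, ← h3]
  constructor
  · rintro ⟨i, hi, h⟩
    have := h.1
    interval_cases i
    · exact .inl h
    · exact .inr h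
  · rintro (h | h)
    · exact ⟨2, by norm_num, h⟩
    · exact ⟨3, le_rfl, h⟩

theorem isEmpty_iso_loupekine : IsEmpty (loupekine₁ ≃g loupekine₂) := by
  have h := classified_certified4.inv
  simp only [certified4, List.mem_cons, List.not_mem_nil, or_false, forall_eq_or_imp, forall_eq] at h
  rw [mkG_eq_loupekine.1, mkG_eq_loupekine.2] at h
  refine ⟨fun e => ?_⟩
  have := walkInv_iso e 4
  omega

end HistSnark

theorem theorem1 :
    -- the rotation `T_i`-snarks with `i ≤ 3`
    (∀ (V : Type*) [Finite V] (G : SimpleGraph V),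
      (∃ i, i ≤ 3 ∧ HistSnark.IsRotationSnark i G) ↔
        (Nonempty (G ≃g HistSnark.petersen) ∨ Nonempty (G ≃g HistSnark.loupekine₁) ∨
          Nonempty (G ≃g HistSnark.loupekine₂))) ∧
    IsEmpty (HistSnark.loupekine₁ ≃g HistSnark.loupekine₂) ∧
    -- the number of rotation `T_4`-snarks
    (HistSnark.isoClasses fun G => HistSnark.IsRotationSnark 4 G.2).ncard = 15 ∧
    -- the multiset of outer cycle lengths depends only on the rotation `T_4`-snark
    (∀ (V : Type*) [Finite V] (G : SimpleGraph V), HistSnark.IsRotationSnark 4 G →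
      ∃! S : Multiset ℕ, HistSnark.IsRotationSnarkWith 4 S G) ∧
    -- the numbers of rotation `T_4`-snarks with given outer cycle lengths
    (HistSnark.isoClasses fun G => HistSnark.IsRotationSnarkWith 4 {24} G.2).ncard = 2 ∧
    (HistSnark.isoClasses fun G => HistSnark.IsRotationSnarkWith 4 {12, 12} G.2).ncard = 1 ∧
    (HistSnark.isoClasses fun G => HistSnark.IsRotationSnarkWith 4 {18, 6} G.2).ncard = 1 ∧
    (HistSnark.isoClasses fun G => HistSnark.IsRotationSnarkWith 4 {8, 8, 8} G.2).ncard = 8 ∧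
    (HistSnark.isoClasses fun G => HistSnark.IsRotationSnarkWith 4 {6, 6, 6, 6} G.2).ncard = 3 := by
  have h := HistSnark.classified_certified8
  refine ⟨fun V _ G => HistSnark.isRotationSnark_le_three_iff, HistSnark.isEmpty_iso_loupekine,
    h.ncard_isRotationSnark, fun V _ G hG => h.existsUnique_oc hG, ?_, ?_, ?_, ?_, ?_⟩
  all_goals
    rw [h.ncard_isRotationSnarkWith]
    decide +kernel
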